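/- **Model.** Let $d\ge 0$ and $\kappa_1,\dots,\kappa_d>0$. Let $s_{c,k}$ ($1\le c\le d$, $k\ge 0$) and $t_a$ ($a=(a_1,\dots,a_d)\in\mathbb N^d$) be formal couplings, $V_c(x)=\frac{\kappa_c}{2}x^2+\sum_{k}s_{c,k}x^k$, and consider Hermitian $N\times N$ matrices $M_1,\dots,M_d$ with the action $$S=N\sum_{c=1}^d \mathrm{tr}\,V_c(M_c)+N^{2-d}\sum_{a\in\mathbb N^d}t_a\prod_{c=1}^d\mathrm{tr}\,M_c^{a_c}.$$ The integral $\int\prod_c dM_c\,\mathcal O\,e^{-S}$ is formal: the non-Gaussian part of $e^{-S}$ is expanded in the couplings and integrated term by term. Write $\langle\mathcal O\rangle=\frac1Z\int\prod_c dM_c\,\mathcal O\,e^{-S}$, and $\langle\cdots\rangle_c$ for the joint cumulants of traces. Put $\Gamma_c=[-2/\sqrt{\kappa_c},\,2/\sqrt{\kappa_c}]\subset\hat{\mathbb C}_c$, where $\hat{\mathbb C}_1,\dots,\hat{\mathbb C}_d$ are $d$ copies of the Riemann sphere. **Correlators.** At each order in the couplings, $\langle\prod_j \mathrm{tr}\,M_{c_j}^{p_j}\rangle_c$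 is a Laurent polynomial in $N$. For colors $c_1,\dots,c_n$ (and colors $b_l$ and exponents $a_l$) there is, at each order in the couplings and in $1/N$, a holomorphic function on $\prod_j(\hat{\mathbb C}_{c_j}\setminus\Gamma_{c_j})$, denoted $$W(x_1,\dots,x_n;(b_l,a_l)_l)=\Big\langle\prod_j\mathrm{tr}\frac1{x_j-M_{c_j}}\prod_l\mathrm{tr}\,M_{b_l}^{a_l}\Big\rangle_c ,$$ with expansion at infinity $\sum_{p}\langle\prod_j\mathrm{tr}M_{c_j}^{p_j}\prod_l\mathrm{tr}M_{b_l}^{a_l}\rangle_c\prod_j x_j^{-p_j-1}$. At each order, the number of positive powers of $N$ is finite, so these functions take values in formal series in the couplings with coefficients in $\mathbb C((1/N))$. Moreover $(c,a)$ stands for the extraction of $[\tilde x^{-a-1}]$ in a variable $\tilde x$ of color $c$: for $|\tilde x|>2/\sqrt{\kappa_c}$, $W(\tilde x,x_1,\dots;\cdots)=\sum_{a\ge0}W(x_1,\dots;(c,a),\cdots)\,\tilde x^{-a-1}$ at each order. **Colored loop equations.** Write $U^{(a)}_i(x_0,\dots)=\langle\mathrm{tr}\frac{x_0^{a-1}-M_i^{a-1}}{x_0-M_i}\cdots\rangle_c$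 for $a\ge1$ and $P_i(x_0;\dots)=\langle\mathrm{tr}\frac{V_i'(x_0)-V_i'(M_i)}{x_0-M_i}\cdots\rangle_c$. For every color $i$, every $n\ge0$, every $x_0\in\mathbb C_i\setminus\Gamma_i$ and all $x_j\in\mathbb C_{c_j}\setminus\Gamma_{c_j}$, with $I=\{1,\dots,n\}$, $$\sum_{J\subseteq I}W(x_0,x_J)W(x_0,x_{I\setminus J})+W(x_0,x_0,x_I)-NV_i'(x_0)W(x_0,x_I)+NP_i(x_0;x_I)+\sum_{j:\,c_j=i}\partial_{x_j}\frac{W(x_I)-W(x_{I\setminus j},x_0)}{x_j-x_0}$$ $$-N^{2-d}\sum_{\Lambda}\sum_{\mu}\sum_{a:\,a_i\ge1}a_it_a\Big[\prod_{c\ne i}\tilde x_c^{-a_c-1}\Big]\prod_{j\ge2}W(x_{\mu_j},\tilde x_{\lambda_j})\Big(x_0^{a_i-1}W(x_0,x_{\mu_1},\tilde x_{\lambda_1})-U_i^{(a_i)}(x_0,x_{\mu_1},\tilde x_{\lambda_1})\Big)=0,$$ where $\Lambda=(\lambda_1,\{\lambda_2,\dots\})$ runs over the decompositions of the set of colors $c\neq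 i$ into disjoint parts, all non-empty except possibly $\lambda_1$, and $\mu$ over the ordered decompositions of $I$ into possibly empty sets $\mu_j$, one for each part of $\Lambda$. Difference quotients are extended to the diagonal by continuity. **Global loop equation.** For $x_j\in\bigcup_c\hat{\mathbb C}_c$ (disjoint union) set $W_n(x_1,\dots,x_n)=\sum_{i_1,\dots,i_n}\prod_j\mathbf 1_{\hat{\mathbb C}_{i_j}\setminus\Gamma_{i_j}}(x_j)\,W_{e_{i_1}+\dots+e_{i_n}}(x_1,\dots,x_n)$, where $W_{e_{i_1}+\dots+e_{i_n}}$ is the correlator $W$ above (without power traces) for the colors $i_1,\dots,i_n$; and similarly $V'=\sum_i\mathbf 1_{\hat{\mathbb C}_i}V_i'$, $P_n(x_0;x_1,\dots,x_n)=\sum_{k,i_1,\dots,i_n}\mathbf 1_{\hat{\mathbb C}_k}(x_0)\prod_j\mathbf 1_{\hat{\mathbb C}_{i_j}}(x_j)\,P_k(x_0;x_1,\dots,x_n)$ (the $x_j$ being given the colors $i_j$); let $\mathbf 1_{(x,y)}$ be $1$ if $x,y$ lie in the same $\hat{\mathbb C}_c$ and $0$ otherwise; $T(x_1,\dots,x_d)=\prod_j\mathbf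 1_{\hat{\mathbb C}_j}(x_j)\sum_{a\ne0}t_a\prod_jx_j^{a_j}$, and for $x\in\hat{\mathbb C}_i$ $$\mathcal U(x;\zeta_1;\zeta_2,\dots,\zeta_d)=\frac{\mathbf 1_{(x,\zeta_1)}}{(d-1)!}\sum_{\pi}\frac{(\partial_iT)(\zeta_{\pi(1)},\dots,x,\dots,\zeta_{\pi(d)})-(\partial_iT)(\zeta_{\pi(1)},\dots,\zeta_1,\dots,\zeta_{\pi(d)})}{x-\zeta_1},$$ with $x$, resp. $\zeta_1$, in the $i$-th place and $\pi$ running over the permutations of $\{1,\dots,d\}$ with $\pi(i)=1$. Let $\oint_{\Gamma}$ be the integral over the images, under $z\mapsto(z+1/z)/\sqrt{\kappa_c}$ for $c=1,\dots,d$, of the positively oriented circle $|z|=\rho$, for any $\rho>1$ such that $x_0$ lies outside these contours. Then for every $n\ge0$ and all finite points $x_0,\dots,x_n$ of $\bigcup_c(\hat{\mathbb C}_c\setminus\Gamma_c)$ $$\sum_{J\subseteq I}W_{|J|+1}(x_0,x_J)W_{n+1-|J|}(x_0,x_{I\setminus J})+W_{n+2}(x_0,x_0,x_I)-NV'(x_0)W_{n+1}(x_0,x_I)+NP_n(x_0;x_I)$$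 $$+\sum_{j\in I}\partial_{x_j}\Big(\mathbf 1_{(x_0,x_j)}\frac{W_n(x_0,x_{I\setminus j})-W_n(x_I)}{x_0-x_j}\Big)$$ $$-N^{2-d}\sum_{K,\,J}\oint_{\Gamma^d}\prod_{j=1}^d\frac{d\zeta_j}{2i\pi}\Big(\sum_{q=1}^d(\partial_qT)(\zeta_1,\dots,\underset{q}{x_0},\dots,\zeta_d)\frac{\mathbf 1_{(x_0,\zeta_q)}}{x_0-\zeta_q}\Big)\prod_pW_{|K_p|+|J_p|}(\zeta_{K_p},x_{J_p})$$ $$+N^{2-d}\sum_{K,\,J}\oint_{\Gamma^d}\prod_{j=1}^d\frac{d\zeta_j}{2i\pi}\;\mathcal U(x_0;\zeta_1;\zeta_2,\dots,\zeta_d)\prod_pW_{|K_p|+|J_p|}(\zeta_{K_p},x_{J_p})=0,$$ where $K$ runs over the set partitions of $\{1,\dots,d\}$ and $J$ over the decompositions $I=\bigsqcup_pJ_p$ into possibly empty sets indexed by the parts $K_p$. Likewise the equation holds with the last two lines replaced by the single term $-N^{2-d}\sum_{K,J}\oint_{\Gamma^d}\prod_j\frac{d\zeta_j}{2i\pi}\big(\sum_q\partial_{\zeta_q}T(\zeta_1,\dots,\zeta_d)\frac{\mathbf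 1_{(x_0,\zeta_q)}}{x_0-\zeta_q}\big)\prod_pW_{|K_p|+|J_p|}(\zeta_{K_p},x_{J_p})$. All equations hold at each order in the couplings and in $1/N$. (At $x=\infty$, where the correlators are holomorphic but $V'$ has a pole, the equations are understood by continuity of the left-hand side.) -/

import Mathlib

namespace MultiTrace

noncomputable section

/-! ### The formal matrix integral at fixed size `N` -/

/-- The coupling constants, taken as formal indeterminates: `Sum.inl a` is the multi-trace coupling
`t_a` of `∏ c, tr (M_c ^ a_c)`, and `Sum.inr (c, k)` is the coefficient `s_{c,k}` of `x ^ k` in the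
non-Gaussian part of the potential `V_c(x) = κ_c x² / 2 + ∑ k, s_{c,k} x ^ k`. -/
abbrev Coupling (d : ℕ) : Type := (Fin d → ℕ) ⊕ (Fin d × ℕ)

/-- The general Hermitian `N × N` matrix, with real coordinates `X` orthonormal for
`(A, B) ↦ tr (A * B)`. Lebesgue measure in `X` is the Lebesgue measure `dM`. -/
def herm {N : ℕ} (X : Fin N → Fin N → ℝ) : Matrix (Fin N) (Fin N) ℂ :=
  Matrix.of fun a b =>
    if a = b then (X a a : ℂ)
    else if a < b then ((X a b : ℂ) + Complex.I * (X b a : ℂ)) / (Real.sqrt 2 : ℂ)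
    else ((X b a : ℂ) - Complex.I * (X a b : ℂ)) / (Real.sqrt 2 : ℂ)

theorem herm_isHermitian {N : ℕ} (X : Fin N → Fin N → ℝ) : (herm X).IsHermitian := by
  ext a b
  rcases lt_trichotomy a b with h | h | h
  · simp [herm, h, h.ne, h.ne', h.not_gt, sub_eq_add_neg]
  · subst h
    simp [herm]
  · simp [herm, h, h.ne, h.ne', h.not_gt, sub_eq_add_neg]

/-- The interaction term multiplied by a given coupling in the action `S`:
`N ^ (2 - d) * ∏ c, tr (M_c ^ a_c)` for `t_a`, and `N * tr (M_c ^ k)` for `s_{c,k}`. -/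
def vertex {d N : ℕ} (M : Fin d → Matrix (Fin N) (Fin N) ℂ) : Coupling d → ℂ
  | Sum.inl a => (N : ℂ) ^ (2 - (d : ℤ)) * ∏ c, (M c ^ a c).trace
  | Sum.inr (c, k) => (N : ℂ) * (M c ^ k).trace

/-- The formal integral `∫ ∏ c, dM_c O(M) exp (-S)`, where
`S = N ∑ c, tr V_c(M_c) + N ^ (2 - d) ∑ a, t_a ∏ c, tr (M_c ^ a_c)`: the exponential of the
non-Gaussian part of `-S` is expanded in the couplings and integrated term by term. -/
def formalIntegral {d : ℕ} (κ : Fin d → ℝ) (N : ℕ)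
    (O : (Fin d → Matrix (Fin N) (Fin N) ℂ) → ℂ) : MvPowerSeries (Coupling d) ℂ :=
  fun m => ∫ X : Fin d → Fin N → Fin N → ℝ,
    O (fun c => herm (X c)) *
      (m.prod fun v e => (-vertex (fun c => herm (X c)) v) ^ e / (e.factorial : ℂ)) *
      Complex.exp (-((N : ℂ) / 2) * ∑ c, (κ c : ℂ) * (herm (X c) ^ 2).trace)

/-- The expectation `⟨O⟩ = Z⁻¹ ∫ ∏ c, dM_c O(M) exp (-S)`. -/
def expectation {d : ℕ} (κ : Fin d → ℝ) (N : ℕ)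
    (O : (Fin d → Matrix (Fin N) (Fin N) ℂ) → ℂ) : MvPowerSeries (Coupling d) ℂ :=
  (formalIntegral κ N fun _ => 1)⁻¹ * formalIntegral κ N O

/-- The cumulants `W` of a family of moments `E` indexed by finite sets, determined recursively by
`E S = ∑ π ⊢ S, ∏ B ∈ π, W B`, the sum being over the set partitions of `S`. -/
def cumulant {ι R : Type*} [DecidableEq ι] [CommRing R] (E : Finset ι → R) (S : Finset ι) : R :=
  E S - ∑ π : {π : Finpartition S // S ∉ π.parts}, ∏ B : {B // B ∈ π.1.parts}, cumulant E B.1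
termination_by S.card
decreasing_by
  refine Finset.card_lt_card (lt_of_le_of_ne (π.1.le B.2) ?_)
  intro h
  have hB := B.2
  rw [h] at hB
  exact π.2 hB

theorem moment_eq_sum_cumulant {ι R : Type*} [DecidableEq ι] [CommRing R] (E : Finset ι → R)
    (S : Finset ι) (hS : S.Nonempty) :
    E S = ∑ π : Finpartition S, ∏ B ∈ π.parts, cumulant E B := by
  classical
  have hS' : S ≠ ⊥ := hS.ne_empty
  have key : ∀ π : Finpartition S, S ∈ π.parts ↔ π = Finpartition.indiscrete hS' := by
    intro π
    constructor
    · intro h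
      ext B
      simp only [Finpartition.indiscrete_parts, Finset.mem_singleton]
      constructor
      · intro hB
        by_contra hne
        have hd := π.disjoint hB h hne
        have hle : B ≤ S := π.le hB
        exact π.ne_bot hB (disjoint_self.1 (hd.mono_right hle))
      · rintro rfl
        exact h
    · rintro rfl
      simp
  rw [← Finset.sum_filter_add_sum_filter_not Finset.univ (fun π : Finpartition S => S ∈ π.parts)]
  have h1 : (Finset.univ.filter fun π : Finpartition S => S ∈ π.parts)
      = {Finpartition.indiscrete hS'} := by
    ext π
    simp [key]
  rw [h1, Finset.sum_singleton, Finpartition.indiscrete_parts, Finset.prod_singleton]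
  have h2 : ∑ π ∈ Finset.univ.filter (fun π : Finpartition S => S ∉ π.parts),
      ∏ B ∈ π.parts, cumulant E B
      = ∑ π : {π : Finpartition S // S ∉ π.parts},
          ∏ B : {B // B ∈ π.1.parts}, cumulant E B.1 := by
    rw [← Finset.sum_subtype_eq_sum_filter, Finset.subtype_univ]
    refine Finset.sum_congr rfl fun π _ => ?_
    rw [← Finset.prod_coe_sort]
  rw [h2, cumulant.eq_1]
  ring

/-- The connected correlator `⟨∏ j, tr (M_{c_j} ^ p_j)⟩_c` at size `N`, where `v j = (c_j, p_j)`. -/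
def connectedTraces {d : ℕ} (κ : Fin d → ℝ) (N : ℕ) {ι : Type} [Fintype ι] [DecidableEq ι]
    (v : ι → Fin d × ℕ) : MvPowerSeries (Coupling d) ℂ :=
  cumulant (fun S : Finset ι => expectation κ N fun M => ∏ j ∈ S, (M (v j).1 ^ (v j).2).trace)
    Finset.univ

/-! ### Series in the couplings and in `1 / N` -/

/-- Formal series in the couplings whose coefficients are formal Laurent series in `1 / N`. -/
abbrev Series (d : ℕ) : Type := MvPowerSeries (Coupling d) (LaurentSeries ℂ)

/-- The coefficient of `N ^ k` times the monomial `m` in the couplings. -/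
def coeffN {d : ℕ} (m : Coupling d →₀ ℕ) (k : ℤ) (f : Series d) : ℂ :=
  (MvPowerSeries.coeff m f).coeff (-k)

/-- `N ^ k`. -/
def powN (d : ℕ) (k : ℤ) : Series d := MvPowerSeries.C (HahnSeries.single (-k) (1 : ℂ))

/-- The constant series `z`. -/
def scalar {d : ℕ} (z : ℂ) : Series d := MvPowerSeries.C (HahnSeries.C z)

theorem coeffN_scalar_mul {d : ℕ} (m : Coupling d →₀ ℕ) (k : ℤ) (z : ℂ) (f : Series d) :
    coeffN m k (scalar z * f) = z * coeffN m k f := by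
  simp [coeffN, scalar, MvPowerSeries.coeff_C_mul]

/-- The sum `∑ v, v * F v` over all couplings `v`. It is infinite, but each of its coefficients
is a finite sum. -/
def couplingSum {d : ℕ} (F : Coupling d → Series d) : Series d :=
  fun m => ∑ v ∈ m.support, MvPowerSeries.coeff (m - Finsupp.single v 1) (F v)

theorem coeff_couplingSum {d : ℕ} (F : Coupling d → Series d) (m : Coupling d →₀ ℕ)
    (s : Finset (Coupling d)) (hs : m.support ⊆ s) :
    MvPowerSeries.coeff m (couplingSum F)
      = MvPowerSeries.coeff m (∑ v ∈ s, MvPowerSeries.X v * F v) := by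
  classical
  rw [map_sum]
  have h : ∀ v ∈ s, MvPowerSeries.coeff m (MvPowerSeries.X v * F v)
      = if v ∈ m.support then MvPowerSeries.coeff (m - Finsupp.single v 1) (F v) else 0 := by
    intro v _
    rw [MvPowerSeries.X_def, MvPowerSeries.coeff_monomial_mul]
    simp [Finsupp.single_le_iff, Nat.one_le_iff_ne_zero]
  rw [Finset.sum_congr rfl h, ← Finset.sum_filter, Finset.filter_mem_eq_inter,
    Finset.inter_eq_right.2 hs]
  rfl

/-! ### Correlation functions on the complements of the cuts -/

/-- A pair `(c, x)` is the point `x` of the copy `Ĉ_c` of the Riemann sphere; the pairs form the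
disjoint union of `Ĉ_1, …, Ĉ_d`. -/
abbrev Point (d : ℕ) : Type := Fin d × OnePoint ℂ

/-- The points of the disjoint union of `ℂ_1, …, ℂ_d`. -/
abbrev FinitePoint (d : ℕ) : Type := Fin d × ℂ

/-- The inclusion of `ℂ_c` into `Ĉ_c`. -/
def FinitePoint.toPoint {d : ℕ} (X : FinitePoint d) : Point d := (X.1, (X.2 : OnePoint ℂ))

/-- The cut `Γ_c = [-2 / √κ_c, 2 / √κ_c]` of color `c`. -/
def cut {d : ℕ} (κ : Fin d → ℝ) (c : Fin d) : Set (OnePoint ℂ) :=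
  {x | ∃ r : ℝ, |r| ≤ 2 / Real.sqrt (κ c) ∧ x = ((r : ℂ) : OnePoint ℂ)}

/-- The union over `c` of `Ĉ_c ∖ Γ_c`. -/
def offCuts {d : ℕ} (κ : Fin d → ℝ) : Set (Point d) := {X | X.2 ∉ cut κ X.1}

/-- The two standard charts of the Riemann sphere: `u ↦ u` and `u ↦ 1 / u`. -/
def chart (atInfinity : Bool) (u : ℂ) : OnePoint ℂ :=
  if atInfinity then (if u = 0 then OnePoint.infty else ((u⁻¹ : ℂ) : OnePoint ℂ))
  else (u : OnePoint ℂ)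

/-- The multiset of the values of a finite family. -/
def values {ι α : Type} [Fintype ι] (f : ι → α) : Multiset α := (Finset.univ : Finset ι).val.map f

/-- A family of functions with values in the series in the couplings and `1 / N`: the intended
meaning of `W s A` is the connected correlator
`⟨∏ (c, x) ∈ s, tr (1 / (x - M_c)) * ∏ (c, a) ∈ A, tr (M_c ^ a)⟩_c`.
For `A = 0` these are the correlation functions `W_k(x_k)`, as functions of a set of variables of
each color. For general `A`, the pairs `(c, a) ∈ A` stand for the extraction of the coefficient of
`x̃ ^ (-a - 1)` in a variable `x̃` of color `c`. -/
abbrev Family (d : ℕ) : Type := Multiset (Point d) → Multiset (Fin d × ℕ) → Series d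

/-- `W` is the family of connected correlation functions of the matrix model: at each order in the
couplings and in `1 / N`, it is holomorphic in its variables on the product of the `Ĉ_c ∖ Γ_c`, and
its expansion at infinity is the generating function
`∑ p, ⟨∏ j, tr (M_{c_j} ^ p_j) ∏ l, tr (M_{b_l} ^ a_l)⟩_c ∏ j, x_j ^ (-p_j - 1)`,
where at each order in the couplings the connected correlator is a Laurent polynomial in `N`. -/
structure IsConnectedCorrelators {d : ℕ} (κ : Fin d → ℝ) (W : Family d) : Prop where
  holomorphic : ∀ (n l : ℕ) (c : Fin n → Fin d) (B : Fin l → Fin d × ℕ)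
    (m : Coupling d →₀ ℕ) (k : ℤ) (atInf : Fin n → Bool),
    DifferentiableOn ℂ
      (fun u : Fin n → ℂ =>
        coeffN m k (W (values fun j => (c j, chart (atInf j) (u j))) (values B)))
      {u | ∀ j, (c j, chart (atInf j) (u j)) ∈ offCuts κ}
  expansion : ∀ (n l : ℕ) (c : Fin n → Fin d) (B : Fin l → Fin d × ℕ) (m : Coupling d →₀ ℕ),
    ∃ w : (Fin n → ℕ) → (ℤ →₀ ℂ),
      (∀ (p : Fin n → ℕ) (N : ℕ), 0 < N →
        MvPowerSeries.coeff m
            (connectedTraces κ N (Sum.elim (fun j => (c j, p j)) B : Fin n ⊕ Fin l → Fin d × ℕ))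
          = (w p).sum fun k z => z * (N : ℂ) ^ k) ∧
      ∀ k : ℤ, ∃ R : ℝ, ∀ x : Fin n → ℂ, (∀ j, R < ‖x j‖) →
        HasSum (fun p : Fin n → ℕ => w p k * ∏ j, (x j)⁻¹ ^ (p j + 1))
          (coeffN m k (W (values fun j => (c j, (x j : OnePoint ℂ))) (values B)))

/-! ### Colored loop equations -/

/-- `⟨tr ((x₀ ^ (a - 1) - M_i ^ (a - 1)) / (x₀ - M_i)) ∏ (c, x) ∈ s, tr (1 / (x - M_c))
∏ (c, b) ∈ A, tr (M_c ^ b)⟩_c`. -/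
def colorU {d : ℕ} (W : Family d) (i : Fin d) (a : ℕ) (x₀ : ℂ)
    (s : Multiset (Point d)) (A : Multiset (Fin d × ℕ)) : Series d :=
  ∑ l ∈ Finset.range (a - 1), scalar (x₀ ^ (a - 2 - l)) * W s ((i, l) ::ₘ A)

/-- `V_i'(x) = κ_i x + ∑ k, k s_{i,k} x ^ (k - 1)`. -/
def colorV' {d : ℕ} (κ : Fin d → ℝ) (i : Fin d) (x : ℂ) : Series d :=
  scalar ((κ i : ℂ) * x) +
    couplingSum fun v => match v with
      | Sum.inl _ => 0
      | Sum.inr (c, k) => if c = i then scalar ((k : ℂ) * x ^ (k - 1)) else 0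

/-- `P_{i;n}(x₀; s) = ⟨tr ((V_i'(x₀) - V_i'(M_i)) / (x₀ - M_i))
∏ (c, x) ∈ s, tr (1 / (x - M_c))⟩_c`. -/
def colorP {d : ℕ} (κ : Fin d → ℝ) (W : Family d) (i : Fin d) (x₀ : ℂ)
    (s : Multiset (Point d)) : Series d :=
  scalar (κ i : ℂ) * colorU W i 2 x₀ s 0 +
    couplingSum fun v => match v with
      | Sum.inl _ => 0
      | Sum.inr (c, k) => if c = i then scalar (k : ℂ) * colorU W i k x₀ s 0 else 0

/-- The sum over the almost-partitions `(L; {λ_2, …})` of the set of colors `c ≠ i`, with `L`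
possibly empty, over the distributions `f` of the variables `X_1, …, X_n` among the parts
(`none` standing for `L`), and over the couplings `t_a`, of
`a_i t_a [∏ c ≠ i, x̃_c ^ (-a_c - 1)] ∏ j ≥ 2, W(x_{μ_j}, x̃_{λ_j})
* (x₀ ^ (a_i - 1) W(x₀, x_{μ_1}, x̃_L) - U^{(a_i)}(x₀, x_{μ_1}, x̃_L))`. -/
def colorMultiTrace {d : ℕ} (W : Family d) (i : Fin d) (x₀ : ℂ) {n : ℕ}
    (X : Fin n → Point d) : Series d :=
  ∑ L ∈ (Finset.univ.erase i).powerset,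
    ∑ Λ : Finpartition (Finset.univ.erase i \ L),
      ∑ f : Fin n → Option {B // B ∈ Λ.parts},
        couplingSum fun v => match v with
          | Sum.inr _ => 0
          | Sum.inl a =>
            let rest : Multiset (Point d) := (Finset.univ.filter fun j => f j = none).val.map X
            let A : Multiset (Fin d × ℕ) := L.val.map fun c => (c, a c)
            scalar (a i : ℂ) *
              ((∏ B : {B // B ∈ Λ.parts},
                  W ((Finset.univ.filter fun j => f j = some B).val.map X)
                    (B.1.val.map fun c => (c, a c))) *
                (scalar (x₀ ^ (a i - 1)) * W ((i, (x₀ : OnePoint ℂ)) ::ₘ rest) A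
                  - colorU W i (a i) x₀ rest A))

/-- The left-hand side of the colored loop equation of color `i`, with variables `x₀ ∈ ℂ_i` and
`X j = (c_j, x_j)`, at order `N ^ k` and at the order `m` in the couplings. The difference quotient
is `dslope`, so that its removable singularity at `x_j = x₀` is removed. -/
def coloredLHS {d : ℕ} (κ : Fin d → ℝ) (W : Family d) (i : Fin d) (x₀ : ℂ) {n : ℕ}
    (X : Fin n → FinitePoint d) (m : Coupling d →₀ ℕ) (k : ℤ) : ℂ :=
  let Y : Fin n → Point d := fun j => (X j).toPoint
  let y₀ : Point d := (i, (x₀ : OnePoint ℂ))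
  coeffN m k
    ((∑ J : Finset (Fin n), W (y₀ ::ₘ J.val.map Y) 0 * W (y₀ ::ₘ Jᶜ.val.map Y) 0)
      + W (y₀ ::ₘ y₀ ::ₘ values Y) 0
      - powN d 1 * colorV' κ i x₀ * W (y₀ ::ₘ values Y) 0
      + powN d 1 * colorP κ W i x₀ (values Y))
  + (∑ j ∈ Finset.univ.filter fun j => (X j).1 = i,
      deriv (dslope (fun z : ℂ =>
        coeffN m k (W ((i, (z : OnePoint ℂ)) ::ₘ (Finset.univ.erase j).val.map Y) 0)) x₀) (X j).2)
  - coeffN m k (powN d (2 - (d : ℤ)) * colorMultiTrace W i x₀ Y)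

/-! ### Global loop equations -/

open Classical in
/-- The global correlation function on the disjoint union of the `Ĉ_c ∖ Γ_c`:
`W_n(X) = ∑ i_1, …, i_n, ∏ j, 1_{Ĉ_{i_j} ∖ Γ_{i_j}}(X_j) * W_{e_{i_1} + ⋯ + e_{i_n}}(X)`. -/
def globalW {d : ℕ} (κ : Fin d → ℝ) (W : Family d) {ι : Type} [Fintype ι]
    (X : ι → Point d) : Series d :=
  ∑ i : ι → Fin d,
    (∏ j, if (X j).1 = i j ∧ X j ∈ offCuts κ then 1 else 0) *
      W (values fun j => (i j, (X j).2)) 0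

/-- `V'(X) = ∑ i, 1_{Ĉ_i}(X) V_i'(X)`. -/
def globalV' {d : ℕ} (κ : Fin d → ℝ) (X : FinitePoint d) : Series d :=
  ∑ i : Fin d, (if X.1 = i then 1 else 0) * colorV' κ i X.2

/-- `P_n(X₀; X) = ∑ k, i_1, …, i_n, 1_{Ĉ_k}(X₀) ∏ j, 1_{Ĉ_{i_j}}(X_j) * P_{k;n}(X₀; X)`. -/
def globalP {d : ℕ} (κ : Fin d → ℝ) (W : Family d) (X₀ : FinitePoint d) {n : ℕ}
    (X : Fin n → Point d) : Series d :=
  ∑ k : Fin d, ∑ i : Fin n → Fin d,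
    ((if X₀.1 = k then 1 else 0) * ∏ j, if (X j).1 = i j then 1 else 0) *
      colorP κ W k X₀.2 (values fun j => (i j, (X j).2))

/-- `T(X_1, …, X_d) = ∏ j, 1_{Ĉ_j}(X_j) * ∑ a ≠ 0, t_a ∏ j, X_j ^ a_j`. -/
def globalT {d : ℕ} (X : Fin d → FinitePoint d) : Series d :=
  scalar (∏ j, if (X j).1 = j then 1 else 0) *
    couplingSum fun v => match v with
      | Sum.inl a => if a = 0 then 0 else scalar (∏ j, (X j).2 ^ a j)
      | Sum.inr _ => 0

/-- The partial derivative `∂_q T` of `T` in its `q`-th argument. -/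
def globalDT {d : ℕ} (q : Fin d) (X : Fin d → FinitePoint d) : Series d :=
  scalar (∏ j, if (X j).1 = j then 1 else 0) *
    couplingSum fun v => match v with
      | Sum.inl a =>
          scalar ((a q : ℂ) * (X q).2 ^ (a q - 1) * ∏ j ∈ Finset.univ.erase q, (X j).2 ^ a j)
      | Sum.inr _ => 0

theorem coeffN_globalDT {d : ℕ} (q : Fin d) (X : Fin d → FinitePoint d) (m : Coupling d →₀ ℕ)
    (k : ℤ) :
    coeffN m k (globalDT q X) = deriv (fun z : ℂ =>
      coeffN m k (globalT (Function.update X q ((X q).1, z)))) (X q).2 := by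
  classical
  have h1 : ∀ z : ℂ, (∏ j, if (Function.update X q ((X q).1, z) j).1 = j then (1 : ℂ) else 0)
      = ∏ j, if (X j).1 = j then (1 : ℂ) else 0 := by
    intro z
    refine Finset.prod_congr rfl fun j _ => ?_
    by_cases hj : j = q
    · subst hj
      simp
    · simp [Function.update_of_ne hj]
  have h2 : ∀ (z : ℂ) (a : Fin d → ℕ), (∏ j, (Function.update X q ((X q).1, z) j).2 ^ a j)
      = z ^ a q * ∏ j ∈ Finset.univ.erase q, (X j).2 ^ a j := by
    intro z a
    rw [← Finset.mul_prod_erase _ _ (Finset.mem_univ q)]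
    congr 1
    · simp
    · refine Finset.prod_congr rfl fun j hj => ?_
      rw [Function.update_of_ne (Finset.ne_of_mem_erase hj)]
  have hs : ∀ (f : ℂ) (m' : Coupling d →₀ ℕ), (MvPowerSeries.coeff m' (scalar f : Series d)).coeff (-k)
      = f * (MvPowerSeries.coeff m' (1 : Series d)).coeff (-k) := by
    intro f m'
    simpa [coeffN] using coeffN_scalar_mul m' k f (1 : Series d)
  have hc : ∀ (z : ℂ) (F : Coupling d → Series d), coeffN m k (scalar z * couplingSum F)
      = z * ∑ v ∈ m.support,
        (MvPowerSeries.coeff (m - Finsupp.single v 1) (F v)).coeff (-k) := by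
    intro z F
    rw [coeffN_scalar_mul]
    congr 1
    change (∑ v ∈ m.support, MvPowerSeries.coeff (m - Finsupp.single v 1) (F v)).coeff (-k) = _
    rw [HahnSeries.coeff_sum]
  unfold globalDT globalT
  simp only [hc, h1, h2]
  rw [deriv_const_mul_field]
  congr 1
  have hd : ∀ v ∈ m.support, HasDerivAt (fun z : ℂ =>
      (MvPowerSeries.coeff (m - Finsupp.single v 1) (match v with
        | Sum.inl a => if a = 0 then 0 else
            (scalar (z ^ a q * ∏ j ∈ Finset.univ.erase q, (X j).2 ^ a j) : Series d)
        | Sum.inr _ => 0)).coeff (-k))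
      ((MvPowerSeries.coeff (m - Finsupp.single v 1) (match v with
        | Sum.inl a =>
          scalar ((a q : ℂ) * (X q).2 ^ (a q - 1) * ∏ j ∈ Finset.univ.erase q, (X j).2 ^ a j)
        | Sum.inr _ => 0)).coeff (-k)) (X q).2 := by
    intro v _
    rcases v with a | b
    · by_cases ha : a = 0
      · subst ha
        simpa [hs] using hasDerivAt_const (X q).2 (0 : ℂ)
      · simp only [ha, if_false, hs]
        exact ((hasDerivAt_pow (a q) (X q).2).mul_const _).mul_const _
    · simpa using hasDerivAt_const (X q).2 (0 : ℂ)
  exact (HasDerivAt.fun_sum hd).deriv.symm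

/-- `1_{(X, Y)}`, which is `1` if `X` and `Y` lie in the same `ℂ_c` and `0` otherwise. -/
def sameSheet {d : ℕ} (X Y : FinitePoint d) : ℂ := if X.1 = Y.1 then 1 else 0

/-- `𝒰_i(X; ζ_1; ζ_2, …, ζ_d)`, the average, over the `(d - 1)!` bijections between the positions
`2, …, d` of the variables and the colors `c ≠ i`, of the difference quotient
`(∂_i T(…, X, …) - ∂_i T(…, ζ_1, …)) / (X - ζ_1)`. The bijections are extended by `i ↦ 1`, and the
quotient is understood for `X`, `ζ_1` in the same `ℂ_c`. -/
def multiTraceU {d : ℕ} (i : Fin d) (X : FinitePoint d) (ζ : Fin d → FinitePoint d) : Series d :=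
  scalar (1 / ((d - 1).factorial : ℂ)) *
    ∑ π ∈ Finset.univ.filter fun π : Equiv.Perm (Fin d) => π i = ⟨0, i.pos⟩,
      scalar (sameSheet X (ζ ⟨0, i.pos⟩) / (X.2 - (ζ ⟨0, i.pos⟩).2)) *
        (globalDT i (Function.update (fun c => ζ (π c)) i X) - globalDT i fun c => ζ (π c))

/-- `𝒰(X; ζ_1; ζ_2, …, ζ_d) = ∑ i, 1_{Ĉ_i}(X) 𝒰_i(X; ζ_1; ζ_2, …, ζ_d)`. -/
def globalU {d : ℕ} (X : FinitePoint d) (ζ : Fin d → FinitePoint d) : Series d :=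
  ∑ i : Fin d, (if X.1 = i then 1 else 0) * multiTraceU i X ζ

/-- The Joukowsky map `z ↦ (z + 1 / z) / √κ_c`. -/
def joukowsky {d : ℕ} (κ : Fin d → ℝ) (c : Fin d) (z : ℂ) : ℂ :=
  (z + z⁻¹) / (Real.sqrt (κ c) : ℂ)

/-- `X` is outside the contours `‖z‖ = ρ` around the cuts. -/
def OutsideContour {d : ℕ} (κ : Fin d → ℝ) (ρ : ℝ) (X : FinitePoint d) : Prop :=
  ∀ z : ℂ, 1 ≤ ‖z‖ → ‖z‖ ≤ ρ → joukowsky κ X.1 z ≠ X.2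

/-- `∮_{Γ ^ d} ∏ j, (dζ_j / 2πi) F(ζ_1, …, ζ_d)`, each `ζ_j` running over the union of the
positively oriented contours around the cuts `Γ_c` that are the images, under the Joukowsky maps,
of the circle `‖z‖ = ρ`, with `1 < ρ`. -/
def contourIntegral {d : ℕ} (κ : Fin d → ℝ) (ρ : ℝ) (F : (Fin d → FinitePoint d) → ℂ) : ℂ :=
  ∑ γ : Fin d → Fin d, (1 / (2 * Real.pi * Complex.I)) ^ d *
    torusIntegral (fun z : Fin d → ℂ =>
      (∏ j, deriv (joukowsky κ (γ j)) (z j)) * F fun j => (γ j, joukowsky κ (γ j) (z j)))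
      0 fun _ => ρ

/-- The sum over set partitions `K` of `{1, …, d}` and over decompositions of `{1, …, n}` into
possibly empty sets `J_p`, indexed by the parts of `K`, of `∏ p, W(ζ_{K_p}, X_{J_p})`. -/
def globalProducts {d : ℕ} (κ : Fin d → ℝ) (W : Family d) {n : ℕ} (X : Fin n → Point d)
    (ζ : Fin d → FinitePoint d) : Series d :=
  ∑ K : Finpartition (Finset.univ : Finset (Fin d)),
    ∑ f : Fin n → {B // B ∈ K.parts},
      ∏ B : {B // B ∈ K.parts},
        globalW κ W (Sum.elim (fun q : {q // q ∈ B.1} => (ζ q.1).toPoint)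
          (fun j : {j // f j = B} => X j.1))

/-- The terms without multi-trace couplings of the global loop equation at `X₀`, `X_1, …, X_n`,
at order `N ^ k` and at the order `m` in the couplings. -/
def globalSingleTrace {d : ℕ} (κ : Fin d → ℝ) (W : Family d) (X₀ : FinitePoint d) {n : ℕ}
    (X : Fin n → FinitePoint d) (m : Coupling d →₀ ℕ) (k : ℤ) : ℂ :=
  let Y : Fin n → Point d := fun j => (X j).toPoint
  let Y₀ : Point d := X₀.toPoint
  coeffN m k
    ((∑ J : Finset (Fin n),
        globalW κ W (fun o : Option {j // j ∈ J} => o.elim Y₀ fun j => Y j.1) *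
          globalW κ W (fun o : Option {j // j ∈ Jᶜ} => o.elim Y₀ fun j => Y j.1))
      + globalW κ W (fun o : Option (Option (Fin n)) => o.elim Y₀ fun o' => o'.elim Y₀ Y)
      - powN d 1 * globalV' κ X₀ * globalW κ W (fun o : Option (Fin n) => o.elim Y₀ Y)
      + powN d 1 * globalP κ W X₀ Y)
  + ∑ j, sameSheet X₀ (X j) *
      deriv (dslope (fun z : ℂ =>
        coeffN m k (globalW κ W (Function.update Y j ((X j).1, (z : OnePoint ℂ))))) X₀.2) (X j).2

/-- The left-hand side of the global loop equation at `X₀`, `X_1, …, X_n`, at order `N ^ k` and at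
the order `m` in the couplings, with contours of parameter `ρ`. -/
def globalLHS {d : ℕ} (κ : Fin d → ℝ) (W : Family d) (ρ : ℝ) (X₀ : FinitePoint d) {n : ℕ}
    (X : Fin n → FinitePoint d) (m : Coupling d →₀ ℕ) (k : ℤ) : ℂ :=
  globalSingleTrace κ W X₀ X m k
  - contourIntegral κ ρ (fun ζ => coeffN m k (powN d (2 - (d : ℤ)) *
      (∑ q, scalar (sameSheet X₀ (ζ q) / (X₀.2 - (ζ q).2)) * globalDT q (Function.update ζ q X₀)) *
      globalProducts κ W (fun j => (X j).toPoint) ζ))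
  + contourIntegral κ ρ (fun ζ => coeffN m k (powN d (2 - (d : ℤ)) *
      globalU X₀ ζ * globalProducts κ W (fun j => (X j).toPoint) ζ))

/-- The same left-hand side, the two multi-trace terms being combined into a single one. -/
def globalLHS' {d : ℕ} (κ : Fin d → ℝ) (W : Family d) (ρ : ℝ) (X₀ : FinitePoint d) {n : ℕ}
    (X : Fin n → FinitePoint d) (m : Coupling d →₀ ℕ) (k : ℤ) : ℂ :=
  globalSingleTrace κ W X₀ X m k
  - contourIntegral κ ρ (fun ζ => coeffN m k (powN d (2 - (d : ℤ)) *
      (∑ q, scalar (sameSheet X₀ (ζ q) / (X₀.2 - (ζ q).2)) * globalDT q ζ) *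
      globalProducts κ W (fun j => (X j).toPoint) ζ))

end

end MultiTrace

open MultiTrace

namespace MultiTrace
noncomputable section
open Finset (univ sum_congr mem_univ mul_sum range prod_congr sum_add_distrib sum_insert
  mem_insert_self sum_comm insert_val_of_notMem sum_mul sum_eq_single prod_mul_distrib sum_nonneg
  prod_insert mul_prod_erase erase_insert single_le_sum ne_of_mem_erase sum_eq_zero prod_nonneg
  univ_eq_empty smul_sum mem_range sum_le_sum sum_empty prod_empty insert_erase mem_powerset map_val
  mem_insert_of_mem card_univ mem_sdiff mem_erase mem_insert sum_filter sum_const cons_val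
  notMem_erase prod_coe_sort add_sum_erase mem_filter sum_sub_distrib)
open Finset.HasAntidiagonal (antidiagonal mem_antidiagonal)
open Multiset (induction_on map_cons sum_cons card_cons exists_cons_of_mem singleton_add card_map
  map_map exists_mem_of_ne_zero cons_add)
open Finsupp (single weight)
open Function (update update_of_ne update_self)
open Complex (exp I norm_real log normSq slitPlane ofReal_re)
open Real (pi norm_of_nonneg sqrt_pos sqrt_nonneg)
open LinearMap (mulLeft mulLeft_apply comp_apply)
open Metric (sphere)
open Nat (succ_ne_zero)

/-- Orders in the couplings. -/
abbrev Order (d : ℕ) : Type := Coupling d →₀ ℕ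

/-- Traces of powers `tr M_c ^ p`. -/
abbrev Label (d : ℕ) : Type := Fin d × ℕ

/-- Families of traces of powers `tr M_c ^ p`. -/
abbrev Labels (d : ℕ) : Type := Multiset (Label d)

/-- The set partitions of `S`, sorted by the block `insert p L` of a distinguished element `p`. -/
lemma sum_finpartition_eq {α R : Type*} [DecidableEq α] [AddCommMonoid R] (S : Finset α) {p : α}
    (hp : p ∈ S) (F : Finset (Finset α) → R) :
    ∑ π : Finpartition S, F π.parts
      = ∑ L ∈ (S.erase p).powerset, ∑ Λ : Finpartition (S.erase p \ L),
          F (insert (insert p L) Λ.parts) := by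
  classical
  rw [Finset.sum_sigma']
  symm
  have hdis : ∀ L : Finset α, L ⊆ S.erase p → Disjoint (S.erase p \ L) (insert p L) :=
    fun L _ => Finset.disjoint_left.2 fun x => by grind
  have hun : ∀ L : Finset α, L ⊆ S.erase p → (S.erase p \ L) ⊔ insert p L = S := fun L hL => by
    rw [Finset.sup_eq_union]
    grind
  have hnp : ∀ (L : Finset α) (Λ : Finpartition (S.erase p \ L)), ∀ B ∈ Λ.parts, p ∉ B := fun L Λ B hB hpB => by
    have := Λ.le hB hpB
    simp at this
  refine Finset.sum_bij
    (fun x hx => x.2.extend (b := insert p x.1) (c := S) (Finset.insert_ne_empty _ _)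
      (hdis _ (by simpa using hx)) (hun _ (by simpa using hx)))
    (fun _ _ => mem_univ _) ?_ ?_ ?_
  · rintro ⟨L, Λ⟩ h1 ⟨L', Λ'⟩ h2 h
    have h := congrArg Finpartition.parts h
    simp only [Finpartition.extend] at h
    have h1' : L ⊆ S.erase p := by simpa using h1
    have h2' : L' ⊆ S.erase p := by simpa using h2
    have hL : insert p L = insert p L' := by
      have : insert p L ∈ insert (insert p L') Λ'.parts := by
        rw [← h]; exact mem_insert_self _ _
      rcases mem_insert.1 this with h3 | h3
      · exact h3
      · exact absurd (mem_insert_self p L) (hnp _ _ _ h3)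
    have hpL : p ∉ L := fun h3 => by simpa using h1' h3
    have hpL' : p ∉ L' := fun h3 => by simpa using h2' h3
    have hLL : L = L' := by
      rw [← erase_insert hpL, hL, erase_insert hpL']
    subst hLL
    have h4 : Λ.parts = Λ'.parts := by
      have a1 : insert p L ∉ Λ.parts := fun h3 => hnp _ _ _ h3 (mem_insert_self p L)
      have a2 : insert p L ∉ Λ'.parts := fun h3 => hnp _ _ _ h3 (mem_insert_self p L)
      rw [← erase_insert a1, h, erase_insert a2]
    rw [Finpartition.ext h4]
  · intro π _
    obtain ⟨B, hB, hpB⟩ : ∃ B ∈ π.parts, p ∈ B := π.exists_mem hp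
    have hle : B ⊆ S := π.le hB
    have hL : B.erase p ⊆ S.erase p := Finset.erase_subset_erase p hle
    have hsd : S.erase p \ B.erase p = S \ B := by grind
    have hsup : (π.parts.erase B).sup id = S.erase p \ B.erase p := by
      rw [hsd]
      ext x
      simp only [Finset.mem_sup, mem_erase, id, mem_sdiff]
      constructor
      · rintro ⟨C, ⟨h1, h2⟩, h3⟩
        refine ⟨π.le h2 h3, fun h4 => ?_⟩
        exact (Finset.disjoint_left.1 (π.disjoint h2 hB h1)) h3 h4
      · rintro ⟨h1, h2⟩
        obtain ⟨C, hC, hx⟩ := π.exists_mem h1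
        exact ⟨C, ⟨fun h => h2 (h ▸ hx), hC⟩, hx⟩
    refine ⟨⟨B.erase p, π.parts.erase B, π.supIndep.subset (Finset.erase_subset _ _), hsup,
      fun h => π.bot_notMem (Finset.mem_of_mem_erase h)⟩, by simpa using hL, ?_⟩
    ext1
    simp [Finpartition.extend, insert_erase hpB, insert_erase hB]
  · rintro ⟨L, Λ⟩ h
    rfl

lemma sum_finpartition_prod {α R : Type*} [DecidableEq α] [CommSemiring R] (S : Finset α) {p : α}
    (hp : p ∈ S) (F : Finset α → R) :
    ∑ π : Finpartition S, ∏ B ∈ π.parts, F B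
      = ∑ L ∈ (S.erase p).powerset, ∑ Λ : Finpartition (S.erase p \ L),
          F (insert p L) * ∏ B ∈ Λ.parts, F B := by
  rw [sum_finpartition_eq S hp (fun P => ∏ B ∈ P, F B)]
  refine sum_congr rfl fun L hL => sum_congr rfl fun Λ _ => ?_
  rw [prod_insert]
  intro h
  have := Λ.le h (mem_insert_self p L)
  simp at this

/-- Commuting derivations `D a`, with a closed family `F a`: in the matrix model, `D a` inserts a
trace in a connected correlator, and `F a` is the expectation of that trace. -/
structure Insertions (Λ : Type) (R : Type*) [CommRing R] [Algebra ℂ R] where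
  D : Λ → Derivation ℂ R R
  F : Λ → R
  comm : ∀ a b f, D a (D b f) = D b (D a f)
  symm : ∀ a b, D a (F b) = D b (F a)

namespace Insertions
variable {Λ : Type} {R : Type*} [CommRing R] [Algebra ℂ R] (I : Insertions Λ R)

instance : LeftCommutative (fun a f => I.D a f) := ⟨fun a b f => I.comm a b f⟩

/-- The iterated insertion of the elements of a multiset. -/
def iter (s : Multiset Λ) (f : R) : R := s.foldr (fun a g => I.D a g) f

@[simp] theorem iter_zero (f : R) : I.iter 0 f = f := rfl

@[simp] theorem iter_cons (a : Λ) (s : Multiset Λ) (f : R) :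
    I.iter (a ::ₘ s) f = I.D a (I.iter s f) := Multiset.foldr_cons _ _ _ _

lemma iter_add_left (s t : Multiset Λ) (f : R) : I.iter (s + t) f = I.iter s (I.iter t f) := by
  induction s using induction_on with
  | empty => simp
  | cons a s ih => simp [ih]

lemma iter_cons' (a : Λ) (s : Multiset Λ) (f : R) : I.iter (a ::ₘ s) f = I.iter s (I.D a f) := by
  rw [← singleton_add, add_comm, iter_add_left]
  rfl

lemma iter_add (s : Multiset Λ) (f g : R) : I.iter s (f + g) = I.iter s f + I.iter s g := by
  induction s using induction_on with
  | empty => simp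
  | cons a s ih => simp [ih]

lemma iter_smul (s : Multiset Λ) (z : ℂ) (f : R) : I.iter s (z • f) = z • I.iter s f := by
  induction s using induction_on with
  | empty => simp
  | cons a s ih => simp [ih]

/-- Iterated insertion, as a linear map. -/
def iterLin (s : Multiset Λ) : R →ₗ[ℂ] R where
  toFun := I.iter s
  map_add' := I.iter_add s
  map_smul' z f := I.iter_smul s z f

lemma iter_zero_right (s : Multiset Λ) : I.iter s (0 : R) = 0 := map_zero (I.iterLin s)

lemma iter_sub (s : Multiset Λ) (f g : R) : I.iter s (f - g) = I.iter s f - I.iter s g := 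
  map_sub (I.iterLin s) f g

lemma iter_sum {ι : Type*} (s : Multiset Λ) (A : Finset ι) (f : ι → R) :
    I.iter s (∑ i ∈ A, f i) = ∑ i ∈ A, I.iter s (f i) := 
  map_sum (I.iterLin s) f A

lemma iter_mul_of_D_eq_zero (s : Multiset Λ) (c f : R) (hc : ∀ a, I.D a c = 0) :
    I.iter s (c * f) = c * I.iter s f := by
  induction s using induction_on with
  | empty => simp
  | cons a s ih => simp [ih, hc]

lemma iter_of_D_eq_zero (s : Multiset Λ) (c : R) (hc : ∀ a, I.D a c = 0) (hs : s ≠ 0) :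
    I.iter s c = 0 := by
  obtain ⟨a, ha⟩ := exists_mem_of_ne_zero hs
  obtain ⟨t, rfl⟩ := exists_cons_of_mem ha
  rw [iter_cons', hc, iter_zero_right]

lemma iter_symm (s : Multiset Λ) (a b : Λ) :
    I.iter (b ::ₘ s) (I.F a) = I.iter (a ::ₘ s) (I.F b) := by
  rw [iter_cons', iter_cons', I.symm]

open Classical in
/-- The connected correlator of a multiset of insertions. -/
def corr (s : Multiset Λ) : R := if h : s = 0 then 0 else
    I.iter (s.erase (exists_mem_of_ne_zero h).choose) (I.F (exists_mem_of_ne_zero h).choose)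

@[simp] theorem corr_zero : I.corr 0 = 0 := by simp [corr]

lemma corr_cons (a : Λ) (s : Multiset Λ) : I.corr (a ::ₘ s) = I.iter s (I.F a) := by
  classical
  have h : a ::ₘ s ≠ 0 := Multiset.cons_ne_zero
  rw [corr, dif_neg h]
  have hb := (exists_mem_of_ne_zero h).choose_spec
  generalize (exists_mem_of_ne_zero h).choose = b at hb ⊢
  by_cases hba : b = a
  · subst hba; simp
  · have hbs : b ∈ s := by simpa [hba] using hb
    obtain ⟨t, rfl⟩ := exists_cons_of_mem hbs
    rw [Multiset.cons_swap, Multiset.erase_cons_head, iter_symm]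

lemma iter_corr_cons (a : Λ) (s t : Multiset Λ) :
    I.iter s (I.corr (a ::ₘ t)) = I.corr (a ::ₘ (s + t)) := by
  rw [corr_cons, corr_cons, iter_add_left]

lemma iter_corr (s t : Multiset Λ) (ht : t ≠ 0) : I.iter s (I.corr t) = I.corr (s + t) := by
  obtain ⟨a, ha⟩ := exists_mem_of_ne_zero ht
  obtain ⟨t, rfl⟩ := exists_cons_of_mem ha
  rw [iter_corr_cons, Multiset.add_cons]

lemma iter_mul {ι : Type*} [DecidableEq ι] (v : ι → Λ) (S : Finset ι) (f g : R) :
    I.iter (S.val.map v) (f * g)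
      = ∑ J ∈ S.powerset, I.iter (J.val.map v) f * I.iter ((S \ J).val.map v) g := by
  induction S using Finset.induction_on with
  | empty => simp
  | insert a S ha ih =>
    rw [insert_val_of_notMem ha, map_cons, iter_cons, ih,
      Finset.sum_powerset_insert ha, map_sum, ← sum_add_distrib]
    refine sum_congr rfl fun J hJ => ?_
    have hJ := mem_powerset.1 hJ
    have haJ : a ∉ J := fun h => ha (hJ h)
    have h1 : insert a S \ J = insert a (S \ J) := Finset.insert_sdiff_of_notMem _ haJ
    have h2 : insert a S \ insert a J = S \ J := by
      rw [Finset.insert_sdiff_insert, Finset.sdiff_insert_of_notMem ha]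
    rw [h1, h2, insert_val_of_notMem (by simp [ha]), insert_val_of_notMem haJ,
      map_cons, map_cons, iter_cons, iter_cons, Derivation.leibniz]
    simp only [smul_eq_mul]
    ring

lemma iter_mul_univ {n : ℕ} (v : Fin n → Λ) (f g : R) : I.iter (values v) (f * g)
      = ∑ J : Finset (Fin n), I.iter (J.val.map v) f * I.iter (Jᶜ.val.map v) g := by
  rw [values, iter_mul, Finset.powerset_univ]
  rfl

lemma D_prod {P : Type*} [DecidableEq P] (a : Λ) (A : Finset P) (F : P → R) :
    I.D a (∏ b ∈ A, F b) = ∑ c ∈ A, ∏ b ∈ A, if b = c then I.D a (F b) else F b := by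
  induction A using Finset.induction_on with
  | empty => simp
  | insert p A hp ih =>
    rw [prod_insert hp, Derivation.leibniz, ih, sum_insert hp,
      prod_insert hp, if_pos rfl, smul_eq_mul, smul_eq_mul, add_comm, mul_sum]
    congr 1
    · rw [mul_comm]
      congr 1
      exact prod_congr rfl fun b hb => by rw [if_neg (ne_of_mem_of_not_mem hb hp)]
    · refine sum_congr rfl fun c hc => ?_
      rw [prod_insert hp, if_neg (ne_of_mem_of_not_mem hc hp).symm]

lemma iter_prod {P : Type*} [Fintype P] [DecidableEq P] {n : ℕ} (v : Fin n → Λ) (F : P → R) :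
    I.iter (values v) (∏ b, F b)
      = ∑ f : Fin n → P, ∏ b, I.iter ((univ.filter fun j => f j = b).val.map v) (F b) := by
  induction n with
  | zero =>
    simp only [values, univ_eq_empty, Finset.empty_val, Multiset.map_zero, iter_zero,
      Finset.filter_empty]
    simp
  | succ n ih =>
    have hv : values v = v 0 ::ₘ values (Fin.tail v) := by
      simp only [values]
      rw [Fin.univ_succ, cons_val, map_cons, map_val, map_map]
      rfl
    rw [hv, iter_cons, ih, map_sum, ← (Fin.consEquiv fun _ => P).sum_comp, Fintype.sum_prod_type,
      sum_comm]
    refine sum_congr rfl fun f _ => ?_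
    rw [D_prod]
    refine sum_congr rfl fun c _ => prod_congr rfl fun b _ => ?_
    have hmap : (univ.filter fun j => (Fin.cons c f : Fin (n + 1) → P) j = b).val.map v
        = (if b = c then {v 0} else 0) + (univ.filter fun j => f j = b).val.map (Fin.tail v) := by
      rw [Finset.filter_val, Fin.univ_succ, cons_val, map_val, Multiset.filter_cons,
        Multiset.map_add, Multiset.filter_map, map_map]
      congr 1
      simp only [Fin.cons_zero, eq_comm (a := c)]
      split_ifs <;> simp
    have hcons : (Fin.consEquiv fun _ => P) (c, f) = Fin.cons c f := rfl
    rw [hcons, hmap]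
    split_ifs with h
    · rw [singleton_add, iter_cons]
    · rw [zero_add]

lemma moment_insert {ι : Type*} [DecidableEq ι] (v : ι → Λ) (E : Finset ι → R) (hE0 : E ∅ = 1)
    (hE : ∀ S j, j ∉ S → E (insert j S) = E S * I.F (v j) + I.D (v j) (E S))
    (S : Finset ι) (j : ι) (hj : j ∉ S) :
    E (insert j S) = ∑ J ∈ S.powerset, I.corr (v j ::ₘ J.val.map v) * E (S \ J) := by
  induction S using Finset.induction_on with
  | empty =>
    rw [hE _ _ hj]
    simp [hE0, corr_cons]
  | insert l S hl ih =>
    have hjl : j ≠ l := fun h => hj (h ▸ mem_insert_self _ _)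
    have hjS : j ∉ S := fun h => hj (mem_insert_of_mem h)
    have ih := ih hjS
    rw [Finset.insert_comm, hE _ _ (by simp [hl, hjl.symm]), ih, Finset.sum_powerset_insert hl,
      map_sum, sum_mul, ← sum_add_distrib, ← sum_add_distrib]
    refine sum_congr rfl fun J hJ => ?_
    have hJ := mem_powerset.1 hJ
    have hlJ : l ∉ J := fun h => hl (hJ h)
    have h1 : insert l S \ J = insert l (S \ J) := Finset.insert_sdiff_of_notMem _ hlJ
    have h2 : insert l S \ insert l J = S \ J := by
      rw [Finset.insert_sdiff_insert, Finset.sdiff_insert_of_notMem hl]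
    rw [h1, h2, hE _ _ (by simp [hl]), insert_val_of_notMem hlJ, map_cons,
      corr_cons, corr_cons, iter_cons, Derivation.leibniz]
    simp only [smul_eq_mul]
    ring

lemma cumulant_eq_corr {ι : Type*} [DecidableEq ι] (v : ι → Λ) (E : Finset ι → R) (hE0 : E ∅ = 1)
    (hE : ∀ S j, j ∉ S → E (insert j S) = E S * I.F (v j) + I.D (v j) (E S))
    (S : Finset ι) (hS : S.Nonempty) : cumulant E S = I.corr (S.val.map v) := by
  induction S using Finset.strongInduction with
  | H S ih =>
  obtain ⟨j, hj⟩ := hS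
  have hM : ∀ T : Finset ι, ∑ π : Finpartition T, ∏ B ∈ π.parts, cumulant E B = E T := fun T => by
    rcases T.eq_empty_or_nonempty with rfl | hT
    · rw [hE0]
      have : ∀ π : Finpartition (∅ : Finset ι), π.parts = ∅ := fun π => by
        rw [Finpartition.parts_eq_empty_iff]; rfl
      rw [sum_congr rfl fun π _ => by rw [this π, prod_empty]]
      have hu : Fintype.card (Finpartition (∅ : Finset ι)) = 1 :=
        Fintype.card_eq_one_iff.2 ⟨Finpartition.empty _, fun π => by ext1; rw [this, this]⟩
      simp [hu]
    · exact (moment_eq_sum_cumulant E T hT).symm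
  have h1 := moment_eq_sum_cumulant E S ⟨j, hj⟩
  rw [sum_finpartition_prod S hj] at h1
  simp only [← mul_sum, hM] at h1
  have h2 := I.moment_insert v E hE0 hE (S.erase j) j (by simp)
  rw [insert_erase hj] at h2
  rw [h1] at h2
  have hmem : S.erase j ∈ (S.erase j).powerset := by simp
  rw [← add_sum_erase _ _ hmem, ← add_sum_erase _ _ hmem] at h2
  have h3 : ∑ J ∈ (S.erase j).powerset.erase (S.erase j), cumulant E (insert j J) * E (S.erase j \ J)
      = ∑ J ∈ (S.erase j).powerset.erase (S.erase j),
        I.corr (v j ::ₘ J.val.map v) * E (S.erase j \ J) := by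
    refine sum_congr rfl fun J hJ => ?_
    simp only [mem_erase, mem_powerset] at hJ
    have hjJ : j ∉ J := fun h => by simpa using hJ.2 h
    have hss : insert j J ⊂ S := by
      refine Finset.ssubset_iff_subset_ne.2 ⟨?_, ?_⟩
      · exact Finset.insert_subset hj (hJ.2.trans (Finset.erase_subset _ _))
      · intro h
        apply hJ.1
        rw [← h, erase_insert hjJ]
    rw [ih _ hss (Finset.insert_nonempty _ _), insert_val_of_notMem hjJ, map_cons]
  rw [h3, add_left_inj, Finset.sdiff_self, hE0, mul_one, mul_one, insert_erase hj] at h2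
  rw [h2, ← map_cons, ← insert_val_of_notMem (by simp), insert_erase hj]

end Insertions

section
open MeasureTheory
open Matrix (trace of_apply trace_smul)

/-! ### Gaussian integration by parts for Hermitian matrices -/

section Growth
variable {E : Type*} [NormedAddCommGroup E]

/-- Continuous functions of at most polynomial growth. -/
def Growth (f : E → ℂ) : Prop := Continuous f ∧ ∃ (C : ℝ) (n : ℕ), ∀ x, ‖f x‖ ≤ C * (1 + ‖x‖) ^ n

lemma Growth.const (z : ℂ) : Growth fun _ : E => z := ⟨continuous_const, ‖z‖, 0, fun x => by simp⟩

lemma Growth.add {f g : E → ℂ} (hf : Growth f) (hg : Growth g) : Growth fun x => f x + g x := by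
  obtain ⟨h1, C, n, h2⟩ := hf
  obtain ⟨h3, C', n', h4⟩ := hg
  refine ⟨h1.add h3, |C| + |C'|, n + n', fun x => (norm_add_le _ _).trans ?_⟩
  have hx : 1 ≤ 1 + ‖x‖ := by linarith [norm_nonneg x]
  rw [add_mul]
  refine add_le_add ((h2 x).trans ?_) ((h4 x).trans ?_)
  · exact mul_le_mul (le_abs_self _) (pow_le_pow_right₀ hx (by omega)) (by positivity) (by positivity)
  · exact mul_le_mul (le_abs_self _) (pow_le_pow_right₀ hx (by omega)) (by positivity) (by positivity)

lemma Growth.mul {f g : E → ℂ} (hf : Growth f) (hg : Growth g) : Growth fun x => f x * g x := by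
  obtain ⟨h1, C, n, h2⟩ := hf
  obtain ⟨h3, C', n', h4⟩ := hg
  refine ⟨h1.mul h3, C * C', n + n', fun x => ?_⟩
  rw [norm_mul, pow_add, mul_mul_mul_comm]
  exact mul_le_mul (h2 x) (h4 x) (norm_nonneg _) ((norm_nonneg _).trans (h2 x))

lemma Growth.sum {ι : Type*} (s : Finset ι) {f : ι → E → ℂ} (hf : ∀ i ∈ s, Growth (f i)) :
    Growth fun x => ∑ i ∈ s, f i x := by
  simpa only [Finset.sum_fn] using
    Finset.sum_induction f Growth (fun _ _ => Growth.add) (Growth.const 0) hf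

lemma Growth.prod {ι : Type*} (s : Finset ι) {f : ι → E → ℂ} (hf : ∀ i ∈ s, Growth (f i)) :
    Growth fun x => ∏ i ∈ s, f i x := by
  simpa only [Finset.prod_fn] using
    Finset.prod_induction f Growth (fun _ _ => Growth.mul) (Growth.const 1) hf

lemma Growth.pow {f : E → ℂ} (hf : Growth f) (n : ℕ) : Growth fun x => f x ^ n := by
  induction n with
  | zero => simpa using Growth.const (E := E) 1
  | succ n ih => simpa [pow_succ] using ih.mul hf

lemma Growth.matrix_mul {N : ℕ} {A B : E → Matrix (Fin N) (Fin N) ℂ}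
    (hA : ∀ a b, Growth fun x => A x a b) (hB : ∀ a b, Growth fun x => B x a b) (a b : Fin N) :
    Growth fun x => (A x * B x) a b := by
  simp only [Matrix.mul_apply]
  exact Growth.sum _ fun j _ => (hA a j).mul (hB j b)

lemma Growth.matrix_pow {N : ℕ} {A : E → Matrix (Fin N) (Fin N) ℂ}
    (hA : ∀ a b, Growth fun x => A x a b) (k : ℕ) (a b : Fin N) :
    Growth fun x => (A x ^ k) a b := by
  induction k generalizing a b with
  | zero => simpa using Growth.const (E := E) _
  | succ k ih => simpa only [pow_succ] using Growth.matrix_mul ih hA a b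

lemma Growth.trace {N : ℕ} {A : E → Matrix (Fin N) (Fin N) ℂ}
    (hA : ∀ a b, Growth fun x => A x a b) : Growth fun x => (A x).trace :=
  Growth.sum _ fun a _ => hA a a

lemma Growth.integrable_mul [NormedSpace ℝ E] [FiniteDimensional ℝ E] [MeasurableSpace E]
    [BorelSpace E] (μ : Measure E) [μ.IsAddHaarMeasure] {f w : E → ℂ} (hf : Growth f)
    (hw : Continuous w) {b : ℝ} (hb : 0 < b) (hwb : ∀ x, ‖w x‖ ≤ Real.exp (-(b * ‖x‖ ^ 2))) :
    Integrable (fun x => f x * w x) μ := by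
  obtain ⟨h1, C, n, h2⟩ := hf
  set r : ℕ := Module.finrank ℝ E + 1
  have hint : Integrable (fun x : E => (1 + ‖x‖) ^ (-(r : ℝ))) μ :=
    integrable_one_add_norm (by simp [r])
  have key : ∀ x : E, (1 + ‖x‖) ^ (n + r)
      ≤ (2 ^ (n + r) * ((n + r).factorial / b ^ (n + r)) * Real.exp b) * Real.exp (b * ‖x‖ ^ 2) := fun x => by
    have h3 : (1 + ‖x‖) ^ (n + r) ≤ (2 * (1 + ‖x‖ ^ 2)) ^ (n + r) := by
      refine pow_le_pow_left₀ (by positivity) ?_ _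
      nlinarith [sq_nonneg (‖x‖ - 1), norm_nonneg x]
    refine h3.trans ?_
    have h4 := Real.pow_div_factorial_le_exp (b * (1 + ‖x‖ ^ 2)) (by positivity) (n + r)
    rw [mul_add, mul_one, Real.exp_add, div_le_iff₀ (by positivity)] at h4
    rw [mul_pow]
    have h5 : (1 + ‖x‖ ^ 2) ^ (n + r) = (b + b * ‖x‖ ^ 2) ^ (n + r) / b ^ (n + r) := by
      rw [eq_div_iff (by positivity), ← mul_pow]; ring
    rw [h5]
    calc 2 ^ (n + r) * ((b + b * ‖x‖ ^ 2) ^ (n + r) / b ^ (n + r))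
        ≤ 2 ^ (n + r) * ((Real.exp b * Real.exp (b * ‖x‖ ^ 2) * (n + r).factorial) / b ^ (n + r)) := by
          gcongr
      _ = _ := by ring
  set A := 2 ^ (n + r) * ((n + r).factorial / b ^ (n + r)) * Real.exp b
  refine (hint.const_mul (|C| * A)).mono' (h1.mul hw).aestronglyMeasurable (ae_of_all _ fun x => ?_)
  rw [norm_mul]
  have hx : 0 < 1 + ‖x‖ := by positivity
  have h6 := key x
  rw [pow_add] at h6
  calc ‖f x‖ * ‖w x‖ ≤ (|C| * (1 + ‖x‖) ^ n) * Real.exp (-(b * ‖x‖ ^ 2)) :=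
        mul_le_mul ((h2 x).trans (by gcongr; exact le_abs_self C)) (hwb x) (norm_nonneg _)
          (by positivity)
    _ ≤ |C| * A * (1 + ‖x‖) ^ (-(r : ℝ)) := by
        rw [Real.rpow_neg hx.le, Real.rpow_natCast, Real.exp_neg, mul_assoc, mul_assoc]
        refine mul_le_mul_of_nonneg_left ?_ (abs_nonneg _)
        rw [← div_eq_mul_inv, ← div_eq_mul_inv, div_le_div_iff₀ (Real.exp_pos _) (by positivity)]
        exact h6

end Growth

/-- The space of real coordinates of `d` Hermitian `N × N` matrices. -/
abbrev Conf (d N : ℕ) : Type := Fin d → Fin N → Fin N → ℝ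

instance (d N : ℕ) : (volume : Measure (Conf d N)).IsAddHaarMeasure :=
  haveI : (volume : Measure (Fin N → Fin N → ℝ)).IsAddHaarMeasure :=
    Measure.pi.isAddHaarMeasure fun _ => volume
  Measure.pi.isAddHaarMeasure fun _ => volume

variable {d N : ℕ}

lemma herm_add_smul (X Y : Fin N → Fin N → ℝ) (t : ℝ) : herm (X + t • Y) = herm X + t • herm Y := by
  ext a b
  simp only [herm, of_apply, Matrix.add_apply, Matrix.smul_apply, Pi.add_apply,
    Pi.smul_apply, smul_eq_mul, Complex.real_smul]
  split_ifs <;> push_cast <;> ring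

lemma herm_zero : herm (0 : Fin N → Fin N → ℝ) = 0 := by
  ext a b
  simp [herm]

lemma herm_growth (c : Fin d) (a b : Fin N) : Growth fun X : Conf d N => herm (X c) a b := by
  have hX : ∀ a b : Fin N, Growth fun X : Conf d N => (X c a b : ℂ) := fun a b =>
    ⟨by fun_prop, 1, 1, fun X => by
      rw [norm_real, one_mul, pow_one]
      have := ((norm_le_pi_norm (X c a) b).trans (norm_le_pi_norm (X c) a)).trans (norm_le_pi_norm X c)
      linarith⟩
  simp only [herm, of_apply]
  split_ifs
  · exact hX a a
  · simpa [div_eq_mul_inv] using ((hX a b).add ((Growth.const I).mul (hX b a))).mul (Growth.const _)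
  · simpa [div_eq_mul_inv, sub_eq_add_neg] using
      ((hX b a).add ((Growth.const (-I)).mul (hX a b))).mul (Growth.const _)

lemma trace_herm_sq (X : Fin N → Fin N → ℝ) :
    (herm X ^ 2).trace = ((∑ a, ∑ b, X a b ^ 2 : ℝ) : ℂ) := by
  have h2 : ((√2 : ℝ) : ℂ) ^ 2 = 2 := by
    rw [← Complex.ofReal_pow, Real.sq_sqrt (by norm_num)]; norm_num
  have h1 : ∀ a b, herm X a b * herm X b a = ((X a b : ℂ) ^ 2 + (X b a : ℂ) ^ 2) / 2 := fun a b => by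
    rcases lt_trichotomy a b with h | h | h
    · simp only [herm, of_apply, h, h.ne, h.ne', h.not_gt, if_true, if_false]
      field_simp
      rw [h2]; linear_combination (-2 * (X b a : ℂ) ^ 2) * Complex.I_sq
    · subst h; simp [herm]; ring
    · simp only [herm, of_apply, h, h.ne, h.ne', h.not_gt, if_true, if_false]
      field_simp
      rw [h2]; linear_combination (-2 * (X a b : ℂ) ^ 2) * Complex.I_sq
  rw [sq, trace]
  simp only [Matrix.diag, Matrix.mul_apply, h1]
  push_cast
  simp only [add_div, sum_add_distrib]
  rw [sum_comm (f := fun a b => (X b a : ℂ) ^ 2 / 2)]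
  simp only [← sum_add_distrib]
  exact sum_congr rfl fun a _ => sum_congr rfl fun b _ => by ring

/-- The Gaussian weight. -/
def gauss (κ : Fin d → ℝ) (X : Conf d N) : ℂ :=
  exp (-((N : ℂ) / 2) * ∑ c, (κ c : ℂ) * (herm (X c) ^ 2).trace)

lemma gauss_eq (κ : Fin d → ℝ) (X : Conf d N) :
    gauss κ X = (Real.exp (-((N : ℝ) / 2 * ∑ c, κ c * ∑ a, ∑ b, X c a b ^ 2)) : ℂ) := by
  rw [gauss]
  simp only [trace_herm_sq]
  push_cast
  ring_nf

lemma continuous_gauss (κ : Fin d → ℝ) : Continuous (gauss κ : Conf d N → ℂ) := by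
  have : (gauss κ : Conf d N → ℂ) = _ := funext fun X => gauss_eq κ X
  rw [this]
  fun_prop

lemma exists_norm_gauss_le {κ : Fin d → ℝ} (hκ : ∀ c, 0 < κ c) (hN : 0 < N) :
    ∃ b : ℝ, 0 < b ∧ ∀ X : Conf d N, ‖gauss κ X‖ ≤ Real.exp (-(b * ‖X‖ ^ 2)) := by
  obtain ⟨b, hb, hbκ⟩ : ∃ b : ℝ, 0 < b ∧ ∀ c, b ≤ κ c := by
    rcases isEmpty_or_nonempty (Fin d) with h | h
    · exact ⟨1, one_pos, fun c => h.elim c⟩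
    · obtain ⟨c, hc⟩ := Finite.exists_min κ
      exact ⟨κ c, hκ c, hc⟩
  have hN' : (0 : ℝ) < N := by exact_mod_cast hN
  refine ⟨N / 2 * b, by positivity, fun X => ?_⟩
  rw [gauss_eq, norm_real, norm_of_nonneg (Real.exp_nonneg _)]
  refine Real.exp_le_exp.2 (neg_le_neg ?_)
  rw [mul_assoc]
  refine mul_le_mul_of_nonneg_left ?_ (by positivity)
  have h1 : ‖X‖ ^ 2 ≤ ∑ c, ∑ a, ∑ b, X c a b ^ 2 := by
    have h0 : ‖X‖ ≤ √(∑ c, ∑ a, ∑ b, X c a b ^ 2) := by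
      refine (pi_norm_le_iff_of_nonneg (sqrt_nonneg _)).2 fun c =>
        (pi_norm_le_iff_of_nonneg (sqrt_nonneg _)).2 fun a =>
        (pi_norm_le_iff_of_nonneg (sqrt_nonneg _)).2 fun b => Real.le_sqrt_of_sq_le ?_
      rw [Real.norm_eq_abs, sq_abs]
      calc X c a b ^ 2 ≤ ∑ b, X c a b ^ 2 :=
            single_le_sum (f := fun b => X c a b ^ 2) (fun _ _ => sq_nonneg _) (mem_univ b)
        _ ≤ ∑ a, ∑ b, X c a b ^ 2 := single_le_sum (f := fun a => ∑ b, X c a b ^ 2)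
            (fun _ _ => by positivity) (mem_univ a)
        _ ≤ _ := single_le_sum (f := fun c => ∑ a, ∑ b, X c a b ^ 2)
            (fun _ _ => by positivity) (mem_univ c)
    calc ‖X‖ ^ 2 ≤ √(∑ c, ∑ a, ∑ b, X c a b ^ 2) ^ 2 :=
          pow_le_pow_left₀ (norm_nonneg _) h0 2
      _ = _ := Real.sq_sqrt (by positivity)
  calc b * ‖X‖ ^ 2 ≤ b * ∑ c, ∑ a, ∑ b, X c a b ^ 2 := by gcongr
    _ ≤ _ := by
      rw [mul_sum]
      exact sum_le_sum fun c _ => mul_le_mul_of_nonneg_right (hbκ c) (by positivity)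

lemma integrable_mul_gauss {κ : Fin d → ℝ} (hκ : ∀ c, 0 < κ c) (hN : 0 < N)
    {f : Conf d N → ℂ} (hf : Growth f) : Integrable fun X => f X * gauss κ X := by
  obtain ⟨b, hb, h⟩ := exists_norm_gauss_le (d := d) hκ hN
  exact hf.integrable_mul _ (continuous_gauss κ) hb h

lemma hasLineDerivAt_gauss (κ : Fin d → ℝ) (X v : Conf d N) : HasLineDerivAt ℝ (gauss κ)
      (-(N : ℂ) * (∑ c, (κ c : ℂ) * (herm (X c) * herm (v c)).trace) * gauss κ X) X v := by
  have h1 : ∀ c, HasDerivAt (fun t : ℝ => (herm ((X + t • v) c) ^ 2).trace)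
      (2 * (herm (X c) * herm (v c)).trace) 0 := fun c => by
    have h2 : ∀ t : ℝ, (herm ((X + t • v) c) ^ 2).trace = (herm (X c) ^ 2).trace
        + (t : ℂ) * (2 * (herm (X c) * herm (v c)).trace) + (t : ℂ) ^ 2 * (herm (v c) ^ 2).trace := fun t => by
      rw [Pi.add_apply, Pi.smul_apply, herm_add_smul]
      simp only [sq, add_mul, mul_add, Matrix.trace_add, Matrix.smul_mul, Matrix.mul_smul,
        trace_smul, Complex.real_smul]
      rw [Matrix.trace_mul_comm (herm (v c)) (herm (X c))]
      ring
    simp only [h2]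
    have h3 : HasDerivAt (fun t : ℝ => (t : ℂ)) 1 0 := Complex.ofRealCLM.hasDerivAt
    have := ((h3.mul_const (2 * (herm (X c) * herm (v c)).trace)).const_add
      ((herm (X c) ^ 2).trace)).add ((h3.pow 2).mul_const ((herm (v c) ^ 2).trace))
    exact this.congr_deriv (by simp)
  have h4 := (HasDerivAt.fun_sum (u := univ) fun c _ => (h1 c).const_mul (κ c : ℂ)).const_mul
    (-((N : ℂ) / 2))
  have h5 := h4.cexp
  unfold HasLineDerivAt
  refine h5.congr_deriv ?_
  simp only [zero_smul, add_zero, gauss]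
  rw [mul_comm]
  congr 1
  simp only [mul_sum]
  exact sum_congr rfl fun c _ => by ring

lemma integral_gauss_by_parts {κ : Fin d → ℝ} (hκ : ∀ c, 0 < κ c) (hN : 0 < N)
    {f f' : Conf d N → ℂ} (v : Conf d N) (hf : Growth f) (hf' : Growth f')
    (hd : ∀ X, HasLineDerivAt ℝ f (f' X) X v) :
    ∫ X, f X * ((N : ℂ) * ∑ c, (κ c : ℂ) * (herm (X c) * herm (v c)).trace) * gauss κ X
      = ∫ X, f' X * gauss κ X := by
  have hG : Growth fun X : Conf d N =>
      (-(N : ℂ) * ∑ c, (κ c : ℂ) * (herm (X c) * herm (v c)).trace) :=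
    (Growth.const _).mul (Growth.sum _ fun c _ => (Growth.const _).mul (Growth.trace
      fun a b => Growth.matrix_mul (herm_growth c) (B := fun _ => herm (v c))
      (fun _ _ => Growth.const _) a b))
  have := integral_bilinear_hasLineDerivAt_right_eq_neg_left_of_integrable
    (μ := (volume : Measure (Conf d N))) (B := ContinuousLinearMap.mul ℝ ℂ) (f := f) (f' := f')
    (g := gauss κ)
    (g' := fun X => -(N : ℂ) * (∑ c, (κ c : ℂ) * (herm (X c) * herm (v c)).trace) * gauss κ X)
    (v := v) (integrable_mul_gauss hκ hN hf')
    (by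
      have := integrable_mul_gauss hκ hN (hf.mul hG)
      simpa [mul_assoc] using this)
    (integrable_mul_gauss hκ hN hf) (fun X _ => hd X) (fun X _ => hasLineDerivAt_gauss κ X v)
  simp only [ContinuousLinearMap.mul_apply'] at this
  rw [← neg_eq_iff_eq_neg, ← integral_neg] at this
  rw [← this]
  congr 1
  ext X
  ring

/-- The orthonormal basis of the Hermitian matrices. -/
def hermBasis (p q : Fin N) : Matrix (Fin N) (Fin N) ℂ := herm (Pi.single p (Pi.single q 1))

lemma sum_hermBasis (a b c e : Fin N) :
    ∑ p, ∑ q, hermBasis p q a b * hermBasis p q c e = if a = e ∧ b = c then 1 else 0 := by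
  have h2 : ((√2 : ℝ) : ℂ) ^ 2 = 2 := by
    rw [← Complex.ofReal_pow, Real.sq_sqrt (by norm_num)]; norm_num
  let α : Fin N → Fin N → ℂ := fun a b =>
    if a = b then 1 else if a < b then 1 / (√2 : ℂ) else -I / (√2 : ℂ)
  let β : Fin N → Fin N → ℂ := fun a b =>
    if a = b then 0 else if a < b then I / (√2 : ℂ) else 1 / (√2 : ℂ)
  let δ : Fin N → Fin N → Fin N → Fin N → ℂ := fun x y p q => if p = x then if q = y then 1 else 0 else 0
  have hE : ∀ p q a b : Fin N, hermBasis p q a b = α a b * δ a b p q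
        + β a b * δ b a p q := fun p q a b => by
    have hs : ∀ x y : Fin N, (((Pi.single p (Pi.single q 1) : Fin N → Fin N → ℝ) x y : ℝ) : ℂ)
        = δ x y p q := fun x y => by
      by_cases h1 : p = x <;> by_cases h2 : q = y <;> simp [δ, Pi.single_apply, *, eq_comm]
    simp only [hermBasis, herm, of_apply, hs, α, β]
    rcases lt_trichotomy a b with h | h | h
    · simp only [h, h.ne, if_true, if_false]; ring
    · subst h; simp
    · simp only [h.ne', h.not_gt, if_false]; ring
  have hs : ∀ x y x' y' : Fin N, ∑ p, ∑ q, δ x y p q * δ x' y' p q = if x = x' ∧ y = y' then 1 else 0 := fun x y x' y' => by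
    simp only [δ, ite_mul, zero_mul, one_mul]
    rw [sum_eq_single x (fun p _ hp => by simp [hp]) (by simp),
      sum_eq_single y (fun q _ hq => by simp [hq]) (by simp)]
    simp [ite_and]
  have : ∀ p q, hermBasis p q a b * hermBasis p q c e = α a b * α c e * (δ a b p q * δ c e p q)
      + α a b * β c e * (δ a b p q * δ e c p q)
      + β a b * α c e * (δ b a p q * δ c e p q)
      + β a b * β c e * (δ b a p q * δ e c p q) := by
    intro p q; rw [hE, hE]; ring
  simp only [this, sum_add_distrib, ← mul_sum, hs]
  have hI : I * I = -1 := Complex.I_mul_I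
  have hi : (√2 : ℂ)⁻¹ * (√2 : ℂ)⁻¹ = 1 / 2 := by
    rw [← mul_inv, ← sq, h2]; norm_num
  have hq : (√2 : ℂ) * (√2 : ℂ) = 2 := by rw [← sq, h2]
  by_cases h1 : a = c ∧ b = e
  · obtain ⟨rfl, rfl⟩ := h1
    rcases lt_trichotomy a b with h | h | h
    · simp [α, β, h, h.ne, h.ne', div_mul_div_comm, hI, hq, hi]; norm_num
    · subst h; simp [α, β]
    · simp [α, β, h.ne, h.ne', h.not_gt, div_mul_div_comm, hI, hq, hi]; norm_num
  · by_cases h4 : a = e ∧ b = c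
    · obtain ⟨rfl, rfl⟩ := h4
      rcases lt_trichotomy a b with h | h | h
      · simp [α, β, h, h.ne, h.ne', h.not_gt, div_mul_div_comm, hI, hq, hi]; norm_num
      · subst h; simp at h1
      · simp [α, β, h, h.ne, h.ne', h.not_gt, div_mul_div_comm, hI, hq, hi]; norm_num
    · have h5 : ¬ (b = c ∧ a = e) := fun h => h4 ⟨h.2, h.1⟩
      have h6 : ¬ (b = e ∧ a = c) := fun h => h1 ⟨h.2, h.1⟩
      simp [h1, h4, h5, h6]

lemma sum_hermBasis_mul (f : Fin N → Fin N → Fin N → Fin N → ℂ) :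
    ∑ p, ∑ q, ∑ a, ∑ b, ∑ c, ∑ e, hermBasis p q a b * hermBasis p q c e * f a b c e
      = ∑ a, ∑ b, f a b b a := by
  rw [← Finset.sum_product', sum_comm]
  refine sum_congr rfl fun a _ => ?_
  rw [sum_comm]
  refine sum_congr rfl fun b _ => ?_
  rw [sum_comm]
  have h : ∀ c e, ∑ x ∈ univ ×ˢ univ, hermBasis x.1 x.2 a b * hermBasis x.1 x.2 c e * f a b c e
      = (if a = e then if b = c then 1 else 0 else 0) * f a b c e := fun c e => by
    rw [← sum_mul, Finset.sum_product, sum_hermBasis, ite_and]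
  calc _ = ∑ c, ∑ e, (if a = e then if b = c then 1 else 0 else 0) * f a b c e := by
        refine sum_congr rfl fun c _ => ?_
        rw [sum_comm]
        exact sum_congr rfl fun e _ => h c e
    _ = _ := by simp

lemma sum_trace_hermBasis_mul_trace (A B : Matrix (Fin N) (Fin N) ℂ) :
    ∑ p, ∑ q, (hermBasis p q * A).trace * (hermBasis p q * B).trace = (A * B).trace := by
  have h : ∀ p q, (hermBasis p q * A).trace * (hermBasis p q * B).trace
      = ∑ a, ∑ b, ∑ c, ∑ e, hermBasis p q a b * hermBasis p q c e * (A b a * B e c) := fun p q => by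
    simp only [trace, Matrix.diag, Matrix.mul_apply]
    rw [sum_mul]
    refine sum_congr rfl fun a _ => ?_
    rw [sum_mul]
    refine sum_congr rfl fun b _ => ?_
    simp only [mul_sum]
    exact sum_congr rfl fun c _ => sum_congr rfl fun e _ => by ring
  simp only [h, sum_hermBasis_mul]
  rw [sum_comm]
  simp [trace, Matrix.mul_apply]

lemma sum_trace_hermBasis_mul_mul (A B : Matrix (Fin N) (Fin N) ℂ) :
    ∑ p, ∑ q, (hermBasis p q * A * hermBasis p q * B).trace = A.trace * B.trace := by
  have h : ∀ p q, (hermBasis p q * A * hermBasis p q * B).trace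
      = ∑ a, ∑ b, ∑ c, ∑ e, hermBasis p q a b * hermBasis p q c e * (A b c * B e a) := fun p q => by
    rw [mul_assoc, mul_assoc]
    simp only [trace, Matrix.diag, Matrix.mul_apply]
    refine sum_congr rfl fun a _ => sum_congr rfl fun b _ => ?_
    simp only [mul_sum]
    exact sum_congr rfl fun c _ => sum_congr rfl fun e _ => by ring
  simp only [h, sum_hermBasis_mul]
  rw [sum_comm, trace, trace, sum_mul]
  simp [mul_sum]

/-! ### The Schwinger–Dyson equation at fixed size -/

section FiniteSize
variable {d N : ℕ}

lemma hasDerivAt_matrix_pow (A E : Matrix (Fin N) (Fin N) ℂ) (k : ℕ) (a b : Fin N) :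
    HasDerivAt (fun t : ℝ => ((A + t • E) ^ k) a b)
      ((∑ j ∈ range k, A ^ j * E * A ^ (k - 1 - j)) a b) 0 := by
  induction k generalizing a b with
  | zero => simpa using hasDerivAt_const (0 : ℝ) _
  | succ k ih =>
    have h1 : ∀ c, HasDerivAt (fun t : ℝ => (A + t • E) c b) (E c b) 0 := fun c => by
      simp only [Matrix.add_apply, Matrix.smul_apply, Complex.real_smul]
      simpa using ((Complex.ofRealCLM.hasDerivAt (x := 0)).mul_const (E c b)).const_add (A c b)
    simp only [pow_succ, Matrix.mul_apply]
    have h2 := fun c => (ih a c).mul (h1 c)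
    have h3 := HasDerivAt.fun_sum (u := univ) fun c _ => h2 c
    refine h3.congr_deriv ?_
    simp only [zero_smul, add_zero]
    rw [sum_add_distrib, ← Matrix.mul_apply, ← Matrix.mul_apply, ← Matrix.add_apply]
    refine congrFun (congrFun ?_ a) b
    rw [Finset.sum_range_succ, sum_mul]
    simp only [Nat.add_sub_cancel, Nat.sub_self, pow_zero, mul_one]
    refine congrArg (· + _) ?_
    refine sum_congr rfl fun j hj => ?_
    have hj := mem_range.1 hj
    have : k - j = (k - 1 - j) + 1 := by omega
    rw [this, pow_succ, mul_assoc, mul_assoc]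

lemma hasDerivAt_trace_mul_pow (B A E : Matrix (Fin N) (Fin N) ℂ) (k : ℕ) :
    HasDerivAt (fun t : ℝ => (B * (A + t • E) ^ k).trace)
      (∑ j ∈ range k, (B * A ^ j * E * A ^ (k - 1 - j)).trace) 0 := by
  have ht : ∀ P : Matrix (Fin N) (Fin N) ℂ, (B * P).trace = ∑ a, ∑ b, B a b * P b a := fun P => by
    simp [trace, Matrix.mul_apply]
  have h1 := fun a b => (hasDerivAt_matrix_pow A E k b a).const_mul (B a b)
  have h2 := HasDerivAt.fun_sum (u := univ) fun a _ =>
    HasDerivAt.fun_sum (u := univ) fun b _ => h1 a b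
  simp only [ht]
  refine h2.congr_deriv ?_
  have : ∀ j, B * A ^ j * E * A ^ (k - 1 - j) = B * (A ^ j * E * A ^ (k - 1 - j)) := fun j => by
    simp only [mul_assoc]
  simp only [this]
  rw [← Matrix.trace_sum, ← mul_sum, ht]

lemma hasDerivAt_trace_pow (A E : Matrix (Fin N) (Fin N) ℂ) (k : ℕ) :
    HasDerivAt (fun t : ℝ => ((A + t • E) ^ k).trace) (k * (E * A ^ (k - 1)).trace) 0 := by
  have h := hasDerivAt_trace_mul_pow 1 A E k
  simp only [one_mul] at h
  refine h.congr_deriv ?_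
  rw [sum_congr rfl (g := fun _ => (E * A ^ (k - 1)).trace)]
  · simp
  · intro j hj
    have hj := mem_range.1 hj
    rw [mul_assoc, Matrix.trace_mul_comm, mul_assoc, ← pow_add]
    congr 3
    omega

/-- The direction of the coordinate `(p, q)` of the matrix of color `i`. -/
def dir (i : Fin d) (p q : Fin N) : Conf d N := Pi.single i (Pi.single p (Pi.single q 1))

lemma herm_dir_same (i : Fin d) (p q : Fin N) : herm (dir i p q i) = hermBasis p q := by
  simp [dir, hermBasis]

lemma herm_dir_ne {i c : Fin d} (h : c ≠ i) (p q : Fin N) : herm (dir i p q c) = 0 := by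
  simp [dir, h, herm_zero]

lemma herm_add_dir_same (X : Conf d N) (t : ℝ) (i : Fin d) (p q : Fin N) :
    herm ((X + t • dir i p q) i) = herm (X i) + t • hermBasis p q := by
  rw [Pi.add_apply, Pi.smul_apply, herm_add_smul, herm_dir_same]

lemma herm_add_dir_ne (X : Conf d N) (t : ℝ) {i c : Fin d} (h : c ≠ i) (p q : Fin N) :
    herm ((X + t • dir i p q) c) = herm (X c) := by
  rw [Pi.add_apply, Pi.smul_apply, herm_add_smul, herm_dir_ne h, smul_zero, add_zero]

/-- The matrix gradient of a vertex in the matrix of color `i`. -/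
def gradVertex (M : Fin d → Matrix (Fin N) (Fin N) ℂ) (i : Fin d) :
    Coupling d → Matrix (Fin N) (Fin N) ℂ
  | Sum.inl a => ((N : ℂ) ^ (2 - (d : ℤ)) * (a i : ℂ) * ∏ c ∈ univ.erase i, (M c ^ a c).trace) •
      M i ^ (a i - 1)
  | Sum.inr (c, k) => if c = i then ((N : ℂ) * k) • M i ^ (k - 1) else 0

lemma hasLineDerivAt_vertex (i : Fin d) (p q : Fin N) (v : Coupling d) (X : Conf d N) :
    HasLineDerivAt ℝ (fun X : Conf d N => vertex (fun c => herm (X c)) v)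
      (hermBasis p q * gradVertex (fun c => herm (X c)) i v).trace X (dir i p q) := by
  unfold HasLineDerivAt
  rcases v with a | ⟨c, k⟩
  · have h : ∀ t : ℝ, vertex (fun c => herm ((X + t • dir i p q) c)) (Sum.inl a)
        = ((N : ℂ) ^ (2 - (d : ℤ)) * ∏ c ∈ univ.erase i, (herm (X c) ^ a c).trace)
          * ((herm (X i) + t • hermBasis p q) ^ a i).trace := fun t => by
      rw [vertex, ← mul_prod_erase _ _ (mem_univ i), herm_add_dir_same]
      rw [prod_congr rfl fun c hc => by rw [herm_add_dir_ne X t (ne_of_mem_erase hc)]]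
      ring
    simp only [h]
    refine ((hasDerivAt_trace_pow _ _ _).const_mul _).congr_deriv ?_
    simp only [gradVertex, Matrix.mul_smul, trace_smul, smul_eq_mul]
    ring
  · by_cases hc : c = i
    · subst hc
      have h : ∀ t : ℝ, vertex (fun e => herm ((X + t • dir c p q) e)) (Sum.inr (c, k))
          = (N : ℂ) * ((herm (X c) + t • hermBasis p q) ^ k).trace := fun t => by
        rw [vertex, herm_add_dir_same]
      simp only [h]
      refine ((hasDerivAt_trace_pow _ _ _).const_mul _).congr_deriv ?_
      simp only [gradVertex, Matrix.mul_smul, trace_smul, smul_eq_mul, if_true]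
      ring
    · have h : ∀ t : ℝ, vertex (fun c => herm ((X + t • dir i p q) c)) (Sum.inr (c, k))
          = vertex (fun c => herm (X c)) (Sum.inr (c, k)) := fun t => by
        rw [vertex, vertex, herm_add_dir_ne X t hc]
      simp only [h]
      simpa [gradVertex, hc] using hasDerivAt_const (0 : ℝ) _

/-- The coefficient of a monomial in the couplings in the exponential of the interaction. -/
def expCoeff (m : Order d) (X : Conf d N) : ℂ :=
  m.prod fun v e => (-vertex (fun c => herm (X c)) v) ^ e / (e.factorial : ℂ)

lemma expCoeff_eq_prod (m : Order d) (X : Conf d N) (s : Finset (Coupling d))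
    (hs : m.support ⊆ s) : expCoeff m X
      = ∏ v ∈ s, (-vertex (fun c => herm (X c)) v) ^ (m v) / ((m v).factorial : ℂ) :=
  Finsupp.prod_of_support_subset _ hs _ (by simp)

lemma hasLineDerivAt_expCoeff (i : Fin d) (p q : Fin N) (m : Order d) (X : Conf d N) :
    HasLineDerivAt ℝ (expCoeff m) (-∑ v ∈ m.support, expCoeff (m - single v 1) X *
        (hermBasis p q * gradVertex (fun c => herm (X c)) i v).trace) X (dir i p q) := by
  classical
  unfold HasLineDerivAt
  have h := HasDerivAt.fun_finsetProd (u := m.support)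
    (f := fun v (t : ℝ) => (-vertex (fun c => herm ((X + t • dir i p q) c)) v) ^ (m v)
      / ((m v).factorial : ℂ)) (x := 0) fun v _ =>
      (((hasLineDerivAt_vertex i p q v X).neg.pow (m v)).div_const _)
  refine h.congr_deriv ?_
  rw [← Finset.sum_neg_distrib]
  refine sum_congr rfl fun v hv => ?_
  rw [expCoeff_eq_prod _ X m.support (Finsupp.support_mono tsub_le_self), ← mul_prod_erase _ _ hv]
  simp only [zero_smul, add_zero, smul_eq_mul, Pi.neg_apply]
  have h1 : ∀ u ∈ m.support.erase v, (m - single v 1 : Order d) u = m u := fun u hu => by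
    simp [(ne_of_mem_erase hu).symm]
  have h4 : ∏ u ∈ m.support.erase v, (-vertex (fun c => herm (X c)) u) ^
      ((m - single v 1 : Order d) u) / (((m - single v 1 : Order d) u).factorial : ℂ)
      = ∏ u ∈ m.support.erase v, (-vertex (fun c => herm (X c)) u) ^ (m u) / ((m u).factorial : ℂ) :=
    prod_congr rfl fun u hu => by rw [h1 u hu]
  rw [h4]
  have h2 : (m - single v 1 : Order d) v = m v - 1 := by simp
  have hv0 : m v ≠ 0 := Finsupp.mem_support_iff.1 hv
  obtain ⟨k, hk⟩ := Nat.exists_eq_succ_of_ne_zero hv0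
  rw [h2, hk, Nat.succ_sub_one, Nat.factorial_succ]
  have : ((k : ℂ) + 1) ≠ 0 := by exact_mod_cast succ_ne_zero k
  push_cast
  field_simp

lemma trace_pow_growth (c : Fin d) (k : ℕ) : Growth fun X : Conf d N => (herm (X c) ^ k).trace :=
  Growth.trace fun a b => Growth.matrix_pow (herm_growth c) k a b

lemma vertex_growth (v : Coupling d) :
    Growth fun X : Conf d N => vertex (fun c => herm (X c)) v := by
  rcases v with a | ⟨c, k⟩
  · exact (Growth.const _).mul (Growth.prod _ fun c _ => trace_pow_growth c _)
  · exact (Growth.const _).mul (trace_pow_growth c k)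

lemma expCoeff_growth (m : Order d) : Growth (expCoeff m : Conf d N → ℂ) := by
  have := Growth.prod (E := Conf d N) m.support fun v _ =>
    (((Growth.const (-1)).mul (vertex_growth v)).pow (m v)).mul
      (Growth.const ((m v).factorial : ℂ)⁻¹)
  have h : (expCoeff m : Conf d N → ℂ) = _ := funext fun X => Finsupp.prod.eq_1 m _
  rw [h]
  simpa [div_eq_mul_inv] using this

lemma gradVertex_growth (i : Fin d) (v : Coupling d) (a b : Fin N) :
    Growth fun X : Conf d N => gradVertex (fun c => herm (X c)) i v a b := by
  rcases v with e | ⟨c, k⟩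
  · exact ((Growth.const _).mul (Growth.prod _ fun c _ => trace_pow_growth c _)).mul
      (Growth.matrix_pow (herm_growth i) _ a b)
  · by_cases h : c = i
    · simpa [gradVertex, h] using
        (Growth.const _).mul (Growth.matrix_pow (herm_growth i) (k - 1) a b)
    · simpa [gradVertex, h] using Growth.const (E := Conf d N) 0

lemma integral_schwinger_dyson {κ : Fin d → ℝ} (hκ : ∀ c, 0 < κ c) (hN : 0 < N) (i : Fin d)
    (k : ℕ) (m : Order d) :
    (N : ℂ) * κ i * ∫ X : Conf d N, (herm (X i) ^ (k + 1)).trace * expCoeff m X * gauss κ X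
      = ∑ a ∈ range k, (∫ X : Conf d N,
          ((herm (X i) ^ a).trace * (herm (X i) ^ (k - 1 - a)).trace) * expCoeff m X * gauss κ X)
        - ∑ v ∈ m.support, ∫ X : Conf d N,
          (herm (X i) ^ k * gradVertex (fun c => herm (X c)) i v).trace
            * expCoeff (m - single v 1) X * gauss κ X := by
  have hB : ∀ p q a b : Fin N, Growth fun _ : Conf d N => hermBasis p q a b :=
    fun p q a b => Growth.const _
  have hP : ∀ (k : ℕ) (a b : Fin N), Growth fun X : Conf d N => (herm (X i) ^ k) a b :=
    fun k a b => Growth.matrix_pow (herm_growth i) k a b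
  obtain ⟨A, hA⟩ : ∃ A : Fin N → Fin N → Conf d N → ℂ,
    A = fun p q X => (hermBasis p q * herm (X i) ^ k).trace := ⟨_, rfl⟩
  obtain ⟨J, hJ⟩ : ∃ J : Fin N → Fin N → Conf d N → ℂ, J = fun p q X => ∑ j ∈ range k,
    (hermBasis p q * herm (X i) ^ j * hermBasis p q * herm (X i) ^ (k - 1 - j)).trace := ⟨_, rfl⟩
  obtain ⟨G, hG⟩ : ∃ G : Fin N → Fin N → Conf d N → ℂ, G = fun p q X => ∑ v ∈ m.support,
    expCoeff (m - single v 1) X * (hermBasis p q * gradVertex (fun c => herm (X c)) i v).trace :=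
    ⟨_, rfl⟩
  have gA : ∀ p q, Growth (A p q) := fun p q => hA ▸
    Growth.trace fun a b => Growth.matrix_mul (hB p q) (hP k) a b
  have gJ : ∀ p q, Growth (J p q) := fun p q => hJ ▸
    Growth.sum _ fun j _ => Growth.trace fun a b => Growth.matrix_mul (Growth.matrix_mul
      (Growth.matrix_mul (hB p q) (hP j)) (hB p q)) (hP _) a b
  have gG : ∀ p q, Growth (G p q) := fun p q => hG ▸ Growth.sum _ fun v _ =>
    (expCoeff_growth _).mul
      (Growth.trace fun a b => Growth.matrix_mul (hB p q) (gradVertex_growth i v) a b)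
  have hR := fun p q => ((gJ p q).mul (expCoeff_growth m)).add
    ((gA p q).mul ((Growth.const (-1)).mul (gG p q)))
  have hd : ∀ (p q : Fin N) (X : Conf d N), HasLineDerivAt ℝ (fun X => A p q X * expCoeff m X)
      (J p q X * expCoeff m X + A p q X * (-1 * G p q X)) X (dir i p q) := fun p q X => by
    have h1 : HasLineDerivAt ℝ (A p q) (J p q X) X (dir i p q) := by
      have := hasDerivAt_trace_mul_pow (hermBasis p q) (herm (X i)) (hermBasis p q) k
      unfold HasLineDerivAt
      simpa only [hA, hJ, herm_add_dir_same] using this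
    refine (HasDerivAt.mul h1 (hasLineDerivAt_expCoeff i p q m X)).congr_deriv ?_
    simp only [zero_smul, add_zero, hG]
    ring
  have hI := fun p q => integral_gauss_by_parts hκ hN (dir i p q)
    ((gA p q).mul (expCoeff_growth m)) (hR p q) (hd p q)
  have hS : ∀ (X : Conf d N) (p q : Fin N), ∑ c, (κ c : ℂ) * (herm (X c) * herm (dir i p q c)).trace
        = κ i * (hermBasis p q * herm (X i)).trace := fun X p q => by
    rw [sum_eq_single i _ (by simp), herm_dir_same, Matrix.trace_mul_comm]
    intro c _ hc
    rw [herm_dir_ne hc]; simp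
  simp only [hS] at hI
  have hsum := sum_congr rfl fun p (_ : p ∈ (univ : Finset (Fin N))) =>
    sum_congr rfl fun q (_ : q ∈ (univ : Finset (Fin N))) => hI p q
  have hL := fun p q => integrable_mul_gauss hκ hN (((gA p q).mul (expCoeff_growth m)).mul
    ((Growth.const (N : ℂ)).mul ((Growth.const (κ i : ℂ)).mul
      (Growth.trace fun a b => Growth.matrix_mul (hB p q) (herm_growth i) a b))))
  have hR := fun p q => integrable_mul_gauss hκ hN (hR p q)
  simp only [← integral_finsetSum _ fun q _ => hL _ q, ← integral_finsetSum _ fun q _ => hR _ q,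
    ← integral_finsetSum _ fun p _ => integrable_finsetSum _ fun q _ => hL p q,
    ← integral_finsetSum _ fun p _ => integrable_finsetSum _ fun q _ => hR p q] at hsum
  have e1 : ∀ X : Conf d N, ∑ p, ∑ q, A p q X * expCoeff m X *
        ((N : ℂ) * (κ i * (hermBasis p q * herm (X i)).trace)) * gauss κ X
      = N * κ i * ((herm (X i) ^ (k + 1)).trace * expCoeff m X * gauss κ X) := fun X => by
    rw [pow_succ, ← sum_trace_hermBasis_mul_trace]
    simp only [mul_sum, sum_mul, hA]
    exact sum_congr rfl fun p _ => sum_congr rfl fun q _ => by ring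
  have e2 : ∀ X : Conf d N, ∑ p, ∑ q, (J p q X * expCoeff m X + A p q X * (-1 * G p q X)) * gauss κ X
      = ∑ a ∈ range k,
          ((herm (X i) ^ a).trace * (herm (X i) ^ (k - 1 - a)).trace) * expCoeff m X * gauss κ X
        - ∑ v ∈ m.support, (herm (X i) ^ k * gradVertex (fun c => herm (X c)) i v).trace
            * expCoeff (m - single v 1) X * gauss κ X := fun X => by
    have a1 : ∑ p, ∑ q, J p q X
        = ∑ a ∈ range k, (herm (X i) ^ a).trace * (herm (X i) ^ (k - 1 - a)).trace := by
      simp only [← sum_trace_hermBasis_mul_mul, hJ, sum_comm (t := range k)]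
    have a3 : ∑ p, ∑ q, A p q X * G p q X
        = ∑ v ∈ m.support, (herm (X i) ^ k * gradVertex (fun c => herm (X c)) i v).trace
          * expCoeff (m - single v 1) X := by
      simp only [← sum_trace_hermBasis_mul_trace (herm (X i) ^ k), hA, hG, sum_mul, mul_sum,
        sum_comm (t := m.support)]
      exact sum_congr rfl fun v _ => sum_congr rfl fun p _ => sum_congr rfl fun q _ => by ring
    rw [← sum_mul (range k), ← sum_mul (range k), ← sum_mul, ← a1, ← a3]
    simp only [sum_mul, ← sum_sub_distrib]
    exact sum_congr rfl fun p _ => sum_congr rfl fun q _ => by ring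
  have i1 := fun a => integrable_mul_gauss hκ hN (((trace_pow_growth i a).mul
    (trace_pow_growth i (k - 1 - a))).mul (expCoeff_growth m))
  have i2 := fun v => integrable_mul_gauss hκ hN ((Growth.trace fun a b =>
    Growth.matrix_mul (hP k) (gradVertex_growth i v) a b).mul (expCoeff_growth (m - single v 1)))
  simp only [e1, e2] at hsum
  rwa [integral_const_mul, integral_sub (integrable_finsetSum _ fun a _ => i1 a)
    (integrable_finsetSum _ fun v _ => i2 v), integral_finsetSum _ fun a _ => i1 a,
    integral_finsetSum _ fun v _ => i2 v] at hsum

end FiniteSize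

end

section
open MeasureTheory
open MvPowerSeries (coeff C X map pderiv map_C coeff_map coeff_mul)
open Matrix (trace of_apply trace_smul)

/-! ### Insertions and the Schwinger–Dyson equation for series in the couplings -/

section Series
variable {d : ℕ} {K : Type} [CommRing K]

/-- Formal power series in the couplings. -/
abbrev PS (d : ℕ) (K : Type) [CommRing K] : Type := MvPowerSeries (Coupling d) K

/-- The sum `∑ v, v * F v` over all couplings `v`. -/
def cSum (F : Coupling d → PS d K) : PS d K :=
  fun m => ∑ v ∈ m.support, coeff (m - single v 1) (F v)

lemma coeff_cSum (F : Coupling d → PS d K) (m : Order d) : coeff m (cSum F)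
      = ∑ v ∈ m.support, coeff (m - single v 1) (F v) := rfl

lemma coeff_cSum_eq (F : Coupling d → PS d K) (m : Order d)
    (s : Finset (Coupling d)) (hs : m.support ⊆ s) :
    coeff m (cSum F) = coeff m (∑ v ∈ s, X v * F v) := by
  classical
  rw [map_sum]
  have h : ∀ v ∈ s, coeff m (X v * F v)
      = if v ∈ m.support then coeff (m - single v 1) (F v) else 0 := fun v _ => by
    rw [MvPowerSeries.X_def, MvPowerSeries.coeff_monomial_mul]
    simp [Finsupp.single_le_iff, Nat.one_le_iff_ne_zero]
  rw [sum_congr rfl h, ← sum_filter, Finset.filter_mem_eq_inter, Finset.inter_eq_right.2 hs]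
  rfl

lemma cSum_add (F G : Coupling d → PS d K) : cSum (fun v => F v + G v) = cSum F + cSum G := by
  ext m
  simp [coeff_cSum, sum_add_distrib]

lemma cSum_finset_sum {ι : Type*} (s : Finset ι) (F : ι → Coupling d → PS d K) :
    cSum (fun v => ∑ j ∈ s, F j v) = ∑ j ∈ s, cSum (F j) := by
  ext m
  simp only [coeff_cSum, map_sum]
  rw [sum_comm]

lemma mul_cSum (f : PS d K) (F : Coupling d → PS d K) : f * cSum F = cSum fun v => f * F v := by
  classical
  ext m
  rw [coeff_cSum_eq _ m m.support le_rfl]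
  have h : ∀ v, X v * (f * F v) = f * (X v * F v) := fun v => by ring
  simp only [h]
  rw [← mul_sum, coeff_mul, coeff_mul]
  refine sum_congr rfl fun p hp => ?_
  rw [coeff_cSum_eq F p.2 m.support]
  refine Finsupp.support_mono ?_
  rw [← mem_antidiagonal.1 hp]
  exact le_add_self

variable [Algebra ℂ K]

lemma smul_cSum (z : ℂ) (F : Coupling d → PS d K) : z • cSum F = cSum fun v => z • F v := by
  ext m
  simp [coeff_cSum, smul_sum]

lemma pderiv_cSum (w : Coupling d) (F : Coupling d → PS d K) :
    pderiv K w (cSum F) = F w + cSum fun v => pderiv K w (F v) := by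
  classical
  ext m
  have hs : m.support ⊆ insert w m.support := Finset.subset_insert _ _
  have hs' : (m + single w 1).support ⊆ insert w m.support := fun v => by
    simp only [Finsupp.mem_support_iff, mem_insert, Finsupp.add_apply, Finsupp.single_apply]
    by_cases h : w = v
    · simp [h]
    · simp [h, Ne.symm h]
  rw [map_add, coeff_cSum_eq _ m _ hs, MvPowerSeries.coeff_pderiv, coeff_cSum_eq _ _ _ hs',
    ← MvPowerSeries.coeff_pderiv, map_sum]
  simp only [Derivation.leibniz, smul_eq_mul, sum_add_distrib, map_add]
  rw [add_comm]
  congr 1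
  have h1 : ∀ v, F v * pderiv K w (X v : PS d K) = if v = w then F w else 0 := fun v => by
    have : pderiv K w (X v : PS d K) = if v = w then 1 else 0 := by
      ext n
      rw [MvPowerSeries.coeff_pderiv, MvPowerSeries.coeff_X]
      by_cases hv : v = w
      · subst hv
        rw [if_pos rfl, MvPowerSeries.coeff_one]
        by_cases hn : n = 0
        · subst hn; simp
        · have : ¬ (n + single v 1 = single v 1) := by simpa using hn
          simp [hn]
      · have : ¬ (n + single w 1 = single v 1) := fun h => by
          have := DFunLike.congr_fun h w
          simp [Finsupp.single_apply, hv] at this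
        simp [hv, this]
    rw [this]
    split_ifs with hv
    · rw [hv, mul_one]
    · rw [mul_zero]
  simp only [h1, Finset.sum_ite_eq', mem_insert_self, if_true]

/-- The derivation `-ν⁻¹ ∂ / ∂ s_{c, k}`, which inserts `tr (M_c ^ k)` in a connected correlator. -/
def insD (ν : Kˣ) (w : Label d) : Derivation ℂ (PS d K) (PS d K) :=
  ((C (-(↑ν⁻¹ : K)) : PS d K) • pderiv K (Sum.inr w)).restrictScalars ℂ

lemma insD_apply (ν : Kˣ) (w : Label d) (f : PS d K) :
    insD ν w f = C (-(↑ν⁻¹ : K)) * pderiv K (Sum.inr w) f := rfl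

lemma coeff_insD (ν : Kˣ) (w : Label d) (f : PS d K) (m : Order d) :
    coeff m (insD ν w f) = -(↑ν⁻¹ : K) *
      (coeff (m + single (Sum.inr w) 1) f * (m (Sum.inr w) + 1)) := by
  rw [insD_apply, MvPowerSeries.coeff_C_mul, MvPowerSeries.coeff_pderiv]

lemma insD_comm (ν : Kˣ) (a b : Label d) (f : PS d K) :
    insD ν a (insD ν b f) = insD ν b (insD ν a f) := by
  classical
  by_cases hab : a = b
  · rw [hab]
  ext m
  simp only [coeff_insD, Finsupp.add_apply, Finsupp.single_apply, Sum.inr.injEq, hab, Ne.symm hab,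
    if_false, add_zero]
  rw [add_right_comm]
  push_cast
  ring

lemma insD_C (ν : Kˣ) (w : Label d) (z : K) : insD ν w (C z : PS d K) = 0 := by
  rw [insD_apply]
  have : pderiv K (Sum.inr w) (C z : PS d K) = 0 := (pderiv K (Sum.inr w)).map_algebraMap z
  rw [this, mul_zero]

lemma insD_cSum (ν : Kˣ) (w : Label d) (F : Coupling d → PS d K) :
    insD ν w (cSum F) = C (-(↑ν⁻¹ : K)) * F (Sum.inr w) + cSum fun v => insD ν w (F v) := by
  simp only [insD_apply]
  rw [pderiv_cSum, mul_add, mul_cSum]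

/-- The insertions for given expectations `F (c, k)` of `tr (M_c ^ k)`. -/
def seriesInsertions (ν : Kˣ) (F : Label d → PS d K)
    (h : ∀ a b, insD ν a (F b) = insD ν b (F a)) : Insertions (Label d) (PS d K) where
  D := insD ν
  F := F
  comm := insD_comm ν
  symm := h

/-- The interaction terms in the Schwinger–Dyson equation for `tr (M_i ^ p)`. -/
def interaction (ν : Kˣ) (I : Insertions (Label d) (PS d K)) (i : Fin d) (p : ℕ) :
    Coupling d → PS d K
  | Sum.inl a => (a i : ℂ) • (C ((ν ^ (2 - (d : ℤ)) : Kˣ) : K) *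
      ∑ L ∈ (univ.erase i).powerset, ∑ Λ : Finpartition (univ.erase i \ L),
        I.corr ((i, p + a i - 1) ::ₘ L.val.map fun c => (c, a c)) *
          ∏ B ∈ Λ.parts, I.corr (B.val.map fun c => (c, a c)))
  | Sum.inr (c, k) => if c = i then (k : ℂ) • (C (ν : K) * I.F (i, p + k - 1)) else 0

/-- The Schwinger–Dyson equations of the matrix model. -/
def SchwingerDyson (κ : Fin d → ℝ) (ν : Kˣ) (I : Insertions (Label d) (PS d K)) : Prop :=
  ∀ i p, (κ i : ℂ) • (C (ν : K) * I.F (i, p + 1))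
    = ∑ a ∈ range p, (I.F (i, a) * I.F (i, p - 1 - a) + I.D (i, a) (I.F (i, p - 1 - a)))
      - cSum (interaction ν I i p)

end Series

section FiniteSize
variable {d N : ℕ} {κ : Fin d → ℝ}

lemma coeff_formalIntegral (O : (Fin d → Matrix (Fin N) (Fin N) ℂ) → ℂ) (m : Order d) :
    coeff m (formalIntegral κ N O)
      = ∫ X : Conf d N, O (fun c => herm (X c)) * expCoeff m X * gauss κ X := rfl

lemma formalIntegral_const_mul (z : ℂ) (O : (Fin d → Matrix (Fin N) (Fin N) ℂ) → ℂ) :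
    formalIntegral κ N (fun M => z * O M) = z • formalIntegral κ N O := by
  ext m
  rw [map_smul, coeff_formalIntegral, coeff_formalIntegral, smul_eq_mul, ← integral_const_mul]
  congr 1
  ext X
  ring

lemma expectation_const_mul (z : ℂ) (O : (Fin d → Matrix (Fin N) (Fin N) ℂ) → ℂ) :
    expectation κ N (fun M => z * O M) = z • expectation κ N O := by
  rw [expectation, formalIntegral_const_mul, expectation, mul_smul_comm]

lemma expCoeff_add_single (m : Order d) (v : Coupling d) (X : Conf d N) :
    expCoeff (m + single v 1) X * ((m v : ℂ) + 1)
      = -vertex (fun c => herm (X c)) v * expCoeff m X := by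
  classical
  have hs : m.support ⊆ insert v m.support := Finset.subset_insert _ _
  have hs' : (m + single v 1).support ⊆ insert v m.support := fun u => by
    simp only [Finsupp.mem_support_iff, mem_insert, Finsupp.add_apply, Finsupp.single_apply]
    by_cases h : v = u
    · simp [h]
    · simp [h, Ne.symm h]
  rw [expCoeff_eq_prod _ X _ hs, expCoeff_eq_prod _ X _ hs',
    ← mul_prod_erase _ _ (mem_insert_self v _),
    ← mul_prod_erase _ _ (mem_insert_self v _)]
  have h4 : ∏ u ∈ (insert v m.support).erase v, (-vertex (fun c => herm (X c)) u) ^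
      ((m + single v 1 : Order d) u) / (((m + single v 1 : Order d) u).factorial : ℂ)
      = ∏ u ∈ (insert v m.support).erase v,
        (-vertex (fun c => herm (X c)) u) ^ (m u) / ((m u).factorial : ℂ) := by
    refine prod_congr rfl fun u hu => ?_
    have : (m + single v 1 : Order d) u = m u := by
      simp [(ne_of_mem_erase hu).symm]
    rw [this]
  have h5 : (m + single v 1 : Order d) v = m v + 1 := by simp
  rw [h4, h5, Nat.factorial_succ]
  have : ((m v : ℂ) + 1) ≠ 0 := by exact_mod_cast succ_ne_zero (m v)
  push_cast
  field_simp
  ring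

variable (hN : 0 < N)

/-- The size `N` as a unit. -/
def sizeUnit (hN : 0 < N) : ℂˣ := Units.mk0 (N : ℂ) (by exact_mod_cast hN.ne')

@[simp] theorem coe_sizeUnit : ((sizeUnit hN : ℂˣ) : ℂ) = N := rfl

lemma insD_formalIntegral (w : Label d) (O : (Fin d → Matrix (Fin N) (Fin N) ℂ) → ℂ) :
    insD (sizeUnit hN) w (formalIntegral κ N O)
      = formalIntegral κ N fun M => O M * (M w.1 ^ w.2).trace := by
  have hN' : (N : ℂ) ≠ 0 := by exact_mod_cast hN.ne'
  ext m
  rw [coeff_insD, coeff_formalIntegral, coeff_formalIntegral, ← integral_mul_const,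
    ← integral_const_mul]
  congr 1
  ext X
  have h := expCoeff_add_single m (Sum.inr w) X
  have h2 : vertex (fun c => herm (X c)) (Sum.inr w) = N * (herm (X w.1) ^ w.2).trace := rfl
  rw [h2] at h
  have h3 : ((↑(sizeUnit hN)⁻¹ : ℂ)) = (N : ℂ)⁻¹ := by simp [sizeUnit]
  rw [h3]
  field_simp
  linear_combination (-(O fun c => herm (X c)) * gauss κ X) * h

include hN in
lemma constantCoeff_formalIntegral_one (hκ : ∀ c, 0 < κ c) :
    MvPowerSeries.constantCoeff (formalIntegral κ N fun _ => 1) ≠ 0 := by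
  rw [← MvPowerSeries.coeff_zero_eq_constantCoeff_apply, coeff_formalIntegral]
  have hint := integrable_mul_gauss (d := d) hκ hN (Growth.const 1)
  simp only [one_mul, gauss_eq] at hint
  have h : ∀ X : Conf d N, 1 * expCoeff 0 X * gauss κ X
      = ((Real.exp (-((N : ℝ) / 2 * ∑ c, κ c * ∑ a, ∑ b, X c a b ^ 2)) : ℝ) : ℂ) := fun X => by
    simp [expCoeff, gauss_eq]
  simp only [h]
  rw [integral_complex_ofReal]
  have hr := hint.re
  simp only [RCLike.re_to_complex, ofReal_re] at hr
  exact_mod_cast (integral_exp_pos hr).ne'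

lemma expectation_one (hκ : ∀ c, 0 < κ c) (hN : 0 < N) : expectation κ N (fun _ => 1) = 1 :=
  MvPowerSeries.inv_mul_cancel _ (constantCoeff_formalIntegral_one hN hκ)

lemma insD_expectation (hκ : ∀ c, 0 < κ c) (w : Label d)
    (O : (Fin d → Matrix (Fin N) (Fin N) ℂ) → ℂ) :
    insD (sizeUnit hN) w (expectation κ N O) = expectation κ N (fun M => O M * (M w.1 ^ w.2).trace)
        - expectation κ N O * expectation κ N fun M => (M w.1 ^ w.2).trace := by
  set Z := formalIntegral κ N fun _ => 1 with hZ
  have hZ1 : Z⁻¹ * Z = 1 := expectation_one hκ hN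
  have h1 : ∀ O : (Fin d → Matrix (Fin N) (Fin N) ℂ) → ℂ, Z * expectation κ N O = formalIntegral κ N O := fun O => by
    rw [expectation, ← mul_assoc, mul_comm Z, hZ1, one_mul]
  have h2 := congrArg (insD (sizeUnit hN) w) (h1 O)
  rw [Derivation.leibniz, insD_formalIntegral, hZ, insD_formalIntegral, ← hZ] at h2
  simp only [one_mul, smul_eq_mul] at h2
  rw [← h1, ← h1] at h2
  have h3 := congrArg (Z⁻¹ * ·) h2
  simp only [mul_add, ← mul_assoc] at h3
  rw [mul_right_comm Z⁻¹ _ Z, hZ1] at h3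
  simp only [one_mul] at h3
  linear_combination h3

/-- The expectation of `tr (M_c ^ k)`. -/
def traceExpectation (κ : Fin d → ℝ) (N : ℕ) (w : Label d) : PS d ℂ :=
  expectation κ N fun M => (M w.1 ^ w.2).trace

/-- The insertions at finite size. -/
def finiteInsertions (hκ : ∀ c, 0 < κ c) (hN : 0 < N) : Insertions (Label d) (PS d ℂ) :=
  seriesInsertions (sizeUnit hN) (traceExpectation κ N) fun a b => by
    rw [traceExpectation, traceExpectation, insD_expectation hN hκ, insD_expectation hN hκ]
    congr 1
    · congr 1
      ext M
      rw [mul_comm]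
    · rw [mul_comm]

lemma cumulant_eq_corr_finite (hκ : ∀ c, 0 < κ c) {ι : Type*} [DecidableEq ι]
    (v : ι → Label d) (S : Finset ι) (hS : S.Nonempty) :
    cumulant (fun S : Finset ι => expectation κ N fun M => ∏ j ∈ S, (M (v j).1 ^ (v j).2).trace) S
      = (finiteInsertions hκ hN).corr (S.val.map v) := by
  refine Insertions.cumulant_eq_corr _ v _ ?_ ?_ S hS
  · simpa using expectation_one hκ hN
  · intro S j hj
    have h := insD_expectation hN hκ (v j) fun M => ∏ j ∈ S, (M (v j).1 ^ (v j).2).trace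
    have h2 : (finiteInsertions hκ hN).D = insD (sizeUnit hN) := rfl
    have h3 : (finiteInsertions hκ hN).F (v j) = expectation κ N fun M => (M (v j).1 ^ (v j).2).trace := rfl
    rw [h2, h3, h]
    simp only [prod_insert hj, mul_comm ((_ : Matrix (Fin N) (Fin N) ℂ).trace)]
    ring

lemma connectedTraces_eq_corr (hκ : ∀ c, 0 < κ c) {ι : Type} [Fintype ι] [DecidableEq ι]
    (v : ι → Label d) : connectedTraces κ N v = (finiteInsertions hκ hN).corr (values v) := by
  rcases isEmpty_or_nonempty ι with h | h
  · have h1 : ∀ π : Finpartition (∅ : Finset ι), π.parts = ∅ := fun π => by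
      rw [Finpartition.parts_eq_empty_iff]; rfl
    have h2 : values v = 0 := by simp [values]
    have h3 : ∀ π : {π : Finpartition (∅ : Finset ι) // ∅ ∉ π.parts},
        ∏ B : {B // B ∈ π.1.parts}, cumulant (fun S : Finset ι =>
          expectation κ N fun M => ∏ j ∈ S, (M (v j).1 ^ (v j).2).trace) B.1 = 1 := fun π => by
      rw [prod_coe_sort, h1, prod_empty]
    have h4 : Fintype.card (Finpartition (∅ : Finset ι)) = 1 :=
      Fintype.card_eq_one_iff.2 ⟨Finpartition.empty _, fun π => Finpartition.ext (by rw [h1, h1])⟩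
    rw [h2, Insertions.corr_zero, connectedTraces, univ_eq_empty, cumulant.eq_1,
      sum_congr rfl fun π _ => h3 π]
    simp [expectation_one hκ hN, card_univ, h4]
  · rw [connectedTraces, cumulant_eq_corr_finite hN hκ _ _ Finset.univ_nonempty]
    rfl

lemma schwingerDyson_finite (hκ : ∀ c, 0 < κ c) :
    SchwingerDyson κ (sizeUnit hN) (finiteInsertions hκ hN) := fun i p => by
  have hF : ∀ w, (finiteInsertions hκ hN).F w = expectation κ N fun M => (M w.1 ^ w.2).trace :=
    fun w => rfl
  have hD : (finiteInsertions (d := d) hκ hN).D = insD (sizeUnit hN) := rfl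
  have h1 : ∀ a b : Label d, (finiteInsertions hκ hN).F a * (finiteInsertions hκ hN).F b
      + (finiteInsertions hκ hN).D a ((finiteInsertions hκ hN).F b)
      = expectation κ N fun M => (M a.1 ^ a.2).trace * (M b.1 ^ b.2).trace := fun a b => by
    rw [hF, hF, hD, insD_expectation hN hκ]
    simp only [mul_comm]
    ring
  simp only [h1]
  have h0 : expectation κ N (fun _ => 0) = 0 := by
    simpa using expectation_const_mul (κ := κ) (N := N) 0 (fun _ => 0)
  have h2 : ∀ v, interaction (sizeUnit hN) (finiteInsertions hκ hN) i p v
      = expectation κ N fun M => (M i ^ p * gradVertex M i v).trace := by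
    rintro (a | ⟨c, k⟩)
    · rw [interaction]
      rcases Nat.eq_zero_or_pos (a i) with ha | ha
      · simp [ha, gradVertex, h0]
      obtain ⟨f, hf⟩ : ∃ f : Fin d → Label d,
        f = fun c => if c = i then (i, p + a i - 1) else (c, a c) := ⟨_, rfl⟩
      have hfi : f i = (i, p + a i - 1) := by simp [hf]
      have hf' : ∀ c ≠ i, f c = (c, a c) := fun c hc => by simp [hf, hc]
      have h3 : ∀ M : Fin d → Matrix (Fin N) (Fin N) ℂ, (M i ^ p * gradVertex M i (Sum.inl a)).trace
          = (a i * (N : ℂ) ^ (2 - (d : ℤ))) * ∏ c : Fin d, (M (f c).1 ^ (f c).2).trace := fun M => by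
        have h6 : ∏ c ∈ univ.erase i, (M (f c).1 ^ (f c).2).trace
            = ∏ c ∈ univ.erase i, (M c ^ a c).trace :=
          prod_congr rfl fun c hc => by rw [hf' c (ne_of_mem_erase hc)]
        rw [← mul_prod_erase _ _ (mem_univ i), h6, gradVertex, Matrix.mul_smul,
          trace_smul, ← pow_add, smul_eq_mul, hfi, Nat.add_sub_assoc ha]
        ring
      simp only [h3, expectation_const_mul]
      rw [moment_eq_sum_cumulant (fun S : Finset (Fin d) => expectation κ N fun M =>
        ∏ c ∈ S, (M (f c).1 ^ (f c).2).trace) univ ⟨i, mem_univ i⟩,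
        sum_finpartition_prod _ (mem_univ i), mul_smul]
      congr 1
      have h5 : (C ((sizeUnit hN ^ (2 - (d : ℤ)) : ℂˣ) : ℂ) : PS d ℂ)
          = algebraMap ℂ _ ((N : ℂ) ^ (2 - (d : ℤ))) := by
        rw [Units.val_zpow_eq_zpow_val, coe_sizeUnit]; rfl
      rw [h5, ← Algebra.smul_def]
      congr 1
      refine sum_congr rfl fun L hL => sum_congr rfl fun Λ _ => ?_
      have hiL : i ∉ L := fun h => by simpa using mem_powerset.1 hL h
      have hB : ∀ B : Finset (Fin d), i ∉ B → B.val.map (fun c => (c, a c)) = B.val.map f :=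
        fun B hB => Multiset.map_congr rfl fun c hc => (hf' c (ne_of_mem_of_not_mem hc hB)).symm
      congr 1
      · rw [cumulant_eq_corr_finite hN hκ _ _ (Finset.insert_nonempty _ _),
          insert_val_of_notMem hiL, map_cons, hfi, ← hB L hiL]
      · refine prod_congr rfl fun B hBΛ => ?_
        have hiB : i ∉ B := fun h => by simpa using Λ.le hBΛ h
        rw [cumulant_eq_corr_finite hN hκ _ _ (Λ.nonempty_of_mem_parts hBΛ), ← hB B hiB]
    · rw [interaction]
      by_cases hc : c = i
      · subst hc
        rcases Nat.eq_zero_or_pos k with hk | hk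
        · simp [hk, gradVertex, h0]
        have h3 : ∀ M : Fin d → Matrix (Fin N) (Fin N) ℂ,
            (M c ^ p * gradVertex M c (Sum.inr (c, k))).trace
            = (k * (N : ℂ)) * (M c ^ (p + k - 1)).trace := fun M => by
          rw [gradVertex, if_pos rfl, Matrix.mul_smul, trace_smul, ← pow_add, smul_eq_mul,
            Nat.add_sub_assoc hk]
          ring
        simp only [h3, expectation_const_mul, if_true, hF]
        rw [mul_smul]
        congr 1
        exact (Algebra.smul_def (N : ℂ) (_ : PS d ℂ)).symm
      · simp [hc, gradVertex, h0]
  rw [show interaction (sizeUnit hN) (finiteInsertions hκ hN) i p = _ from funext h2]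
  have hCN : (C (((sizeUnit hN : ℂˣ)) : ℂ) : PS d ℂ) = algebraMap ℂ _ (N : ℂ) := rfl
  rw [hCN, ← Algebra.smul_def, smul_smul, hF]
  simp only [expectation]
  rw [← mul_cSum, ← mul_sum, ← mul_sub, ← mul_smul_comm]
  congr 1
  ext m
  simp only [map_smul, map_sub, map_sum, coeff_formalIntegral, coeff_cSum]
  rw [smul_eq_mul, mul_comm (κ i : ℂ)]
  exact integral_schwinger_dyson hκ hN i p m

end FiniteSize

end

section
open MvPowerSeries (coeff map pderiv map_C coeff_map coeff_mul)

/-! ### Transfer to Laurent series in `1 / N` -/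

section Functoriality
variable {d : ℕ} {K K' : Type} [CommRing K] [CommRing K'] [Algebra ℂ K] [Algebra ℂ K'] (φ : K →ₐ[ℂ] K')

lemma map_smul_series (z : ℂ) (f : PS d K) :
    map (φ : K →+* K') (z • f) = z • map (φ : K →+* K') f := by
  ext m
  simp

lemma map_insD (ν : Kˣ) (w : Label d) (f : PS d K) : map (φ : K →+* K') (insD ν w f)
      = insD (Units.map (φ : K →* K') ν) w (map (φ : K →+* K') f) := by
  ext m
  simp only [coeff_map, coeff_insD]
  simp

lemma map_cSum (F : Coupling d → PS d K) : map (φ : K →+* K') (cSum F)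
      = cSum fun v => map (φ : K →+* K') (F v) := by
  ext m
  simp [coeff_cSum]

variable {ν : Kˣ} {I : Insertions (Fin d × ℕ) (PS d K)} {I' : Insertions (Fin d × ℕ) (PS d K')}
  (hD : I.D = insD ν) (hD' : I'.D = insD (Units.map (φ : K →* K') ν))
  (hF : ∀ w, MvPowerSeries.map (φ : K →+* K') (I.F w) = I'.F w)

include hD hD' in
lemma map_iter (s : Labels d) (f : PS d K) : map (φ : K →+* K') (I.iter s f)
      = I'.iter s (map (φ : K →+* K') f) := by
  induction s using induction_on with
  | empty => simp
  | cons a s ih => rw [Insertions.iter_cons, Insertions.iter_cons, hD, map_insD, ih, hD']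

include hD hD' hF in
lemma map_corr (s : Labels d) : map (φ : K →+* K') (I.corr s) = I'.corr s := by
  induction s using induction_on with
  | empty => simp
  | cons a s _ => rw [Insertions.corr_cons, Insertions.corr_cons, map_iter φ hD hD', hF]

include hD hD' hF in
lemma map_interaction (i : Fin d) (p : ℕ) (v : Coupling d) :
    map (φ : K →+* K') (interaction ν I i p v)
      = interaction (Units.map (φ : K →* K') ν) I' i p v := by
  rcases v with a | ⟨c, k⟩
  · simp only [interaction, map_smul_series, map_mul, map_sum, map_prod, map_corr φ hD hD' hF,
      map_C]
    rw [← map_zpow]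
    rfl
  · simp only [interaction]
    split_ifs
    · simp only [map_smul_series, map_mul, hF, map_C]
      rfl
    · simp

include hD hD' hF in
lemma SchwingerDyson.map {κ : Fin d → ℝ} (h : SchwingerDyson κ ν I) :
    SchwingerDyson κ (Units.map (φ : K →* K') ν) I' := fun i p => by
  have := congrArg (MvPowerSeries.map (φ : K →+* K')) (h i p)
  simp only [map_smul_series, map_mul, map_sub, map_sum, map_add, hF, hD, map_insD, map_cSum,
    map_interaction φ hD hD' hF, MvPowerSeries.map_C] at this
  rw [hD']
  exact this

include hD hD' hF in
lemma SchwingerDyson.map_sub_eq_zero {κ : Fin d → ℝ}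
    (h : SchwingerDyson κ (Units.map (φ : K →* K') ν) I') (i : Fin d) (p : ℕ) :
    MvPowerSeries.map (φ : K →+* K') ((κ i : ℂ) • (MvPowerSeries.C (ν : K) * I.F (i, p + 1)))
    = MvPowerSeries.map (φ : K →+* K') (∑ a ∈ range p,
      (I.F (i, a) * I.F (i, p - 1 - a) + I.D (i, a) (I.F (i, p - 1 - a)))
      - cSum (interaction ν I i p)) := by
  have := h i p
  simp only [map_smul_series, map_mul, map_sub, map_sum, map_add, hF, hD, map_insD, map_cSum,
    map_interaction φ hD hD' hF, MvPowerSeries.map_C]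
  rw [hD'] at this
  exact this

end Functoriality

section Laurent
open LaurentPolynomial

/-- Substitution of a unit for the variable of a Laurent polynomial. -/
def laurentEval {K : Type} [CommRing K] [Algebra ℂ K] (x : Kˣ) : ℂ[T;T⁻¹] →ₐ[ℂ] K :=
  { LaurentPolynomial.eval₂ (algebraMap ℂ K) x with
    commutes' := fun z => LaurentPolynomial.eval₂_C (algebraMap ℂ K) x z }

lemma laurentEval_C_mul_T {K : Type} [CommRing K] [Algebra ℂ K] (x : Kˣ) (z : ℂ) (n : ℤ) :
    laurentEval x (C z * T n) = z • ((x ^ n : Kˣ) : K) := by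
  rw [Algebra.smul_def]
  exact LaurentPolynomial.eval₂_C_mul_T (algebraMap ℂ K) x z n

lemma laurentEval_sizeUnit {N : ℕ} (hN : 0 < N) (P : ℂ[T;T⁻¹]) :
    laurentEval (sizeUnit hN) P = P.coeff.sum fun k z => z * (N : ℂ) ^ k := by
  induction P using LaurentPolynomial.induction_on' with
  | add p q hp hq =>
    rw [map_add, hp, hq, AddMonoidAlgebra.coeff_add, Finsupp.sum_add_index']
    · simp
    · intro k a b; ring
  | C_mul_T n a =>
    rw [laurentEval_C_mul_T, ← single_eq_C_mul_T, AddMonoidAlgebra.coeff_single,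
      Finsupp.sum_single_index (by simp)]
    simp

/-- The variable `T`, which stands for `N`. -/
def unitT : ℂ[T;T⁻¹]ˣ := ⟨T 1, T (-1), by rw [← T_add]; simp, by rw [← T_add]; simp⟩

lemma map_unitT {K : Type} [CommRing K] [Algebra ℂ K] (x : Kˣ) :
    Units.map (laurentEval x : ℂ[T;T⁻¹] →* K) unitT = x := by
  ext
  have := laurentEval_C_mul_T x 1 1
  change laurentEval x (T 1) = x
  simpa using this

lemma laurent_ext {P Q : ℂ[T;T⁻¹]}
    (h : ∀ N (hN : 0 < N), laurentEval (sizeUnit hN) P = laurentEval (sizeUnit hN) Q) : P = Q := by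
  rw [← sub_eq_zero]
  have h' : ∀ N (hN : 0 < N), laurentEval (sizeUnit hN) (P - Q) = 0 := fun N hN => by
    rw [map_sub, h N hN, sub_self]
  generalize P - Q = R at h'
  obtain ⟨n, f, hf⟩ := R.exists_T_pow
  have hf0 : f = 0 := by
    refine Polynomial.eq_zero_of_infinite_isRoot f ?_
    refine Set.Infinite.mono (s := (fun N : ℕ => ((N + 1 : ℕ) : ℂ)) '' Set.univ) ?_ ?_
    · rintro _ ⟨N, _, rfl⟩
      have h1 := congrArg (laurentEval (sizeUnit N.succ_pos)) hf
      rw [map_mul, h' _ N.succ_pos, zero_mul] at h1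
      have h2 : laurentEval (sizeUnit N.succ_pos) (Polynomial.toLaurent f)
          = Polynomial.eval₂ (algebraMap ℂ ℂ) ((N + 1 : ℕ) : ℂ) f :=
        LaurentPolynomial.eval₂_toLaurent _ _ _
      rw [h2] at h1
      simpa [Polynomial.eval₂_eq_eval_map] using h1
    · refine Set.Infinite.image ?_ Set.infinite_univ
      intro a _ b _ hab
      simpa using hab
  have h2 : R * T n * T (-n) = 0 := by rw [← hf, hf0]; simp
  rwa [mul_assoc, ← T_add, add_neg_cancel, T_zero, mul_one] at h2

/-- Laurent polynomials of degree at most `D`. -/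
def degLE (D : ℤ) : Submodule ℂ ℂ[T;T⁻¹] := Submodule.span ℂ (T '' Set.Iic D)

lemma T_mem_degLE {n D : ℤ} (h : n ≤ D) : (T n : ℂ[T;T⁻¹]) ∈ degLE D :=
  Submodule.subset_span ⟨n, h, rfl⟩

lemma degLE_mono {D D' : ℤ} (h : D ≤ D') : degLE D ≤ degLE D' :=
  Submodule.span_mono (Set.image_mono (Set.Iic_subset_Iic.2 h))

lemma mul_mem_degLE {D D' : ℤ} {P Q : ℂ[T;T⁻¹]} (hP : P ∈ degLE D) (hQ : Q ∈ degLE D') :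
    P * Q ∈ degLE (D + D') := by
  have h := Submodule.mul_mem_mul hP hQ
  rw [degLE, degLE, Submodule.span_mul_span] at h
  refine Submodule.span_mono ?_ h
  rintro _ ⟨_, ⟨n, hn, rfl⟩, _, ⟨k, hk, rfl⟩, rfl⟩
  exact ⟨n + k, Set.mem_Iic.2 (add_le_add hn hk), T_add n k⟩

lemma coeff_eq_zero_of_mem_degLE {D : ℤ} {P : ℂ[T;T⁻¹]} (hP : P ∈ degLE D) {k : ℤ}
    (hk : D < k) : P.coeff k = 0 := by
  refine Submodule.span_induction (p := fun P _ => P.coeff k = 0) ?_ (by simp) ?_ ?_ hP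
  · rintro _ ⟨n, hn, rfl⟩
    rw [T, AddMonoidAlgebra.coeff_single, Finsupp.single_apply, if_neg]
    exact (lt_of_le_of_lt hn hk).ne
  · intro x y _ _ hx hy
    simp [hx, hy]
  · intro a x _ hx
    simp [hx]

end Laurent

section Degree
variable {d : ℕ}
open LaurentPolynomial

/-- The degree in the matrices of the interaction multiplied by a coupling. -/
def couplingDegree : Coupling d → ℕ
  | Sum.inl a => ∑ c, a c
  | Sum.inr w => w.2

/-- The families over the sizes `N` of series whose coefficients of order `m`, for the monomials `m`
with `deg m + r ≤ t`, are Laurent polynomials in `N` of degree at most `D`. -/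
def LaurentUpTo (r t : ℕ) (D : ℤ) (G : ∀ N : ℕ, 0 < N → PS d ℂ) : Prop :=
  ∀ m : Order d, weight couplingDegree m + r ≤ t →
    ∃ P ∈ degLE D, ∀ N hN, coeff m (G N hN) = laurentEval (sizeUnit hN) P

lemma finiteInsertions_zero {κ : Fin d → ℝ} (hκ : ∀ c, 0 < κ c) {N : ℕ} (hN : 0 < N) (i : Fin d) :
    (finiteInsertions hκ hN).F (i, 0) = MvPowerSeries.C (N : ℂ) := by
  have h4 := expectation_const_mul (κ := κ) (N := N) (N : ℂ) (fun _ => 1)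
  rw [expectation_one hκ hN] at h4
  have h5 : (finiteInsertions hκ hN).F (i, 0) = expectation κ N fun _ => (N : ℂ) * 1 := by
    change expectation κ N _ = _
    simp
  rw [h5, h4, Algebra.smul_def, mul_one]
  rfl

namespace LaurentUpTo
variable {r r' t : ℕ} {D D' : ℤ} {F G : ∀ N : ℕ, 0 < N → PS d ℂ}

lemma mono (h : LaurentUpTo r t D G) (hr : r ≤ r') (hD : D ≤ D') : LaurentUpTo r' t D' G := fun m hm => by
  obtain ⟨P, hP, hP'⟩ := h m (by omega)
  exact ⟨P, degLE_mono hD hP, hP'⟩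

lemma zero : LaurentUpTo r t D (fun _ _ => (0 : PS d ℂ)) := fun m _ =>
  ⟨0, zero_mem _, fun N hN => by simp⟩

lemma add (hF : LaurentUpTo r t D F) (hG : LaurentUpTo r t D G) :
    LaurentUpTo r t D (fun N hN => F N hN + G N hN) := fun m hm => by
  obtain ⟨P, hP, hP'⟩ := hF m hm
  obtain ⟨Q, hQ, hQ'⟩ := hG m hm
  exact ⟨P + Q, add_mem hP hQ, fun N hN => by rw [map_add, map_add, hP', hQ']⟩

lemma smul (hF : LaurentUpTo r t D F) (z : ℂ) : LaurentUpTo r t D (fun N hN => z • F N hN) := fun m hm => by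
  obtain ⟨P, hP, hP'⟩ := hF m hm
  exact ⟨z • P, Submodule.smul_mem _ _ hP, fun N hN => by rw [map_smul, map_smul, hP']⟩

lemma sub (hF : LaurentUpTo r t D F) (hG : LaurentUpTo r t D G) :
    LaurentUpTo r t D (fun N hN => F N hN - G N hN) := by
  convert hF.add (hG.smul (-1)) using 3
  simp [sub_eq_add_neg]

lemma sum {ι : Type*} (s : Finset ι) {F : ι → ∀ N : ℕ, 0 < N → PS d ℂ}
    (h : ∀ i ∈ s, LaurentUpTo r t D (F i)) : LaurentUpTo r t D (fun N hN => ∑ i ∈ s, F i N hN) := by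
  classical
  induction s using Finset.induction_on with
  | empty => simpa using zero
  | insert a s ha ih =>
    simp only [sum_insert ha]
    exact (h a (mem_insert_self _ _)).add (ih fun i hi => h i (mem_insert_of_mem hi))

lemma mul (hF : LaurentUpTo r t D F) (hG : LaurentUpTo r' t D' G) :
    LaurentUpTo (r + r') t (D + D') (fun N hN => F N hN * G N hN) := by
  classical
  intro m hm
  have h : ∀ p : Order d × Order d, ∃ P ∈ degLE (D + D'),
      p ∈ antidiagonal m → ∀ N hN, coeff p.1 (F N hN)
        * coeff p.2 (G N hN) = laurentEval (sizeUnit hN) P := fun p => by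
    by_cases hp : p ∈ antidiagonal m
    · have hp' := mem_antidiagonal.1 hp
      have hw : weight couplingDegree p.1 + weight couplingDegree p.2
          = weight couplingDegree m := by rw [← map_add, hp']
      obtain ⟨P, hP, hP'⟩ := hF p.1 (by omega)
      obtain ⟨Q, hQ, hQ'⟩ := hG p.2 (by omega)
      exact ⟨P * Q, mul_mem_degLE hP hQ, fun _ N hN => by rw [map_mul, hP', hQ']⟩
    · exact ⟨0, zero_mem _, fun h => absurd h hp⟩
  choose P hP hP' using h
  refine ⟨∑ p ∈ antidiagonal m, P p, sum_mem fun p _ => hP p, fun N hN => ?_⟩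
  rw [coeff_mul, map_sum]
  exact sum_congr rfl fun p hp => hP' p hp N hN

lemma const {P : ℂ[T;T⁻¹]} (hP : P ∈ degLE D) :
    LaurentUpTo r t D (fun _ hN => (MvPowerSeries.C (laurentEval (sizeUnit hN) P) : PS d ℂ)) := by
  classical
  intro m _
  by_cases hm : m = 0
  · subst hm
    exact ⟨P, hP, fun N hN => by simp⟩
  · exact ⟨0, zero_mem _, fun N hN => by rw [MvPowerSeries.coeff_C, if_neg hm, map_zero]⟩

lemma prod {ι : Type*} (s : Finset ι) {F : ι → ∀ N : ℕ, 0 < N → PS d ℂ} {ρ : ι → ℕ} {δ : ι → ℤ}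
    (h : ∀ i ∈ s, LaurentUpTo (ρ i) t (δ i) (F i)) :
    LaurentUpTo (∑ i ∈ s, ρ i) t (∑ i ∈ s, δ i) (fun N hN => ∏ i ∈ s, F i N hN) := by
  classical
  induction s using Finset.induction_on with
  | empty =>
    have := const (d := d) (r := 0) (t := t) (D := 0) (P := 1) (by
      rw [← T_zero]; exact T_mem_degLE le_rfl)
    simpa using this
  | insert a s ha ih =>
    simp only [prod_insert ha, sum_insert ha]
    exact (h a (mem_insert_self _ _)).mul (ih fun i hi => h i (mem_insert_of_mem hi))

lemma insD (hG : LaurentUpTo r t D G) (w : Label d) :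
    LaurentUpTo (r + w.2) t (D - 1) (fun N hN => insD (sizeUnit hN) w (G N hN)) := fun m hm => by
  obtain ⟨P, hP, hP'⟩ := hG (m + single (Sum.inr w) 1) (by
    rw [map_add, Finsupp.weight_single]
    simp only [couplingDegree, smul_eq_mul]
    omega)
  refine ⟨(-((m (Sum.inr w) : ℂ) + 1)) • (T (-1) * P), Submodule.smul_mem _ _ ?_, fun N hN => ?_⟩
  · rw [sub_eq_add_neg, add_comm]
    exact mul_mem_degLE (T_mem_degLE le_rfl) hP
  · rw [coeff_insD, hP', map_smul, map_mul]
    have h1 : laurentEval (sizeUnit hN) (T (-1)) = ((sizeUnit hN)⁻¹ : ℂˣ) := by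
      have := laurentEval_C_mul_T (sizeUnit hN) 1 (-1)
      simpa using this
    rw [h1, smul_eq_mul]
    ring

lemma cSum {F : Coupling d → ∀ N : ℕ, 0 < N → PS d ℂ}
    (h : ∀ v, LaurentUpTo (r + couplingDegree v) t D (F v)) :
    LaurentUpTo r t D (fun N hN => cSum fun v => F v N hN) := by
  classical
  intro m hm
  have h : ∀ v, ∃ P ∈ degLE D, v ∈ m.support → ∀ N hN,
      coeff (m - single v 1) (F v N hN) = laurentEval (sizeUnit hN) P := fun v => by
    by_cases hv : v ∈ m.support
    · have hle : single v 1 ≤ m := by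
        rw [Finsupp.single_le_iff]
        exact Nat.one_le_iff_ne_zero.2 (Finsupp.mem_support_iff.1 hv)
      have hw : weight couplingDegree (m - single v 1) + couplingDegree v
          = weight couplingDegree m := by
        have := Finsupp.weight_single (couplingDegree (d := d)) v 1
        rw [one_smul] at this
        rw [← this, ← map_add, tsub_add_cancel_of_le hle]
      obtain ⟨P, hP, hP'⟩ := h v (m - single v 1) (by omega)
      exact ⟨P, hP, fun _ => hP'⟩
    · exact ⟨0, zero_mem _, fun h => absurd h hv⟩
  choose P hP hP' using h
  refine ⟨∑ v ∈ m.support, P v, sum_mem fun v _ => hP v, fun N hN => ?_⟩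
  rw [coeff_cSum, map_sum]
  exact sum_congr rfl fun v hv => hP' v hv N hN

variable {κ : Fin d → ℝ} (hκ : ∀ c, 0 < κ c)

lemma iter (s : Labels d) (hG : LaurentUpTo r t D G) :
    LaurentUpTo (r + (s.map Prod.snd).sum) t (D - s.card)
      (fun _ hN => (finiteInsertions hκ hN).iter s (G _ hN)) := by
  induction s using induction_on with
  | empty => simpa using hG
  | cons a s ih =>
    simp only [Insertions.iter_cons]
    refine (ih.insD a).mono ?_ ?_
    · simp only [map_cons, sum_cons]; omega
    · simp only [card_cons]; push_cast; omega

lemma corr (hF : ∀ w, LaurentUpTo w.2 t 1 (fun _ hN => (finiteInsertions hκ hN).F w))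
    (s : Labels d) :
    LaurentUpTo (s.map Prod.snd).sum t (2 - s.card)
      (fun _ hN => (finiteInsertions hκ hN).corr s) := by
  induction s using induction_on with
  | empty => simpa using zero
  | cons a s ih =>
    simp only [Insertions.corr_cons]
    refine ((hF a).iter hκ s).mono ?_ ?_
    · simp only [map_cons, sum_cons]; omega
    · simp only [card_cons]; push_cast; omega

lemma const_zpow (k : ℤ) : LaurentUpTo 0 t k
    (fun _ hN => (MvPowerSeries.C ((sizeUnit hN ^ k : ℂˣ) : ℂ) : PS d ℂ)) := by
  have h1 : ∀ N (hN : 0 < N), laurentEval (sizeUnit hN) (T k) = ((sizeUnit hN ^ k : ℂˣ) : ℂ) :=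
    fun N hN => by simpa using laurentEval_C_mul_T (sizeUnit hN) 1 k
  simpa only [h1] using const (d := d) (r := 0) (t := t) (T_mem_degLE (le_refl k))

lemma interaction (hF : ∀ w, LaurentUpTo w.2 t 1 (fun _ hN => (finiteInsertions hκ hN).F w))
    (i : Fin d) (p : ℕ) (v : Coupling d) :
    LaurentUpTo (p + couplingDegree v) t 2
      (fun _ hN => interaction (sizeUnit hN) (finiteInsertions hκ hN) i p v) := by
  rcases v with a | ⟨c, k⟩
  · simp only [MultiTrace.interaction]
    rcases Nat.eq_zero_or_pos (a i) with h0 | h0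
    · simpa [h0] using zero
    refine smul ?_ _
    have hsum : LaurentUpTo (p + ∑ c, a c) t (d : ℤ) (fun _ hN =>
        ∑ L ∈ (univ.erase i).powerset, ∑ Λ : Finpartition (univ.erase i \ L),
          (finiteInsertions hκ hN).corr ((i, p + a i - 1) ::ₘ L.val.map fun c => (c, a c)) *
            ∏ B ∈ Λ.parts, (finiteInsertions hκ hN).corr (B.val.map fun c => (c, a c))) := by
      refine sum _ fun L hL => sum _ fun Λ _ => ?_
      have hL := mem_powerset.1 hL
      refine ((corr hκ hF _).mul (prod Λ.parts fun B _ => corr hκ hF _)).mono ?_ ?_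
      · simp only [map_cons, sum_cons, map_map, Function.comp_def]
        have h1 : ∑ B ∈ Λ.parts, (B.val.map fun c => a c).sum = ∑ c ∈ univ.erase i \ L, a c := by
          conv_rhs => rw [← Λ.biUnion_parts]
          rw [Finset.sum_biUnion Λ.disjoint]
          rfl
        have h2 : (L.val.map fun c => a c).sum + ∑ c ∈ univ.erase i \ L, a c
            = ∑ c ∈ univ.erase i, a c := by
          rw [add_comm]
          exact Finset.sum_sdiff hL
        have h3 := add_sum_erase univ a (mem_univ i)
        omega
      · simp only [card_cons, card_map, Finset.card_val, sum_sub_distrib, sum_const, nsmul_eq_mul]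
        have h1 : ∑ B ∈ Λ.parts, (B.card : ℤ) = (univ.erase i \ L).card := by
          rw [← Λ.sum_card_parts]; push_cast; rfl
        have h2 := Λ.card_parts_le_card
        have h3 := Finset.card_sdiff_add_card_eq_card hL
        rw [Finset.card_erase_of_mem (mem_univ i), card_univ, Fintype.card_fin] at h3
        have h4 := i.pos
        rw [h1]
        push_cast
        omega
    exact ((const_zpow (2 - d)).mul hsum).mono (by simp [couplingDegree]) (by omega)
  · simp only [MultiTrace.interaction]
    split_ifs
    · have h1 := (const_zpow 1).mul (hF (i, p + k - 1))
      simp only [zpow_one] at h1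
      exact (h1.mono (by simp only [couplingDegree]; omega) (by norm_num)).smul _
    · exact zero

include hκ in
lemma traceExpectation (t : ℕ) :
    ∀ w : Label d, LaurentUpTo w.2 t 1 (fun _ hN => (finiteInsertions hκ hN).F w) := by
  have hF0 : ∀ (t : ℕ) (i : Fin d), LaurentUpTo 0 t 1 (fun _ hN => (finiteInsertions hκ hN).F (i, 0)) := fun t i => by
    simpa [finiteInsertions_zero hκ] using const_zpow (d := d) (t := t) 1
  induction t with
  | zero =>
    rintro ⟨i, p⟩
    rcases p with _ | p
    · exact hF0 0 i
    · intro m hm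
      simp at hm
  | succ t ih =>
    rintro ⟨i, p⟩
    rcases p with _ | p
    · exact hF0 (t + 1) i
    have h1 : LaurentUpTo p t 2 (fun _ hN => ∑ a ∈ range p,
        ((finiteInsertions hκ hN).F (i, a) * (finiteInsertions hκ hN).F (i, p - 1 - a)
          + (finiteInsertions hκ hN).D (i, a) ((finiteInsertions hκ hN).F (i, p - 1 - a)))
        - MultiTrace.cSum (MultiTrace.interaction (sizeUnit hN) (finiteInsertions hκ hN) i p)) := by
      refine sub (sum _ fun a ha => add ?_ ?_) (cSum fun v => interaction hκ ih i p v)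
      · have ha := mem_range.1 ha
        exact ((ih (i, a)).mul (ih (i, p - 1 - a))).mono (by simp only; omega) (by norm_num)
      · have ha := mem_range.1 ha
        exact ((ih (i, p - 1 - a)).insD (i, a)).mono (by simp only; omega) (by norm_num)
    intro m hm
    obtain ⟨P, hP, hP'⟩ := h1 m (by simp only at hm; omega)
    refine ⟨((κ i : ℂ)⁻¹) • (T (-1) * P), Submodule.smul_mem _ _ ?_, fun N hN => ?_⟩
    · have h := mul_mem_degLE (T_mem_degLE (le_refl (-1))) hP
      rwa [show (-1 : ℤ) + 2 = 1 by norm_num] at h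
    have h2 := schwingerDyson_finite hN hκ i p
    have h3 := congrArg (coeff m) h2
    rw [hP', map_smul, MvPowerSeries.coeff_C_mul] at h3
    have hκ' : (κ i : ℂ) ≠ 0 := by exact_mod_cast (hκ i).ne'
    have hN' : (N : ℂ) ≠ 0 := by exact_mod_cast hN.ne'
    have h4 : laurentEval (sizeUnit hN) (T (-1)) = (N : ℂ)⁻¹ := by
      have := laurentEval_C_mul_T (sizeUnit hN) 1 (-1)
      simpa using this
    rw [map_smul, map_mul, h4, ← h3, smul_eq_mul, smul_eq_mul, coe_sizeUnit]
    field_simp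

end LaurentUpTo

/-- Evaluation of series at a fixed size. -/
abbrev evalMap (hN : 0 < N) : PS d ℂ[T;T⁻¹] →+* PS d ℂ :=
  MvPowerSeries.map (laurentEval (sizeUnit hN) : ℂ[T;T⁻¹] →+* ℂ)

lemma exists_insertions {κ : Fin d → ℝ} (hκ : ∀ c, 0 < κ c) :
    ∃ I : Insertions (Label d) (PS d ℂ[T;T⁻¹]), I.D = insD unitT ∧
      SchwingerDyson κ unitT I ∧ (∀ i, I.F (i, 0) = MvPowerSeries.C (T 1)) ∧
      (∀ N (hN : 0 < N) s, evalMap hN (I.corr s) = (finiteInsertions hκ hN).corr s) ∧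
      ∀ s m, coeff m (I.corr s) ∈ degLE (2 - s.card) := by
  have h : ∀ (w : Label d) (m : Order d), ∃ P : ℂ[T;T⁻¹], ∀ (N : ℕ) (hN : 0 < N),
      coeff m ((finiteInsertions hκ hN).F w) = laurentEval (sizeUnit hN) P := fun w m => by
    obtain ⟨P, _, hP⟩ := LaurentUpTo.traceExpectation hκ (weight couplingDegree m + w.2) w m le_rfl
    exact ⟨P, hP⟩
  choose P hP using h
  let F : Label d → PS d ℂ[T;T⁻¹] := fun w m => P w m
  have hF : ∀ N (hN : 0 < N) w, evalMap hN (F w) = (finiteInsertions hκ hN).F w := fun N hN w => by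
    ext m
    rw [coeff_map, hP]
    rfl
  have hext : ∀ f g : PS d ℂ[T;T⁻¹],
      (∀ N (hN : 0 < N), evalMap hN f = evalMap hN g) → f = g := fun f g hfg => by
    ext1 m
    refine laurent_ext fun N hN => ?_
    have := congrArg (coeff m) (hfg N hN)
    simpa using this
  have hsymm : ∀ a b, insD unitT a (F b) = insD unitT b (F a) := fun a b => by
    refine hext _ _ fun N hN => ?_
    rw [map_insD, map_insD, hF, hF, map_unitT]
    exact (finiteInsertions hκ hN).symm a b
  let I := seriesInsertions unitT F hsymm
  have hD : I.D = insD unitT := rfl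
  have hD' : ∀ N (hN : 0 < N), (finiteInsertions hκ hN).D
      = insD (Units.map (laurentEval (sizeUnit hN) : ℂ[T;T⁻¹] →* ℂ) unitT) := fun N hN => by
    rw [map_unitT]
    rfl
  have hcorr : ∀ N (hN : 0 < N) s,
      evalMap hN (I.corr s) = (finiteInsertions hκ hN).corr s := fun N hN s =>
    map_corr _ hD (hD' N hN) (hF N hN) s
  refine ⟨I, hD, ?_, ?_, hcorr, ?_⟩
  · intro i p
    refine hext _ _ fun N hN => ?_
    refine SchwingerDyson.map_sub_eq_zero _ hD (hD' N hN) (hF N hN) ?_ i p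
    rw [map_unitT]
    exact schwingerDyson_finite hN hκ
  · intro i
    refine hext _ _ fun N hN => ?_
    have h1 : evalMap hN (I.F (i, 0)) = _ := hF N hN (i, 0)
    have h2 := laurentEval_C_mul_T (sizeUnit hN) 1 1
    simp only [map_one, one_mul, one_smul, zpow_one, coe_sizeUnit] at h2
    rw [h1, finiteInsertions_zero, map_C]
    exact congrArg _ h2.symm
  · intro s m
    obtain ⟨Q, hQ, hQ'⟩ := LaurentUpTo.corr hκ (LaurentUpTo.traceExpectation hκ
      (weight couplingDegree m + (s.map Prod.snd).sum)) s m le_rfl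
    have h1 : coeff m (I.corr s) = Q := by
      refine laurent_ext fun N hN => ?_
      refine Eq.trans ?_ (hQ' N hN)
      beta_reduce
      rw [← hcorr N hN s, coeff_map]
      rfl
    rwa [h1]

lemma coeff_C_mul_laurentSeries (z : ℂ) (f : LaurentSeries ℂ) (k : ℤ) :
    (HahnSeries.C z * f).coeff k = z * f.coeff k := by
  rw [HahnSeries.C_mul_eq_smul, HahnSeries.coeff_smul, smul_eq_mul]

lemma single_neg_one_mul_single_one :
    (HahnSeries.single (-1) 1 * HahnSeries.single 1 1 : LaurentSeries ℂ) = 1 := by simp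

/-- Laurent series in `1 / N`, with the algebra structure given by the constants. -/
def LK : Type := LaurentSeries ℂ

instance : CommRing LK := inferInstanceAs (CommRing (LaurentSeries ℂ))

instance : Algebra ℂ LK := RingHom.toAlgebra (HahnSeries.C : ℂ →+* LaurentSeries ℂ)

lemma LK_algebraMap (z : ℂ) : algebraMap ℂ LK z = (HahnSeries.C z : LaurentSeries ℂ) := rfl

/-- The coefficient of `N ^ k`. -/
def LK.coeff (f : LK) (k : ℤ) : ℂ := HahnSeries.coeff (Γ := ℤ) (R := ℂ) f (-k)

lemma LK.ext {f g : LK} (h : ∀ k, f.coeff k = g.coeff k) : f = g := by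
  refine HahnSeries.ext (Γ := ℤ) (R := ℂ) (funext fun k => ?_)
  have := h (-k)
  rwa [LK.coeff, LK.coeff, neg_neg] at this

lemma LK.coeff_add (f g : LK) (k : ℤ) : (f + g).coeff k = f.coeff k + g.coeff k := rfl

lemma LK.coeff_smul (z : ℂ) (f : LK) (k : ℤ) : (z • f).coeff k = z * f.coeff k := by
  rw [Algebra.smul_def, LK_algebraMap]
  exact coeff_C_mul_laurentSeries z f (-k)

/-- The coefficient of `N ^ k`, times the monomial `m` in the couplings. -/
def coN (m : Order d) (k : ℤ) : PS d LK →ₗ[ℂ] ℂ where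
  toFun f := (coeff m f).coeff k
  map_add' f g := by rw [map_add, LK.coeff_add]
  map_smul' z f := by
    exact LK.coeff_smul z _ k

lemma coN_apply (m : Order d) (k : ℤ) (f : PS d LK) : coN m k f = (coeff m f).coeff k := rfl

lemma coN_ext {f g : PS d LK} (h : ∀ m k, coN m k f = coN m k g) : f = g :=
  MvPowerSeries.ext fun m => LK.ext fun k => h m k

/-- `N`, as a unit of the Laurent series in `1 / N`. -/
def unitN : LKˣ :=
  ⟨(HahnSeries.single (-1) 1 : LaurentSeries ℂ), (HahnSeries.single 1 1 : LaurentSeries ℂ),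
    single_neg_one_mul_single_one, (mul_comm _ _).trans single_neg_one_mul_single_one⟩

lemma coe_unitN_zpow (n : ℤ) :
    ((unitN ^ n : LKˣ) : LK) = (HahnSeries.single (-n) 1 : LaurentSeries ℂ) := by
  obtain ⟨k, rfl | rfl⟩ := n.eq_nat_or_neg
  · rw [zpow_natCast, Units.val_pow_eq_pow_val]
    change (HahnSeries.single (-1) 1 : LaurentSeries ℂ) ^ k = _
    rw [HahnSeries.single_pow]
    simp
  · rw [zpow_neg, zpow_natCast, ← inv_pow, Units.val_pow_eq_pow_val]
    change (HahnSeries.single 1 1 : LaurentSeries ℂ) ^ k = _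
    rw [HahnSeries.single_pow]
    simp

lemma LK.coeff_unitN_zpow_mul (n : ℤ) (f : LK) (k : ℤ) :
    (((unitN ^ n : LKˣ) : LK) * f).coeff k = f.coeff (k - n) := by
  rw [coe_unitN_zpow]
  have := HahnSeries.coeff_single_mul_add (r := (1 : ℂ)) (x := (f : LaurentSeries ℂ))
    (a := -(k - n)) (b := -n)
  rw [one_mul, show -(k - n) + -n = -k by ring] at this
  exact this

lemma coeff_laurentEval_unitN (P : ℂ[T;T⁻¹]) (k : ℤ) :
    (laurentEval unitN P).coeff k = P.coeff k := by
  induction P using LaurentPolynomial.induction_on' with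
  | add p q hp hq => rw [map_add, LK.coeff_add, hp, hq]; rfl
  | C_mul_T n a =>
    rw [laurentEval_C_mul_T, ← single_eq_C_mul_T, AddMonoidAlgebra.coeff_single, LK.coeff_smul,
      coe_unitN_zpow, Finsupp.single_apply]
    change a * (HahnSeries.single (-n) (1 : ℂ) : LaurentSeries ℂ).coeff (-k) = _
    rw [HahnSeries.coeff_single]
    by_cases h : n = k
    · subst h; simp
    · have h' : ¬ -k = -n := fun h2 => h (by omega)
      rw [if_neg h', if_neg h, mul_zero]

/-- The insertions of the matrix model, in the series in the couplings and in `1 / N`. -/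
lemma exists_seriesInsertions {κ : Fin d → ℝ} (hκ : ∀ c, 0 < κ c) :
    ∃ I : Insertions (Label d) (PS d LK), I.D = insD unitN ∧
      SchwingerDyson κ unitN I ∧ (∀ i, I.F (i, 0) = MvPowerSeries.C (unitN : LK)) ∧
      (∀ s m, ∃ w : ℤ →₀ ℂ, (∀ k, w k = coN m k (I.corr s)) ∧ ∀ N (hN : 0 < N),
        coeff m ((finiteInsertions hκ hN).corr s) = w.sum fun k z => z * (N : ℂ) ^ k) ∧
      ∀ s m (k : ℤ), 2 - (s.card : ℤ) < k → coN m k (I.corr s) = 0 := by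
  obtain ⟨I, hD, hSD, hF0, hcorr, hdeg⟩ := exists_insertions hκ
  let φ := laurentEval unitN
  let Φ := map (σ := Coupling d) (φ : ℂ[T;T⁻¹] →+* LK)
  have hν : Units.map (φ : ℂ[T;T⁻¹] →* LK) unitT = unitN := map_unitT unitN
  let J : Insertions (Label d) (PS d LK) := seriesInsertions unitN (fun w => Φ (I.F w)) (by
    intro a b
    have h := congrArg Φ (I.symm a b)
    rw [hD, map_insD, map_insD, hν] at h
    exact h)
  have hJD : J.D = insD (Units.map (φ : ℂ[T;T⁻¹] →* LK) unitT) := by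
    rw [hν]; rfl
  have hJ : ∀ s, Φ (I.corr s) = J.corr s := map_corr φ hD hJD fun w => rfl
  have hc : ∀ s m k, coN m k (J.corr s) = (coeff m (I.corr s)).coeff k := fun s m k => by
    rw [← hJ, coN_apply, coeff_map]
    exact coeff_laurentEval_unitN _ _
  refine ⟨J, rfl, ?_, ?_, ?_, ?_⟩
  · have := SchwingerDyson.map φ hD hJD (fun w => rfl) hSD
    rwa [hν] at this
  · intro i
    change Φ (I.F (i, 0)) = _
    rw [hF0, map_C]
    congr 1
    have := laurentEval_C_mul_T unitN 1 1
    rw [Algebra.smul_def, map_one, map_one, one_mul, one_mul, zpow_one] at this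
    exact this
  · intro s m
    refine ⟨(coeff m (I.corr s)).coeff, fun k => (hc s m k).symm, fun N hN => ?_⟩
    rw [← hcorr, coeff_map]
    exact laurentEval_sizeUnit hN _
  · intro s m k hk
    rw [hc]
    exact coeff_eq_zero_of_mem_degLE (hdeg s m) hk

end Degree

end

section
open Polynomial
open MultiTrace.Insertions (corr_cons iter_cons iter_smul iter_zero_right iter_zero)

/-! ### Insertions of polynomials of the matrices -/

section PolyMap
variable {M M' : Type*} [AddCommGroup M] [Module ℂ M] [AddCommGroup M'] [Module ℂ M']

/-- The linear map on polynomials with given values on the monomials. -/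
def polyMap (g : ℕ → M) : ℂ[X] →ₗ[ℂ] M :=
  Polynomial.lsum fun k => LinearMap.toSpanSingleton ℂ M (g k)

@[simp] theorem polyMap_monomial (g : ℕ → M) (k : ℕ) (z : ℂ) :
    polyMap g (monomial k z) = z • g k := by
  simp [polyMap, Polynomial.lsum]

@[simp] theorem polyMap_X_pow (g : ℕ → M) (k : ℕ) : polyMap g (X ^ k) = g k := by
  rw [X_pow_eq_monomial, polyMap_monomial, one_smul]

@[simp] theorem polyMap_one (g : ℕ → M) : polyMap g 1 = g 0 := by
  rw [← pow_zero X, polyMap_X_pow]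

lemma map_polyMap (L : M →ₗ[ℂ] M') (g : ℕ → M) (f : ℂ[X]) :
    L (polyMap g f) = polyMap (fun k => L (g k)) f := by
  induction f using Polynomial.induction_on' with
  | add p q hp hq => rw [map_add, map_add, hp, hq, map_add]
  | monomial k z => rw [polyMap_monomial, map_smul, polyMap_monomial]

lemma linearMap_eq_polyMap (L : ℂ[X] →ₗ[ℂ] M) : L = polyMap fun k => L (X ^ k) := by
  refine LinearMap.ext fun f => ?_
  induction f using Polynomial.induction_on' with
  | add p q hp hq => rw [map_add, map_add, hp, hq]
  | monomial k z =>
    rw [polyMap_monomial, ← map_smul, X_pow_eq_monomial, smul_monomial, smul_eq_mul, mul_one]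

/-- The non-commutative derivative `X ^ p ↦ ∑ a + b = p - 1, X ^ a ⊗ X ^ b` composed with a bilinear
map. -/
def ncDeriv (β : ℂ[X] →ₗ[ℂ] ℂ[X] →ₗ[ℂ] M) : ℂ[X] →ₗ[ℂ] M :=
  polyMap fun p => ∑ a ∈ range p, β (X ^ a) (X ^ (p - 1 - a))

lemma ncDeriv_one (β : ℂ[X] →ₗ[ℂ] ℂ[X] →ₗ[ℂ] M) : ncDeriv β 1 = 0 := by
  simp [ncDeriv]

lemma ncDeriv_X_mul (β : ℂ[X] →ₗ[ℂ] ℂ[X] →ₗ[ℂ] M) (f : ℂ[X]) :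
    ncDeriv β (X * f) = β 1 f + ncDeriv (β.comp (mulLeft ℂ X)) f := by
  induction f using Polynomial.induction_on' with
  | add p q hp hq => rw [mul_add, map_add, hp, hq, map_add, map_add]; abel
  | monomial k z =>
    rw [X_mul_monomial, ncDeriv, polyMap_monomial, ncDeriv, polyMap_monomial,
      Finset.sum_range_succ', smul_add, add_comm]
    congr 1
    · have h : (monomial k z : ℂ[X]) = z • X ^ k := by
        rw [X_pow_eq_monomial, smul_monomial, smul_eq_mul, mul_one]
      rw [h, map_smul]
      simp
    · congr 1
      refine sum_congr rfl fun a _ => ?_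
      rw [comp_apply, mulLeft_apply, ← pow_succ']
      congr 2
      omega

end PolyMap

/-- The polynomials `P_q`, orthonormal for the semicircle law on `[-2 / √κ, 2 / √κ]`. -/
def chebP (κ : ℝ) : ℕ → ℂ[X]
  | 0 => 1
  | 1 => C (√κ : ℂ) * X
  | (q + 2) => C (√κ : ℂ) * X * chebP κ (q + 1) - chebP κ q

lemma chebP_zero (κ : ℝ) : chebP κ 0 = 1 := rfl
lemma chebP_one (κ : ℝ) : chebP κ 1 = C (√κ : ℂ) * X := rfl
lemma chebP_add_two (κ : ℝ) (q : ℕ) :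
    chebP κ (q + 2) = C (√κ : ℂ) * X * chebP κ (q + 1) - chebP κ q := rfl

lemma X_mul_chebP (κ : ℝ) (q : ℕ) :
    (√κ : ℂ) • (X * chebP κ (q + 1)) = chebP κ (q + 2) + chebP κ q := by
  rw [chebP_add_two, smul_eq_C_mul]; ring

lemma X_mul_chebP_zero (κ : ℝ) : (√κ : ℂ) • (X * chebP κ 0) = chebP κ 1 := by
  rw [chebP_one, chebP_zero, smul_eq_C_mul]; ring

lemma chebP_mul_chebP (κ : ℝ) (a b : ℕ) :
    chebP κ (a + 1) * chebP κ (b + 1) = chebP κ a * chebP κ b + chebP κ (a + b + 2) := by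
  induction a using Nat.twoStepInduction generalizing b with
  | zero => rw [zero_add, chebP_one, chebP_zero, zero_add, chebP_add_two]; ring
  | one =>
    rw [show 1 + b + 2 = b + 1 + 2 by ring, chebP_add_two κ (b + 1), chebP_add_two κ b,
      chebP_add_two κ 0, chebP_one, chebP_zero]
    ring
  | more a h1 h2 =>
    rw [chebP_add_two κ (a + 1), sub_mul, mul_assoc, h2, h1, chebP_add_two κ a,
      show a + 2 + b + 2 = a + b + 2 + 2 by ring, chebP_add_two κ (a + b + 2),
      show a + 1 + b + 2 = a + b + 2 + 1 by ring]
    ring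

lemma ncDeriv_chebP {M : Type*} [AddCommGroup M] [Module ℂ M] (κ : ℝ)
    (β : ℂ[X] →ₗ[ℂ] ℂ[X] →ₗ[ℂ] M) (q : ℕ) :
    ncDeriv β (chebP κ (q + 1)) = (√κ : ℂ) • ∑ x ∈ antidiagonal q,
          β (chebP κ x.1) (chebP κ x.2) := by
  induction q using Nat.twoStepInduction generalizing β with
  | zero =>
    rw [zero_add, chebP_one, ← smul_eq_C_mul, map_smul, ← mul_one X, ncDeriv_X_mul, ncDeriv_one]
    simp [chebP_zero]
  | one =>
    rw [show 1 + 1 = 0 + 2 by rfl, chebP_add_two, map_sub, mul_assoc, ← smul_eq_C_mul, map_smul,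
      ncDeriv_X_mul, zero_add, chebP_one, ← smul_eq_C_mul, map_smul, map_smul, ← mul_one X,
      ncDeriv_X_mul, ncDeriv_one, chebP_zero, ncDeriv_one,
      Finset.Nat.sum_antidiagonal_succ]
    simp [chebP_zero, chebP_one, ← smul_eq_C_mul]
  | more q h1 h2 =>
    rw [chebP_add_two, map_sub, mul_assoc, ← smul_eq_C_mul, map_smul,
      ncDeriv_X_mul, h2, h1, Finset.Nat.sum_antidiagonal_succ, Finset.Nat.sum_antidiagonal_succ,
      Finset.Nat.sum_antidiagonal_succ]
    simp only [comp_apply, mulLeft_apply]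
    have h3 : ∀ a b, (√κ : ℂ) • β (X * chebP κ (a + 1)) b
        = β (chebP κ (a + 2)) b + β (chebP κ a) b := fun a b => by
      rw [← LinearMap.smul_apply, ← map_smul, X_mul_chebP, map_add, LinearMap.add_apply]
    have h4 : ∀ b, (√κ : ℂ) • β (X * chebP κ 0) b = β (chebP κ 1) b := fun b => by
      rw [← LinearMap.smul_apply, ← map_smul, X_mul_chebP_zero]
    rw [smul_add (√κ : ℂ) (β (X * chebP κ 0) _), h4, smul_sum]
    simp only [h3, sum_add_distrib]
    rw [← smul_sub, chebP_zero, zero_add]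
    congr 1
    abel

lemma derivative_chebP (κ : ℝ) (q : ℕ) : derivative (chebP κ (q + 1))
      = (√κ : ℂ) • ∑ x ∈ antidiagonal q, chebP κ x.1 * chebP κ x.2 := by
  have h := ncDeriv_chebP κ (LinearMap.mul ℂ ℂ[X]) q
  simp only [LinearMap.mul_apply'] at h
  rw [← h]
  generalize chebP κ (q + 1) = f
  induction f using Polynomial.induction_on' with
  | add p q hp hq => rw [map_add, map_add, hp, hq]
  | monomial k z =>
    rw [ncDeriv, polyMap_monomial, derivative_monomial]
    simp only [LinearMap.mul_apply', ← pow_add]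
    rw [sum_congr rfl (g := fun _ => X ^ (k - 1)) fun a ha => by
      congr 1; have := mem_range.1 ha; omega]
    simp [smul_eq_C_mul, ← C_mul_X_pow_eq_monomial, mul_assoc]

section PolyInsertions
variable {d : ℕ} {R : Type*} [CommRing R] [Algebra ℂ R]

lemma polyMap_derivation_apply {g : ℕ → Derivation ℂ R R} (f : ℂ[X]) (x : R) :
    polyMap g f x = polyMap (fun k => g k x) f :=
  map_polyMap ({ toFun := fun D => D x, map_add' := fun _ _ => rfl, map_smul' := fun _ _ => rfl } :
    Derivation ℂ R R →ₗ[ℂ] R) g f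

/-- The insertions of polynomials of the matrices. -/
def polyInsertions (I : Insertions (Label d) R) : Insertions (Fin d × ℂ[X]) R where
  D a := polyMap (fun k => I.D (a.1, k)) a.2
  F a := polyMap (fun k => I.F (a.1, k)) a.2
  comm a b x := by
    obtain ⟨c, f⟩ := a
    obtain ⟨c', f'⟩ := b
    simp only
    induction f using Polynomial.induction_on' with
    | add p q hp hq => simp only [map_add, Derivation.add_apply, hp, hq]
    | monomial k z =>
      induction f' using Polynomial.induction_on' with
      | add p q hp hq => simp only [map_add, Derivation.add_apply, hp, hq]
      | monomial k' z' =>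
        simp only [polyMap_monomial, Derivation.smul_apply, Derivation.map_smul]
        rw [I.comm, smul_comm]
  symm a b := by
    obtain ⟨c, f⟩ := a
    obtain ⟨c', f'⟩ := b
    simp only
    induction f using Polynomial.induction_on' with
    | add p q hp hq => simp only [map_add, Derivation.add_apply, hp, hq]
    | monomial k z =>
      induction f' using Polynomial.induction_on' with
      | add p q hp hq => simp only [map_add, Derivation.add_apply, hp, hq]
      | monomial k' z' =>
        simp only [polyMap_monomial, Derivation.smul_apply, Derivation.map_smul]
        rw [I.symm, smul_comm]

variable (I : Insertions (Label d) R)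

lemma polyInsertions_D (c : Fin d) (f : ℂ[X]) (x : R) :
    (polyInsertions I).D (c, f) x = polyMap (fun k => I.D (c, k) x) f :=
  polyMap_derivation_apply f x

lemma polyInsertions_F (c : Fin d) (f : ℂ[X]) :
    (polyInsertions I).F (c, f) = polyMap (fun k => I.F (c, k)) f := rfl

lemma polyInsertions_corr_cons (c : Fin d) (f : ℂ[X]) (s : Multiset (Fin d × ℂ[X])) :
    (polyInsertions I).corr ((c, f) ::ₘ s)
      = polyMap (fun k => (polyInsertions I).iter s (I.F (c, k))) f := by
  rw [corr_cons, polyInsertions_F]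
  exact map_polyMap ((polyInsertions I).iterLin s) _ f

lemma polyInsertions_iter_X_pow (s : Labels d) (x : R) :
    (polyInsertions I).iter (s.map fun w => (w.1, X ^ w.2)) x = I.iter s x := by
  induction s using induction_on with
  | empty => rfl
  | cons a s ih =>
    rw [map_cons, iter_cons, ih, polyInsertions_D, polyMap_X_pow, iter_cons]

lemma polyInsertions_corr_X_pow (s : Labels d) :
    (polyInsertions I).corr (s.map fun w => (w.1, X ^ w.2)) = I.corr s := by
  induction s using induction_on with
  | empty => simp
  | cons a s _ =>
    rw [map_cons, corr_cons, polyInsertions_iter_X_pow, polyInsertions_F,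
      polyMap_X_pow, corr_cons]

/-- The bilinear map `(f, g) ↦ F f * F g + D f (F g)`. -/
def pairing (i : Fin d) : ℂ[X] →ₗ[ℂ] ℂ[X] →ₗ[ℂ] R :=
  LinearMap.mk₂ ℂ (fun f g => (polyInsertions I).F (i, f) * (polyInsertions I).F (i, g)
      + (polyInsertions I).D (i, f) ((polyInsertions I).F (i, g)))
    (fun f f' g => by
      simp only [polyInsertions_F, polyInsertions_D, map_add]
      ring)
    (fun z f g => by
      simp only [polyInsertions_F, polyInsertions_D, map_smul, smul_mul_assoc, smul_add])
    (fun f g g' => by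
      simp only [polyInsertions_F, map_add]
      ring)
    (fun z f g => by
      simp only [polyInsertions_F, map_smul, Derivation.map_smul, mul_smul_comm, smul_add])

lemma pairing_apply (i : Fin d) (f g : ℂ[X]) :
    pairing I i f g = (polyInsertions I).F (i, f) * (polyInsertions I).F (i, g)
      + (polyInsertions I).D (i, f) ((polyInsertions I).F (i, g)) := rfl

lemma Insertions.iter_of_step {Λ : Type} (I : Insertions Λ R) {ι : Type*} [DecidableEq ι]
    (v : ι → Λ) (Φ : Multiset Λ → R) (E : Λ → R)
    (h : ∀ a s, I.D a (Φ s) = Φ (a ::ₘ s) - I.iter s (E a)) (S : Finset ι) :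
    I.iter (S.val.map v) (Φ 0)
      = Φ (S.val.map v) - ∑ j ∈ S, I.iter ((S.erase j).val.map v) (E (v j)) := by
  induction S using Finset.induction_on with
  | empty => simp
  | insert a S ha ih =>
    rw [insert_val_of_notMem ha, map_cons, iter_cons, ih, map_sub, h,
      map_sum, sum_insert ha, erase_insert ha, ← sub_sub]
    congr 1
    refine sum_congr rfl fun j hj => ?_
    have hja : j ≠ a := ne_of_mem_of_not_mem hj ha
    rw [Finset.erase_insert_of_ne hja.symm, insert_val_of_notMem (by simp [ha]),
      map_cons, iter_cons]

end PolyInsertions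

section Model
variable {d : ℕ} {K : Type} [CommRing K] [Algebra ℂ K]

/-- Insertions that satisfy the Schwinger–Dyson equations of the matrix model. -/
structure MatrixModel (ν : Kˣ) (κ : Fin d → ℝ) where
  I : Insertions (Label d) (PS d K)
  D_eq : I.D = insD ν
  sd : SchwingerDyson κ ν I
  F_zero : ∀ i, I.F (i, 0) = MvPowerSeries.C (ν : K)

/-- The constant series `ν ^ k`. -/
def nPow (ν : Kˣ) (k : ℤ) : PS d K := MvPowerSeries.C ((ν ^ k : Kˣ) : K)

lemma nPow_add (ν : Kˣ) (j k : ℤ) : (nPow ν (j + k) : PS d K) = nPow ν j * nPow ν k := by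
  rw [nPow, nPow, nPow, ← map_mul, zpow_add, Units.val_mul]

lemma nPow_zero (ν : Kˣ) : (nPow ν 0 : PS d K) = 1 := by
  rw [nPow, zpow_zero, Units.val_one, map_one]

lemma nPow_one (ν : Kˣ) : (nPow ν 1 : PS d K) = MvPowerSeries.C (ν : K) := by
  rw [nPow, zpow_one]

lemma insD_nPow_mul (ν : Kˣ) (w : Label d) (j : ℤ) (f : PS d K) :
    insD ν w (nPow ν j * f) = nPow ν j * insD ν w f := by
  rw [Derivation.leibniz, nPow, insD_C, smul_zero, add_zero, smul_eq_mul]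

lemma coN_nPow_mul (m : Order d) (k j : ℤ) (f : PS d LK) :
    coN m k (nPow unitN j * f) = coN m (k - j) f := by
  rw [coN_apply, nPow, MvPowerSeries.coeff_C_mul, LK.coeff_unitN_zpow_mul, coN_apply]

namespace MatrixModel
variable {ν : Kˣ} {κ : Fin d → ℝ} (M : MatrixModel ν κ)

/-- The insertions of polynomials in the matrix model. -/
abbrev J : Insertions (Fin d × ℂ[X]) (PS d K) := polyInsertions M.I

/-- The interaction terms in the Schwinger–Dyson equation for `tr f(M_i)`. -/
def interaction (i : Fin d) (f : ℂ[X]) : Coupling d → PS d K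
  | Sum.inl a => (a i : ℂ) • (nPow ν (2 - d) *
      ∑ L ∈ (univ.erase i).powerset, ∑ Λ : Finpartition (univ.erase i \ L),
        M.J.corr ((i, f * X ^ (a i - 1)) ::ₘ L.val.map fun c => (c, X ^ a c)) *
          ∏ B ∈ Λ.parts, M.J.corr (B.val.map fun c => (c, X ^ a c)))
  | Sum.inr (c, k) => if c = i then (k : ℂ) • (nPow ν 1 * M.J.F (i, f * X ^ (k - 1))) else 0

lemma interaction_add (i : Fin d) (f g : ℂ[X]) (v : Coupling d) :
    M.interaction i (f + g) v = M.interaction i f v + M.interaction i g v := by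
  rcases v with a | ⟨c, k⟩
  · simp only [interaction, polyInsertions_corr_cons, add_mul, map_add, sum_add_distrib,
      mul_add, smul_add]
  · simp only [interaction, polyInsertions_F, add_mul, map_add, mul_add, smul_add]
    split_ifs <;> simp

lemma interaction_smul (i : Fin d) (z : ℂ) (f : ℂ[X]) (v : Coupling d) :
    M.interaction i (z • f) v = z • M.interaction i f v := by
  rcases v with a | ⟨c, k⟩
  · simp only [interaction, polyInsertions_corr_cons, smul_mul_assoc, map_smul, ← smul_sum,
      mul_smul_comm]
    rw [smul_comm]
  · simp only [interaction, polyInsertions_F, smul_mul_assoc, map_smul, mul_smul_comm]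
    split_ifs
    · rw [smul_comm]
    · rw [smul_zero]

lemma interaction_X_pow (i : Fin d) (p : ℕ) (v : Coupling d) :
    M.interaction i (X ^ p) v = MultiTrace.interaction ν M.I i p v := by
  rcases v with a | ⟨c, k⟩
  · simp only [interaction, MultiTrace.interaction, nPow]
    rcases Nat.eq_zero_or_pos (a i) with h0 | h0
    · simp [h0]
    have h1 : ∀ L : Finset (Fin d), M.J.corr (L.val.map fun c => (c, X ^ a c))
        = M.I.corr (L.val.map fun c => (c, a c)) := fun L => by
      rw [← polyInsertions_corr_X_pow, map_map]; rfl
    have h2 : ∀ L : Finset (Fin d), M.J.corr ((i, X ^ p * X ^ (a i - 1)) ::ₘ L.val.map fun c => (c, X ^ a c))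
        = M.I.corr ((i, p + a i - 1) ::ₘ L.val.map fun c => (c, a c)) := fun L => by
      rw [← polyInsertions_corr_X_pow, map_cons, map_map, ← pow_add, Nat.add_sub_assoc h0]; rfl
    simp only [h1, h2]
  · simp only [interaction, MultiTrace.interaction, nPow_one]
    rcases Nat.eq_zero_or_pos k with h0 | h0
    · simp [h0]
    rw [← pow_add, Nat.add_sub_assoc h0, polyInsertions_F, polyMap_X_pow]

lemma sd_poly (i : Fin d) (f : ℂ[X]) : (κ i : ℂ) • (nPow ν 1 * M.J.F (i, X * f))
      = ncDeriv (pairing M.I i) f - cSum (M.interaction i f) := by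
  induction f using Polynomial.induction_on' with
  | add p q hp hq =>
    have h : M.interaction i (p + q) = fun v => M.interaction i p v + M.interaction i q v :=
      funext (M.interaction_add i p q)
    rw [h, cSum_add, map_add, add_sub_add_comm, ← hp, ← hq, mul_add, polyInsertions_F, map_add,
      mul_add, smul_add]
    rfl
  | monomial k z =>
    have hz : (monomial k z : ℂ[X]) = z • X ^ k := by
      rw [X_pow_eq_monomial, smul_monomial, smul_eq_mul, mul_one]
    rw [hz]
    have h : M.interaction i (z • X ^ k) = fun v => z • M.interaction i (X ^ k) v :=
      funext (M.interaction_smul i z (X ^ k))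
    have h' : M.interaction i (X ^ k) = MultiTrace.interaction ν M.I i k :=
      funext (M.interaction_X_pow i k)
    rw [h, ← smul_cSum, map_smul, ← smul_sub, mul_smul_comm, polyInsertions_F, map_smul,
      mul_smul_comm, smul_comm, h', ← pow_succ', polyMap_X_pow, nPow_one, M.sd i k, ncDeriv,
      polyMap_X_pow]
    simp only [pairing_apply, polyInsertions_F, polyMap_X_pow, polyInsertions_D]

lemma D_nPow_mul (a : Fin d × ℂ[X]) (j : ℤ) (f : PS d K) :
    M.J.D a (nPow ν j * f) = nPow ν j * M.J.D a f := by
  obtain ⟨c, g⟩ := a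
  simp only [polyInsertions_D, M.D_eq, insD_nPow_mul]
  exact (map_polyMap (mulLeft ℂ (nPow ν j)) _ g).symm

lemma D_nPow (a : Fin d × ℂ[X]) (j : ℤ) : M.J.D a (nPow ν j) = 0 := by
  have := M.D_nPow_mul a j 1
  rw [mul_one, Derivation.map_one_eq_zero, mul_zero] at this
  exact this

lemma D_cSum (c : Fin d) (g : ℂ[X]) (F : Coupling d → PS d K) :
    M.J.D (c, g) (cSum F) = cSum (fun v => M.J.D (c, g) (F v))
      - nPow ν (-1) * polyMap (fun k => F (Sum.inr (c, k))) g := by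
  simp only [polyInsertions_D, M.D_eq, insD_cSum, map_neg, show (MvPowerSeries.C ((ν⁻¹ : Kˣ) : K) : PS d K) = nPow ν (-1) by rw [nPow, zpow_neg_one]]
  induction g using Polynomial.induction_on' with
  | add p q hp hq =>
    simp only [map_add, hp, hq, cSum_add, mul_add]
    abel
  | monomial k z =>
    simp only [polyMap_monomial, ← smul_cSum, smul_add, mul_smul_comm]
    rw [neg_mul, smul_neg]
    abel

lemma iter_interaction_inr (s : Multiset (Fin d × ℂ[X])) (i : Fin d) (f : ℂ[X]) (k : ℕ) :
    M.J.iter s (M.interaction i f (Sum.inr (i, k)))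
      = (k : ℂ) • (nPow ν 1 * M.J.iter s (M.J.F (i, f * X ^ (k - 1)))) := by
  rw [interaction, if_pos rfl, iter_smul,
    Insertions.iter_mul_of_D_eq_zero _ _ _ _ fun a => M.D_nPow a 1]

lemma iter_cSum_interaction {n : ℕ} (v : Fin n → Fin d × ℂ[X]) (i : Fin d) (f : ℂ[X]) :
    M.J.iter (values v) (cSum (M.interaction i f))
      = cSum (fun u => M.J.iter (values v) (M.interaction i f u))
        - ∑ j ∈ univ.filter fun j => (v j).1 = i,
          M.J.corr ((i, f * derivative (v j).2) ::ₘ (univ.erase j).val.map v) := by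
  rw [sum_filter]
  have hstep : ∀ (a : Fin d × ℂ[X]) (s : Multiset (Fin d × ℂ[X])),
      M.J.D a (cSum fun u => M.J.iter s (M.interaction i f u))
        = (cSum fun u => M.J.iter (a ::ₘ s) (M.interaction i f u))
          - M.J.iter s (if a.1 = i then M.J.F (i, f * derivative a.2) else 0) := by
    rintro ⟨c, g⟩ s
    rw [D_cSum]
    simp only [iter_cons]
    congr 1
    by_cases hc : c = i
    · subst hc
      simp only [if_true, iter_interaction_inr]
      induction g using Polynomial.induction_on' with
      | add p q hp hq =>
        rw [map_add, mul_add, hp, hq, derivative_add, mul_add, ← Insertions.iter_add,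
          polyInsertions_F, polyInsertions_F, polyInsertions_F, map_add]
      | monomial k z =>
        have hz : (monomial (k - 1) (z * k) : ℂ[X]) = (z * k) • X ^ (k - 1) := by
          rw [X_pow_eq_monomial, smul_monomial, smul_eq_mul, mul_one]
        rw [polyMap_monomial, derivative_monomial, hz, mul_smul_comm, mul_smul_comm, mul_smul_comm,
          ← mul_assoc, ← nPow_add, neg_add_cancel, nPow_zero, one_mul, smul_smul, polyInsertions_F,
          polyInsertions_F, map_smul, iter_smul]
    · simp only [hc, if_false, interaction, iter_zero_right]
      simp [polyMap, Polynomial.lsum, Polynomial.sum]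
  have h := M.J.iter_of_step v (fun s => cSum fun u => M.J.iter s (M.interaction i f u))
    (fun a => if a.1 = i then M.J.F (i, f * derivative a.2) else 0) hstep univ
  simp only [iter_zero] at h
  rw [values]
  refine h.trans ?_
  congr 1
  refine sum_congr rfl fun j _ => ?_
  split_ifs
  · rw [corr_cons]
  · rw [iter_zero_right]

lemma iter_pairing {n : ℕ} (v : Fin n → Fin d × ℂ[X]) (i : Fin d) (f g : ℂ[X]) :
    M.J.iter (values v) (pairing M.I i f g)
      = ∑ S : Finset (Fin n), M.J.corr ((i, f) ::ₘ S.val.map v) * M.J.corr ((i, g) ::ₘ Sᶜ.val.map v)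
        + M.J.corr ((i, f) ::ₘ (i, g) ::ₘ values v) := by
  rw [pairing_apply, Insertions.iter_add, Insertions.iter_mul_univ]
  simp only [corr_cons]
  congr 1
  rw [← Insertions.iter_cons', ← Insertions.iter_symm]

/-- The Schwinger–Dyson equation with `n` insertions. -/
lemma sd_insertions {n : ℕ} (v : Fin n → Fin d × ℂ[X]) (i : Fin d) (f : ℂ[X]) :
    (κ i : ℂ) • (nPow ν 1 * M.J.corr ((i, X * f) ::ₘ values v))
      = M.J.iter (values v) (ncDeriv (pairing M.I i) f)
        - cSum (fun u => M.J.iter (values v) (M.interaction i f u))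
        + ∑ j ∈ univ.filter fun j => (v j).1 = i,
          M.J.corr ((i, f * derivative (v j).2) ::ₘ (univ.erase j).val.map v) := by
  have h := congrArg (M.J.iter (values v)) (M.sd_poly i f)
  rw [Insertions.iter_sub, iter_cSum_interaction, iter_smul,
    Insertions.iter_mul_of_D_eq_zero _ _ _ _ fun a => M.D_nPow a 1, ← corr_cons] at h
  rw [h]
  abel

end MatrixModel

lemma linearMap_polyMap_eq_zero {M : Type*} [AddCommGroup M] [Module ℂ M] (L : M →ₗ[ℂ] ℂ)
    (g : ℕ → M) (f : ℂ[X]) (hg : ∀ k, L (g k) = 0) : L (polyMap g f) = 0 := by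
  simp [map_polyMap, hg, polyMap, Polynomial.lsum, Polynomial.sum]

lemma coN_corr_eq_zero (I : Insertions (Label d) (PS d LK))
    (deg : ∀ s m (k : ℤ), 2 - (s.card : ℤ) < k → coN m k (I.corr s) = 0)
    (s : Multiset (Fin d × ℂ[X])) (m : Order d)
    (k : ℤ) (hk : 2 - (s.card : ℤ) < k) : coN m k ((polyInsertions I).corr s) = 0 := by
  have hpoly : ∀ (g : ℕ → PS d LK) (f : ℂ[X]), (∀ k', coN m k (g k') = 0) →
      coN m k (polyMap g f) = 0 := fun g f => linearMap_polyMap_eq_zero _ g f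
  have key : ∀ (s : Multiset (Fin d × ℂ[X])) (t : Labels d), t ≠ 0 →
      2 - (s.card : ℤ) - t.card < k → coN m k ((polyInsertions I).iter s (I.corr t)) = 0 := fun s => by
    induction s using induction_on with
    | empty =>
      intro t _ h
      exact deg t m k (by simpa using h)
    | cons a s ih =>
      intro t ht h
      obtain ⟨c, f⟩ := a
      rw [Insertions.iter_cons', polyInsertions_D]
      have h1 : (polyInsertions I).iter s (polyMap (fun k' => I.D (c, k') (I.corr t)) f)
          = polyMap (fun k' => (polyInsertions I).iter s (I.D (c, k') (I.corr t))) f :=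
        map_polyMap ((polyInsertions I).iterLin s) _ f
      rw [h1]
      refine hpoly _ _ fun k' => ?_
      have h2 : I.D (c, k') (I.corr t) = I.corr ((c, k') ::ₘ t) := by
        have := I.iter_corr {(c, k')} t ht
        rw [singleton_add] at this
        exact this
      rw [h2]
      refine ih _ Multiset.cons_ne_zero ?_
      simp only [card_cons] at h ⊢
      push_cast at h ⊢
      omega
  rcases s.empty_or_exists_mem with rfl | ⟨⟨c, f⟩, ha⟩
  · simp
  · obtain ⟨s, rfl⟩ := exists_cons_of_mem ha
    rw [polyInsertions_corr_cons]
    refine hpoly _ _ fun k' => ?_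
    have h2 : I.F (c, k') = I.corr {(c, k')} := by
      have := I.corr_cons (c, k') 0
      simpa using this.symm
    rw [h2]
    refine key _ _ (by simp) ?_
    simp only [card_cons, Multiset.card_singleton] at hk ⊢
    push_cast at hk ⊢
    omega

end Model

/-! ### Families of polynomial growth -/

section PolynomialGrowth
variable {Θ Θ' : Type}

/-- The size of an index. -/
abbrev natWt : ℕ → ℕ := fun q => q

/-- The size of a pair of indices. -/
abbrev addWt : ℕ × ℕ → ℕ := fun z => z.1 + z.2

lemma one_add_add_pow_le (a q e : ℕ) : (1 + (a + q : ℕ) : ℝ) ^ e ≤ (1 + a : ℝ) ^ e * (1 + q : ℝ) ^ e := by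
  rw [← mul_pow]
  gcongr
  exact_mod_cast (by nlinarith : 1 + (a + q) ≤ (1 + a) * (1 + q))

/-- Families of numbers bounded by a power of a size. -/
def PBdd (wt : Θ → ℕ) (f : Θ → ℂ) : Prop :=
  ∃ (C : ℝ) (e : ℕ), 0 ≤ C ∧ ∀ θ, ‖f θ‖ ≤ C * (1 + wt θ : ℝ) ^ e

namespace PBdd
variable {wt : Θ → ℕ} {wt' : Θ' → ℕ} {f g : Θ → ℂ}

lemma one_le (n : ℕ) : (1 : ℝ) ≤ 1 + n := by
  have : (0 : ℝ) ≤ n := n.cast_nonneg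
  linarith

lemma const (z : ℂ) : PBdd wt (fun _ => z) := ⟨‖z‖, 0, norm_nonneg _, fun θ => by simp⟩

lemma add (hf : PBdd wt f) (hg : PBdd wt g) : PBdd wt (fun θ => f θ + g θ) := by
  obtain ⟨C, e, hC, h⟩ := hf
  obtain ⟨C', e', hC', h'⟩ := hg
  refine ⟨C + C', max e e', add_nonneg hC hC', fun θ => (norm_add_le _ _).trans ?_⟩
  rw [add_mul]
  refine add_le_add ((h θ).trans ?_) ((h' θ).trans ?_)
  · gcongr
    · exact one_le _
    · exact le_max_left _ _
  · gcongr
    · exact one_le _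
    · exact le_max_right _ _

lemma mul (hf : PBdd wt f) (hg : PBdd wt g) : PBdd wt (fun θ => f θ * g θ) := by
  obtain ⟨C, e, hC, h⟩ := hf
  obtain ⟨C', e', hC', h'⟩ := hg
  refine ⟨C * C', e + e', mul_nonneg hC hC', fun θ => ?_⟩
  rw [norm_mul, pow_add, mul_mul_mul_comm]
  exact mul_le_mul (h θ) (h' θ) (norm_nonneg _) ((norm_nonneg _).trans (h θ))

lemma const_mul (z : ℂ) (hf : PBdd wt f) : PBdd wt (fun θ => z * f θ) := (const z).mul hf

lemma sum {ι : Type*} (s : Finset ι) {f : ι → Θ → ℂ} (h : ∀ i ∈ s, PBdd wt (f i)) :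
    PBdd wt (fun θ => ∑ i ∈ s, f i θ) := by
  simpa only [Finset.sum_fn] using Finset.sum_induction f (PBdd wt) (fun _ _ => add) (const 0) h

lemma comp (hf : PBdd wt f) (g : Θ' → Θ) (A : ℕ) (hA : ∀ θ, wt (g θ) ≤ A * (wt' θ + 1)) :
    PBdd wt' (fun θ => f (g θ)) := by
  obtain ⟨C, e, hC, h⟩ := hf
  refine ⟨C * (A + 1) ^ e, e, by positivity, fun θ => (h _).trans ?_⟩
  rw [mul_assoc, ← mul_pow]
  gcongr
  have : (wt (g θ) : ℝ) ≤ A * (wt' θ + 1) := by exact_mod_cast hA θ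
  nlinarith

end PBdd
end PolynomialGrowth

section Families
variable {d : ℕ}

lemma coeff_laurentSeries_mul (f g : LaurentSeries ℂ) (k K K' : ℤ)
    (hf : ∀ j > K, f.coeff (-j) = 0) (hg : ∀ j > K', g.coeff (-j) = 0) :
    (f * g).coeff (-k) = ∑ j ∈ Finset.Icc (k - K') K, f.coeff (-j) * g.coeff (-(k - j)) := by
  rw [HahnSeries.coeff_mul]
  refine Finset.sum_of_injOn (fun ij => -ij.1) ?_ ?_ ?_ ?_
  · intro x hx y hy hxy
    have hx := (Finset.mem_addAntidiagonal.1 hx).2.2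
    have hy := (Finset.mem_addAntidiagonal.1 hy).2.2
    have h1 : x.1 = y.1 := by simpa using hxy
    exact Prod.ext h1 (by omega)
  · intro x hx
    obtain ⟨h1, h2, h3⟩ := Finset.mem_addAntidiagonal.1 hx
    simp only [Finset.coe_Icc, Set.mem_Icc]
    constructor
    · by_contra h
      refine h2 ?_
      have := hg (-x.2) (by omega)
      rwa [neg_neg] at this
    · by_contra h
      refine h1 ?_
      have := hf (-x.1) (by omega)
      rwa [neg_neg] at this
  · intro j _ hj
    by_contra hne
    refine hj ⟨(-j, -(k - j)), ?_, by simp⟩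
    exact Finset.mem_coe.2 (Finset.mem_addAntidiagonal.2
      ⟨left_ne_zero_of_mul hne, right_ne_zero_of_mul hne, by ring⟩)
  · intro x hx
    obtain ⟨h1, h2, h3⟩ := Finset.mem_addAntidiagonal.1 hx
    have h4 : -(k - -x.1) = x.2 := by omega
    rw [neg_neg, h4]

lemma LK.coeff_mul (f g : LK) (k K K' : ℤ) (hf : ∀ j > K, f.coeff j = 0)
    (hg : ∀ j > K', g.coeff j = 0) :
    (f * g).coeff k = ∑ j ∈ Finset.Icc (k - K') K, f.coeff j * g.coeff (k - j) :=
  coeff_laurentSeries_mul f g k K K' hf hg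

lemma LK.coeff_sum {ι : Type*} (s : Finset ι) (F : ι → LK) (k : ℤ) :
    (∑ p ∈ s, F p).coeff k = ∑ p ∈ s, (F p).coeff k :=
  map_sum (⟨⟨fun f : LK => f.coeff k, rfl⟩, fun f g => LK.coeff_add f g k⟩ : LK →+ ℂ) F s

lemma coN_mul (m : Order d) (k K K' : ℤ) (f g : PS d LK)
    (hf : ∀ m' ≤ m, ∀ j > K, coN m' j f = 0) (hg : ∀ m' ≤ m, ∀ j > K', coN m' j g = 0) :
    coN m k (f * g) = ∑ p ∈ antidiagonal m, ∑ j ∈ Finset.Icc (k - K') K,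
      coN p.1 j f * coN p.2 (k - j) g := by
  rw [coN_apply, MvPowerSeries.coeff_mul, LK.coeff_sum]
  refine sum_congr rfl fun p hp => ?_
  have hp := mem_antidiagonal.1 hp
  exact LK.coeff_mul _ _ _ _ _ (hf p.1 (hp ▸ le_self_add)) (hg p.2 (hp ▸ le_add_self))

variable {Θ Θ' : Type} {wt : Θ → ℕ} {wt' : Θ' → ℕ}

/-- Families of series whose coefficients up to order `m` in the couplings have polynomial growth,
and a bounded degree in `N`. -/
def Bdd (m : Order d) (wt : Θ → ℕ) (y : Θ → PS d LK) : Prop :=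
  ∀ m' ≤ m, (∃ K : ℤ, ∀ θ, ∀ k > K, coN m' k (y θ) = 0) ∧ ∀ k, PBdd wt fun θ => coN m' k (y θ)

namespace Bdd
variable {m : Order d} {y z : Θ → PS d LK}

lemma exists_bound (hy : Bdd m wt y) : ∃ K : ℤ, ∀ m' ≤ m, ∀ θ, ∀ k > K, coN m' k (y θ) = 0 := by
  choose K hK using fun m' (h : m' ≤ m) => (hy m' h).1
  have hfin : (Set.Iic m).Finite := Set.finite_Iic m
  have : ∃ K₀ : ℤ, ∀ m' (h : m' ≤ m), K m' h ≤ K₀ := by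
    have := hfin.to_subtype
    obtain ⟨K₀, hK₀⟩ := (Set.finite_range fun x : Set.Iic m => K x.1 x.2).bddAbove
    exact ⟨K₀, fun m' h => hK₀ ⟨⟨m', h⟩, rfl⟩⟩
  obtain ⟨K₀, hK₀⟩ := this
  exact ⟨K₀, fun m' h θ k hk => hK m' h θ k (lt_of_le_of_lt (hK₀ m' h) hk)⟩

lemma zero : Bdd m wt (fun _ => (0 : PS d LK)) := fun m' _ =>
  ⟨⟨0, fun θ k _ => map_zero _⟩, fun k => by simpa using PBdd.const 0⟩

lemma add (hy : Bdd m wt y) (hz : Bdd m wt z) : Bdd m wt (fun θ => y θ + z θ) := fun m' hm' => by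
  obtain ⟨⟨K, hK⟩, hy⟩ := hy m' hm'
  obtain ⟨⟨K', hK'⟩, hz⟩ := hz m' hm'
  refine ⟨⟨max K K', fun θ k hk => ?_⟩, fun k => ?_⟩
  · rw [map_add, hK θ k (lt_of_le_of_lt (le_max_left _ _) hk),
      hK' θ k (lt_of_le_of_lt (le_max_right _ _) hk), add_zero]
  · simpa only [map_add] using (hy k).add (hz k)

lemma smul (c : ℂ) (hy : Bdd m wt y) : Bdd m wt (fun θ => c • y θ) := fun m' hm' => by
  obtain ⟨⟨K, hK⟩, hy⟩ := hy m' hm'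
  refine ⟨⟨K, fun θ k hk => ?_⟩, fun k => ?_⟩
  · rw [map_smul, hK θ k hk, smul_zero]
  · simpa only [map_smul, smul_eq_mul] using (hy k).const_mul c

lemma comp (hy : Bdd m wt y) (g : Θ' → Θ) (A : ℕ) (hA : ∀ θ, wt (g θ) ≤ A * (wt' θ + 1)) :
    Bdd m wt' (fun θ => y (g θ)) := fun m' hm' => by
  obtain ⟨⟨K, hK⟩, hy⟩ := hy m' hm'
  exact ⟨⟨K, fun θ => hK (g θ)⟩, fun k => (hy k).comp g A hA⟩

lemma mul (hy : Bdd m wt y) (hz : Bdd m wt z) : Bdd m wt (fun θ => y θ * z θ) := by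
  obtain ⟨K, hK⟩ := hy.exists_bound
  obtain ⟨K', hK'⟩ := hz.exists_bound
  intro m' hm'
  have h : ∀ θ k, coN m' k (y θ * z θ) = _ := fun θ k => coN_mul m' k K K' (y θ) (z θ)
    (fun m'' h => hK m'' (h.trans hm') θ) (fun m'' h => hK' m'' (h.trans hm') θ)
  refine ⟨⟨K + K', fun θ k hk => ?_⟩, fun k => ?_⟩
  · rw [h]
    refine sum_eq_zero fun p _ => sum_eq_zero fun j hj => ?_
    have := Finset.mem_Icc.1 hj
    omega
  · simp only [h]
    refine PBdd.sum _ fun p hp => PBdd.sum _ fun j _ => ?_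
    have hp := mem_antidiagonal.1 hp
    exact ((hy p.1 ((hp ▸ le_self_add : p.1 ≤ m').trans hm')).2 j).mul
      ((hz p.2 ((hp ▸ le_add_self : p.2 ≤ m').trans hm')).2 (k - j))

lemma const (x : PS d LK) : Bdd m wt (fun _ => x) := fun m' _ => by
  refine ⟨?_, fun k => PBdd.const _⟩
  have h : ∃ K : ℤ, ∀ j < K, HahnSeries.coeff (Γ := ℤ) (R := ℂ) (MvPowerSeries.coeff m' x) j = 0 := by
    refine ⟨HahnSeries.order (Γ := ℤ) (R := ℂ) (MvPowerSeries.coeff m' x), fun j hj => ?_⟩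
    exact HahnSeries.coeff_eq_zero_of_lt_order hj
  obtain ⟨K, hK⟩ := h
  exact ⟨-K, fun _ k hk => hK _ (by omega)⟩

end Bdd

/-- Restriction of the insertions along a map of labels. -/
def Insertions.comap {Λ Λ' : Type} {R : Type*} [CommRing R] [Algebra ℂ R] (I : Insertions Λ R)
    (p : Λ' → Λ) : Insertions Λ' R where
  D a := I.D (p a)
  F a := I.F (p a)
  comm a b f := I.comm _ _ f
  symm a b := I.symm _ _

lemma Insertions.comap_iter {Λ Λ' : Type} {R : Type*} [CommRing R] [Algebra ℂ R]
    (I : Insertions Λ R) (p : Λ' → Λ) (s : Multiset Λ') (x : R) :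
    (I.comap p).iter s x = I.iter (s.map p) x := by
  induction s using induction_on with
  | empty => rfl
  | cons a s ih => rw [map_cons, iter_cons, iter_cons, ih]; rfl

lemma Insertions.comap_corr {Λ Λ' : Type} {R : Type*} [CommRing R] [Algebra ℂ R]
    (I : Insertions Λ R) (p : Λ' → Λ) (s : Multiset Λ') :
    (I.comap p).corr s = I.corr (s.map p) := by
  induction s using induction_on with
  | empty => simp
  | cons a s _ =>
    rw [map_cons, corr_cons, corr_cons, comap_iter]; rfl

/-- The correlators of the matrix model, with their degrees in `N`. -/
structure CorrModel (κ : Fin d → ℝ) extends MatrixModel unitN κ where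
  pos : ∀ c, 0 < κ c
  deg : ∀ s m (k : ℤ), 2 - (s.card : ℤ) < k → coN m k (I.corr s) = 0

/-- The label of `tr P_q(M_c)`. -/
def chebLabel (κ : Fin d → ℝ) (w : Label d) : Fin d × ℂ[X] := (w.1, chebP (κ w.1) w.2)

variable {κ : Fin d → ℝ}

lemma sqrt_ne_zero_of_pos {x : ℝ} (h : 0 < x) : (√x : ℂ) ≠ 0 := by
  exact_mod_cast (sqrt_pos.2 h).ne'

lemma sqrt_mul_sqrt_of_pos {x : ℝ} (h : 0 < x) : (√x : ℂ) * √x = x := by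
  exact_mod_cast Real.mul_self_sqrt h.le

namespace CorrModel
variable (M : CorrModel κ)

/-- The insertions of the polynomials `P_q`. -/
abbrev B : Insertions (Label d) (PS d LK) := M.J.comap (chebLabel κ)

/-- Families of series that have polynomial growth up to order `m` in the couplings, together with
their first `n` insertions. -/
def TF (m : Order d) : ℕ → ∀ {Θ : Type} (_ : Θ → ℕ) (_ : Θ → PS d LK), Prop
  | 0, _, wt, y => Bdd m wt y
  | n + 1, Θ, wt, y => Bdd m wt y ∧
      TF m n (Θ := Θ × Label d) (fun x => wt x.1 + x.2.2) (fun x => M.B.D x.2 (y x.1))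

namespace TF
variable {M} {m : Order d} {n : ℕ} {y z : Θ → PS d LK}

lemma bdd (h : M.TF m n wt y) : Bdd m wt y := by
  cases n with
  | zero => exact h
  | succ n => exact h.1

lemma of_succ (h : M.TF m (n + 1) wt y) : M.TF m n wt y := by
  induction n generalizing Θ with
  | zero => exact h.1
  | succ n ih => exact ⟨h.1, ih h.2⟩

lemma comp (hy : M.TF m n wt y) (g : Θ' → Θ) (A : ℕ) (hA : ∀ θ, wt (g θ) ≤ A * (wt' θ + 1)) :
    M.TF m n wt' (fun θ => y (g θ)) := by
  induction n generalizing Θ Θ' A with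
  | zero => exact Bdd.comp hy g A hA
  | succ n ih =>
    refine ⟨hy.1.comp g A hA, ?_⟩
    have h := ih (wt' := fun x : Θ' × Label d => wt' x.1 + x.2.2) hy.2
      (fun x => (g x.1, x.2)) (A + 1) (fun x => by
        have := hA x.1
        beta_reduce
        nlinarith)
    exact h

lemma zero : M.TF m n wt (fun _ => (0 : PS d LK)) := by
  induction n generalizing Θ with
  | zero => exact Bdd.zero
  | succ n ih => exact ⟨Bdd.zero, by simpa only [map_zero] using ih⟩

lemma add (hy : M.TF m n wt y) (hz : M.TF m n wt z) : M.TF m n wt (fun θ => y θ + z θ) := by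
  induction n generalizing Θ with
  | zero => exact Bdd.add hy hz
  | succ n ih =>
    refine ⟨hy.1.add hz.1, ?_⟩
    simp only [map_add]
    exact ih hy.2 hz.2

lemma smul (c : ℂ) (hy : M.TF m n wt y) : M.TF m n wt (fun θ => c • y θ) := by
  induction n generalizing Θ with
  | zero => exact Bdd.smul c hy
  | succ n ih =>
    refine ⟨hy.1.smul c, ?_⟩
    simp only [Derivation.map_smul]
    exact ih hy.2

lemma sum {ι : Type*} (s : Finset ι) {y : ι → Θ → PS d LK} (h : ∀ i ∈ s, M.TF m n wt (y i)) :
    M.TF m n wt (fun θ => ∑ i ∈ s, y i θ) := by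
  simpa only [Finset.sum_fn] using Finset.sum_induction y (M.TF m n wt) (fun _ _ => add) zero h

lemma mul (hy : M.TF m n wt y) (hz : M.TF m n wt z) : M.TF m n wt (fun θ => y θ * z θ) := by
  induction n generalizing Θ with
  | zero => exact Bdd.mul hy hz
  | succ n ih =>
    refine ⟨hy.1.mul hz.1, ?_⟩
    simp only [Derivation.leibniz, smul_eq_mul]
    have h1 : ∀ {u : Θ → PS d LK}, M.TF m (n + 1) wt u →
        M.TF m n (fun x : Θ × Label d => wt x.1 + x.2.2) (fun x => u x.1) := fun h =>
      h.of_succ.comp Prod.fst 1 fun θ => by omega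
    exact (ih (h1 hy) hz.2).add (ih (h1 hz) hy.2)

lemma one : M.TF m n wt (fun _ => (1 : PS d LK)) := by
  cases n with
  | zero => exact Bdd.const 1
  | succ n =>
    refine ⟨Bdd.const 1, ?_⟩
    simp only [Derivation.map_one_eq_zero]
    exact zero

lemma prod {ι : Type*} (s : Finset ι) {y : ι → Θ → PS d LK} (h : ∀ i ∈ s, M.TF m n wt (y i)) :
    M.TF m n wt (fun θ => ∏ i ∈ s, y i θ) := by
  simpa only [Finset.prod_fn] using Finset.prod_induction y (M.TF m n wt) (fun _ _ => mul) one h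

lemma nPow (j : ℤ) : M.TF m n wt (fun _ => (nPow unitN j : PS d LK)) := by
  cases n with
  | zero => exact Bdd.const _
  | succ n =>
    refine ⟨Bdd.const _, ?_⟩
    have : ∀ w, M.B.D w (MultiTrace.nPow unitN j) = 0 := fun w => M.D_nPow _ j
    simp only [this]
    exact zero

/-- Polynomial growth of the iterated insertions. -/
lemma iter (hy : M.TF m n wt y) :
    Bdd m (fun x : Θ × {s : Labels d // s.card = n} => wt x.1 + (x.2.1.map Prod.snd).sum)
      (fun x => M.B.iter x.2.1 (y x.1)) := by
  induction n generalizing Θ with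
  | zero =>
    have h : ∀ x : Θ × {s : Labels d // s.card = 0}, M.B.iter x.2.1 (y x.1) = y x.1 := fun x => by
      rw [Multiset.card_eq_zero.1 x.2.2, iter_zero]
    simp only [h]
    exact Bdd.comp hy Prod.fst 1 fun θ => by omega
  | succ n ih =>
    have hex : ∀ s : {s : Labels d // s.card = n + 1}, ∃ (w : Label d)
        (t : {s : Labels d // s.card = n}), s.1 = w ::ₘ t.1 := by
      rintro ⟨s, hs⟩
      obtain ⟨w, hw⟩ := Multiset.card_pos_iff_exists_mem.1 (by omega : 0 < s.card)
      obtain ⟨t, rfl⟩ := exists_cons_of_mem hw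
      exact ⟨w, ⟨t, by simpa using hs⟩, rfl⟩
    choose w t hwt using hex
    have h := ih hy.2
    have h2 : ∀ x : Θ × {s : Labels d // s.card = n + 1},
        M.B.iter x.2.1 (y x.1) = M.B.iter (t x.2).1 (M.B.D (w x.2) (y x.1)) := fun x => by
      rw [hwt x.2, Insertions.iter_cons']
    simp only [h2]
    have h4 := Bdd.comp (wt' := fun x : Θ × {s : Labels d // s.card = n + 1} =>
      wt x.1 + (x.2.1.map Prod.snd).sum) h (fun x => ((x.1, w x.2), t x.2)) 1 (fun x => by
        have h3 : (x.2.1.map Prod.snd).sum = (w x.2).2 + ((t x.2).1.map Prod.snd).sum := by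
          rw [hwt x.2, map_cons, sum_cons]
        dsimp only
        omega)
    exact h4

end TF
end CorrModel

/-! ### Polynomials of controlled size in the basis `P_q` -/

/-- Families of polynomials on which linear forms of polynomial growth on the `P_q` have polynomial
growth. -/
def PolyBdd (x : ℝ) (wt : Θ → ℕ) (p : Θ → ℂ[X]) : Prop :=
  ∀ e : ℕ, ∃ (A : ℝ) (e' : ℕ), 0 ≤ A ∧ ∀ (φ : ℂ[X] →ₗ[ℂ] ℂ) (C : ℝ), 0 ≤ C →
    (∀ q, ‖φ (chebP x q)‖ ≤ C * (1 + q : ℝ) ^ e) → ∀ θ, ‖φ (p θ)‖ ≤ C * (A * (1 + wt θ : ℝ) ^ e')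

namespace PolyBdd
variable {x : ℝ} {p p' : Θ → ℂ[X]}

lemma add (hp : PolyBdd x wt p) (hp' : PolyBdd x wt p') : PolyBdd x wt (fun θ => p θ + p' θ) := fun e => by
  obtain ⟨A, e1, hA, h⟩ := hp e
  obtain ⟨A', e2, hA', h'⟩ := hp' e
  refine ⟨A + A', max e1 e2, add_nonneg hA hA', fun φ C hC hφ θ => ?_⟩
  rw [map_add]
  refine (norm_add_le _ _).trans ?_
  rw [add_mul, mul_add]
  refine add_le_add ((h φ C hC hφ θ).trans ?_) ((h' φ C hC hφ θ).trans ?_)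
  · gcongr
    · exact PBdd.one_le _
    · exact le_max_left _ _
  · gcongr
    · exact PBdd.one_le _
    · exact le_max_right _ _

lemma smul (hp : PolyBdd x wt p) (z : ℂ) : PolyBdd x wt (fun θ => z • p θ) := fun e => by
  obtain ⟨A, e1, hA, h⟩ := hp e
  refine ⟨‖z‖ * A, e1, by positivity, fun φ C hC hφ θ => ?_⟩
  rw [map_smul, norm_smul]
  calc ‖z‖ * ‖φ (p θ)‖ ≤ ‖z‖ * (C * (A * (1 + wt θ : ℝ) ^ e1)) := by gcongr; exact h φ C hC hφ θ
    _ = _ := by ring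

lemma comp (hp : PolyBdd x wt p) (g : Θ' → Θ) (A : ℕ) (hA : ∀ θ, wt (g θ) ≤ A * (wt' θ + 1)) :
    PolyBdd x wt' (fun θ => p (g θ)) := fun e => by
  obtain ⟨A1, e1, hA1, h⟩ := hp e
  refine ⟨A1 * (A + 1) ^ e1, e1, by positivity, fun φ C hC hφ θ => (h φ C hC hφ _).trans ?_⟩
  rw [mul_assoc A1, ← mul_pow]
  gcongr
  have : (wt (g θ) : ℝ) ≤ A * (wt' θ + 1) := by exact_mod_cast hA θ
  nlinarith

lemma cheb : PolyBdd x natWt (fun q => chebP x q) := fun e =>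
  ⟨1, e, zero_le_one, fun φ C hC hφ q => by simpa using hφ q⟩

lemma X_mul (hx : 0 < x) {a : ℕ} (h : PolyBdd x (fun q : ℕ => q) (fun q => X ^ a * chebP x q)) :
    PolyBdd x (fun q : ℕ => q) (fun q => X ^ (a + 1) * chebP x q) := by
  have hs := sqrt_ne_zero_of_pos hx
  have h1 : PolyBdd x (fun q : ℕ => q) (fun q => X ^ a * chebP x (q + 1)) :=
    h.comp (fun q => q + 1) 1 fun q => by omega
  have h2 : PolyBdd x (fun q : ℕ => q)
      (fun q => if q = 0 then 0 else X ^ a * chebP x (q - 1)) := fun e => by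
    obtain ⟨A, e', hA, h'⟩ := (h.comp (fun q => q - 1) 1 (wt' := fun q : ℕ => q) fun q => by omega) e
    refine ⟨A, e', hA, fun φ C hC hφ q => ?_⟩
    beta_reduce
    split_ifs
    · rw [map_zero, norm_zero]; positivity
    · exact h' φ C hC hφ q
  have h3 : ∀ q, X ^ (a + 1) * chebP x q = ((√x : ℂ)⁻¹) •
      (X ^ a * chebP x (q + 1)
        + if q = 0 then 0 else X ^ a * chebP x (q - 1)) := fun q => by
    rw [eq_inv_smul_iff₀ hs]
    rcases q with _ | q
    · rw [if_pos rfl, add_zero, zero_add, ← X_mul_chebP_zero, mul_smul_comm]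
      ring_nf
    · rw [if_neg (succ_ne_zero q), Nat.add_sub_cancel, ← mul_add, ← X_mul_chebP, mul_smul_comm]
      ring_nf
  simp only [h3]
  exact (h1.add h2).smul _

lemma X_pow_mul (hx : 0 < x) (a : ℕ) :
    PolyBdd x natWt (fun q => X ^ a * chebP x q) := by
  induction a with
  | zero => simpa using cheb
  | succ a ih => exact X_mul hx ih

lemma const (hx : 0 < x) (f : ℂ[X]) : PolyBdd x wt (fun _ => f) := by
  induction f using Polynomial.induction_on' with
  | add p q hp hq => exact hp.add hq
  | monomial k z =>
    have h := ((X_pow_mul hx k).comp (fun _ : Θ => 0) 0 (wt' := wt) fun _ => by simp).smul z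
    simpa [chebP_zero, ← C_mul_X_pow_eq_monomial, smul_eq_C_mul] using h

lemma mul_bound (φ : ℂ[X] →ₗ[ℂ] ℂ) {C : ℝ} (hC : 0 ≤ C) {e : ℕ}
    (hφ : ∀ q, ‖φ (chebP x q)‖ ≤ C * (1 + q : ℝ) ^ e) (a b : ℕ) :
    ‖φ (chebP x a * chebP x b)‖ ≤ C * (1 + a) * (1 + (a + b : ℕ) : ℝ) ^ e := by
  induction a generalizing b with
  | zero =>
    rw [chebP_zero, one_mul]
    refine (hφ b).trans (le_of_eq ?_)
    simp
  | succ a ih =>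
    rcases b with _ | b
    · rw [chebP_zero, mul_one]
      refine (hφ (a + 1)).trans ?_
      have : (0 : ℝ) ≤ C * (1 + (a + 1 : ℕ) : ℝ) ^ e := by positivity
      have ha : (0 : ℝ) ≤ a := a.cast_nonneg
      push_cast at this ⊢
      rw [mul_right_comm, add_zero]
      nlinarith
    · rw [chebP_mul_chebP, map_add]
      refine (norm_add_le _ _).trans ((add_le_add (ih b) (hφ _)).trans ?_)
      have h1 : (1 + (a + b : ℕ) : ℝ) ^ e ≤ (1 + (a + 1 + (b + 1) : ℕ) : ℝ) ^ e := by
        gcongr <;> omega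
      have h2 : ((a + b + 2 : ℕ) : ℝ) = (a + 1 + (b + 1) : ℕ) := by push_cast; ring
      rw [h2]
      have ha : (0 : ℝ) ≤ C * (1 + a) := by positivity
      push_cast at h1 ⊢
      nlinarith [mul_le_mul_of_nonneg_left h1 ha]

lemma mul_chebP (p : Θ → ℂ[X]) (hp : PolyBdd x wt p) :
    PolyBdd x (fun z : Θ × ℕ => wt z.1 + z.2) (fun z => p z.1 * chebP x z.2) := fun e => by
  obtain ⟨A, e', hA, h⟩ := hp e
  refine ⟨A, e' + (1 + e), hA, fun φ C hC hφ z => ?_⟩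
  have h1 : ∀ q, ‖(φ.comp (LinearMap.mulRight ℂ (chebP x z.2))) (chebP x q)‖
      ≤ (C * (1 + z.2 : ℝ) ^ (1 + e)) * (1 + q : ℝ) ^ e := fun q => by
    rw [comp_apply, LinearMap.mulRight_apply, mul_comm]
    refine (mul_bound φ hC hφ z.2 q).trans ?_
    rw [pow_add, pow_one, mul_assoc, mul_assoc, mul_assoc]
    gcongr
    exact one_add_add_pow_le ..
  have h2 := h (φ.comp (LinearMap.mulRight ℂ (chebP x z.2))) _ (by positivity) h1 z.1
  rw [comp_apply, LinearMap.mulRight_apply] at h2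
  refine h2.trans ?_
  have h3 : (1 + z.2 : ℝ) ^ (1 + e) ≤ (1 + (wt z.1 + z.2 : ℕ) : ℝ) ^ (1 + e) := by
    gcongr; omega
  have h4 : (1 + wt z.1 : ℝ) ^ e' ≤ (1 + (wt z.1 + z.2 : ℕ) : ℝ) ^ e' := by
    gcongr; omega
  rw [pow_add _ e']
  calc C * (1 + z.2 : ℝ) ^ (1 + e) * (A * (1 + wt z.1 : ℝ) ^ e')
      ≤ C * (1 + (wt z.1 + z.2 : ℕ) : ℝ) ^ (1 + e) * (A * (1 + (wt z.1 + z.2 : ℕ) : ℝ) ^ e') := by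
        gcongr
    _ = _ := by ring

lemma derivative : PolyBdd x natWt (fun q => derivative (chebP x q)) := fun e => by
  obtain ⟨A, e', hA, h⟩ := (mul_chebP (fun q => chebP x q) (cheb (x := x))) e
  refine ⟨√x * A, 1 + e', by positivity, fun φ C hC hφ q => ?_⟩
  beta_reduce
  rcases q with _ | q
  · rw [chebP_zero, derivative_one, map_zero, norm_zero]
    positivity
  · rw [derivative_chebP, map_smul, norm_smul, map_sum]
    have h1 : ‖∑ z ∈ antidiagonal q, φ (chebP x z.1 * chebP x z.2)‖
        ≤ ∑ _z ∈ antidiagonal q, C * (A * (1 + q : ℝ) ^ e') := by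
      refine norm_sum_le_of_le _ fun z hz => (h φ C hC hφ z).trans (le_of_eq ?_)
      have hz' := mem_antidiagonal.1 hz
      dsimp only
      rw [hz']
    rw [sum_const, Finset.Nat.card_antidiagonal, nsmul_eq_mul] at h1
    have h2 : ‖(√x : ℂ)‖ = √x := by
      rw [norm_real, norm_of_nonneg (sqrt_nonneg x)]
    rw [h2, pow_add, pow_one]
    have h3 : (1 + q : ℝ) ^ e' ≤ (1 + (q + 1 : ℕ) : ℝ) ^ e' := by gcongr; simp
    calc √x * _ ≤ √x * (((q + 1 : ℕ) : ℝ) * (C * (A * (1 + q : ℝ) ^ e'))) := by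
          gcongr
      _ ≤ √x * ((1 + (q + 1 : ℕ) : ℝ) * (C * (A * (1 + (q + 1 : ℕ) : ℝ) ^ e'))) := by
          gcongr; simp
      _ = _ := by ring

lemma pBdd {x : ℝ} {φ : Θ → ℂ[X] →ₗ[ℂ] ℂ} {p : Θ' → ℂ[X]} (hp : PolyBdd x wt' p)
    (hφ : PBdd (fun z : Θ × ℕ => wt z.1 + z.2) fun z => φ z.1 (chebP x z.2)) :
    PBdd (fun z : Θ × Θ' => wt z.1 + wt' z.2) fun z => φ z.1 (p z.2) := by
  obtain ⟨C, e, hC, hb⟩ := hφ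
  obtain ⟨A, e', hA, h⟩ := hp e
  refine ⟨C * A, e + e', by positivity, fun z => ?_⟩
  have := h (φ z.1) (C * (1 + wt z.1 : ℝ) ^ e) (by positivity) (fun q => by
    refine (hb (z.1, q)).trans ?_
    rw [mul_assoc]
    gcongr
    exact one_add_add_pow_le ..) z.2
  refine this.trans ?_
  have h3 : (1 + wt z.1 : ℝ) ^ e ≤ (1 + (wt z.1 + wt' z.2 : ℕ) : ℝ) ^ e := by
    gcongr; omega
  have h4 : (1 + wt' z.2 : ℝ) ^ e' ≤ (1 + (wt z.1 + wt' z.2 : ℕ) : ℝ) ^ e' := by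
    gcongr; omega
  rw [pow_add]
  calc C * (1 + wt z.1 : ℝ) ^ e * (A * (1 + wt' z.2 : ℝ) ^ e')
      ≤ C * (1 + (wt z.1 + wt' z.2 : ℕ) : ℝ) ^ e * (A * (1 + (wt z.1 + wt' z.2 : ℕ) : ℝ) ^ e') := by
        gcongr
    _ = _ := by ring

lemma bdd {m : Order d} {x : ℝ} {Y : Θ → ℂ[X] →ₗ[ℂ] PS d LK} {p : Θ' → ℂ[X]} (hp : PolyBdd x wt' p)
    (hY : Bdd m (fun z : Θ × ℕ => wt z.1 + z.2) fun z => Y z.1 (chebP x z.2)) :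
    Bdd m (fun z : Θ × Θ' => wt z.1 + wt' z.2) fun z => Y z.1 (p z.2) := fun m' hm' => by
  obtain ⟨⟨K, hK⟩, hY⟩ := hY m' hm'
  refine ⟨⟨K, fun z k hk => ?_⟩, fun k => ?_⟩
  · obtain ⟨A, e', hA, h⟩ := hp 0
    have := h ((coN m' k).comp (Y z.1)) 0 le_rfl (fun q => by
      rw [comp_apply, hK (z.1, q) k hk]; simp) z.2
    rw [zero_mul] at this
    exact norm_le_zero_iff.1 this
  · exact pBdd (φ := fun θ => (coN m' k).comp (Y θ)) hp (hY k)

lemma tf {M : CorrModel κ} {m : Order d} {n : ℕ} {x : ℝ} {Y : Θ → ℂ[X] →ₗ[ℂ] PS d LK}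
    {p : Θ' → ℂ[X]} (hp : PolyBdd x wt' p)
    (hY : M.TF m n (fun z : Θ × ℕ => wt z.1 + z.2) fun z => Y z.1 (chebP x z.2)) :
    M.TF m n (fun z : Θ × Θ' => wt z.1 + wt' z.2) fun z => Y z.1 (p z.2) := by
  induction n generalizing Θ with
  | zero => exact bdd hp hY
  | succ n ih =>
    refine ⟨bdd hp hY.1, ?_⟩
    have h0 := CorrModel.TF.comp (wt' := fun z : (Θ × Label d) × ℕ => wt z.1.1 + z.1.2.2 + z.2)
      hY.2 (fun z => ((z.1.1, z.2), z.1.2)) 1 (fun z => by dsimp only; omega)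
    have h := ih (wt := fun z : Θ × Label d => wt z.1 + z.2.2) (Y := fun z : Θ × Label d =>
        ((M.B.D z.2 : Derivation ℂ (PS d LK) (PS d LK)) : PS d LK →ₗ[ℂ] PS d LK).comp (Y z.1)) h0
    have h2 := CorrModel.TF.comp (wt' := fun z : (Θ × Θ') × Label d => wt z.1.1 + wt' z.1.2 + z.2.2)
      h (fun z => ((z.1.1, z.2), z.1.2)) 1 (fun z => by dsimp only; omega)
    exact h2

end PolyBdd

end Families

/-! ### Polynomial growth of the correlators -/

lemma exists_values {α : Type} {n : ℕ} (s : Multiset α) (h : s.card = n) :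
    ∃ v : Fin n → α, values v = s := by
  subst h
  induction s using Quotient.inductionOn with
  | h l =>
    refine ⟨l.get, ?_⟩
    change univ.val.map l.get = _
    rw [Fin.univ_val_map, List.ofFn_get]
    rfl

namespace PBdd
variable {Θ : Type} {wt : Θ → ℕ}

lemma ite {f : Θ → ℂ} (P : Θ → Prop) [DecidablePred P] (hf : PBdd wt f) :
    PBdd wt (fun θ => if P θ then f θ else 0) := by
  obtain ⟨C, e, hC, h⟩ := hf
  refine ⟨C, e, hC, fun θ => ?_⟩
  beta_reduce
  split_ifs
  · exact h θ
  · rw [norm_zero]; positivity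

lemma sum_antidiagonal {f : (ℕ × ℕ) × Θ → ℂ}
    (hf : PBdd (fun z : (ℕ × ℕ) × Θ => z.1.1 + z.1.2 + wt z.2) f) :
    PBdd (fun z : ℕ × Θ => z.1 + wt z.2) (fun z => ∑ x ∈ antidiagonal z.1, f (x, z.2)) := by
  obtain ⟨C, e, hC, h⟩ := hf
  refine ⟨C, 1 + e, hC, fun z => ?_⟩
  have h1 : ‖∑ x ∈ antidiagonal z.1, f (x, z.2)‖
      ≤ ∑ _x ∈ antidiagonal z.1, C * (1 + (z.1 + wt z.2 : ℕ) : ℝ) ^ e := by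
    refine norm_sum_le_of_le _ fun x hx => (h _).trans (le_of_eq ?_)
    have := mem_antidiagonal.1 hx
    dsimp only
    rw [this]
  rw [sum_const, Finset.Nat.card_antidiagonal, nsmul_eq_mul] at h1
  refine h1.trans ?_
  rw [pow_add, pow_one, mul_left_comm]
  gcongr
  push_cast
  have : (0 : ℝ) ≤ wt z.2 := Nat.cast_nonneg _
  linarith

lemma of_recurrence {a : ℕ × Θ → ℂ} (h0 : ∀ θ, a (0, θ) = 0) (h1 : PBdd wt fun θ => a (1, θ))
    (h2 : PBdd (fun z : ℕ × Θ => z.1 + wt z.2) fun z => a (z.1 + 2, z.2) - a (z.1, z.2)) :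
    PBdd (fun z : ℕ × Θ => z.1 + wt z.2) a := by
  obtain ⟨C, e, hC, h1⟩ := h1
  obtain ⟨C', e', hC', h2⟩ := h2
  have key : ∀ q θ, ‖a (q, θ)‖ ≤ (1 + q : ℝ) * ((C + C') * (1 + (q + wt θ : ℕ) : ℝ) ^ (e + e')) := by
    intro q θ
    have hmono : ∀ {E E' : ℕ} {x y : ℕ}, E ≤ E' → x ≤ y → (1 + x : ℝ) ^ E ≤ (1 + y : ℝ) ^ E' := by
      intro E E' x y hE hxy
      refine (pow_le_pow_right₀ (one_le x) hE).trans ?_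
      gcongr
    induction q using Nat.twoStepInduction with
    | zero => rw [h0, norm_zero]; positivity
    | one =>
      refine (h1 θ).trans ?_
      have h3 : (1 + wt θ : ℝ) ^ e ≤ (1 + (1 + wt θ : ℕ) : ℝ) ^ (e + e') :=
        hmono (by omega) (by omega)
      have h4 : (0 : ℝ) ≤ (1 + (1 + wt θ : ℕ) : ℝ) ^ (e + e') := by positivity
      have h5 := mul_le_mul_of_nonneg_left h3 hC
      push_cast at h3 h4 h5 ⊢
      nlinarith [mul_nonneg hC h4, mul_nonneg hC' h4]
    | more q ih _ =>
      have h5 : a (q + 2, θ) = (a (q + 2, θ) - a (q, θ)) + a (q, θ) := by ring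
      rw [h5]
      refine (norm_add_le _ _).trans ((add_le_add (h2 (q, θ)) ih).trans ?_)
      have h3 : (1 + (q + wt θ : ℕ) : ℝ) ^ e' ≤ (1 + (q + 2 + wt θ : ℕ) : ℝ) ^ (e + e') :=
        hmono (by omega) (by omega)
      have h4 : (1 + (q + wt θ : ℕ) : ℝ) ^ (e + e') ≤ (1 + (q + 2 + wt θ : ℕ) : ℝ) ^ (e + e') :=
        hmono le_rfl (by omega)
      have h6 : (0 : ℝ) ≤ (1 + (q + 2 + wt θ : ℕ) : ℝ) ^ (e + e') := by positivity
      have h8 : (1 + q : ℝ) * ((C + C') * (1 + (q + wt θ : ℕ) : ℝ) ^ (e + e'))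
          ≤ (1 + q : ℝ) * ((C + C') * (1 + (q + 2 + wt θ : ℕ) : ℝ) ^ (e + e')) := by gcongr
      dsimp only
      have h11 : ((q + 2 : ℕ) : ℝ) = q + 2 := by push_cast; ring
      rw [h11]
      nlinarith
  refine ⟨C + C', 1 + (e + e'), by positivity, fun z => (key z.1 z.2).trans ?_⟩
  beta_reduce
  have h : ((1 : ℝ) + (z.1 + wt z.2 : ℕ)) ^ (1 + (e + e'))
      = (1 + (z.1 + wt z.2 : ℕ)) * (1 + (z.1 + wt z.2 : ℕ)) ^ (e + e') := by
    rw [pow_add _ 1, pow_one]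
  rw [h, mul_left_comm]
  gcongr
  omega

lemma of_fin {d : ℕ} {f : Fin d × Θ → ℂ} (hf : ∀ i, PBdd wt fun θ => f (i, θ)) :
    PBdd (fun z : Fin d × Θ => wt z.2) f := by
  choose C e hC h using hf
  refine ⟨∑ i, C i, ∑ i, e i, sum_nonneg fun i _ => hC i, fun z => (h z.1 z.2).trans ?_⟩
  gcongr
  · exact sum_nonneg fun i _ => hC i
  · exact single_le_sum (fun i _ => hC i) (mem_univ z.1)
  · exact one_le _
  · exact single_le_sum (fun i _ => Nat.zero_le _) (mem_univ z.1)

end PBdd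

namespace CorrModel
variable {d : ℕ} {κ : Fin d → ℝ} (M : CorrModel κ)

lemma B_corr (s : Labels d) : M.B.corr s = M.J.corr (s.map (chebLabel κ)) :=
  Insertions.comap_corr _ _ _

lemma B_corr_cons (i : Fin d) (q : ℕ) (s : Labels d) :
    M.B.corr ((i, q) ::ₘ s) = M.J.corr ((i, chebP (κ i) q) ::ₘ s.map (chebLabel κ)) := by
  rw [B_corr, map_cons]; rfl

lemma coN_B_corr_eq_zero (s : Labels d) (m : Order d) (k : ℤ)
    (hk : 2 - (s.card : ℤ) < k) : coN m k (M.B.corr s) = 0 := by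
  rw [B_corr]
  exact coN_corr_eq_zero M.I M.deg _ _ _ (by rwa [card_map])

lemma B_corr_zero_cons (i : Fin d) (s : Labels d) :
    M.B.corr ((i, 0) ::ₘ s) = if s = 0 then nPow unitN 1 else 0 := by
  have h : M.B.F (i, 0) = nPow unitN 1 := by
    change M.J.F (i, chebP (κ i) 0) = _
    rw [chebP_zero, polyInsertions_F, polyMap_one, M.F_zero, nPow_one]
  rw [corr_cons, h]
  split_ifs with hs
  · rw [hs, iter_zero]
  · exact Insertions.iter_of_D_eq_zero _ _ _ (fun a => M.D_nPow _ 1) hs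

/-- The correlators, without the leading part `N` of `tr 1`. -/
def reduced (i : Fin d) (q : ℕ) (s : Labels d) : PS d LK :=
  if q = 0 then 0 else M.B.corr ((i, q) ::ₘ s)

/-- The terms of the Schwinger–Dyson equation that come from the insertions and from the couplings. -/
def sources {n : ℕ} (v : Fin n → Label d) (i : Fin d) (q : ℕ) : PS d LK :=
  (∑ j ∈ univ.filter fun j => (v j).1 = i,
      M.J.corr ((i, chebP (κ i) q * derivative (chebP (κ i) (v j).2)) ::ₘ
        ((univ.erase j).val.map v).map (chebLabel κ)))
    - cSum (fun u => M.B.iter (values v) (M.interaction i (chebP (κ i) q) u))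

lemma values_comp {α β : Type} {n : ℕ} (g : α → β) (v : Fin n → α) :
    values (fun j => g (v j)) = (values v).map g := by
  rw [values, values, map_map]; rfl

lemma sd_cheb {n : ℕ} (v : Fin n → Label d) (i : Fin d) (q : ℕ) :
    (κ i : ℂ) • (nPow unitN 1 * M.J.corr ((i, X * chebP (κ i) q) ::ₘ (values v).map (chebLabel κ)))
      = M.J.iter (values fun j => chebLabel κ (v j)) (ncDeriv (pairing M.I i) (chebP (κ i) q))
        + M.sources v i q := by
  have h := M.sd_insertions (fun j => chebLabel κ (v j)) i (chebP (κ i) q)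
  rw [values_comp (chebLabel κ) v] at h
  rw [values_comp (chebLabel κ) v, h, sources]
  have h1 : ∀ u, M.B.iter (values v) (M.interaction i (chebP (κ i) q) u)
      = M.J.iter ((values v).map (chebLabel κ)) (M.interaction i (chebP (κ i) q) u) := fun u =>
    Insertions.comap_iter _ _ _ _
  simp only [h1]
  have h2 : ∑ j ∈ univ.filter (fun j => (chebLabel κ (v j)).1 = i),
      M.J.corr ((i, chebP (κ i) q * derivative (chebLabel κ (v j)).2) ::ₘ
        (univ.erase j).val.map fun j => chebLabel κ (v j))
      = ∑ j ∈ univ.filter (fun j => (v j).1 = i),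
        M.J.corr ((i, chebP (κ i) q * derivative (chebP (κ i) (v j).2)) ::ₘ
        ((univ.erase j).val.map v).map (chebLabel κ)) := by
    refine sum_congr rfl fun j hj => ?_
    have hj := (mem_filter.1 hj).2
    have hj : (v j).1 = i := hj
    rw [map_map]
    simp only [chebLabel, hj]
    rfl
  rw [h2]
  abel

lemma sqrt_ne_zero {d : ℕ} {κ : Fin d → ℝ} (M : CorrModel κ) (i : Fin d) : (√(κ i) : ℂ) ≠ 0 := sqrt_ne_zero_of_pos (M.pos i)

lemma sqrt_mul_sqrt {d : ℕ} {κ : Fin d → ℝ} (M : CorrModel κ) (i : Fin d) : (√(κ i) : ℂ) * √(κ i) = κ i :=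
  sqrt_mul_sqrt_of_pos (M.pos i)

lemma sd_one {n : ℕ} (v : Fin n → Label d) (i : Fin d) : nPow unitN 1 * M.reduced i 1 (values v)
      = (√(κ i) : ℂ)⁻¹ • M.sources v i 0 := by
  have h := M.sd_cheb v i 0
  rw [eq_inv_smul_iff₀ (M.sqrt_ne_zero i), reduced, if_neg one_ne_zero, B_corr_cons,
    ← X_mul_chebP_zero, polyInsertions_corr_cons, map_smul, mul_smul_comm, smul_smul,
    M.sqrt_mul_sqrt, ← polyInsertions_corr_cons, h, chebP_zero, ncDeriv_one,
    iter_zero_right, zero_add]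

lemma sd_add_two {n : ℕ} (v : Fin n → Label d) (i : Fin d) (q : ℕ) :
    nPow unitN 1 * (M.reduced i (q + 2) (values v) - M.reduced i q (values v))
      = (∑ x ∈ antidiagonal q,
          ((∑ S : Finset (Fin n), M.reduced i x.1 (S.val.map v) * M.reduced i x.2 (Sᶜ.val.map v))
            + M.B.corr ((i, x.1) ::ₘ (i, x.2) ::ₘ values v)))
        + (√(κ i) : ℂ)⁻¹ • M.sources v i (q + 1) := by
  set N : PS d LK := nPow unitN 1 with hN
  have hA : N * (M.B.corr ((i, q + 2) ::ₘ values v) + M.B.corr ((i, q) ::ₘ values v))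
      = (∑ x ∈ antidiagonal q, ((∑ S : Finset (Fin n), M.B.corr ((i, x.1) ::ₘ S.val.map v) *
              M.B.corr ((i, x.2) ::ₘ Sᶜ.val.map v))
            + M.B.corr ((i, x.1) ::ₘ (i, x.2) ::ₘ values v)))
        + (√(κ i) : ℂ)⁻¹ • M.sources v i (q + 1) := by
    have h := M.sd_cheb v i (q + 1)
    have h1 : (κ i : ℂ) • (N * M.J.corr ((i, X * chebP (κ i) (q + 1)) ::ₘ (values v).map (chebLabel κ)))
        = (√(κ i) : ℂ) • (N * (M.B.corr ((i, q + 2) ::ₘ values v)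
          + M.B.corr ((i, q) ::ₘ values v))) := by
      rw [B_corr_cons, B_corr_cons, polyInsertions_corr_cons, polyInsertions_corr_cons,
        polyInsertions_corr_cons, ← map_add, ← X_mul_chebP, map_smul, mul_smul_comm, smul_smul,
        M.sqrt_mul_sqrt]
    rw [h1, ncDeriv_chebP, iter_smul, Insertions.iter_sum] at h
    have h2 := congrArg (fun z => (√(κ i) : ℂ)⁻¹ • z) h
    simp only [smul_add, inv_smul_smul₀ (M.sqrt_ne_zero i)] at h2
    rw [h2]
    congr 1
    refine sum_congr rfl fun x _ => ?_
    rw [M.iter_pairing]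
    simp only [B_corr, map_cons, map_map, values, chebLabel, Function.comp_def]
  have hr : ∀ a s, M.B.corr ((i, a) ::ₘ s) = M.reduced i a s + if a = 0 ∧ s = 0 then N else 0 := fun a s => by
    by_cases ha : a = 0
    · subst ha
      rw [B_corr_zero_cons, reduced, if_pos rfl, zero_add]
      simp only [true_and]
      rfl
    · rw [reduced, if_neg ha, if_neg (fun h => ha h.1), add_zero]
  have hq2 : M.B.corr ((i, q + 2) ::ₘ values v) = M.reduced i (q + 2) (values v) := by
    rw [reduced, if_neg (by omega)]
  have hl : ∀ g : ℕ → Finset (Fin n) → PS d LK, ∑ x ∈ antidiagonal q,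
      ∑ S : Finset (Fin n), (if x.1 = 0 ∧ S.val.map v = 0 then N else 0) * g x.2 Sᶜ
      = N * g q univ := fun g => by
    rw [sum_eq_single (0, q), sum_eq_single ∅]
    · simp
    · intro S _ hS
      rw [if_neg (by simp [hS]), zero_mul]
    · simp
    · rintro ⟨a, b⟩ hx hne
      have hx := mem_antidiagonal.1 hx
      refine sum_eq_zero fun S _ => ?_
      rw [if_neg, zero_mul]
      rintro ⟨ha, _⟩
      apply hne
      simp only at ha hx
      rw [Prod.mk.injEq]
      omega
    · intro h
      exact absurd ((mem_antidiagonal).2 (by simp)) h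
  have hr' : ∀ g : ℕ → Finset (Fin n) → PS d LK, ∑ x ∈ antidiagonal q,
      ∑ S : Finset (Fin n), g x.1 S * (if x.2 = 0 ∧ Sᶜ.val.map v = 0 then N else 0)
      = N * g q univ := fun g => by
    rw [← hl g, ← Finset.Nat.sum_antidiagonal_swap]
    refine sum_congr rfl fun x _ => ?_
    refine Fintype.sum_bijective compl compl_bijective _ _ fun S => ?_
    simp only [Prod.fst_swap, Prod.snd_swap, compl_compl]
    rw [mul_comm]
  have hprod : ∑ x ∈ antidiagonal q, ∑ S : Finset (Fin n),
      M.B.corr ((i, x.1) ::ₘ S.val.map v) * M.B.corr ((i, x.2) ::ₘ Sᶜ.val.map v)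
      = (∑ x ∈ antidiagonal q, ∑ S : Finset (Fin n),
        M.reduced i x.1 (S.val.map v) * M.reduced i x.2 (Sᶜ.val.map v))
        + N * M.reduced i q (values v) + N * M.B.corr ((i, q) ::ₘ values v) := by
    have e1 := hl fun b S => M.B.corr ((i, b) ::ₘ S.val.map v)
    have e2 := hr' fun a S => M.reduced i a (S.val.map v)
    rw [values, ← e1, ← e2, ← sum_add_distrib, ← sum_add_distrib]
    refine sum_congr rfl fun x _ => ?_
    rw [← sum_add_distrib, ← sum_add_distrib]
    refine sum_congr rfl fun S _ => ?_
    rw [hr x.1, hr x.2]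
    ring
  rw [sum_add_distrib, hprod, hq2] at hA
  rw [sum_add_distrib]
  linear_combination hA

/-- Polynomial growth of the correlators of `n` traces of the polynomials `P_q`. -/
def Est (m : Order d) (n : ℕ) (k : ℤ) : Prop :=
  PBdd (fun s : {s : Labels d // s.card = n} => (s.1.map Prod.snd).sum)
    fun s => coN m k (M.B.corr s.1)

variable {M}
variable {Θ : Type} {wt : Θ → ℕ} {m : Order d} {n : ℕ}

lemma est_of_lt {k : ℤ} (h : 2 - (n : ℤ) < k) : M.Est m n k := by
  have : ∀ s : {s : Labels d // s.card = n}, coN m k (M.B.corr s.1) = 0 := fun s =>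
    M.coN_B_corr_eq_zero _ _ _ (by rwa [s.2])
  unfold Est
  simp only [this]
  exact PBdd.const 0

lemma tf_corr (h : ∀ m' ≤ m, ∀ n k, M.Est m' n k) (r : ℕ) (S : Θ → Labels d)
    (hS : ∀ θ, (S θ).card = r + 1) (A : ℕ) (hA : ∀ θ, ((S θ).map Prod.snd).sum ≤ A * (wt θ + 1)) :
    M.TF m n wt fun θ => M.B.corr (S θ) := by
  induction n generalizing Θ r A with
  | zero =>
    intro m' hm'
    refine ⟨⟨2 - (r + 1 : ℕ), fun θ k hk => M.coN_B_corr_eq_zero _ _ _ (by rw [hS]; exact hk)⟩,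
      fun k => ?_⟩
    exact (h m' hm' (r + 1) k).comp (fun θ => ⟨S θ, hS θ⟩) A hA
  | succ n ih =>
    refine ⟨?_, ?_⟩
    · intro m' hm'
      refine ⟨⟨2 - (r + 1 : ℕ), fun θ k hk => M.coN_B_corr_eq_zero _ _ _ (by rw [hS]; exact hk)⟩,
        fun k => ?_⟩
      exact (h m' hm' (r + 1) k).comp (fun θ => ⟨S θ, hS θ⟩) A hA
    · have h1 : ∀ x : Θ × Label d, M.B.D x.2 (M.B.corr (S x.1)) = M.B.corr (x.2 ::ₘ S x.1) := fun x => by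
        have hne : S x.1 ≠ 0 := fun h0 => by
          have := hS x.1
          rw [h0] at this
          simp at this
        have := M.B.iter_corr {x.2} (S x.1) hne
        rw [singleton_add] at this
        exact this
      simp only [h1]
      refine ih (Θ := Θ × Label d) (r + 1) (fun x => x.2 ::ₘ S x.1) (fun x => ?_) (A + 1) fun x => ?_
      · rw [card_cons, hS]
      · rw [map_cons, sum_cons]
        have := hA x.1
        nlinarith

lemma tf_F (h : ∀ m' ≤ m, ∀ n k, M.Est m' n k) (i : Fin d) {p : Θ → ℂ[X]}
    (hp : PolyBdd (κ i) wt p) : M.TF m n wt fun θ => M.J.F (i, p θ) := by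
  have h0 : M.TF m n (fun z : Unit × ℕ => 0 + z.2)
      fun z => (polyMap fun k => M.I.F (i, k)) (chebP (κ i) z.2) := by
    have h1 : ∀ z : Unit × ℕ, (polyMap fun k => M.I.F (i, k)) (chebP (κ i) z.2)
        = M.B.corr {(i, z.2)} := fun z => by
      have := M.B.corr_cons (i, z.2) 0
      exact this.symm
    simp only [h1]
    exact tf_corr h 0 _ (fun _ => rfl) 1 fun z => by simp
  have h1 := PolyBdd.tf (Θ := Unit) (wt := fun _ => 0) (Y := fun _ => polyMap fun k => M.I.F (i, k)) hp h0
  exact h1.comp (fun θ => ((), θ)) 1 fun θ => by dsimp only; omega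

lemma tf_D {y : Θ → PS d LK} (c : Fin d) (f : ℂ[X]) (hy : M.TF m (n + 1) wt y) :
    M.TF m n wt fun θ => M.J.D (c, f) (y θ) := by
  have h1 : M.TF m n (fun z : Θ × ℕ => wt z.1 + z.2)
      fun z => (polyMap fun k => M.I.D (c, k) (y z.1)) (chebP (κ c) z.2) := by
    have h0 := TF.comp (wt' := fun z : Θ × ℕ => wt z.1 + z.2) hy.2 (fun z => (z.1, (c, z.2))) 1
      (fun z => by dsimp only; omega)
    have h2 : ∀ z : Θ × ℕ, (polyMap fun k => M.I.D (c, k) (y z.1)) (chebP (κ c) z.2)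
        = M.B.D (c, z.2) (y z.1) := fun z => (polyInsertions_D M.I c (chebP (κ c) z.2) (y z.1)).symm
    simp only [h2]
    exact h0
  have h2 := PolyBdd.tf (wt' := fun _ : Unit => 0) (Y := fun θ => polyMap fun k => M.I.D (c, k) (y θ))
    (PolyBdd.const (M.pos c) f) h1
  have h3 : ∀ θ, M.J.D (c, f) (y θ) = (polyMap fun k => M.I.D (c, k) (y θ)) f := fun θ =>
    polyInsertions_D M.I c f (y θ)
  simp only [h3]
  exact h2.comp (fun θ => (θ, ())) 1 fun θ => by dsimp only; omega

lemma tf_corr_cons (h : ∀ m' ≤ m, ∀ n k, M.Est m' n k) (i : Fin d) {p : Θ → ℂ[X]}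
    (hp : PolyBdd (κ i) wt p) (S : Multiset (Fin d × ℂ[X])) :
    M.TF m n wt fun θ => M.J.corr ((i, p θ) ::ₘ S) := by
  simp only [corr_cons]
  induction S using induction_on generalizing n with
  | empty => exact tf_F h i hp
  | cons a S ih =>
    simp only [iter_cons]
    exact tf_D a.1 a.2 ih

lemma tf_corr_const (h : ∀ m' ≤ m, ∀ n k, M.Est m' n k) (S : Multiset (Fin d × ℂ[X])) :
    M.TF m n wt fun _ => M.J.corr S := by
  rcases S.empty_or_exists_mem with rfl | ⟨⟨c, f⟩, ha⟩
  · simp only [Insertions.corr_zero]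
    exact TF.zero
  · obtain ⟨S, rfl⟩ := exists_cons_of_mem ha
    exact tf_corr_cons h c (PolyBdd.const (M.pos c) f) S

lemma tf_interaction (h : ∀ m' ≤ m, ∀ n k, M.Est m' n k) (i : Fin d) (u : Coupling d) :
    M.TF m n natWt fun q => M.interaction i (chebP (κ i) q) u := by
  have hP : ∀ a, PolyBdd (κ i) natWt fun q => chebP (κ i) q * X ^ a := fun a => by
    have := PolyBdd.X_pow_mul (M.pos i) a
    simpa only [mul_comm] using this
  rcases u with a | ⟨c, k⟩
  · simp only [MatrixModel.interaction]
    refine TF.smul _ ((TF.nPow _).mul (TF.sum _ fun L _ => TF.sum _ fun Λ _ => TF.mul ?_ ?_))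
    · exact tf_corr_cons h i (hP _) _
    · exact TF.prod _ fun B _ => tf_corr_const h _
  · simp only [MatrixModel.interaction]
    split_ifs
    · exact TF.smul _ ((TF.nPow _).mul (tf_F h i (hP _)))
    · exact TF.zero

end CorrModel

namespace CorrModel
variable {d : ℕ} {κ : Fin d → ℝ} (M : CorrModel κ)

lemma coN_cSum (m : Order d) (k : ℤ) (F : Coupling d → PS d LK) :
    coN m k (cSum F) = ∑ u ∈ m.support, coN (m - single u 1) k (F u) := by
  rw [coN_apply, coeff_cSum, LK.coeff_sum]
  rfl

lemma coN_reduced_eq_zero (i : Fin d) (q : ℕ) (s : Labels d) (m : Order d)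
    (k : ℤ) (hk : 1 - (s.card : ℤ) < k) : coN m k (M.reduced i q s) = 0 := by
  rw [reduced]
  split_ifs
  · exact map_zero _
  · refine M.coN_B_corr_eq_zero _ _ _ ?_
    rw [card_cons]
    push_cast
    omega

lemma coN_nPow_one_mul (m : Order d) (k : ℤ) (f : PS d LK) :
    coN m (k + 1) (nPow unitN 1 * f) = coN m k f := by
  rw [coN_nPow_mul, add_sub_cancel_right]

lemma planar (i : Fin d) (q : ℕ) : coN 0 1 (M.reduced i q 0) = 0 := by
  have hs : ∀ q, coN 0 2 (M.sources (Fin.elim0 : Fin 0 → Label d) i q) = 0 := fun q => by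
    rw [sources, map_sub, coN_cSum]
    simp
  have hv : values (Fin.elim0 : Fin 0 → Label d) = 0 := rfl
  induction q using Nat.strong_induction_on with
  | _ q ih =>
    match q, ih with
    | 0, _ => rw [reduced, if_pos rfl, map_zero]
    | 1, _ =>
      have h := congrArg (coN 0 (1 + 1)) (M.sd_one Fin.elim0 i)
      rw [coN_nPow_one_mul, map_smul, hv] at h
      rw [h, show (1 + 1 : ℤ) = 2 from rfl, hs, smul_zero]
    | q + 2, ih =>
      have h := congrArg (coN 0 (1 + 1)) (M.sd_add_two Fin.elim0 i q)
      rw [coN_nPow_one_mul, map_sub, hv, ih q (by omega), sub_zero] at h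
      rw [h, show (1 + 1 : ℤ) = 2 from rfl, map_add, map_smul, hs, smul_zero, add_zero, map_sum]
      refine sum_eq_zero fun x hx => ?_
      have hx := mem_antidiagonal.1 hx
      rw [map_add, M.coN_B_corr_eq_zero _ _ _ (by simp), add_zero, map_sum]
      refine sum_eq_zero fun S _ => ?_
      have h0 : ∀ S : Finset (Fin 0), S.val.map (Fin.elim0 : Fin 0 → Label d) = 0 := fun S => by
        rw [Finset.eq_empty_of_isEmpty S]; rfl
      rw [h0, h0, coN_mul 0 2 1 1 _ _ (fun m' _ j hj => M.coN_reduced_eq_zero _ _ _ _ _ (by simpa using hj))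
        (fun m' _ j hj => M.coN_reduced_eq_zero _ _ _ _ _ (by simpa using hj))]
      refine sum_eq_zero fun p hp => sum_eq_zero fun j hj => ?_
      have hp : p.1 = 0 := by
        have := mem_antidiagonal.1 hp
        exact (add_eq_zero.1 this).1
      have hj : j = 1 := by
        have := Finset.mem_Icc.1 hj
        omega
      rw [hp, hj, ih x.1 (by omega), zero_mul]

variable {M}
variable {m : Order d} {n : ℕ} {k : ℤ}

/-- The size of a family of labels. -/
def labelWt {n : ℕ} (v : Fin n → Label d) : ℕ := ∑ j, (v j).2

/-- The size of a number and a family of labels. -/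
abbrev tupleWt (z : ℕ × (Fin n → Label d)) : ℕ := z.1 + labelWt z.2

/-- The size of two numbers and a family of labels. -/
abbrev pairWt (z : (ℕ × ℕ) × (Fin n → Label d)) : ℕ := z.1.1 + z.1.2 + labelWt z.2

lemma sum_map_snd_le (v : Fin n → Label d) (S : Finset (Fin n)) :
    ((S.val.map v).map Prod.snd).sum ≤ labelWt v := by
  rw [map_map]
  exact Finset.sum_le_sum_of_subset (Finset.subset_univ S)

lemma pBdd_reduced {p : Order d} {j : ℤ} (S : Finset (Fin n)) (h : M.Est p (S.card + 1) j)
    (i : Fin d) : PBdd (tupleWt (n := n)) (fun z => coN p j (M.reduced i z.1 (S.val.map z.2))) := by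
  have h1 : PBdd (tupleWt (n := n)) (fun z => coN p j (M.B.corr ((i, z.1) ::ₘ S.val.map z.2))) := by
    refine PBdd.comp (wt' := tupleWt) h
      (fun z => ⟨(i, z.1) ::ₘ S.val.map z.2, by simp⟩) 1 fun z => ?_
    rw [map_cons, sum_cons]
    have := sum_map_snd_le z.2 S
    dsimp only [tupleWt]
    omega
  have h2 : ∀ z : ℕ × (Fin n → Label d), coN p j (M.reduced i z.1 (S.val.map z.2))
      = if ¬ z.1 = 0 then coN p j (M.B.corr ((i, z.1) ::ₘ S.val.map z.2)) else 0 := fun z => by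
    rw [reduced]
    split_ifs <;> simp_all
  simp only [h2]
  exact PBdd.ite _ h1

lemma pBdd_sources (hm : ∀ m' < m, ∀ n k, M.Est m' n k) (hn : M.Est m n k) (i : Fin d) :
    PBdd (tupleWt (n := n)) (fun z => coN m k (M.sources z.2 i z.1)) := by
  have hsub : ∀ z : ℕ × (Fin n → Label d), coN m k (M.sources z.2 i z.1)
      = (∑ j : Fin n, if (z.2 j).1 = i then
          coN m k (M.J.corr ((i, derivative (chebP (κ i) (z.2 j).2) * chebP (κ i) z.1) ::ₘ
            ((univ.erase j).val.map z.2).map (chebLabel κ))) else 0)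
        + (-1) * ∑ u ∈ m.support, coN (m - single u 1) k
            (M.B.iter (values z.2) (M.interaction i (chebP (κ i) z.1) u)) := fun z => by
    rw [sources, map_sub, coN_cSum, map_sum, sum_filter, sub_eq_add_neg, neg_one_mul]
    simp only [mul_comm]
  simp only [hsub]
  refine PBdd.add (PBdd.sum _ fun j _ => PBdd.ite _ ?_) (PBdd.const_mul _ (PBdd.sum _ fun u hu => ?_))
  · have hcard : ∀ v : Fin n → Label d, ((univ.erase j).val.map v).card + 1 = n := fun v => by
      rw [card_map]
      have := Finset.card_erase_add_one (mem_univ j)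
      rwa [card_univ, Fintype.card_fin] at this
    have h1 : PBdd (fun z : (Fin n → Label d) × ℕ => labelWt z.1 + z.2)
        (fun z => coN m k (M.B.corr ((i, z.2) ::ₘ (univ.erase j).val.map z.1))) := by
      refine PBdd.comp (wt' := fun z : (Fin n → Label d) × ℕ => labelWt z.1 + z.2) hn
        (fun z => ⟨(i, z.2) ::ₘ (univ.erase j).val.map z.1, by
          rw [card_cons, hcard]⟩) 1 fun z => ?_
      rw [map_cons, sum_cons]
      have := sum_map_snd_le z.1 (univ.erase j)
      dsimp only [tupleWt]
      omega
    simp only [B_corr_cons, polyInsertions_corr_cons] at h1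
    have h2 := PolyBdd.pBdd (φ := fun v : Fin n → Label d => (coN m k).comp (polyMap fun k' =>
      (polyInsertions M.I).iter (((univ.erase j).val.map v).map (chebLabel κ)) (M.I.F (i, k'))))
      (PolyBdd.mul_chebP _ (PolyBdd.derivative (x := κ i))) h1
    have h3 := PBdd.comp (wt' := tupleWt) h2 (fun z => (z.2, ((z.2 j).2, z.1))) 2 fun z => by
        have : (z.2 j).2 ≤ labelWt z.2 :=
          single_le_sum (f := fun j => (z.2 j).2) (fun _ _ => Nat.zero_le _) (mem_univ j)
        dsimp only [tupleWt, natWt]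
        omega
    simp only [polyInsertions_corr_cons]
    exact h3
  · have hlt : m - single u 1 < m := by
      refine lt_of_le_of_ne tsub_le_self fun h => ?_
      have := DFunLike.congr_fun h u
      have h0 := Finsupp.mem_support_iff.1 hu
      simp only [Finsupp.coe_tsub, Pi.sub_apply, Finsupp.single_eq_same] at this
      omega
    have h1 := TF.iter (tf_interaction (M := M) (m := m - single u 1) (n := n)
      (fun m' hm' => hm m' (lt_of_le_of_lt hm' hlt)) i u)
    have h2 := (h1 _ le_rfl).2 k
    refine PBdd.comp (wt' := tupleWt) h2
      (fun z => (z.1, ⟨values z.2, by simp [values]⟩)) 1 fun z => ?_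
    have := sum_map_snd_le z.2 univ
    dsimp only [values, tupleWt, natWt]
    omega

lemma pBdd_reduced_mul_reduced
    (IH : ∀ (p : Order d) (n' : ℕ) (k' : ℤ), p < m ∨ (p = m ∧ (2 - (n' : ℤ) - k' < 1 - n - k ∨
      (2 - (n' : ℤ) - k' = 1 - n - k ∧ n' < n + 1))) → M.Est p n' k') (i : Fin d) (S : Finset (Fin n)) :
    PBdd (pairWt (n := n))
      (fun z => coN m (k + 1) (M.reduced i z.1.1 (S.val.map z.2) * M.reduced i z.1.2 (Sᶜ.val.map z.2))) := by
  have hcard : S.card + Sᶜ.card = n := by rw [Finset.card_add_card_compl, Fintype.card_fin]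
  have h : ∀ z : (ℕ × ℕ) × (Fin n → Label d), _ := fun z =>
    coN_mul m (k + 1) (1 - S.card) (1 - Sᶜ.card) (M.reduced i z.1.1 (S.val.map z.2))
      (M.reduced i z.1.2 (Sᶜ.val.map z.2))
      (fun m' _ j hj => M.coN_reduced_eq_zero _ _ _ _ _ (by rw [card_map]; exact hj))
      (fun m' _ j hj => M.coN_reduced_eq_zero _ _ _ _ _ (by rw [card_map]; exact hj))
  simp only [h]
  refine PBdd.sum _ fun p hp => PBdd.sum _ fun j hj => ?_
  have hp := mem_antidiagonal.1 hp
  have hj := Finset.mem_Icc.1 hj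
  have hle1 : p.1 ≤ m := hp ▸ le_self_add
  have hle2 : p.2 ≤ m := hp ▸ le_add_self
  have hzero : ∀ (T : Finset (Fin n)), T.card = 0 → ∀ q (v : Fin n → Label d),
      coN 0 1 (M.reduced i q (T.val.map v)) = 0 := fun T hT q v => by
    rw [Finset.card_eq_zero.1 hT]
    exact M.planar i q
  by_cases c1 : p.1 = m ∧ (1 - (S.card : ℤ) - j = 1 - n - k ∧ S.card = n)
  · obtain ⟨hp1, hj1, hS⟩ := c1
    have hp2 : p.2 = 0 := by rwa [hp1, add_eq_left] at hp
    have : ∀ z : (ℕ × ℕ) × (Fin n → Label d),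
        coN p.2 (k + 1 - j) (M.reduced i z.1.2 (Sᶜ.val.map z.2)) = 0 := fun z => by
      rw [hp2, show k + 1 - j = 1 by omega]
      exact hzero _ (by omega) _ _
    simp only [this, mul_zero]
    exact PBdd.const 0
  by_cases c2 : p.2 = m ∧ (1 - (Sᶜ.card : ℤ) - (k + 1 - j) = 1 - n - k ∧ Sᶜ.card = n)
  · obtain ⟨hp1, hj1, hS⟩ := c2
    have hp2 : p.1 = 0 := by rwa [hp1, add_eq_right] at hp
    have : ∀ z : (ℕ × ℕ) × (Fin n → Label d),
        coN p.1 j (M.reduced i z.1.1 (S.val.map z.2)) = 0 := fun z => by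
      rw [hp2, show j = 1 by omega]
      exact hzero _ (by omega) _ _
    simp only [this, zero_mul]
    exact PBdd.const 0
  have e1 : M.Est p.1 (S.card + 1) j := by
    refine IH _ _ _ ?_
    rcases hle1.lt_or_eq with h1 | h1
    · exact Or.inl h1
    · refine Or.inr ⟨h1, ?_⟩
      push_cast
      have : ¬ (1 - (S.card : ℤ) - j = 1 - n - k ∧ S.card = n) := fun h => c1 ⟨h1, h⟩
      omega
  have e2 : M.Est p.2 (Sᶜ.card + 1) (k + 1 - j) := by
    refine IH _ _ _ ?_
    rcases hle2.lt_or_eq with h1 | h1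
    · exact Or.inl h1
    · refine Or.inr ⟨h1, ?_⟩
      push_cast
      have : ¬ (1 - (Sᶜ.card : ℤ) - (k + 1 - j) = 1 - n - k ∧ Sᶜ.card = n) := fun h => c2 ⟨h1, h⟩
      omega
  refine PBdd.mul ?_ ?_
  · exact PBdd.comp (wt' := pairWt)
      (pBdd_reduced S e1 i) (fun z => (z.1.1, z.2)) 1 fun z => by dsimp only [tupleWt, pairWt]; omega
  · exact PBdd.comp (wt' := pairWt)
      (pBdd_reduced Sᶜ e2 i) (fun z => (z.1.2, z.2)) 1 fun z => by dsimp only [tupleWt, pairWt]; omega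

lemma est_succ
    (IH : ∀ (p : Order d) (n' : ℕ) (k' : ℤ), p < m ∨ (p = m ∧ (2 - (n' : ℤ) - k' < 1 - n - k ∨
      (2 - (n' : ℤ) - k' = 1 - n - k ∧ n' < n + 1))) → M.Est p n' k') : M.Est m (n + 1) k := by
  have hsrc : ∀ i, PBdd (tupleWt (n := n))
      (fun z => coN m (k + 1) (M.sources z.2 i z.1)) := fun i =>
    pBdd_sources (fun m' hm' n k => IH m' n k (Or.inl hm'))
      (IH m n (k + 1) (Or.inr ⟨rfl, Or.inr ⟨by ring, by omega⟩⟩)) i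
  have hred : ∀ i, PBdd (tupleWt (n := n))
      (fun z => coN m k (M.reduced i z.1 (values z.2))) := fun i => by
    refine PBdd.of_recurrence (a := fun z : ℕ × (Fin n → Label d) =>
      coN m k (M.reduced i z.1 (values z.2))) (fun v => by
        dsimp only; rw [reduced, if_pos rfl, map_zero]) ?_ ?_
    · have h1 : ∀ v : Fin n → Label d, coN m k (M.reduced i 1 (values v))
          = (√(κ i) : ℂ)⁻¹ * coN m (k + 1) (M.sources v i 0) := fun v => by
        rw [← coN_nPow_one_mul, M.sd_one, map_smul, smul_eq_mul]
      simp only [h1]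
      exact (PBdd.comp (wt' := labelWt) (hsrc i) (fun v => (0, v)) 1
        fun v => by dsimp only [tupleWt, pairWt]; omega).const_mul _
    · have h2 : ∀ z : ℕ × (Fin n → Label d), coN m k (M.reduced i (z.1 + 2) (values z.2))
          - coN m k (M.reduced i z.1 (values z.2))
          = (∑ x ∈ antidiagonal z.1, ((∑ S : Finset (Fin n), coN m (k + 1)
                (M.reduced i x.1 (S.val.map z.2) * M.reduced i x.2 (Sᶜ.val.map z.2)))
              + coN m (k + 1) (M.B.corr ((i, x.1) ::ₘ (i, x.2) ::ₘ values z.2))))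
            + (√(κ i) : ℂ)⁻¹ * coN m (k + 1) (M.sources z.2 i (z.1 + 1)) := fun z => by
        rw [← map_sub, ← coN_nPow_one_mul, M.sd_add_two, map_add, map_smul, smul_eq_mul, map_sum]
        simp only [map_add, map_sum]
      simp only [h2]
      refine PBdd.add (PBdd.sum_antidiagonal (f := fun y : (ℕ × ℕ) × (Fin n → Label d) =>
        (∑ S : Finset (Fin n), coN m (k + 1)
          (M.reduced i y.1.1 (S.val.map y.2) * M.reduced i y.1.2 (Sᶜ.val.map y.2)))
        + coN m (k + 1) (M.B.corr ((i, y.1.1) ::ₘ (i, y.1.2) ::ₘ values y.2)))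
        (PBdd.add (PBdd.sum _ fun S _ => pBdd_reduced_mul_reduced IH i S) ?_)) (PBdd.const_mul _ ?_)
      · refine PBdd.comp (wt' := pairWt)
          (IH m (n + 2) (k + 1) (Or.inr ⟨rfl, Or.inl (by push_cast; omega)⟩))
          (fun z => ⟨(i, z.1.1) ::ₘ (i, z.1.2) ::ₘ values z.2, by simp [values]⟩) 1 fun z => ?_
        simp only [map_cons, sum_cons]
        have := sum_map_snd_le z.2 univ
        dsimp only [values, tupleWt, pairWt]
        omega
      · exact PBdd.comp (wt' := tupleWt) (hsrc i)
          (fun z => (z.1 + 1, z.2)) 1 fun z => by dsimp only [tupleWt, pairWt]; omega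
  have hcorr : PBdd (fun z : Fin d × (ℕ × (Fin n → Label d)) => z.2.1 + labelWt z.2.2)
      (fun z => coN m k (M.B.corr ((z.1, z.2.1) ::ₘ values z.2.2))) := by
    refine PBdd.of_fin (wt := tupleWt) (f := fun z : Fin d × (ℕ × (Fin n → Label d)) =>
        coN m k (M.B.corr ((z.1, z.2.1) ::ₘ values z.2.2))) fun i => ?_
    have h1 : ∀ z : ℕ × (Fin n → Label d), coN m k (M.B.corr ((i, z.1) ::ₘ values z.2))
        = coN m k (M.reduced i z.1 (values z.2))
          + if z.1 = 0 then (if n = 0 then coN m k (nPow unitN 1) else 0) else 0 := fun z => by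
      by_cases hz : z.1 = 0
      · rw [hz, B_corr_zero_cons, reduced, if_pos rfl, if_pos rfl, map_zero, zero_add]
        have : values z.2 = 0 ↔ n = 0 := by
          rw [← Multiset.card_eq_zero]; simp [values]
        simp only [this]
        split_ifs <;> simp
      · rw [reduced, if_neg hz, if_neg hz, add_zero]
    simp only [h1]
    exact (hred i).add (PBdd.ite _ (PBdd.const _))
  have hex : ∀ s : {s : Labels d // s.card = n + 1}, ∃ (w : Label d)
      (v : Fin n → Label d), s.1 = w ::ₘ values v := by
    rintro ⟨s, hs⟩
    obtain ⟨w, hw⟩ := Multiset.card_pos_iff_exists_mem.1 (by omega : 0 < s.card)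
    obtain ⟨t, rfl⟩ := exists_cons_of_mem hw
    obtain ⟨v, hv⟩ := exists_values t (n := n) (by simpa using hs)
    exact ⟨w, v, by rw [hv]⟩
  choose w v hwv using hex
  have h1 := PBdd.comp (wt' := fun s : {s : Labels d // s.card = n + 1} =>
    (s.1.map Prod.snd).sum) hcorr (fun s => ((w s).1, ((w s).2, v s))) 1 fun s => by
      rw [hwv s, map_cons, sum_cons, values, map_map]
      dsimp only [labelWt, tupleWt]
      have : ((univ.val.map (Prod.snd ∘ v s)).sum : ℕ) = ∑ j, (v s j).2 := rfl
      omega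
  unfold Est
  have h2 : ∀ s : {s : Labels d // s.card = n + 1},
      M.B.corr s.1 = M.B.corr (((w s).1, (w s).2) ::ₘ values (v s)) := fun s => by rw [← hwv s]
  simp only [h2]
  exact h1

lemma est (m : Order d) (n : ℕ) (k : ℤ) : M.Est m n k := by
  induction m using WellFoundedLT.induction generalizing n k with
  | ind m hm =>
    obtain ⟨h, hh⟩ : ∃ h : ℕ, 2 - (n : ℤ) - k < h := ⟨(2 - (n : ℤ) - k).toNat + 1, by omega⟩
    induction h generalizing n k with
    | zero => exact est_of_lt (by push_cast at hh; omega)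
    | succ h ihh =>
      induction n using Nat.strong_induction_on generalizing k with
      | _ n ihn =>
        rcases n with _ | n
        · unfold Est
          have : ∀ s : {s : Labels d // s.card = 0}, coN m k (M.B.corr s.1) = 0 :=
            fun s => by rw [Multiset.card_eq_zero.1 s.2, Insertions.corr_zero, map_zero]
          simp only [this]
          exact PBdd.const 0
        · refine est_succ fun p n' k' hp => ?_
          push_cast at hh
          rcases hp with hp | ⟨rfl, hp | ⟨hp, hn'⟩⟩
          · exact hm p hp n' k'
          · exact ihh n' k' (by omega)
          · exact ihn n' (by omega) k' (by push_cast; omega)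

end CorrModel

/-! ### Rapidly decreasing sequences -/

/-- The rapidly decreasing sequences. -/
def rapid : Submodule ℂ (ℕ → ℂ) where
  carrier := {L | ∀ e : ℕ, Summable fun q => ‖L q‖ * (1 + q : ℝ) ^ e}
  zero_mem' e := by simpa using summable_zero
  add_mem' {L L'} h h' e := by
    refine Summable.of_nonneg_of_le (fun q => by positivity) (fun q => ?_) ((h e).add (h' e))
    rw [← add_mul]
    gcongr
    exact norm_add_le _ _
  smul_mem' z L h e := by
    refine ((h e).mul_left ‖z‖).congr fun q => ?_
    rw [Pi.smul_apply, smul_eq_mul, norm_mul, mul_assoc]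

/-- The space of rapidly decreasing sequences. -/
abbrev Vec : Type := rapid

/-- Families of slots, each with a color and a rapidly decreasing sequence. -/
abbrev Slots (d : ℕ) : Type := Multiset (Fin d × Vec)

namespace Vec

lemma summable (L : Vec) (e : ℕ) : Summable fun q => ‖L.1 q‖ * (1 + q : ℝ) ^ e := L.2 e

lemma summable_mul (L : Vec) {φ : ℕ → ℂ} (hφ : PBdd natWt φ) :
    Summable fun q => L.1 q * φ q := by
  obtain ⟨C, e, hC, h⟩ := hφ
  refine Summable.of_norm_bounded ((L.summable e).mul_left C) fun q => ?_
  rw [norm_mul]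
  calc ‖L.1 q‖ * ‖φ q‖ ≤ ‖L.1 q‖ * (C * (1 + q : ℝ) ^ e) := by gcongr; exact h q
    _ = _ := by ring

lemma pBdd_tsum {Θ : Type} {wt : Θ → ℕ} (L : Vec) {f : Θ × ℕ → ℂ}
    (hf : PBdd (fun z : Θ × ℕ => wt z.1 + z.2) f) : PBdd wt fun θ => ∑' q, L.1 q * f (θ, q) := by
  obtain ⟨C, e, hC, h⟩ := hf
  refine ⟨C * ∑' q, ‖L.1 q‖ * (1 + q : ℝ) ^ e, e, mul_nonneg hC (tsum_nonneg fun q => by positivity),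
    fun θ => ?_⟩
  have hb : ∀ q, ‖L.1 q * f (θ, q)‖ ≤ C * (1 + wt θ : ℝ) ^ e * (‖L.1 q‖ * (1 + q : ℝ) ^ e) := fun q => by
    rw [norm_mul]
    have h1 := one_add_add_pow_le (wt θ) q e
    calc ‖L.1 q‖ * ‖f (θ, q)‖
        ≤ ‖L.1 q‖ * (C * ((1 + wt θ : ℝ) ^ e * (1 + q : ℝ) ^ e)) := by
          gcongr
          exact (h (θ, q)).trans (by gcongr)
      _ = _ := by ring
  refine (tsum_of_norm_bounded ((L.summable e).mul_left _).hasSum hb).trans (le_of_eq ?_)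
  rw [tsum_mul_left]
  ring

lemma tsum_comm (L L' : Vec) {f : ℕ × ℕ → ℂ} (hf : PBdd addWt f) :
    ∑' q, L.1 q * ∑' r, L'.1 r * f (q, r) = ∑' r, L'.1 r * ∑' q, L.1 q * f (q, r) := by
  obtain ⟨C, e, hC, h⟩ := hf
  have hs : Summable fun z : ℕ × ℕ => L.1 z.1 * (L'.1 z.2 * f (z.1, z.2)) := by
    refine Summable.of_norm_bounded (((L.summable e).mul_of_nonneg (L'.summable e)
      (fun q => by positivity) (fun q => by positivity)).mul_left C) fun z => ?_
    rw [norm_mul, norm_mul]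
    have h1 := one_add_add_pow_le z.1 z.2 e
    calc ‖L.1 z.1‖ * (‖L'.1 z.2‖ * ‖f z‖)
        ≤ ‖L.1 z.1‖ * (‖L'.1 z.2‖ * (C * ((1 + z.1 : ℝ) ^ e * (1 + z.2 : ℝ) ^ e))) := by
          gcongr
          exact (h z).trans (by gcongr)
      _ = _ := by ring
  have h1 := Summable.tsum_comm (f := fun q r => L.1 q * (L'.1 r * f (q, r))) hs
  calc ∑' q, L.1 q * ∑' r, L'.1 r * f (q, r) = ∑' q, ∑' r, L.1 q * (L'.1 r * f (q, r)) :=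
        tsum_congr fun q => tsum_mul_left.symm
    _ = ∑' r, ∑' q, L.1 q * (L'.1 r * f (q, r)) := h1.symm
    _ = ∑' r, L'.1 r * ∑' q, L.1 q * f (q, r) := tsum_congr fun r => by
        rw [← tsum_mul_left]
        exact tsum_congr fun q => by ring

/-- The sequence `1` at `q`, and `0` elsewhere. -/
def delta (q : ℕ) : Vec := ⟨Pi.single q 1, fun e => by
  refine summable_of_ne_finset_zero (s := {q}) fun r hr => ?_
  rw [Pi.single_eq_of_ne (by simpa using hr), norm_zero, zero_mul]⟩

lemma tsum_delta (q : ℕ) (φ : ℕ → ℂ) : ∑' r, (delta q).1 r * φ r = φ q := by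
  rw [tsum_eq_single q]
  · simp [delta]
  · intro r hr
    simp [delta, Pi.single_eq_of_ne hr]

end Vec

/-! ### Infinite linear combinations of series -/

section Hsum
variable {d : ℕ}

open Classical in
/-- The coefficientwise sum `∑ q, L q * y q`. -/
def hsum (L : Vec) (y : ℕ → PS d LK) : PS d LK :=
  if h : ∃ f : PS d LK, ∀ m k, coN m k f = ∑' q, L.1 q * coN m k (y q) then h.choose else 0

lemma exists_coN_eq (g : Order d → ℤ → ℂ) (hg : ∀ m, ∃ K : ℤ, ∀ k > K, g m k = 0) :
    ∃ f : PS d LK, ∀ m k, coN m k f = g m k := by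
  have h : ∀ m, ∃ x : LK, ∀ k, x.coeff k = g m k := fun m => by
    obtain ⟨K, hK⟩ := hg m
    have hs : BddBelow (Function.support fun j : ℤ => g m (-j)) := by
      refine ⟨-K, fun j hj => ?_⟩
      by_contra hlt
      exact hj (hK (-j) (by omega))
    refine ⟨HahnSeries.ofSuppBddBelow (fun j : ℤ => g m (-j)) hs, fun k => ?_⟩
    change g m (- -k) = _
    rw [neg_neg]
  choose x hx using h
  exact ⟨x, fun m k => hx m k⟩

end Hsum

namespace CorrModel
variable {d : ℕ} {κ : Fin d → ℝ} (M : CorrModel κ) {Θ Θ' : Type} {wt : Θ → ℕ}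

/-- Families of series whose coefficients, and those of their insertions, have polynomial growth. -/
def Tame {Θ : Type} (wt : Θ → ℕ) (y : Θ → PS d LK) : Prop := ∀ m n, M.TF m n wt y

variable {M}

lemma Tame.pBdd {y : Θ → PS d LK} (hy : M.Tame wt y) (m : Order d) (k : ℤ) :
    PBdd wt fun θ => coN m k (y θ) := ((hy m 0).bdd m le_rfl).2 k

lemma Tame.insert {y : Θ → PS d LK} (hy : M.Tame wt y) :
    M.Tame (fun x : Θ × Label d => wt x.1 + x.2.2) (fun x => M.B.D x.2 (y x.1)) :=
  fun m n => (hy m (n + 1)).2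

lemma Tame.comp {y : Θ → PS d LK} {wt' : Θ' → ℕ} (hy : M.Tame wt y) (g : Θ' → Θ) (A : ℕ)
    (hA : ∀ θ, wt (g θ) ≤ A * (wt' θ + 1)) : M.Tame wt' (fun θ => y (g θ)) :=
  fun m n => (hy m n).comp g A hA

lemma Tame.apply {y : Θ × ℕ → PS d LK} (hy : M.Tame (fun z : Θ × ℕ => wt z.1 + z.2) y) (θ : Θ) :
    M.Tame natWt fun q => y (θ, q) :=
  hy.comp (fun q => (θ, q)) (wt θ + 1) fun q => by dsimp only [natWt]; nlinarith

variable {y y' : ℕ → PS d LK}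

lemma coN_hsum (L : Vec) (hy : M.Tame natWt y) (m : Order d) (k : ℤ) :
    coN m k (hsum L y) = ∑' q, L.1 q * coN m k (y q) := by
  have h : ∃ f : PS d LK, ∀ m k, coN m k f = ∑' q, L.1 q * coN m k (y q) := by
    refine exists_coN_eq _ fun m => ?_
    obtain ⟨⟨K, hK⟩, -⟩ := (hy m 0).bdd m le_rfl
    exact ⟨K, fun k hk => by simp only [hK _ k hk, mul_zero, tsum_zero]⟩
  rw [hsum, dif_pos h]
  exact h.choose_spec m k

lemma summable_coN (L : Vec) (hy : M.Tame natWt y) (m : Order d) (k : ℤ) :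
    Summable fun q => L.1 q * coN m k (y q) := L.summable_mul (hy.pBdd m k)

lemma Tame.add {z z' : Θ → PS d LK} (hz : M.Tame wt z) (hz' : M.Tame wt z') :
    M.Tame wt fun θ => z θ + z' θ := fun m n => (hz m n).add (hz' m n)

lemma Tame.smul {z : Θ → PS d LK} (c : ℂ) (hz : M.Tame wt z) :
    M.Tame wt fun θ => c • z θ := fun m n => (hz m n).smul c

lemma Tame.mul {z z' : Θ → PS d LK} (hz : M.Tame wt z) (hz' : M.Tame wt z') :
    M.Tame wt fun θ => z θ * z' θ := fun m n => (hz m n).mul (hz' m n)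

lemma hsum_add (L : Vec) (hy : M.Tame natWt y) (hy' : M.Tame natWt y') :
    hsum L (fun q => y q + y' q) = hsum L y + hsum L y' := coN_ext fun m k => by
  rw [map_add, coN_hsum L hy, coN_hsum L hy', coN_hsum L (hy.add hy'),
    ← (summable_coN L hy m k).tsum_add (summable_coN L hy' m k)]
  exact tsum_congr fun q => by rw [map_add, mul_add]

lemma hsum_smul (L : Vec) (c : ℂ) (hy : M.Tame natWt y) :
    hsum L (fun q => c • y q) = c • hsum L y := coN_ext fun m k => by
  rw [map_smul, coN_hsum L hy, coN_hsum L (hy.smul c), smul_eq_mul, ← tsum_mul_left]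
  exact tsum_congr fun q => by rw [map_smul, smul_eq_mul]; ring

lemma add_hsum (L L' : Vec) (hy : M.Tame natWt y) :
    hsum (L + L') y = hsum L y + hsum L' y := coN_ext fun m k => by
  rw [map_add, coN_hsum L hy, coN_hsum L' hy, coN_hsum _ hy,
    ← (summable_coN L hy m k).tsum_add (summable_coN L' hy m k)]
  exact tsum_congr fun q => by rw [Submodule.coe_add, Pi.add_apply, add_mul]

lemma smul_hsum (L : Vec) (c : ℂ) (hy : M.Tame natWt y) :
    hsum (c • L) y = c • hsum L y := coN_ext fun m k => by
  rw [map_smul, coN_hsum L hy, coN_hsum _ hy, smul_eq_mul, ← tsum_mul_left]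
  exact tsum_congr fun q => by rw [Submodule.coe_smul, Pi.smul_apply, smul_eq_mul]; ring

lemma delta_hsum (q : ℕ) (hy : M.Tame natWt y) : hsum (Vec.delta q) y = y q :=
  coN_ext fun m k => by rw [coN_hsum _ hy, Vec.tsum_delta q fun q => coN m k (y q)]

lemma hsum_comm (L L' : Vec) {Y : ℕ × ℕ → PS d LK} (hY : M.Tame addWt Y)
    (h1 : M.Tame natWt fun q => hsum L' fun r => Y (q, r))
    (h2 : M.Tame natWt fun r => hsum L fun q => Y (q, r)) :
    hsum L (fun q => hsum L' fun r => Y (q, r)) = hsum L' fun r => hsum L fun q => Y (q, r) :=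
  coN_ext fun m k => by
    have hr : ∀ r, M.Tame natWt fun q => Y (q, r) := fun r =>
      hY.comp (fun q => (q, r)) (r + 1) fun q => by dsimp only [natWt]; nlinarith
    have hq : ∀ q, M.Tame natWt fun r => Y (q, r) := Tame.apply (wt := natWt) hY
    rw [coN_hsum L h1, coN_hsum L' h2]
    simp only [coN_hsum L' (hq _), coN_hsum L (hr _)]
    exact Vec.tsum_comm L L' (f := fun z => coN m k (Y z)) (hY.pBdd m k)

lemma hsum_mul (L : Vec) (f : PS d LK) (hf : M.Tame natWt fun _ => f) (hy : M.Tame natWt y) :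
    hsum L (fun q => f * y q) = f * hsum L y := coN_ext fun m k => by
  obtain ⟨K, hK⟩ := (hf m 0).bdd.exists_bound
  obtain ⟨K', hK'⟩ := (hy m 0).bdd.exists_bound
  have h0 : ∀ m' ≤ m, ∀ j > K', coN m' j (hsum L y) = 0 := fun m' hm' j hj => by
    rw [coN_hsum L hy]
    simp only [hK' m' hm' _ j hj, mul_zero, tsum_zero]
  rw [coN_hsum L (hf.mul hy), coN_mul m k K K' f _ (fun m' hm' => hK m' hm' 0) h0]
  simp only [coN_hsum L hy]
  have h1 : ∀ q, L.1 q * coN m k (f * y q) = ∑ p ∈ antidiagonal m,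
      ∑ j ∈ Finset.Icc (k - K') K, coN p.1 j f * (L.1 q * coN p.2 (k - j) (y q)) := fun q => by
    rw [coN_mul m k K K' f _ (fun m' hm' => hK m' hm' 0) (fun m' hm' => hK' m' hm' q), mul_sum]
    refine sum_congr rfl fun p _ => ?_
    rw [mul_sum]
    exact sum_congr rfl fun j _ => by ring
  simp only [h1]
  have hs : ∀ (p : Order d × Order d) (j : ℤ),
      Summable fun q => coN p.1 j f * (L.1 q * coN p.2 (k - j) (y q)) := fun p j =>
    (summable_coN L hy p.2 (k - j)).mul_left _
  rw [Summable.tsum_finsetSum fun p _ => summable_sum fun j _ => hs p j]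
  refine sum_congr rfl fun p _ => ?_
  rw [Summable.tsum_finsetSum fun j _ => hs p j]
  exact sum_congr rfl fun j _ => tsum_mul_left

lemma tame_D {z : Θ → PS d LK} (c : Fin d) (f : ℂ[X]) (hz : M.Tame wt z) :
    M.Tame wt fun θ => M.J.D (c, f) (z θ) := fun m n => tf_D c f (hz m (n + 1))

lemma J_D_smul (c : Fin d) (z : ℂ) (f : ℂ[X]) (x : PS d LK) :
    M.J.D (c, z • f) x = z • M.J.D (c, f) x := by
  rw [polyInsertions_D, polyInsertions_D, map_smul]

lemma J_D_add (c : Fin d) (f g : ℂ[X]) (x : PS d LK) :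
    M.J.D (c, f + g) x = M.J.D (c, f) x + M.J.D (c, g) x := by
  rw [polyInsertions_D, polyInsertions_D, polyInsertions_D, map_add]

lemma coN_insD (w : Label d) (f : PS d LK) (m : Order d) (k : ℤ) : coN m k (insD unitN w f)
      = -((m (Sum.inr w) + 1 : ℕ) : ℂ) * coN (m + single (Sum.inr w) 1) (k + 1) f := by
  have h0 : (((unitN⁻¹ : LKˣ)) : LK) = ((unitN ^ (-1 : ℤ) : LKˣ) : LK) := by rw [zpow_neg_one]
  have h1 : ((m (Sum.inr w) : LK) + 1) = algebraMap ℂ LK ((m (Sum.inr w) + 1 : ℕ) : ℂ) := by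
    rw [map_natCast]; push_cast; ring
  have h2 : MvPowerSeries.coeff m (insD unitN w f)
      = (-((m (Sum.inr w) + 1 : ℕ) : ℂ)) • (((unitN ^ (-1 : ℤ) : LKˣ) : LK)
        * MvPowerSeries.coeff (m + single (Sum.inr w) 1) f) := by
    rw [coeff_insD, h0, h1, Algebra.smul_def, map_neg]
    ring
  rw [coN_apply, h2, LK.coeff_smul, LK.coeff_unitN_zpow_mul, sub_neg_eq_add, coN_apply]

lemma D_hsum (L : Vec) (c : Fin d) (f : ℂ[X]) (hy : M.Tame natWt y) :
    M.J.D (c, f) (hsum L y) = hsum L fun q => M.J.D (c, f) (y q) := by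
  induction f using Polynomial.induction_on' with
  | add p q hp hq =>
    simp only [J_D_add, hp, hq]
    exact (hsum_add L (tame_D c p hy) (tame_D c q hy)).symm
  | monomial j z =>
    have hz : (monomial j z : ℂ[X]) = z • X ^ j := by
      rw [X_pow_eq_monomial, smul_monomial, smul_eq_mul, mul_one]
    simp only [hz, J_D_smul]
    rw [hsum_smul L z (tame_D c (X ^ j) hy)]
    congr 1
    refine coN_ext fun m k => ?_
    rw [coN_hsum L (tame_D c (X ^ j) hy)]
    simp only [polyInsertions_D, polyMap_X_pow, M.D_eq, coN_insD, coN_hsum L hy, ← tsum_mul_left]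
    exact tsum_congr fun q => by ring

lemma tame_hsum (L : Vec) {Y : Θ × ℕ → PS d LK} (hY : M.Tame (fun z : Θ × ℕ => wt z.1 + z.2) Y) :
    M.Tame wt fun θ => hsum L fun q => Y (θ, q) := by
  have hb : ∀ {Θ : Type} {wt : Θ → ℕ} {Y : Θ × ℕ → PS d LK}
      (_ : M.Tame (fun z : Θ × ℕ => wt z.1 + z.2) Y) (m : Order d),
      Bdd m wt fun θ => hsum L fun q => Y (θ, q) := by
    intro Θ wt Y hY m m' hm'
    obtain ⟨⟨K, hK⟩, h2⟩ := (hY m 0).bdd m' hm'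
    refine ⟨⟨K, fun θ k hk => ?_⟩, fun k => ?_⟩
    · rw [coN_hsum L (hY.apply θ)]
      simp only [hK _ k hk, mul_zero, tsum_zero]
    · simp only [coN_hsum L (hY.apply _)]
      exact Vec.pBdd_tsum L (h2 k)
  intro m n
  induction n generalizing Θ with
  | zero => exact hb hY m
  | succ n ih =>
    refine ⟨hb hY m, ?_⟩
    have h1 : ∀ x : Θ × Label d, M.B.D x.2 (hsum L fun q => Y (x.1, q))
        = hsum L fun q => M.B.D x.2 (Y (x.1, q)) := fun x => D_hsum L _ _ (hY.apply x.1)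
    simp only [h1]
    have h2 := Tame.comp (wt' := fun z : (Θ × Label d) × ℕ => wt z.1.1 + z.1.2.2 + z.2)
      hY.insert (fun z => ((z.1.1, z.2), z.1.2)) 1 (fun z => by dsimp only; omega)
    exact ih (wt := fun x : Θ × Label d => wt x.1 + x.2.2)
      (Y := fun z : (Θ × Label d) × ℕ => M.B.D z.1.2 (Y (z.1.1, z.2))) h2

variable (M)

/-- The algebra of the series whose insertions have polynomial growth. -/
def tameAlgebra : Subalgebra ℂ (PS d LK) where
  carrier := {f | M.Tame (fun _ : Unit => 0) fun _ => f}
  mul_mem' h h' := h.mul h'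
  add_mem' h h' := h.add h'
  algebraMap_mem' z := by
    have h : M.Tame (fun _ : Unit => 0) fun _ => z • (1 : PS d LK) := fun m n => TF.one.smul z
    rwa [← Algebra.algebraMap_eq_smul_one] at h

variable {M}

lemma tame_const (f : M.tameAlgebra) : M.Tame wt fun _ => (f : PS d LK) :=
  Tame.comp (wt' := wt) f.2 (fun _ => ()) 0 fun _ => by simp

lemma tame_B_D (c : Fin d) (f : M.tameAlgebra) : M.Tame natWt fun q => M.B.D (c, q) (f : PS d LK) :=
  (tame_const (wt := fun _ : Unit => 0) f).insert.comp (fun q => ((), (c, q))) 1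
    fun q => by dsimp only [natWt]; omega

lemma tame_hat_D {z : Θ → PS d LK} (hz : M.Tame wt z) (c : Fin d) (L : Vec) :
    M.Tame wt fun θ => hsum L fun q => M.B.D (c, q) (z θ) :=
  tame_hsum L (Y := fun x : Θ × ℕ => M.B.D (c, x.2) (z x.1))
    (hz.insert.comp (fun x : Θ × ℕ => (x.1, (c, x.2))) 1 fun x => by dsimp only; omega)

lemma tame_F (i : Fin d) {p : Θ → ℂ[X]} (hp : PolyBdd (κ i) wt p) :
    M.Tame wt fun θ => M.J.F (i, p θ) := fun _ _ => tf_F (fun m' _ => est m') i hp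

lemma tame_B_F (i : Fin d) : M.Tame natWt fun q => M.B.F (i, q) := tame_F i PolyBdd.cheb

variable (M)

/-- The insertion of `∑ q, L q * tr P_q(M_c)`. -/
def hatD (a : Fin d × Vec) : Derivation ℂ M.tameAlgebra M.tameAlgebra := Derivation.mk'
    { toFun := fun f => ⟨hsum a.2 fun q => M.B.D (a.1, q) (f : PS d LK), tame_hat_D f.2 a.1 a.2⟩
      map_add' := fun f g => Subtype.ext (by
        simp only [Subalgebra.coe_add, map_add]
        exact hsum_add _ (tame_B_D _ f) (tame_B_D _ g))
      map_smul' := fun z f => Subtype.ext (by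
        simp only [Subalgebra.coe_smul, Derivation.map_smul, RingHom.id_apply]
        exact hsum_smul _ z (tame_B_D _ f)) }
    fun f g => Subtype.ext (by
      simp only [LinearMap.coe_mk, AddHom.coe_mk, Subalgebra.coe_mul, Subalgebra.coe_add, smul_eq_mul,
        Derivation.leibniz]
      rw [hsum_add _ ((tame_const f).mul (tame_B_D _ g)) ((tame_const g).mul (tame_B_D _ f)),
        hsum_mul _ _ (tame_const f) (tame_B_D _ g), hsum_mul _ _ (tame_const g) (tame_B_D _ f)])

lemma coe_hatD (c : Fin d) (L : Vec) (f : M.tameAlgebra) :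
    (M.hatD (c, L) f : PS d LK) = hsum L fun q => M.B.D (c, q) (f : PS d LK) := rfl

/-- The expectation of `∑ q, L q * tr P_q(M_c)`. -/
def hatF (a : Fin d × Vec) : M.tameAlgebra := ⟨hsum a.2 fun q => M.B.F (a.1, q),
  tame_hsum (Θ := Unit) (wt := fun _ => 0) a.2 (Y := fun z => M.B.F (a.1, z.2))
    ((tame_B_F a.1).comp (fun z : Unit × ℕ => z.2) 1 fun z => by dsimp only [natWt]; omega)⟩

lemma coe_hatF (c : Fin d) (L : Vec) :
    (M.hatF (c, L) : PS d LK) = hsum L fun q => M.B.F (c, q) := rfl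

lemma hatD_comm (a b : Fin d × Vec) (f : M.tameAlgebra) :
    M.hatD a (M.hatD b f) = M.hatD b (M.hatD a f) := by
  refine Subtype.ext ?_
  obtain ⟨c, L⟩ := a
  obtain ⟨c', L'⟩ := b
  simp only [coe_hatD]
  have h1 : ∀ q, M.B.D (c, q) (hsum L' fun r => M.B.D (c', r) (f : PS d LK))
      = hsum L' fun r => M.B.D (c, q) (M.B.D (c', r) (f : PS d LK)) := fun q =>
    D_hsum L' _ _ (tame_B_D c' f)
  have h2 : ∀ q, M.B.D (c', q) (hsum L fun r => M.B.D (c, r) (f : PS d LK))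
      = hsum L fun r => M.B.D (c', q) (M.B.D (c, r) (f : PS d LK)) := fun q =>
    D_hsum L _ _ (tame_B_D c f)
  simp only [h1, h2]
  have hY : M.Tame (fun z : ℕ × ℕ => z.1 + z.2)
      fun z => M.B.D (c, z.1) (M.B.D (c', z.2) (f : PS d LK)) :=
    (tame_B_D c' f).insert.comp (fun z : ℕ × ℕ => (z.2, (c, z.1))) 1
      fun z => by dsimp only [natWt]; omega
  have hY' : M.Tame (fun z : ℕ × ℕ => z.1 + z.2)
      fun z => M.B.D (c, z.2) (M.B.D (c', z.1) (f : PS d LK)) :=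
    (tame_B_D c' f).insert.comp (fun z : ℕ × ℕ => (z.1, (c, z.2))) 1
      fun z => by dsimp only [natWt]; omega
  rw [hsum_comm L L' hY (tame_hsum (wt := natWt) L' hY) (tame_hsum (wt := natWt) L hY')]
  have h3 : ∀ q r, M.B.D (c, q) (M.B.D (c', r) (f : PS d LK))
      = M.B.D (c', r) (M.B.D (c, q) (f : PS d LK)) := fun q r => M.B.comm _ _ _
  simp only [h3]

lemma hatD_hatF (a b : Fin d × Vec) : M.hatD a (M.hatF b) = M.hatD b (M.hatF a) := by
  refine Subtype.ext ?_
  obtain ⟨c, L⟩ := a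
  obtain ⟨c', L'⟩ := b
  simp only [coe_hatD, coe_hatF]
  have h1 : ∀ q, M.B.D (c, q) (hsum L' fun r => M.B.F (c', r))
      = hsum L' fun r => M.B.D (c, q) (M.B.F (c', r)) := fun q => D_hsum L' _ _ (tame_B_F c')
  have h2 : ∀ q, M.B.D (c', q) (hsum L fun r => M.B.F (c, r))
      = hsum L fun r => M.B.D (c', q) (M.B.F (c, r)) := fun q => D_hsum L _ _ (tame_B_F c)
  simp only [h1, h2]
  have hY : M.Tame (fun z : ℕ × ℕ => z.1 + z.2) fun z => M.B.D (c, z.1) (M.B.F (c', z.2)) :=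
    (tame_B_F c').insert.comp (fun z : ℕ × ℕ => (z.2, (c, z.1))) 1
      fun z => by dsimp only [natWt]; omega
  have hY' : M.Tame (fun z : ℕ × ℕ => z.1 + z.2) fun z => M.B.D (c, z.2) (M.B.F (c', z.1)) :=
    (tame_B_F c').insert.comp (fun z : ℕ × ℕ => (z.1, (c, z.2))) 1
      fun z => by dsimp only [natWt]; omega
  rw [hsum_comm L L' hY (tame_hsum (wt := natWt) L' hY) (tame_hsum (wt := natWt) L hY')]
  have h3 : ∀ q r, M.B.D (c, q) (M.B.F (c', r)) = M.B.D (c', r) (M.B.F (c, q)) :=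
    fun q r => M.B.symm _ _
  simp only [h3]

/-- The connected correlators of infinite linear combinations of the traces `tr P_q(M_c)`. -/
def hat : Insertions (Fin d × Vec) M.tameAlgebra where
  D := M.hatD
  F := M.hatF
  comm := M.hatD_comm
  symm := M.hatD_hatF

/-- The expectation of `tr f(M_i)`. -/
def polyF (i : Fin d) : ℂ[X] →ₗ[ℂ] M.tameAlgebra where
  toFun f := ⟨M.J.F (i, f), tame_F i (PolyBdd.const (M.pos i) f)⟩
  map_add' f g := Subtype.ext (by simp [polyInsertions_F])
  map_smul' z f := Subtype.ext (by simp [polyInsertions_F])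

lemma hat_F_eq (i : Fin d) (L : Vec) : ((M.hat.F (i, L) : M.tameAlgebra) : PS d LK)
      = hsum L fun q => (M.polyF i (chebP (κ i) q) : PS d LK) := rfl

variable {M}

lemma tame_hat_iter {y : Θ → M.tameAlgebra} (hy : M.Tame wt fun θ => (y θ : PS d LK))
    (s : Slots d) : M.Tame wt fun θ => (M.hat.iter s (y θ) : PS d LK) := by
  induction s using induction_on with
  | empty => exact hy
  | cons a s ih =>
    simp only [iter_cons]
    exact tame_hat_D ih a.1 a.2

lemma hat_iter_hsum {y : ℕ → M.tameAlgebra} (hy : M.Tame natWt fun q => (y q : PS d LK)) (L : Vec)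
    (x : M.tameAlgebra) (hx : (x : PS d LK) = hsum L fun q => (y q : PS d LK))
    (s : Slots d) :
    (M.hat.iter s x : PS d LK) = hsum L fun q => (M.hat.iter s (y q) : PS d LK) := by
  induction s using induction_on with
  | empty => exact hx
  | cons a s ih =>
    obtain ⟨c, L'⟩ := a
    simp only [Insertions.iter_cons]
    have hy' := tame_hat_iter hy s
    change hsum L' (fun q => M.B.D (c, q) (M.hat.iter s x : PS d LK))
      = hsum L fun q => hsum L' fun r => M.B.D (c, r) (M.hat.iter s (y q) : PS d LK)
    rw [ih]
    have h1 : ∀ q, M.B.D (c, q) (hsum L fun r => (M.hat.iter s (y r) : PS d LK))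
        = hsum L fun r => M.B.D (c, q) (M.hat.iter s (y r) : PS d LK) := fun q => D_hsum L _ _ hy'
    simp only [h1]
    set Y : ℕ → ℕ → PS d LK := fun q r => M.B.D (c, q) (M.hat.iter s (y r) : PS d LK)
    have hY : M.Tame addWt fun z => Y z.1 z.2 :=
      hy'.insert.comp (fun z : ℕ × ℕ => (z.2, (c, z.1))) 1 fun z => by dsimp only [natWt, addWt]; omega
    have hY' : M.Tame addWt fun z => Y z.2 z.1 :=
      hy'.insert.comp (fun z : ℕ × ℕ => (z.1, (c, z.2))) 1 fun z => by dsimp only [natWt, addWt]; omega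
    exact hsum_comm (Y := fun z => Y z.1 z.2) L' L hY
      (tame_hsum (wt := natWt) (Y := fun z => Y z.1 z.2) L hY)
      (tame_hsum (wt := natWt) (Y := fun z => Y z.2 z.1) L' hY')

variable (M)

/-- A coefficient of a correlator, as a linear form in one of the traces. -/
def slot (i : Fin d) (s : Slots d) (m : Order d) (k : ℤ) : ℂ[X] →ₗ[ℂ] ℂ :=
  coN m k ∘ₗ M.tameAlgebra.val.toLinearMap ∘ₗ M.hat.iterLin s ∘ₗ M.polyF i

lemma slot_apply (i : Fin d) (s : Slots d) (m : Order d) (k : ℤ) (f : ℂ[X]) :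
    M.slot i s m k f = coN m k (M.hat.iter s (M.polyF i f) : PS d LK) := rfl

lemma tame_polyF (i : Fin d) {p : Θ → ℂ[X]} (hp : PolyBdd (κ i) wt p) :
    M.Tame wt fun θ => (M.polyF i (p θ) : PS d LK) := tame_F i hp

lemma tame_iter_polyF (i : Fin d) {p : Θ → ℂ[X]} (hp : PolyBdd (κ i) wt p) (s : Slots d) :
    M.Tame wt fun θ => (M.hat.iter s (M.polyF i (p θ)) : PS d LK) :=
  tame_hat_iter (y := fun θ => M.polyF i (p θ)) (M.tame_polyF i hp) s

lemma pBdd_slot (i : Fin d) (s : Slots d) (m : Order d) (k : ℤ) :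
    PBdd natWt fun q => M.slot i s m k (chebP (κ i) q) := by
  have h := (M.tame_iter_polyF i PolyBdd.cheb s).pBdd m k
  simp only [slot_apply]
  exact h

lemma coe_hat_corr_cons (i : Fin d) (L : Vec) (s : Slots d) : (M.hat.corr ((i, L) ::ₘ s) : PS d LK)
      = hsum L fun q => (M.hat.iter s (M.polyF i (chebP (κ i) q)) : PS d LK) := by
  rw [corr_cons]
  exact hat_iter_hsum (y := fun q => M.polyF i (chebP (κ i) q)) (M.tame_polyF i PolyBdd.cheb) L _
    (M.hat_F_eq i L) s

lemma coN_hat_corr_cons (i : Fin d) (L : Vec) (s : Slots d) (m : Order d)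
    (k : ℤ) : coN m k (M.hat.corr ((i, L) ::ₘ s) : PS d LK)
      = ∑' q, L.1 q * M.slot i s m k (chebP (κ i) q) := by
  rw [coe_hat_corr_cons, coN_hsum L (M.tame_iter_polyF i PolyBdd.cheb s)]
  exact tsum_congr fun q => by rw [slot_apply]

end CorrModel

end

section
open Polynomial
open MultiTrace.Insertions (corr_cons iter_cons iter_smul iter_zero_right iter_zero)
open Vec

/-! ### Linear forms of polynomial growth on the polynomials `P_q` -/

/-- A linear form has polynomial growth on the polynomials `P_q`. -/
def TameForm (x : ℝ) (φ : ℂ[X] →ₗ[ℂ] ℂ) : Prop := PBdd natWt fun q => φ (chebP x q)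

/-- The value of the linear form `φ` at `∑ q, L q * P_q`. -/
def pair (x : ℝ) (φ : ℂ[X] →ₗ[ℂ] ℂ) (L : Vec) : ℂ := ∑' q, L.1 q * φ (chebP x q)

namespace Vec

/-- Weighted `ℓ¹` norms of a rapidly decreasing sequence. -/
def nrm (e : ℕ) (L : Vec) : ℝ := ∑' q, ‖L.1 q‖ * (1 + q : ℝ) ^ e

lemma nrm_nonneg (e : ℕ) (L : Vec) : 0 ≤ nrm e L := tsum_nonneg fun q => by positivity

lemma hasSum_shift_right (L : Vec) (e : ℕ) :
    ∃ S ≤ 2 ^ e * nrm e L, HasSum (fun q : ℕ => ‖if q = 0 then 0 else L.1 (q - 1)‖ * (1 + q : ℝ) ^ e) S := by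
  have h : ∀ q : ℕ, ‖if q + 1 = 0 then 0 else L.1 (q + 1 - 1)‖ * (1 + (q + 1 : ℕ) : ℝ) ^ e
      ≤ 2 ^ e * (‖L.1 q‖ * (1 + q : ℝ) ^ e) := fun q => by
    rw [if_neg (succ_ne_zero q), Nat.add_sub_cancel, mul_left_comm, ← mul_pow]
    gcongr
    push_cast
    linarith
  have hs := Summable.of_nonneg_of_le (fun q => by positivity) h ((L.summable e).mul_left _)
  refine ⟨_, ?_, ((hasSum_nat_add_iff 1).1 hs.hasSum)⟩
  rw [Finset.sum_range_one, if_pos rfl, norm_zero, zero_mul, add_zero]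
  exact (hs.tsum_le_tsum h ((L.summable e).mul_left _)).trans (le_of_eq tsum_mul_left)

lemma hasSum_shift_left (L : Vec) (e : ℕ) :
    ∃ S ≤ nrm e L, HasSum (fun q : ℕ => ‖L.1 (q + 1)‖ * (1 + q : ℝ) ^ e) S := by
  have h : ∀ q : ℕ, ‖L.1 (q + 1)‖ * (1 + q : ℝ) ^ e ≤ ‖L.1 (q + 1)‖ * (1 + (q + 1 : ℕ) : ℝ) ^ e := fun q => by
    gcongr
    exact q.le_succ
  have h1 := (summable_nat_add_iff 1).2 (L.summable e)
  have hs := Summable.of_nonneg_of_le (fun q => by positivity) h h1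
  refine ⟨_, (hs.tsum_le_tsum h h1).trans ?_, hs.hasSum⟩
  rw [nrm, (L.summable e).tsum_eq_zero_add]
  exact le_add_of_nonneg_left (by positivity)

lemma shiftX_bound (x : ℝ) (L : Vec) (e : ℕ) :
    ∃ S ≤ ‖(√x : ℂ)⁻¹‖ * ((2 ^ e + 1) * nrm e L), HasSum (fun q : ℕ =>
      ‖(√x : ℂ)⁻¹‖ * (‖if q = 0 then 0 else L.1 (q - 1)‖ * (1 + q : ℝ) ^ e
        + ‖L.1 (q + 1)‖ * (1 + q : ℝ) ^ e)) S := by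
  obtain ⟨S, h1, h2⟩ := L.hasSum_shift_right e
  obtain ⟨S', h1', h2'⟩ := L.hasSum_shift_left e
  refine ⟨_, ?_, (h2.add h2').mul_left _⟩
  gcongr
  linarith

lemma norm_shiftX_le (x : ℝ) (L : Vec) (e q : ℕ) :
    ‖(√x : ℂ)⁻¹ * ((if q = 0 then 0 else L.1 (q - 1)) + L.1 (q + 1))‖ * (1 + q : ℝ) ^ e
      ≤ ‖(√x : ℂ)⁻¹‖ * (‖if q = 0 then 0 else L.1 (q - 1)‖ * (1 + q : ℝ) ^ e
        + ‖L.1 (q + 1)‖ * (1 + q : ℝ) ^ e) := by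
  rw [norm_mul, mul_assoc, ← add_mul]
  gcongr
  exact norm_add_le _ _

/-- Multiplication by `X`. -/
def shiftX (x : ℝ) : Vec →ₗ[ℂ] Vec where
  toFun L := ⟨fun q => (√x : ℂ)⁻¹ * ((if q = 0 then 0 else L.1 (q - 1)) + L.1 (q + 1)), fun e => by
      obtain ⟨S, -, h⟩ := shiftX_bound x L e
      exact Summable.of_nonneg_of_le (fun q => by positivity) (norm_shiftX_le x L e) h.summable⟩
  map_add' L L' := Subtype.ext (funext fun q => by
    simp only [Submodule.coe_add, Pi.add_apply]
    split_ifs <;> ring)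
  map_smul' z L := Subtype.ext (funext fun q => by
    simp only [Submodule.coe_smul, Pi.smul_apply, smul_eq_mul, RingHom.id_apply]
    split_ifs <;> ring)

lemma shiftX_apply (x : ℝ) (L : Vec) (q : ℕ) : (shiftX x L).1 q
    = (√x : ℂ)⁻¹ * ((if q = 0 then 0 else L.1 (q - 1)) + L.1 (q + 1)) := rfl

lemma nrm_shiftX_le (x : ℝ) (L : Vec) (e : ℕ) :
    nrm e (shiftX x L) ≤ ‖(√x : ℂ)⁻¹‖ * ((2 ^ e + 1) * nrm e L) := by
  obtain ⟨S, h1, h⟩ := shiftX_bound x L e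
  exact (((shiftX x L).summable e).tsum_le_tsum (norm_shiftX_le x L e) h.summable).trans
    (h.tsum_eq.le.trans h1)

/-- The sequence that represents the polynomial `X ^ a`. -/
def powVec (x : ℝ) (a : ℕ) : Vec := (shiftX x)^[a] (delta 0)

lemma powVec_succ (x : ℝ) (a : ℕ) : powVec x (a + 1) = shiftX x (powVec x a) :=
  Function.iterate_succ_apply' _ _ _

lemma exists_nrm_powVec_le (x : ℝ) (e : ℕ) : ∃ A : ℝ, 0 < A ∧ ∀ a, nrm e (powVec x a) ≤ A ^ a := by
  refine ⟨‖(√x : ℂ)⁻¹‖ * (2 ^ e + 1) + 1, by positivity, fun a => ?_⟩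
  induction a with
  | zero =>
    rw [pow_zero, nrm, tsum_eq_single 0]
    · simp [powVec, delta]
    · intro q hq
      simp [powVec, delta, Pi.single_eq_of_ne hq]
  | succ a ih =>
    rw [powVec_succ, pow_succ']
    refine (nrm_shiftX_le x _ e).trans ?_
    rw [← mul_assoc]
    gcongr
    · exact nrm_nonneg _ _
    · exact le_add_of_nonneg_right zero_le_one

open Classical in
/-- The sequence `√x * z ^ (q + 1)` that represents `1 / (y - X)`, where `√x * y = z + 1 / z`. -/
def ev (x : ℝ) (z : ℂ) : Vec := if h : ‖z‖ < 1 then ⟨fun q => (√x : ℂ) * z ^ (q + 1), fun e => by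
    have h1 := (summable_nat_add_iff 1).2
      (summable_norm_pow_mul_geometric_of_norm_lt_one (R := ℂ) e h)
    refine Summable.of_nonneg_of_le (fun q => by positivity) (fun q => ?_) (h1.mul_left ‖(√x : ℂ)‖)
    rw [norm_mul, norm_mul, norm_pow ((q + 1 : ℕ) : ℂ), Complex.norm_natCast, mul_assoc,
      mul_comm ‖z ^ (q + 1)‖]
    push_cast
    rw [add_comm (1 : ℝ)]⟩
  else 0

lemma ev_apply (x : ℝ) {z : ℂ} (h : ‖z‖ < 1) (q : ℕ) : (ev x z).1 q = (√x : ℂ) * z ^ (q + 1) := by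
  rw [ev, dif_pos h]

lemma shiftX_ev {x : ℝ} (hx : 0 < x) {z y : ℂ} (h : ‖z‖ < 1) (hz : z ≠ 0)
    (hy : z + z⁻¹ = (√x : ℂ) * y) : shiftX x (ev x z) = y • ev x z - delta 0 := by
  refine Subtype.ext (funext fun q => ?_)
  have hs := sqrt_ne_zero_of_pos hx
  have h1 : z ^ 2 + 1 = (√x : ℂ) * y * z := by
    rw [← hy, add_mul, inv_mul_cancel₀ hz]; ring
  change _ = y * (ev x z).1 q - (delta 0).1 q
  simp only [shiftX_apply, ev_apply x h]
  rcases q with _ | q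
  · rw [if_pos rfl, zero_add, zero_add, ← mul_assoc, inv_mul_cancel₀ hs]
    simp only [delta, Pi.single_eq_same]
    linear_combination h1
  · rw [if_neg (succ_ne_zero q), Nat.add_sub_cancel, ← mul_add, ← mul_assoc, inv_mul_cancel₀ hs]
    simp only [delta, Pi.single_eq_of_ne (succ_ne_zero q)]
    linear_combination z ^ (q + 1) * h1

lemma shiftX_iterate_ev {x : ℝ} (hx : 0 < x) {z y : ℂ} (h : ‖z‖ < 1) (hz : z ≠ 0)
    (hy : z + z⁻¹ = (√x : ℂ) * y) (a : ℕ) : (shiftX x)^[a] (ev x z)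
      = y ^ a • ev x z - ∑ l ∈ range a, y ^ (a - 1 - l) • powVec x l := by
  induction a with
  | zero => simp
  | succ a ih =>
    rw [Function.iterate_succ_apply', ih, map_sub, map_smul, shiftX_ev hx h hz hy, map_sum,
      Finset.sum_range_succ', smul_sub, smul_smul, ← pow_succ, sub_sub]
    congr 1
    rw [add_comm]
    congr 1
    refine sum_congr rfl fun l hl => ?_
    rw [map_smul, ← powVec_succ]
    congr 2
    omega

end Vec

section Pairing
variable {x : ℝ} {φ : ℂ[X] →ₗ[ℂ] ℂ}

lemma PolyBdd.apply {Θ : Type} {wt : Θ → ℕ} {p : Θ → ℂ[X]} (hp : PolyBdd x wt p)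
    (hφ : TameForm x φ) : PBdd wt fun θ => φ (p θ) := by
  have h := PolyBdd.pBdd (Θ := Unit) (wt := fun _ => 0) (φ := fun _ => φ) hp
    (PBdd.comp (wt' := fun z : Unit × ℕ => 0 + z.2) hφ (fun z => z.2) 1 fun z => by dsimp only [natWt]; omega)
  exact PBdd.comp (wt' := wt) h (fun θ => ((), θ)) 1 fun θ => by dsimp only; omega

lemma PolyBdd.mul_const_chebP (hx : 0 < x) (f : ℂ[X]) :
    PolyBdd x natWt fun q => f * MultiTrace.chebP x q :=
  PolyBdd.comp (wt' := fun q : ℕ => q)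
    (PolyBdd.mul_chebP (Θ := Unit) (wt := fun _ => 0) (fun _ => f) (PolyBdd.const hx f))
    (fun q => ((), q)) 1 fun q => by dsimp only; omega

lemma TameForm.comp_mul (hx : 0 < x) (hφ : TameForm x φ) (f : ℂ[X]) :
    TameForm x (φ ∘ₗ mulLeft ℂ f) := (PolyBdd.mul_const_chebP hx f).apply hφ

lemma TameForm.summable (hφ : TameForm x φ) (L : Vec) : Summable fun q => L.1 q * φ (chebP x q) :=
  L.summable_mul hφ

lemma pair_add (hφ : TameForm x φ) (L L' : Vec) : pair x φ (L + L') = pair x φ L + pair x φ L' := by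
  rw [pair, pair, pair, ← (hφ.summable L).tsum_add (hφ.summable L')]
  exact tsum_congr fun q => by rw [Submodule.coe_add, Pi.add_apply, add_mul]

lemma pair_smul (z : ℂ) (L : Vec) : pair x φ (z • L) = z * pair x φ L := by
  rw [pair, pair, ← tsum_mul_left]
  exact tsum_congr fun q => by rw [Submodule.coe_smul, Pi.smul_apply, smul_eq_mul, mul_assoc]

lemma pair_sub (hφ : TameForm x φ) (L L' : Vec) : pair x φ (L - L') = pair x φ L - pair x φ L' := by
  rw [sub_eq_add_neg, ← neg_one_smul ℂ L', pair_add hφ, pair_smul]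
  ring

lemma pair_delta (q : ℕ) : pair x φ (delta q) = φ (chebP x q) :=
  tsum_delta q fun q => φ (chebP x q)

lemma X_mul_chebP_eq (hx : 0 < x) (q : ℕ) : X * chebP x q = ((√x : ℂ)⁻¹) •
    (chebP x (q + 1) + if q = 0 then 0 else chebP x (q - 1)) := by
  rw [eq_inv_smul_iff₀ (sqrt_ne_zero_of_pos hx)]
  rcases q with _ | q
  · rw [X_mul_chebP_zero, if_pos rfl, add_zero]
  · rw [X_mul_chebP, if_neg (succ_ne_zero q)]
    rfl

lemma pair_shiftX (hx : 0 < x) (hφ : TameForm x φ) (L : Vec) :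
    pair x φ (shiftX x L) = pair x (φ ∘ₗ mulLeft ℂ X) L := by
  have hu : Summable fun q => L.1 q * φ (chebP x (q + 1)) :=
    L.summable_mul (PBdd.comp (wt' := fun q : ℕ => q) hφ (fun q => q + 1) 1 fun q => by dsimp only [natWt]; omega)
  have hv : Summable fun q => L.1 (q + 1) * φ (chebP x q) := by
    refine ((summable_nat_add_iff 1).2 (L.summable_mul (φ := fun q => φ (chebP x (q - 1)))
      (PBdd.comp (wt' := fun q : ℕ => q) hφ (fun q => q - 1) 1 fun q => by dsimp only [natWt]; omega))).congr fun q => ?_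
    rw [Nat.add_sub_cancel]
  have hu' : HasSum (fun q => (if q = 0 then 0 else L.1 (q - 1)) * φ (chebP x q))
      (∑' q, L.1 q * φ (chebP x (q + 1))) := by
    have := (hasSum_nat_add_iff (f := fun q => (if q = 0 then 0 else L.1 (q - 1)) * φ (chebP x q)) 1).1
      (by simpa using hu.hasSum)
    simpa using this
  have hv' : HasSum (fun q => L.1 q * φ (if q = 0 then 0 else chebP x (q - 1)))
      (∑' q, L.1 (q + 1) * φ (chebP x q)) := by
    have := (hasSum_nat_add_iff (f := fun q => L.1 q * φ (if q = 0 then 0 else chebP x (q - 1))) 1).1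
      (by simpa using hv.hasSum)
    simpa using this
  have h1 := (hu'.add hv.hasSum).mul_left (√x : ℂ)⁻¹
  have h2 := (hu.hasSum.add hv').mul_left (√x : ℂ)⁻¹
  calc pair x φ (shiftX x L) = _ := tsum_congr fun q => by
        rw [shiftX_apply, mul_assoc, add_mul]
    _ = _ := h1.tsum_eq.trans h2.tsum_eq.symm
    _ = _ := tsum_congr fun q => by
        rw [comp_apply, mulLeft_apply, X_mul_chebP_eq hx, map_smul, map_add, smul_eq_mul]
        ring

lemma comp_mul_comp_mul (f g : ℂ[X]) : (φ ∘ₗ mulLeft ℂ f) ∘ₗ mulLeft ℂ g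
    = φ ∘ₗ mulLeft ℂ (f * g) := LinearMap.ext fun h => by simp

lemma pair_shiftX_iterate (hx : 0 < x) (hφ : TameForm x φ) (a : ℕ) (L : Vec) :
    pair x φ ((shiftX x)^[a] L) = pair x (φ ∘ₗ mulLeft ℂ (X ^ a)) L := by
  induction a generalizing L with
  | zero => simp [pair]
  | succ a ih =>
    rw [Function.iterate_succ_apply, ih, pair_shiftX hx (hφ.comp_mul hx _), comp_mul_comp_mul, pow_succ]

lemma pair_powVec (hx : 0 < x) (hφ : TameForm x φ) (a : ℕ) : pair x φ (powVec x a) = φ (X ^ a) := by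
  rw [powVec, pair_shiftX_iterate hx hφ, pair_delta]
  simp [chebP_zero]

lemma norm_X_pow_mul_chebP_le (hx : 0 < x) {C : ℝ} {e : ℕ} (hC : 0 ≤ C)
    (hφ : ∀ q : ℕ, ‖φ (chebP x q)‖ ≤ C * (1 + q : ℝ) ^ e) (a q : ℕ) :
    ‖φ (X ^ a * chebP x q)‖ ≤ (2 / √x) ^ a * (C * (1 + (a + q : ℕ) : ℝ) ^ e) := by
  have hs := sqrt_pos.2 hx
  induction a generalizing q with
  | zero => simpa using hφ q
  | succ a ih =>
    rw [pow_succ, mul_assoc, X_mul_chebP_eq hx, mul_smul_comm, map_smul, mul_add, map_add, smul_eq_mul,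
      norm_mul, norm_inv, norm_real, norm_of_nonneg hs.le]
    have h1 : ‖φ (X ^ a * chebP x (q + 1))‖
        ≤ (2 / √x) ^ a * (C * (1 + (a + 1 + q : ℕ) : ℝ) ^ e) := by
      have := ih (q + 1)
      rwa [show a + (q + 1) = a + 1 + q by ring] at this
    have h2 : ‖φ (X ^ a * if q = 0 then 0 else chebP x (q - 1))‖
        ≤ (2 / √x) ^ a * (C * (1 + (a + 1 + q : ℕ) : ℝ) ^ e) := by
      split_ifs
      · rw [mul_zero, map_zero, norm_zero]; positivity
      · have h3 : (1 + (a + (q - 1) : ℕ) : ℝ) ^ e ≤ (1 + (a + 1 + q : ℕ) : ℝ) ^ e := by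
          gcongr <;> omega
        refine (ih (q - 1)).trans ?_
        gcongr
    calc (√x)⁻¹ * ‖φ (X ^ a * chebP x (q + 1)) + φ (X ^ a * if q = 0 then 0 else chebP x (q - 1))‖
        ≤ (√x)⁻¹ * (2 * ((2 / √x) ^ a * (C * (1 + (a + 1 + q : ℕ) : ℝ) ^ e))) := by
          gcongr
          refine (norm_add_le _ _).trans ?_
          linarith
      _ = _ := by rw [pow_succ]; ring

lemma summable_pow_mul_geometric (e : ℕ) {ρ : ℝ} (h0 : 0 ≤ ρ) (h1 : ρ < 1) :
    Summable fun q : ℕ => (1 + q : ℝ) ^ e * ρ ^ q := by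
  have h := (ev 1 ρ).summable e
  rcases h0.eq_or_lt with h0 | h0
  · rw [← h0]
    refine summable_of_ne_finset_zero (s := {0}) fun a ha => ?_
    rw [zero_pow (by simpa using ha), mul_zero]
  · have hρ : ‖(ρ : ℂ)‖ < 1 := by rwa [norm_real, norm_of_nonneg h0.le]
    refine (h.mul_left ρ⁻¹).congr fun q => ?_
    rw [ev_apply 1 hρ, Real.sqrt_one, Complex.ofReal_one, one_mul, norm_pow, norm_real,
      norm_of_nonneg h0.le, pow_succ]
    field_simp

/-- The expansion at infinity of the pairing with `1 / (y - X)`. -/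
lemma hasSum_pair_ev (hx : 0 < x) (hφ : TameForm x φ) {z y : ℂ} (h : ‖z‖ < 1) (hz : z ≠ 0)
    (hy : z + z⁻¹ = (√x : ℂ) * y) (hy' : 2 / √x < ‖y‖) :
    HasSum (fun a : ℕ => φ (X ^ a) * y⁻¹ ^ (a + 1)) (pair x φ (ev x z)) := by
  obtain ⟨C, e, hC, hb⟩ := hφ
  have hφ : TameForm x φ := ⟨C, e, hC, hb⟩
  have hpos : 0 < 2 / √x := by positivity
  have hy0 : y ≠ 0 := norm_pos_iff.1 (hpos.trans hy')
  set t : ℝ := 2 / √x / ‖y‖ with ht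
  have ht1 : ‖t‖ < 1 := by
    rw [norm_of_nonneg (by positivity), ht, div_lt_one (norm_pos_iff.2 hy0)]
    exact hy'
  have ht0 : 0 ≤ t := by positivity
  have hgeo1 := summable_pow_mul_geometric e ht0 ((le_abs_self t).trans_lt ht1)
  have hbd : ∀ a q : ℕ, ‖φ (X ^ a * chebP x q)‖ * ‖y⁻¹ ^ (a + 1)‖
      ≤ ‖y‖⁻¹ * C * (1 + q : ℝ) ^ e * ((1 + a : ℝ) ^ e * t ^ a) := fun a q => by
    rw [norm_pow, norm_inv, pow_succ]
    have h1 := norm_X_pow_mul_chebP_le hx hC hb a q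
    have h2 := one_add_add_pow_le a q e
    calc _ ≤ (2 / √x) ^ a * (C * ((1 + a : ℝ) ^ e * (1 + q : ℝ) ^ e)) * (‖y‖⁻¹ ^ a * ‖y‖⁻¹) := by
          gcongr
          exact h1.trans (by gcongr)
      _ = _ := by rw [ht, div_eq_mul_inv (2 / √x) ‖y‖, mul_pow]; ring
  have hsum : Summable fun a : ℕ => φ (X ^ a) * y⁻¹ ^ (a + 1) := by
    refine Summable.of_norm_bounded (hgeo1.mul_left (‖y‖⁻¹ * C)) fun a => ?_
    rw [norm_mul]
    have := hbd a 0
    simpa [chebP_zero] using this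
  refine (hsum.hasSum_iff_tendsto_nat).2 ?_
  have hpart : ∀ a : ℕ, ∑ l ∈ range a, φ (X ^ l) * y⁻¹ ^ (l + 1)
      = pair x φ (ev x z) - y * (pair x (φ ∘ₗ mulLeft ℂ (X ^ a)) (ev x z) * y⁻¹ ^ (a + 1)) := fun a => by
    have hsumpair : ∀ s : Finset ℕ, pair x φ (∑ l ∈ s, y ^ (a - 1 - l) • powVec x l)
        = ∑ l ∈ s, y ^ (a - 1 - l) * φ (X ^ l) := fun s => by
      induction s using Finset.induction_on with
      | empty => simp [pair]
      | insert b s hb ih =>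
        rw [sum_insert hb, sum_insert hb, pair_add hφ, pair_smul, pair_powVec hx hφ, ih]
    rw [← pair_shiftX_iterate hx hφ, shiftX_iterate_ev hx h hz hy, pair_sub hφ, pair_smul, hsumpair]
    have h1 : ∀ l ∈ range a, φ (X ^ l) * y⁻¹ ^ (l + 1)
        = y * (y ^ (a - 1 - l) * φ (X ^ l) * y⁻¹ ^ (a + 1)) := fun l hl => by
      have hl := mem_range.1 hl
      obtain ⟨b, rfl⟩ : ∃ b, a = l + 1 + b := ⟨a - (l + 1), by omega⟩
      rw [show l + 1 + b - 1 - l = b by omega, inv_pow, inv_pow]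
      field_simp
      ring
    rw [sum_congr rfl h1, ← mul_sum, ← sum_mul]
    have h2 : y * (y ^ a * y⁻¹ ^ (a + 1)) = 1 := by
      rw [inv_pow, ← mul_assoc, ← pow_succ', mul_inv_cancel₀ (pow_ne_zero _ hy0)]
    linear_combination pair x φ (ev x z) * h2
  simp only [hpart]
  have htend : Filter.Tendsto (fun a : ℕ => y * (pair x (φ ∘ₗ mulLeft ℂ (X ^ a)) (ev x z)
      * y⁻¹ ^ (a + 1))) Filter.atTop (nhds 0) := by
    have h0 : Filter.Tendsto (fun a : ℕ => (‖y‖ * (‖y‖⁻¹ * C * nrm e (ev x z)))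
        * ((1 + a : ℝ) ^ e * t ^ a)) Filter.atTop (nhds 0) := by
      simpa using hgeo1.tendsto_atTop_zero.const_mul (‖y‖ * (‖y‖⁻¹ * C * nrm e (ev x z)))
    refine squeeze_zero_norm (fun a => ?_) h0
    rw [norm_mul, mul_assoc ‖y‖]
    refine mul_le_mul_of_nonneg_left ?_ (norm_nonneg _)
    have h1 : ∀ q, ‖(ev x z).1 q * (φ ∘ₗ mulLeft ℂ (X ^ a)) (chebP x q) * y⁻¹ ^ (a + 1)‖
        ≤ (‖y‖⁻¹ * C * ((1 + a : ℝ) ^ e * t ^ a)) * (‖(ev x z).1 q‖ * (1 + q : ℝ) ^ e) := fun q => by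
      rw [norm_mul, norm_mul, mul_assoc]
      calc _ ≤ ‖(ev x z).1 q‖ * (‖y‖⁻¹ * C * (1 + q : ℝ) ^ e * ((1 + a : ℝ) ^ e * t ^ a)) :=
            mul_le_mul_of_nonneg_left (hbd a q) (norm_nonneg _)
        _ = _ := by ring
    rw [pair, ← tsum_mul_right]
    refine (tsum_of_norm_bounded (((ev x z).summable e).mul_left _).hasSum h1).trans (le_of_eq ?_)
    rw [tsum_mul_left, nrm]
    ring
  simpa using tendsto_const_nhds.sub htend

end Pairing

/-! ### The inverse of the Joukowsky map -/

section Joukowsky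

/-- The segment `[-2 / √x, 2 / √x]` in the Riemann sphere. -/
def slit (x : ℝ) : Set (OnePoint ℂ) := {y | ∃ r : ℝ, |r| ≤ 2 / √x ∧ y = ((r : ℂ) : OnePoint ℂ)}

lemma coe_mem_slit {x : ℝ} {y : ℂ} : (y : OnePoint ℂ) ∈ slit x ↔ y.im = 0 ∧ |y.re| ≤ 2 / √x := by
  constructor
  · rintro ⟨r, hr, h⟩
    rw [OnePoint.coe_eq_coe] at h
    rw [h]
    exact ⟨Complex.ofReal_im r, by rwa [ofReal_re]⟩
  · rintro ⟨h1, h2⟩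
    exact ⟨y.re, h2, by rw [OnePoint.coe_eq_coe]; exact Complex.ext rfl (by simpa using h1)⟩

/-- The finite points off the cut. -/
abbrev OffSlit (x : ℝ) (y : ℂ) : Prop := (y : OnePoint ℂ) ∉ slit x

lemma isOpen_compl_slit (x : ℝ) : IsOpen {y : ℂ | (y : OnePoint ℂ) ∉ slit x} := by
  have h : {y : ℂ | (y : OnePoint ℂ) ∉ slit x} = {y : ℂ | y.im = 0 ∧ |y.re| ≤ 2 / √x}ᶜ := by
    ext y
    rw [Set.mem_setOf_eq, coe_mem_slit]
    rfl
  rw [h, isOpen_compl_iff]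
  exact (isClosed_eq Complex.continuous_im continuous_const).inter
    (isClosed_le (continuous_abs.comp Complex.continuous_re) continuous_const)

/-- The inverse of the Joukowsky map, as a function of `(w - 2) / (w + 2)`. -/
def cayley (t : ℂ) : ℂ := (1 - exp (log t / 2)) / (1 + exp (log t / 2))

lemma re_sqrt_pos {t : ℂ} (ht : t ∈ slitPlane) : 0 < (exp (log t / 2)).re := by
  rw [Complex.exp_re]
  refine mul_pos (Real.exp_pos _) (Real.cos_pos_of_mem_Ioo ?_)
  have h : (log t / 2).im = t.arg / 2 := by
    rw [← Complex.log_im]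
    simp
  have h1 := Complex.neg_pi_lt_arg t
  have h2 := (Complex.arg_le_pi t).lt_of_ne (Complex.mem_slitPlane_iff_arg.1 ht).1
  rw [h]
  constructor <;> linarith

lemma one_add_ne_zero_of_re_pos {s : ℂ} (hs : 0 < s.re) : 1 + s ≠ 0 := fun h => by
  have := congrArg Complex.re h
  simp at this
  linarith

lemma norm_cayley_lt_one {t : ℂ} (ht : t ∈ slitPlane) : ‖cayley t‖ < 1 := by
  have hs := re_sqrt_pos ht
  rw [cayley]
  set s := exp (log t / 2)
  rw [norm_div, div_lt_one (norm_pos_iff.2 (one_add_ne_zero_of_re_pos hs)),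
    ← sq_lt_sq₀ (norm_nonneg _) (norm_nonneg _), Complex.sq_norm, Complex.sq_norm, Complex.normSq_apply,
    Complex.normSq_apply]
  simp
  nlinarith

lemma differentiableAt_cayley {t : ℂ} (ht : t ∈ slitPlane) : DifferentiableAt ℂ cayley t := by
  have h : DifferentiableAt ℂ (fun t => exp (log t / 2)) t :=
    ((differentiableAt_id.clog ht).div_const 2).cexp
  exact ((differentiableAt_const 1).sub h).div ((differentiableAt_const 1).add h)
    (one_add_ne_zero_of_re_pos (re_sqrt_pos ht))

lemma cayley_add_inv {t : ℂ} (ht : t ∈ slitPlane) (h1 : t ≠ 1) :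
    cayley t ≠ 0 ∧ cayley t + (cayley t)⁻¹ = 2 * (1 + t) / (1 - t) := by
  have hs := one_add_ne_zero_of_re_pos (re_sqrt_pos ht)
  have hsq : exp (log t / 2) ^ 2 = t := by
    rw [← Complex.exp_nat_mul]
    push_cast
    rw [mul_div_cancel₀ _ two_ne_zero, Complex.exp_log (Complex.slitPlane_ne_zero ht)]
  rw [cayley]
  set s := exp (log t / 2)
  have hs1 : 1 - s ≠ 0 := fun h => h1 (by rw [← hsq, ← sub_eq_zero.1 h, one_pow])
  refine ⟨div_ne_zero hs1 hs, ?_⟩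
  have ht1 : 1 - t ≠ 0 := sub_ne_zero.2 (Ne.symm h1)
  rw [inv_div, div_add_div _ _ hs hs1, div_eq_div_iff (mul_ne_zero hs hs1) ht1, ← hsq]
  ring

lemma mem_slitPlane_of {w : ℂ} (hw : ¬(w.im = 0 ∧ |w.re| ≤ 2)) :
    w + 2 ≠ 0 ∧ (w - 2) / (w + 2) ∈ slitPlane := by
  have h2 : w + 2 ≠ 0 := fun h => by
    rw [eq_neg_of_add_eq_zero_left h] at hw
    norm_num at hw
  refine ⟨h2, ?_⟩
  by_contra hn
  rw [Complex.mem_slitPlane_iff, not_or, not_lt, not_ne_iff] at hn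
  set t := (w - 2) / (w + 2) with ht
  have htr : t = (t.re : ℂ) := Complex.ext rfl (by simpa using hn.2)
  have h3 : (w - 2) = t.re * (w + 2) := by rw [← htr, ht, div_mul_cancel₀ _ h2]
  have hpos : (0 : ℝ) < 1 - t.re := by linarith [hn.1]
  have h4 : w = ((2 * (1 + t.re) / (1 - t.re) : ℝ) : ℂ) := by
    have : (1 - (t.re : ℂ)) ≠ 0 := by exact_mod_cast hpos.ne'
    push_cast
    rw [eq_div_iff this]
    linear_combination h3
  rw [h4, Complex.ofReal_im, ofReal_re] at hw
  refine hw ⟨rfl, ?_⟩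
  rw [abs_le, le_div_iff₀ hpos, div_le_iff₀ hpos]
  constructor <;> linarith [hn.1]

variable {x : ℝ}

/-- The inverse of the Joukowsky map `z ↦ (z + 1 / z) / √x`, with values in the unit disc. -/
def zc (x : ℝ) (y : OnePoint ℂ) : ℂ :=
  y.elim 0 fun y => cayley (((√x : ℂ) * y - 2) / ((√x : ℂ) * y + 2))

lemma sqrt_mul_notMem (hx : 0 < x) {y : ℂ} (hy : (y : OnePoint ℂ) ∉ slit x) :
    ¬(((√x : ℂ) * y).im = 0 ∧ |((√x : ℂ) * y).re| ≤ 2) := by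
  have hs := sqrt_pos.2 hx
  rw [coe_mem_slit] at hy
  rw [Complex.re_ofReal_mul, Complex.im_ofReal_mul, abs_mul, abs_of_pos hs]
  rintro ⟨h1, h2⟩
  refine hy ⟨(mul_eq_zero.1 h1).resolve_left hs.ne', ?_⟩
  rwa [le_div_iff₀ hs, mul_comm]

lemma norm_zc_lt_one (hx : 0 < x) {y : OnePoint ℂ} (hy : y ∉ slit x) : ‖zc x y‖ < 1 := by
  induction y using OnePoint.rec with
  | infty => simp [zc]
  | coe y => exact norm_cayley_lt_one (mem_slitPlane_of (sqrt_mul_notMem hx hy)).2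

lemma zc_add_inv (hx : 0 < x) {y : ℂ} (hy : OffSlit x y) :
    zc x y ≠ 0 ∧ zc x y + (zc x y)⁻¹ = (√x : ℂ) * y := by
  obtain ⟨h1, h2⟩ := mem_slitPlane_of (sqrt_mul_notMem hx hy)
  have h3 : ((√x : ℂ) * y - 2) / ((√x : ℂ) * y + 2) ≠ 1 := fun h => by
    rw [div_eq_one_iff_eq h1] at h
    have : (4 : ℂ) = 0 := by linear_combination (-1 : ℂ) * h
    norm_num at this
  obtain ⟨h4, h5⟩ := cayley_add_inv h2 h3
  refine ⟨h4, h5.trans ?_⟩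
  rw [div_eq_iff (sub_ne_zero.2 (Ne.symm h3))]
  field_simp
  ring

lemma eq_of_add_inv_eq {z z' : ℂ} (h : ‖z‖ < 1) (h' : ‖z'‖ < 1) (hz : z ≠ 0) (hz' : z' ≠ 0)
    (he : z + z⁻¹ = z' + z'⁻¹) : z = z' := by
  have h1 : (z - z') * (z * z' - 1) = 0 := by
    field_simp at he
    linear_combination he
  refine sub_eq_zero.1 ((mul_eq_zero.1 h1).resolve_right fun h2 => ?_)
  have h3 : ‖z‖ * ‖z'‖ = 1 := by rw [← norm_mul, sub_eq_zero.1 h2, norm_one]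
  nlinarith [norm_nonneg z, norm_nonneg z']

lemma joukowsky_notMem_slit (hx : 0 < x) {z : ℂ} (h : ‖z‖ < 1) (hz : z ≠ 0) :
    (((z + z⁻¹) / (√x : ℂ) : ℂ) : OnePoint ℂ) ∉ slit x := by
  have hs := sqrt_pos.2 hx
  rw [coe_mem_slit, Complex.div_ofReal_im, Complex.div_ofReal_re, div_eq_zero_iff, abs_div,
    abs_of_pos hs, div_le_div_iff_of_pos_right hs]
  rintro ⟨h1, h2⟩
  have h1 := h1.resolve_right hs.ne'
  have hn : 0 < normSq z := Complex.normSq_pos.2 hz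
  have hn1 : normSq z < 1 := by
    rw [Complex.normSq_eq_norm_sq]
    nlinarith [norm_nonneg z]
  rw [Complex.add_im, Complex.inv_im] at h1
  rw [Complex.add_re, Complex.inv_re] at h2
  have him : z.im = 0 := by
    have h3 : z.im * (normSq z - 1) = 0 := by
      field_simp at h1
      linear_combination h1
    exact (mul_eq_zero.1 h3).resolve_right (by linarith)
  have hsq : normSq z = z.re ^ 2 := by rw [Complex.normSq_apply, him]; ring
  have hre : z.re ≠ 0 := fun h0 => by rw [hsq, h0] at hn; norm_num at hn
  have h5 : (z.re + z.re / normSq z) ^ 2 ≤ 2 ^ 2 := by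
    rw [← abs_of_pos (zero_lt_two' ℝ)] at h2
    exact sq_le_sq.2 h2
  have h6 : z.re + z.re / normSq z = (normSq z + 1) / z.re := by
    rw [hsq]; field_simp
  rw [h6, div_pow, ← hsq, div_le_iff₀ hn] at h5
  nlinarith [sq_nonneg (normSq z - 1), sq_pos_of_neg (by linarith : normSq z - 1 < 0)]

lemma zc_joukowsky (hx : 0 < x) {z : ℂ} (h : ‖z‖ < 1) (hz : z ≠ 0) :
    zc x (((z + z⁻¹) / (√x : ℂ) : ℂ) : OnePoint ℂ) = z := by
  have hy := joukowsky_notMem_slit hx h hz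
  obtain ⟨h1, h2⟩ := zc_add_inv hx hy
  refine eq_of_add_inv_eq (norm_zc_lt_one hx hy) h h1 hz (h2.trans ?_)
  rw [mul_div_cancel₀ _ (sqrt_ne_zero_of_pos hx)]

lemma differentiableAt_zc (hx : 0 < x) (b : Bool) {u : ℂ} (hu : chart b u ∉ slit x) :
    DifferentiableAt ℂ (fun u => zc x (chart b u)) u := by
  have hs := sqrt_ne_zero_of_pos hx
  rcases b with _ | _
  · have hu : OffSlit x u := hu
    obtain ⟨h1, h2⟩ := mem_slitPlane_of (sqrt_mul_notMem hx hu)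
    have h3 : DifferentiableAt ℂ (fun u : ℂ => ((√x : ℂ) * u - 2) / ((√x : ℂ) * u + 2)) u :=
      ((differentiableAt_id.const_mul _).sub_const _).div
        ((differentiableAt_id.const_mul _).add_const _) h1
    exact (differentiableAt_cayley h2).comp u h3
  · have hfun : (fun u => zc x (chart true u)) = fun u : ℂ =>
        cayley (((√x : ℂ) - 2 * u) / ((√x : ℂ) + 2 * u)) := by
      funext u
      by_cases h0 : u = 0
      · simp [h0, chart, zc, cayley, div_self hs]
      · simp only [chart, if_true, if_neg h0, zc, OnePoint.elim_some]
        congr 1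
        rw [← mul_div_mul_right _ _ h0]
        congr 1 <;> field_simp
    have key : (√x : ℂ) + 2 * u ≠ 0 ∧ ((√x : ℂ) - 2 * u) / ((√x : ℂ) + 2 * u) ∈ slitPlane := by
      by_cases h0 : u = 0
      · simp [h0, div_self hs, hs]
      · have hu : ((u⁻¹ : ℂ) : OnePoint ℂ) ∉ slit x := by simpa [chart, h0] using hu
        obtain ⟨h1, h2⟩ := mem_slitPlane_of (sqrt_mul_notMem hx hu)
        have e1 : (√x : ℂ) + 2 * u = ((√x : ℂ) * u⁻¹ + 2) * u := by field_simp
        have e2 : (√x : ℂ) - 2 * u = ((√x : ℂ) * u⁻¹ - 2) * u := by field_simp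
        rw [e1, e2, mul_div_mul_right _ _ h0]
        exact ⟨mul_ne_zero h1 h0, h2⟩
    rw [hfun]
    have h3 : DifferentiableAt ℂ (fun u : ℂ => ((√x : ℂ) - 2 * u) / ((√x : ℂ) + 2 * u)) u :=
      ((differentiableAt_id.const_mul _).const_sub _).div
        ((differentiableAt_id.const_mul _).const_add _) key.1
    exact DifferentiableAt.comp u (differentiableAt_cayley key.2) h3

end Joukowsky

/-! ### Pairings with the resolvent -/

section Resolvent
variable {x : ℝ} {φ : ℂ[X] →ₗ[ℂ] ℂ}

/-- The sequence that represents `1 / (y - X)`. -/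
def evPt (x : ℝ) (y : OnePoint ℂ) : Vec := ev x (zc x y)

lemma shiftX_evPt (hx : 0 < x) {y : ℂ} (hy : OffSlit x y) :
    shiftX x (evPt x y) = y • evPt x y - delta 0 :=
  Vec.shiftX_ev hx (norm_zc_lt_one hx hy) (zc_add_inv hx hy).1 (zc_add_inv hx hy).2

lemma shiftX_iterate_evPt (hx : 0 < x) {y : ℂ} (hy : OffSlit x y) (a : ℕ) :
    (shiftX x)^[a] (evPt x y)
      = y ^ a • evPt x y - ∑ l ∈ range a, y ^ (a - 1 - l) • powVec x l :=
  shiftX_iterate_ev hx (norm_zc_lt_one hx hy) (zc_add_inv hx hy).1 (zc_add_inv hx hy).2 a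

lemma notMem_slit_of_lt {y : ℂ} (h : 2 / √x < ‖y‖) : OffSlit x y := by
  rintro ⟨r, hr, he⟩
  rw [OnePoint.coe_eq_coe.1 he, norm_real] at h
  exact absurd hr (not_le.2 h)

lemma hasSum_pair_evPt (hx : 0 < x) (hφ : TameForm x φ) {y : ℂ} (h : 2 / √x < ‖y‖) :
    HasSum (fun a : ℕ => φ (X ^ a) * y⁻¹ ^ (a + 1)) (pair x φ (evPt x y)) :=
  hasSum_pair_ev hx hφ (norm_zc_lt_one hx (notMem_slit_of_lt h)) (zc_add_inv hx (notMem_slit_of_lt h)).1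
    (zc_add_inv hx (notMem_slit_of_lt h)).2 h

lemma continuousAt_pair_ev (hφ : TameForm x φ) {z : ℂ} (hz : ‖z‖ < 1) :
    ContinuousAt (fun z => pair x φ (ev x z)) z := by
  obtain ⟨ρ, h1, h2⟩ := exists_between hz
  have hρ0 : 0 ≤ ρ := (norm_nonneg z).trans h1.le
  have hρ : ‖(ρ : ℂ)‖ < 1 := by rwa [norm_real, norm_of_nonneg hρ0]
  have hmem : z ∈ Metric.ball (0 : ℂ) ρ := by simpa using h1
  have hc : ContinuousOn (fun z : ℂ => ∑' q : ℕ, (√x : ℂ) * z ^ (q + 1) * φ (chebP x q))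
      (Metric.ball 0 ρ) := by
    refine continuousOn_tsum (fun q => by fun_prop) (hφ.summable (ev x ρ)).norm fun q w hw => ?_
    have hw : ‖w‖ ≤ ρ := by simpa using (Metric.mem_ball.1 hw).le
    rw [ev_apply x hρ, norm_mul, norm_mul, norm_mul, norm_mul, norm_pow, norm_pow,
      norm_real ρ, norm_of_nonneg hρ0]
    gcongr
  refine (hc.continuousAt (Metric.isOpen_ball.mem_nhds hmem)).congr ?_
  filter_upwards [Metric.isOpen_ball.mem_nhds hmem] with w hw
  have hw : ‖w‖ < 1 := lt_trans (by simpa using hw) h2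
  exact tsum_congr fun q => by rw [ev_apply x hw]

lemma continuousAt_pair_evPt (hx : 0 < x) (hφ : TameForm x φ) {y : ℂ} (hy : OffSlit x y) :
    ContinuousAt (fun y : ℂ => pair x φ (evPt x y)) y :=
  ContinuousAt.comp (g := fun z => pair x φ (ev x z)) (continuousAt_pair_ev hφ (norm_zc_lt_one hx hy))
    (differentiableAt_zc hx false hy).continuousAt

/-- The linear form `f ↦ φ (f * ∑ q, L q * P_q)`. -/
def mulForm (hφ : TameForm x φ) (hx : 0 < x) (L : Vec) : ℂ[X] →ₗ[ℂ] ℂ where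
  toFun f := pair x (φ ∘ₗ mulLeft ℂ f) L
  map_add' f g := by
    rw [pair, pair, pair, ← ((hφ.comp_mul hx f).summable L).tsum_add ((hφ.comp_mul hx g).summable L)]
    exact tsum_congr fun q => by simp [add_mul, mul_add]
  map_smul' z f := by
    rw [pair, pair, RingHom.id_apply, smul_eq_mul, ← tsum_mul_left]
    exact tsum_congr fun q => by simp; ring

lemma mulForm_apply (hφ : TameForm x φ) (hx : 0 < x) (L : Vec) (f : ℂ[X]) :
    mulForm hφ hx L f = pair x (φ ∘ₗ mulLeft ℂ f) L := rfl

lemma pBdd_chebP_mul_chebP (hφ : TameForm x φ) :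
    PBdd addWt fun z => φ (chebP x z.1 * chebP x z.2) :=
  (PolyBdd.mul_chebP _ PolyBdd.cheb).apply hφ

lemma tameForm_mulForm (hφ : TameForm x φ) (hx : 0 < x) (L : Vec) : TameForm x (mulForm hφ hx L) :=
  L.pBdd_tsum (wt := fun q : ℕ => q) (pBdd_chebP_mul_chebP hφ)

lemma mulForm_evPt_X_mul (hφ : TameForm x φ) (hx : 0 < x) {y : ℂ} (hy : OffSlit x y)
    (f : ℂ[X]) : mulForm hφ hx (evPt x y) (X * f) = y * mulForm hφ hx (evPt x y) f - φ f := by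
  rw [mulForm_apply, mulForm_apply, mul_comm X f, ← comp_mul_comp_mul, ← pair_shiftX hx (hφ.comp_mul hx f),
    shiftX_evPt hx hy, pair_sub (hφ.comp_mul hx f), pair_smul, pair_delta]
  simp [chebP_zero]

lemma pair_mulForm_evPt (hφ : TameForm x φ) (hx : 0 < x) {y y' : ℂ} (hy : OffSlit x y)
    (hy' : OffSlit x y') : (y' - y) * pair x (mulForm hφ hx (evPt x y)) (evPt x y')
      = pair x φ (evPt x y) - pair x φ (evPt x y') := by
  have hψ := tameForm_mulForm hφ hx (evPt x y)
  have h1 := pair_shiftX hx hψ (evPt x y')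
  rw [shiftX_evPt hx hy', pair_sub hψ, pair_smul, pair_delta, chebP_zero] at h1
  have h2 : pair x (mulForm hφ hx (evPt x y) ∘ₗ mulLeft ℂ X) (evPt x y')
      = y * pair x (mulForm hφ hx (evPt x y)) (evPt x y') - pair x φ (evPt x y') := by
    rw [pair, pair, pair, ← tsum_mul_left, ← ((hψ.summable _).mul_left y).tsum_sub (hφ.summable _)]
    refine tsum_congr fun q => ?_
    rw [comp_apply, mulLeft_apply, mulForm_evPt_X_mul hφ hx hy]
    ring
  have h3 : mulForm hφ hx (evPt x y) 1 = pair x φ (evPt x y) := by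
    rw [mulForm_apply, pair, pair]
    simp
  rw [h2, h3] at h1
  linear_combination h1

lemma tsum_ev_antidiagonal (hx : 0 < x) {z : ℂ} (hz : ‖z‖ < 1) {f : ℕ × ℕ → ℂ}
    (hf : PBdd addWt f) {g : ℕ → ℂ} (hg : PBdd natWt g) (h0 : g 0 = 0)
    (h1 : ∀ q, g (q + 1) = (√x : ℂ) * ∑ p ∈ antidiagonal q, f p) :
    ∑' q, (ev x z).1 q * g q = ∑' a, (ev x z).1 a * ∑' b, (ev x z).1 b * f (a, b) := by
  obtain ⟨C, e, hC, hb⟩ := hf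
  set L := ev x z with hL
  have hs : Summable fun p : ℕ × ℕ => L.1 p.1 * (L.1 p.2 * f p) := by
    refine Summable.of_norm_bounded (((L.summable e).mul_of_nonneg (L.summable e)
      (fun q => by positivity) (fun q => by positivity)).mul_left C) fun z => ?_
    rw [norm_mul, norm_mul]
    have h1 := one_add_add_pow_le z.1 z.2 e
    calc ‖L.1 z.1‖ * (‖L.1 z.2‖ * ‖f z‖)
        ≤ ‖L.1 z.1‖ * (‖L.1 z.2‖ * (C * ((1 + z.1 : ℝ) ^ e * (1 + z.2 : ℝ) ^ e))) := by
          gcongr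
          exact (hb z).trans (by gcongr)
      _ = _ := by ring
  have hs' := (Finset.HasAntidiagonal.sigmaAntidiagonalEquivProd.summable_iff).2 hs
  rw [(L.summable_mul hg).tsum_eq_zero_add, h0, mul_zero, zero_add]
  calc ∑' q, L.1 (q + 1) * g (q + 1)
      = ∑' q : ℕ, ∑' p : antidiagonal q, L.1 p.1.1 * (L.1 p.1.2 * f p.1) := by
        refine tsum_congr fun q => ?_
        rw [tsum_fintype, Finset.sum_coe_sort (antidiagonal q)
          fun p => L.1 p.1 * (L.1 p.2 * f p), h1, mul_sum, mul_sum]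
        refine sum_congr rfl fun p hp => ?_
        have hp := mem_antidiagonal.1 hp
        rw [hL, ev_apply x hz, ev_apply x hz, ev_apply x hz, ← hp]
        ring
    _ = ∑' p : ℕ × ℕ, L.1 p.1 * (L.1 p.2 * f p) := by
        rw [← Finset.HasAntidiagonal.sigmaAntidiagonalEquivProd.tsum_eq]
        exact hs'.tsum_sigma.symm
    _ = ∑' a, ∑' b, L.1 a * (L.1 b * f (a, b)) := hs.tsum_prod
    _ = _ := tsum_congr fun a => tsum_mul_left

lemma hasDerivAt_pair_evPt (hx : 0 < x) (hφ : TameForm x φ) {y : ℂ} (hy : OffSlit x y) :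
    HasDerivAt (fun y : ℂ => pair x φ (evPt x y)) (-pair x (mulForm hφ hx (evPt x y)) (evPt x y)) y := by
  rw [hasDerivAt_iff_tendsto_slope]
  have h1 : Filter.Tendsto (fun y' : ℂ => -pair x (mulForm hφ hx (evPt x y)) (evPt x y'))
      (nhdsWithin y {y}ᶜ) (nhds (-pair x (mulForm hφ hx (evPt x y)) (evPt x y))) :=
    ((continuousAt_pair_evPt hx (tameForm_mulForm hφ hx _) hy).neg.tendsto).mono_left nhdsWithin_le_nhds
  refine h1.congr' ?_
  filter_upwards [self_mem_nhdsWithin, mem_nhdsWithin_of_mem_nhds ((isOpen_compl_slit x).mem_nhds hy)]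
    with y' hne hy'
  have hne : y' - y ≠ 0 := sub_ne_zero.2 hne
  rw [slope_def_field, eq_div_iff hne]
  linear_combination (-1 : ℂ) * pair_mulForm_evPt hφ hx hy hy'

lemma pair_comp_derivative (hx : 0 < x) (hφ : TameForm x φ) {y : ℂ} (hy : OffSlit x y) :
    pair x (φ ∘ₗ derivative) (evPt x y) = -deriv (fun y : ℂ => pair x φ (evPt x y)) y := by
  rw [(hasDerivAt_pair_evPt hx hφ hy).deriv, neg_neg]
  refine tsum_ev_antidiagonal hx (norm_zc_lt_one hx hy) (pBdd_chebP_mul_chebP hφ)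
    ((PolyBdd.derivative (x := x)).apply hφ) ?_ fun q => ?_
  · simp [chebP_zero]
  · rw [comp_apply, derivative_chebP, map_smul, map_sum, smul_eq_mul]

lemma pair_mulForm_eq_dslope (hx : 0 < x) (hφ : TameForm x φ) {y y' : ℂ}
    (hy : OffSlit x y) (hy' : OffSlit x y') :
    pair x (mulForm hφ hx (evPt x y)) (evPt x y')
      = -dslope (fun y : ℂ => pair x φ (evPt x y)) y y' := by
  by_cases h : y' = y
  · rw [h, dslope_same, (hasDerivAt_pair_evPt hx hφ hy).deriv, neg_neg]
  · rw [dslope_of_ne _ h, slope_def_field, ← neg_div, eq_div_iff (sub_ne_zero.2 h)]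
    linear_combination pair_mulForm_evPt hφ hx hy hy'

/-- The terms with a derivative in the loop equations. -/
lemma pair_mulForm_comp_derivative (hx : 0 < x) (hφ : TameForm x φ) {y y' : ℂ}
    (hy : OffSlit x y) (hy' : OffSlit x y') :
    pair x (mulForm hφ hx (evPt x y) ∘ₗ derivative) (evPt x y')
      = deriv (dslope (fun y : ℂ => pair x φ (evPt x y)) y) y' := by
  rw [pair_comp_derivative hx (tameForm_mulForm hφ hx _) hy', ← deriv.fun_neg]
  refine Filter.EventuallyEq.deriv_eq ?_
  filter_upwards [(isOpen_compl_slit x).mem_nhds hy'] with w hw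
  rw [pair_mulForm_eq_dslope hx hφ hy hw, neg_neg]

end Resolvent

/-! ### Sums over several indices -/

section MultiSum

lemma hasSum_pi_prod {n : ℕ} (a : Fin n → ℕ → ℝ) (S : Fin n → ℝ) (h0 : ∀ j q, 0 ≤ a j q)
    (h : ∀ j, HasSum (a j) (S j)) : HasSum (fun p : Fin n → ℕ => ∏ j, a j (p j)) (∏ j, S j) := by
  induction n with
  | zero => simpa using hasSum_unique fun _ : Fin 0 → ℕ => (1 : ℝ)
  | succ n ih =>
    have h1 := ih (fun j => a j.succ) (fun j => S j.succ) (fun j => h0 _) (fun j => h _)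
    have hnn : (0 : (Fin n → ℕ) → ℝ) ≤ fun p => ∏ j : Fin n, a j.succ (p j) := fun p =>
      prod_nonneg fun j _ => h0 _ _
    have h2 : HasSum (fun x : ℕ × (Fin n → ℕ) => a 0 x.1 * ∏ j : Fin n, a j.succ (x.2 j))
        (S 0 * ∏ j : Fin n, S j.succ) :=
      HasSum.mul (f := a 0) (g := fun p : Fin n → ℕ => ∏ j : Fin n, a j.succ (p j)) (h 0) h1
        (Summable.mul_of_nonneg (f := a 0) (g := fun p : Fin n → ℕ => ∏ j : Fin n, a j.succ (p j))
          (h 0).summable h1.summable (h0 0) hnn)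
    rw [← (Fin.consEquiv fun _ : Fin (n + 1) => ℕ).hasSum_iff, Fin.prod_univ_succ]
    exact h2.congr_fun fun p => by simp [Fin.prod_univ_succ, Fin.consEquiv]

lemma hasSum_of_slots {Y : Type} {n : ℕ} (H : (Fin n → Y) → ℂ) (e : Fin n → ℕ → Y) (t : Fin n → Y)
    (α : Fin n → ℕ → ℂ)
    (hslot : ∀ v j, HasSum (fun q => α j q * H (update v j (e j q))) (H (update v j (t j))))
    (hs : Summable fun p : Fin n → ℕ => (∏ j, α j (p j)) * H fun j => e j (p j)) :
    HasSum (fun p : Fin n → ℕ => (∏ j, α j (p j)) * H fun j => e j (p j)) (H t) := by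
  induction n with
  | zero =>
    have h : HasSum (fun p : Fin 0 → ℕ => (∏ j, α j (p j)) * H fun j => e j (p j)) _ := hasSum_unique _
    convert h using 1
    rw [univ_eq_empty, prod_empty, one_mul]
    exact congrArg H (Subsingleton.elim _ _)
  | succ n ih =>
    let E := Fin.consEquiv fun _ : Fin (n + 1) => ℕ
    rw [← E.summable_iff] at hs
    rw [← E.hasSum_iff]
    have hfun : ((fun p : Fin (n + 1) → ℕ => (∏ j, α j (p j)) * H fun j => e j (p j)) ∘ E) = fun x : ℕ × (Fin n → ℕ) => α 0 x.1 *
          ((∏ j : Fin n, α j.succ (x.2 j)) * H (Fin.cons (e 0 x.1) fun j => e j.succ (x.2 j))) :=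
      funext fun x => by
        change (∏ j, α j ((Fin.cons x.1 x.2 : Fin (n + 1) → ℕ) j)) * H _ = _
        rw [Fin.prod_univ_succ, mul_assoc]
        simp only [Fin.cons_zero, Fin.cons_succ]
        congr 3
        funext j
        refine Fin.cases ?_ (fun j => ?_) j <;> simp [E]
    rw [hfun] at hs ⊢
    have hin : ∀ q, HasSum (fun p : Fin n → ℕ => α 0 q *
        ((∏ j : Fin n, α j.succ (p j)) * H (Fin.cons (e 0 q) fun j => e j.succ (p j))))
        (α 0 q * H (Fin.cons (e 0 q) fun j => t j.succ)) := fun q => by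
      by_cases h0 : α 0 q = 0
      · simp only [h0, zero_mul]
        exact hasSum_zero
      · refine HasSum.mul_left _ (ih (fun v => H (Fin.cons (e 0 q) v)) (fun j => e j.succ)
          (fun j => t j.succ) (fun j => α j.succ) (fun v j => ?_) ?_)
        · have := hslot (Fin.cons (e 0 q) v) j.succ
          simpa only [Fin.cons_update] using this
        · exact (summable_mul_left_iff h0).1 (hs.prod_factor q)
    have h1 := hs.hasSum.prod_fiberwise hin
    have h2 := hslot t 0
    have h3 : ∀ y, update t 0 y = Fin.cons y fun j => t j.succ := fun y => by
      funext j
      refine Fin.cases ?_ (fun j => ?_) j <;> simp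
    simp only [h3] at h2
    have h4 : H (Fin.cons (t 0) fun j => t j.succ) = H t := by
      rw [← h3, Function.update_eq_self]
    rw [h4] at h2
    rw [← h1.unique h2]
    exact hs.hasSum

lemma differentiableAt_tsum_monomials {n : ℕ} {Φ : (Fin n → ℕ) → ℂ} {C : ℝ} {e : ℕ}
    (hΦ : ∀ p, ‖Φ p‖ ≤ C * ∏ j, (1 + p j : ℝ) ^ e) {z : Fin n → ℂ} (hz : ∀ j, ‖z j‖ < 1) :
    DifferentiableAt ℂ (fun z : Fin n → ℂ => ∑' p : Fin n → ℕ, (∏ j, z j ^ (p j + 1)) * Φ p) z := by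
  have hC : 0 ≤ C := by
    have := (norm_nonneg _).trans (hΦ 0)
    simpa using this
  have hz1 : ‖z‖ < 1 := (pi_norm_lt_iff zero_lt_one).2 hz
  obtain ⟨ρ, hzρ, hρ1⟩ := exists_between hz1
  have hρ0 : 0 < ρ := (norm_nonneg z).trans_lt hzρ
  set D : (Fin n → ℕ) → (Fin n → ℂ) → Fin n → (Fin n → ℂ) →L[ℂ] ℂ := fun p w i =>
    (∏ j ∈ univ.erase i, w j ^ (p j + 1)) •
      (((p i + 1 : ℕ) : ℂ) * w i ^ (p i)) • ContinuousLinearMap.proj (R := ℂ) (φ := fun _ : Fin n => ℂ) i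
    with hD
  have hu : Summable fun p : Fin n → ℕ => C * n * ∏ j, ((1 + p j : ℝ) ^ (e + 1) * ρ ^ p j) :=
    ((hasSum_pi_prod (fun _ q => (1 + q : ℝ) ^ (e + 1) * ρ ^ q) _ (fun _ q => by positivity)
      fun _ => (summable_pow_mul_geometric (e + 1) hρ0.le hρ1).hasSum).summable).mul_left _
  refine (hasFDerivAt_tsum_of_isPreconnected (f' := fun p w => Φ p • ∑ i, D p w i) (s := Metric.ball 0 ρ) (x₀ := 0) hu
    Metric.isOpen_ball (convex_ball _ _).isPreconnected (fun p w _ => ?_) (fun p w hw => ?_)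
    (Metric.mem_ball_self hρ0) ?_ (by simpa using hzρ)).differentiableAt
  · have h1 : HasFDerivAt (fun w : Fin n → ℂ => ∏ j, w j ^ (p j + 1))
        (∑ i, D p w i) w := HasFDerivAt.finsetProd fun i _ => by
        have := (hasFDerivAt_apply (𝕜 := ℂ) i w).pow (p i + 1)
        simpa [nsmul_eq_mul] using this
    have h2 := h1.const_mul (Φ p)
    simpa only [mul_comm (Φ p)] using h2
  · have hw : ∀ j, ‖w j‖ ≤ ρ := fun j => (norm_le_pi_norm w j).trans (by simpa using (Metric.mem_ball.1 hw).le)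
    have hi : ∀ i, ‖D p w i‖ ≤ ∏ j, ((1 + p j : ℝ) * ρ ^ p j) := fun i => by
      have hproj : ‖ContinuousLinearMap.proj (R := ℂ) (φ := fun _ : Fin n => ℂ) i‖ ≤ 1 :=
        ContinuousLinearMap.opNorm_le_bound _ zero_le_one fun v => by
          simpa using norm_le_pi_norm v i
      rw [hD, norm_smul, norm_smul, ← mul_prod_erase _ _ (mem_univ i), norm_prod, norm_mul,
        norm_pow, Complex.norm_natCast, mul_comm]
      have h1 : ∏ j ∈ univ.erase i, ‖w j ^ (p j + 1)‖
          ≤ ∏ j ∈ univ.erase i, ((1 + p j : ℝ) * ρ ^ p j) := by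
        refine Finset.prod_le_prod (fun _ _ => norm_nonneg _) fun j _ => ?_
        rw [norm_pow]
        calc ‖w j‖ ^ (p j + 1) ≤ ρ ^ (p j + 1) := by gcongr; exact hw j
          _ ≤ 1 * ρ ^ (p j) := by
              rw [one_mul]
              exact pow_le_pow_of_le_one hρ0.le hρ1.le (Nat.le_succ _)
          _ ≤ (1 + p j : ℝ) * ρ ^ p j := by
              gcongr
              exact PBdd.one_le _
      refine mul_le_mul ?_ h1 (prod_nonneg fun _ _ => norm_nonneg _) (by positivity)
      calc ((p i + 1 : ℕ) : ℝ) * ‖w i‖ ^ p i * _ ≤ ((p i + 1 : ℕ) : ℝ) * ρ ^ p i * 1 := by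
            gcongr
            exact hw i
        _ = _ := by push_cast; ring
    rw [norm_smul]
    calc _ ≤ (C * ∏ j, (1 + p j : ℝ) ^ e) * (n * ∏ j, ((1 + p j : ℝ) * ρ ^ p j)) := by
          refine mul_le_mul (hΦ p) ?_ (norm_nonneg _) (by positivity)
          refine (norm_sum_le_of_le _ fun i _ => hi i).trans (le_of_eq ?_)
          simp
      _ = _ := by
          rw [mul_mul_mul_comm, ← prod_mul_distrib]
          exact congrArg _ (prod_congr rfl fun j _ => by ring)
  · have hu1 : Summable fun p : Fin n → ℕ => C * ∏ j, ((1 + p j : ℝ) ^ e * ρ ^ p j) :=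
      ((hasSum_pi_prod (fun _ q => (1 + q : ℝ) ^ e * ρ ^ q) _ (fun _ q => by positivity)
        fun _ => (summable_pow_mul_geometric e hρ0.le hρ1).hasSum).summable).mul_left _
    refine Summable.of_norm_bounded hu1 fun p => ?_
    rw [norm_mul, norm_prod, mul_comm, prod_mul_distrib, ← mul_assoc]
    refine mul_le_mul (hΦ p) (Finset.prod_le_prod (fun _ _ => norm_nonneg _) fun j _ => ?_)
      (prod_nonneg fun _ _ => norm_nonneg _) (by positivity)
    simp only [Pi.zero_apply]
    rw [zero_pow (succ_ne_zero _), norm_zero]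
    positivity

end MultiSum

/-- A function of several slots given by an absolutely convergent sum over the values at the unit
sequences. -/
structure SlotForm {n : ℕ} (H : (Fin n → Vec) → ℂ) : Prop where
  slot : ∀ v j (L : Vec), HasSum (fun q => L.1 q * H (update v j (delta q))) (H (update v j L))
  bound : ∃ (C : ℝ) (e : ℕ), 0 ≤ C ∧ ∀ p : Fin n → ℕ,
    ‖H fun j => delta (p j)‖ ≤ C * ∏ j, (1 + p j : ℝ) ^ e

namespace SlotForm
variable {n : ℕ} {H : (Fin n → Vec) → ℂ} 

lemma hasSum (hH : SlotForm H) (v : Fin n → Vec) :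
    HasSum (fun p : Fin n → ℕ => (∏ j, (v j).1 (p j)) * H fun j => delta (p j)) (H v) := by
  obtain ⟨C, e, hC, h⟩ := hH.bound
  refine hasSum_of_slots H (fun _ => delta) v (fun j => (v j).1)
    (fun w j => by simpa using hH.slot w j (v j)) ?_
  have h1 := (hasSum_pi_prod (fun j q => ‖(v j).1 q‖ * (1 + q : ℝ) ^ e) _
    (fun j q => by positivity) fun j => ((v j).summable e).hasSum).summable
  refine Summable.of_norm_bounded (h1.mul_left C) fun p => ?_
  rw [norm_mul, norm_prod, prod_mul_distrib, mul_left_comm]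
  exact mul_le_mul_of_nonneg_left (h p) (prod_nonneg fun _ _ => norm_nonneg _)

lemma exists_le (hH : SlotForm H) : ∃ (C : ℝ) (e : ℕ), 0 ≤ C ∧ ∀ v : Fin n → Vec,
    ‖H v‖ ≤ C * ∏ j, nrm e (v j) := by
  obtain ⟨C, e, hC, h⟩ := hH.bound
  refine ⟨C, e, hC, fun v => ?_⟩
  have h1 := (hasSum_pi_prod (fun j q => ‖(v j).1 q‖ * (1 + q : ℝ) ^ e) _
    (fun j q => by positivity) fun j => ((v j).summable e).hasSum).mul_left C
  rw [← (hH.hasSum v).tsum_eq]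
  refine tsum_of_norm_bounded h1 fun p => ?_
  rw [norm_mul, norm_prod, prod_mul_distrib, mul_left_comm]
  exact mul_le_mul_of_nonneg_left (h p) (prod_nonneg fun _ _ => norm_nonneg _)

lemma differentiableAt_ev (hH : SlotForm H) (x : Fin n → ℝ) {w : Fin n → ℂ} (hw : ∀ j, ‖w j‖ < 1) :
    DifferentiableAt ℂ (fun w : Fin n → ℂ => H fun j => ev (x j) (w j)) w := by
  obtain ⟨C, e, hC, h⟩ := hH.bound
  refine ((differentiableAt_tsum_monomials h hw).const_mul
    (∏ j, (√(x j) : ℂ))).congr_of_eventuallyEq ?_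
  have ho : ∀ᶠ u : Fin n → ℂ in nhds w, ∀ j, ‖u j‖ < 1 := Filter.eventually_all.2 fun j =>
    ((continuous_apply j).norm.tendsto w).eventually (gt_mem_nhds (hw j))
  filter_upwards [ho] with u hu
  rw [← (hH.hasSum _).tsum_eq, ← tsum_mul_left]
  refine tsum_congr fun p => ?_
  rw [← mul_assoc, ← prod_mul_distrib]
  congr 1
  exact prod_congr rfl fun j _ => ev_apply _ (hu j) _

end SlotForm

namespace CorrModel
variable {d : ℕ} {κ : Fin d → ℝ} (M : CorrModel κ)

/-! ### Correlators as functions of several variables -/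

lemma values_update {α β : Type} {n : ℕ} (c : Fin n → α) (v : Fin n → β) (j : Fin n) (y : β) :
    values (fun i => (c i, update v j y i))
      = (c j, y) ::ₘ (univ.erase j).val.map fun i => (c i, v i) := by
  rw [values, ← insert_erase (mem_univ j),
    insert_val_of_notMem (notMem_erase _ _), map_cons, update_self,
    erase_insert (notMem_erase _ _)]
  congr 1
  refine Multiset.map_congr rfl fun i hi => ?_
  rw [update_of_ne (ne_of_mem_erase (Finset.mem_def.2 hi))]

lemma values_succ {α : Type} {n : ℕ} (v : Fin (n + 1) → α) :
    values v = v 0 ::ₘ values fun j : Fin n => v j.succ := by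
  rw [values, Fin.univ_succ, cons_val, map_cons, map_val, map_map]
  rfl

/-- A coefficient of a correlator as a function of several slots. -/
def multiSlot {n : ℕ} (c : Fin n → Fin d) (A : Slots d) (m : Order d) (k : ℤ)
    (v : Fin n → Vec) : ℂ := coN m k (M.hat.corr (values (fun j => (c j, v j)) + A) : PS d LK)

lemma coN_hat_corr_cons' (i : Fin d) (L : Vec) (s : Slots d) (m : Order d)
    (k : ℤ) : coN m k (M.hat.corr ((i, L) ::ₘ s) : PS d LK) = pair (κ i) (M.slot i s m k) L :=
  M.coN_hat_corr_cons i L s m k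

lemma multiSlot_update {n : ℕ} (c : Fin n → Fin d) (A : Slots d)
    (m : Order d) (k : ℤ) (v : Fin n → Vec) (j : Fin n) (L : Vec) :
    M.multiSlot c A m k (update v j L) = pair (κ (c j))
      (M.slot (c j) ((univ.erase j).val.map (fun i => (c i, v i)) + A) m k) L := by
  rw [multiSlot, values_update, cons_add, coN_hat_corr_cons']

lemma tame_corr_delta {n : ℕ} (c : Fin n → Fin d) (A : Slots d) :
    M.Tame (fun p : Fin n → ℕ => ∑ j, p j)
      fun p => (M.hat.corr (values (fun j => (c j, delta (p j))) + A) : PS d LK) := by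
  induction n with
  | zero =>
    have h : ∀ p : Fin 0 → ℕ, values (fun j => (c j, delta (p j))) + A = A := fun p => by
      rw [values, univ_eq_empty]; simp
    simp only [h]
    exact tame_const _
  | succ n ih =>
    simp only [values_succ, cons_add]
    by_cases h0 : n = 0 ∧ A = 0
    · obtain ⟨rfl, rfl⟩ := h0
      have h : ∀ p : Fin (0 + 1) → ℕ, (M.hat.corr ((c 0, delta (p 0)) ::ₘ
          (values (fun j : Fin 0 => (c j.succ, delta (p j.succ))) + 0)) : PS d LK)
          = M.B.F (c 0, p 0) := fun p => by
        rw [add_zero, values, univ_eq_empty, Finset.empty_val, Multiset.map_zero,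
          corr_cons, iter_zero]
        exact delta_hsum (p 0) (tame_B_F (M := M) (c 0))
      simp only [h]
      exact (tame_B_F (c 0)).comp (fun p : Fin (0 + 1) → ℕ => p 0) 1 fun p => by simp [natWt]
    · have hne : ∀ p : Fin (n + 1) → ℕ,
          values (fun j : Fin n => (c j.succ, delta (p j.succ))) + A ≠ 0 := fun p h => by
        have := congrArg Multiset.card h
        simp only [Multiset.card_add, values, card_map, Finset.card_val, card_univ,
          Fintype.card_fin, Multiset.card_zero, Nat.add_eq_zero_iff, Multiset.card_eq_zero] at this
        exact h0 this
      have h : ∀ (q : ℕ) (s : Slots d), s ≠ 0 → (M.hat.corr ((c 0, delta q) ::ₘ s) : PS d LK)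
          = M.B.D (c 0, q) (M.hat.corr s : PS d LK) := fun q s hs => by
        have h1 := M.hat.iter_corr {(c 0, delta q)} _ hs
        rw [singleton_add] at h1
        rw [← h1]
        exact delta_hsum q (tame_B_D (M := M) (c 0) _)
      have h := fun p => h (p 0) _ (hne p)
      simp only [h]
      exact (ih fun j => c j.succ).insert.comp
        (fun p : Fin (n + 1) → ℕ => ((fun j : Fin n => p j.succ), (c 0, p 0))) 1 fun p => by
          dsimp only
          rw [Fin.sum_univ_succ]
          omega

variable {M} in
lemma Tame.exists_bound {n : ℕ} {y : (Fin n → ℕ) → PS d LK} (hy : M.Tame (fun p => ∑ j, p j) y)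
    (m : Order d) (k : ℤ) : ∃ (C : ℝ) (e : ℕ), 0 ≤ C ∧ ∀ p : Fin n → ℕ,
      ‖coN m k (y p)‖ ≤ C * ∏ j, (1 + p j : ℝ) ^ e := by
  obtain ⟨C, e, hC, h⟩ := hy.pBdd m k
  refine ⟨C, e, hC, fun p => (h p).trans ?_⟩
  rw [Finset.prod_pow]
  gcongr
  have : ∀ s : Finset (Fin n), (1 : ℝ) + (∑ j ∈ s, p j : ℕ) ≤ ∏ j ∈ s, (1 + p j : ℝ) := fun s => by
    induction s using Finset.induction_on with
    | empty => simp
    | insert a s ha ih =>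
      rw [sum_insert ha, prod_insert ha]
      have h1 : (0 : ℝ) ≤ (p a : ℝ) * (∑ j ∈ s, p j : ℕ) := by positivity
      push_cast at ih h1 ⊢
      nlinarith
  exact this univ

lemma slotForm_multiSlot {n : ℕ} (c : Fin n → Fin d) (A : Slots d)
    (m : Order d) (k : ℤ) : SlotForm (M.multiSlot c A m k) where
  slot v j L := by
    simp only [multiSlot_update, pair_delta]
    exact (TameForm.summable (M.pBdd_slot _ _ _ _) L).hasSum
  bound := (M.tame_corr_delta c A).exists_bound m k

lemma differentiableOn_multiSlot {n : ℕ} (c : Fin n → Fin d) (A : Slots d)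
    (m : Order d) (k : ℤ) (b : Fin n → Bool) :
    DifferentiableOn ℂ (fun u : Fin n → ℂ =>
      M.multiSlot c A m k fun j => evPt (κ (c j)) (chart (b j) (u j)))
      {u | ∀ j, chart (b j) (u j) ∉ slit (κ (c j))} := fun u hu =>
  (DifferentiableAt.comp u ((M.slotForm_multiSlot c A m k).differentiableAt_ev (fun j => κ (c j))
    fun j => norm_zc_lt_one (M.pos _) (hu j)) (differentiableAt_pi.2 fun j =>
      DifferentiableAt.comp (g := fun u => zc (κ (c j)) (chart (b j) u)) u
        (differentiableAt_zc (M.pos _) (b j) (hu j))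
        (differentiableAt_apply j u))).differentiableWithinAt

lemma exists_hasSum_multiSlot_evPt {n : ℕ} (c : Fin n → Fin d) (A : Slots d)
    (m : Order d) (k : ℤ) : ∃ R : ℝ, ∀ y : Fin n → ℂ, (∀ j, R < ‖y j‖) →
      HasSum (fun p : Fin n → ℕ => (M.multiSlot c A m k fun j => powVec (κ (c j)) (p j)) *
        ∏ j, (y j)⁻¹ ^ (p j + 1)) (M.multiSlot c A m k fun j => evPt (κ (c j)) (y j)) := by
  obtain ⟨C, e, hC, h⟩ := (M.slotForm_multiSlot c A m k).exists_le
  choose a ha0 ha using fun j => Vec.exists_nrm_powVec_le (κ (c j)) e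
  refine ⟨∑ j, (a j + 2 / √(κ (c j))), fun y hy => ?_⟩
  have hle : ∀ j, a j + 2 / √(κ (c j)) < ‖y j‖ := fun j =>
    lt_of_le_of_lt (single_le_sum (f := fun j => a j + 2 / √(κ (c j)))
      (fun i _ => by have := ha0 i; positivity) (mem_univ j)) (hy j)
  have hy2 : ∀ j, 2 / √(κ (c j)) < ‖y j‖ := fun j => by linarith [hle j, ha0 j]
  have hy1 : ∀ j, a j < ‖y j‖ := fun j => by
    have : (0 : ℝ) ≤ 2 / √(κ (c j)) := by positivity
    linarith [hle j]
  have hs := hasSum_of_slots (M.multiSlot c A m k) (fun j => powVec (κ (c j)))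
    (fun j => evPt (κ (c j)) (y j)) (fun j q => (y j)⁻¹ ^ (q + 1)) (fun v j => ?_) ?_
  · simpa only [mul_comm] using hs
  · simp only [multiSlot_update, pair_powVec (M.pos _) (M.pBdd_slot _ _ _ _)]
    have := hasSum_pair_evPt (M.pos _) (M.pBdd_slot (c j)
      ((univ.erase j).val.map (fun i => (c i, v i)) + A) m k) (hy2 j)
    simpa only [mul_comm] using this
  · have hg : ∀ j, Summable fun q : ℕ => ‖y j‖⁻¹ * (a j / ‖y j‖) ^ q := fun j => by
      have hpos : 0 < ‖y j‖ := (ha0 j).trans (hy1 j)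
      exact (summable_geometric_of_lt_one (by have := ha0 j; positivity)
        ((div_lt_one hpos).2 (hy1 j))).mul_left _
    have h1 := (hasSum_pi_prod (fun j q => ‖y j‖⁻¹ * (a j / ‖y j‖) ^ q) _
      (fun j q => by have := ha0 j; positivity) fun j => (hg j).hasSum).summable
    refine Summable.of_norm_bounded (h1.mul_left C) fun p => ?_
    rw [norm_mul, norm_prod]
    calc _ ≤ (∏ j, ‖(y j)⁻¹ ^ (p j + 1)‖) * (C * ∏ j, a j ^ p j) := by
          refine mul_le_mul_of_nonneg_left ((h _).trans ?_) (prod_nonneg fun _ _ => norm_nonneg _)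
          gcongr with j
          · intro j _; exact Vec.nrm_nonneg _ _
          · exact ha j _
      _ = _ := by
          rw [mul_left_comm, ← prod_mul_distrib]
          congr 1
          refine prod_congr rfl fun j _ => ?_
          rw [norm_pow, norm_inv, pow_succ, div_pow, inv_pow]
          ring

/-! ### Insertions of powers -/

lemma coe_hat_D_powVec (c : Fin d) (a : ℕ) (f : M.tameAlgebra) :
    (M.hat.D (c, powVec (κ c) a) f : PS d LK) = M.I.D (c, a) (f : PS d LK) :=
  coN_ext fun m k => by
    have h := pair_powVec (φ := coN m k ∘ₗ polyMap fun k' => M.I.D (c, k') (f : PS d LK)) (M.pos c)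
      (by
        have h1 := (tame_B_D c f).pBdd m k
        simp only [Insertions.comap, chebLabel, polyInsertions_D] at h1
        exact h1) a
    rw [comp_apply, polyMap_X_pow] at h
    rw [← h]
    refine (coN_hsum _ (tame_B_D c f) m k).trans (tsum_congr fun q => ?_)
    rw [comp_apply, ← polyInsertions_D]
    rfl

lemma coe_hat_F_powVec (c : Fin d) (a : ℕ) :
    (M.hat.F (c, powVec (κ c) a) : PS d LK) = M.I.F (c, a) :=
  coN_ext fun m k => by
    have h := pair_powVec (φ := coN m k ∘ₗ polyMap fun k' => M.I.F (c, k')) (M.pos c)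
      ((tame_B_F (M := M) c).pBdd m k) a
    rw [comp_apply, polyMap_X_pow] at h
    rw [← h]
    exact coN_hsum _ (tame_B_F c) m k

lemma coe_hat_corr_powVec (s : Labels d) :
    (M.hat.corr (s.map fun b => (b.1, powVec (κ b.1) b.2)) : PS d LK) = M.I.corr s := by
  rcases s.empty_or_exists_mem with rfl | ⟨b, hb⟩
  · simp
  · obtain ⟨s, rfl⟩ := exists_cons_of_mem hb
    rw [map_cons, corr_cons, corr_cons]
    clear hb
    induction s using induction_on with
    | empty => exact M.coe_hat_F_powVec b.1 b.2
    | cons a s ih =>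
      rw [map_cons, iter_cons, iter_cons, coe_hat_D_powVec, ih]

end CorrModel

end

section
open Polynomial
open MultiTrace.Insertions (corr_cons iter_cons iter_smul iter_zero_right iter_zero)
open Vec

variable {d : ℕ} {κ : Fin d → ℝ}

/-! ### The identity theorem off the cuts -/

section Identity

lemma laurent_finsupp_ext {w w' : ℤ →₀ ℂ} (h : ∀ N : ℕ, 0 < N →
    (w.sum fun k z => z * (N : ℂ) ^ k) = w'.sum fun k z => z * (N : ℂ) ^ k) : w = w' := by
  have h1 : (AddMonoidAlgebra.ofCoeff w : LaurentPolynomial ℂ) = AddMonoidAlgebra.ofCoeff w' :=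
    laurent_ext fun N hN => by
      rw [laurentEval_sizeUnit, laurentEval_sizeUnit]
      exact h N hN
  exact congrArg AddMonoidAlgebra.coeff h1

lemma eq_zero_off_slit_of_large {x : ℝ} (hx : 0 < x) {g : OnePoint ℂ → ℂ}
    (hol : ∀ b, DifferentiableOn ℂ (fun u => g (chart b u)) {u | chart b u ∉ slit x}) {R : ℝ}
    (h0 : ∀ y : ℂ, OffSlit x y → R < ‖y‖ → g y = 0) {y : OnePoint ℂ} (hy : y ∉ slit x) :
    g y = 0 := by
  have hs := sqrt_pos.2 hx
  induction y using OnePoint.rec with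
  | infty =>
    have h1 : {u | chart true u ∉ slit x} ∈ nhds (0 : ℂ) := by
      filter_upwards [Metric.ball_mem_nhds (0 : ℂ) (ε := ((2 / √x) + 1)⁻¹) (by positivity)] with u hu
      by_cases h : u = 0
      · simpa [chart, h] using hy
      · simp only [chart, if_true, h, if_false]
        refine notMem_slit_of_lt ?_
        rw [norm_inv]
        have h2 := (lt_inv_comm₀ (norm_pos_iff.2 h) (by positivity)).1 (mem_ball_zero_iff.1 hu)
        linarith
    have h2 : Filter.Tendsto (fun u => g (chart true u)) (nhdsWithin 0 {0}ᶜ)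
        (nhds (g (chart true 0))) :=
      ((hol true).differentiableAt h1).continuousAt.tendsto.mono_left nhdsWithin_le_nhds
    have h3 : Filter.Tendsto (fun u : ℂ => g (chart true u)) (nhdsWithin 0 {0}ᶜ) (nhds 0) := by
      refine tendsto_const_nhds.congr' ?_
      filter_upwards [self_mem_nhdsWithin, nhdsWithin_le_nhds h1, nhdsWithin_le_nhds
        (Metric.ball_mem_nhds (0 : ℂ) (ε := (|R| + 1)⁻¹) (by positivity))] with u hu h4 h5
      have hu : u ≠ 0 := hu
      simp only [chart, if_true, hu, if_false, Set.mem_ofPred_eq] at h4 ⊢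
      refine (h0 _ h4 ?_).symm
      rw [norm_inv]
      have h6 := (lt_inv_comm₀ (norm_pos_iff.2 hu) (by positivity)).1 (mem_ball_zero_iff.1 h5)
      linarith [le_abs_self R]
    simpa [chart] using tendsto_nhds_unique h2 h3
  | coe y =>
    obtain ⟨hz0, hz⟩ := zc_add_inv hx hy
    have hz1 := norm_zc_lt_one hx hy
    set U : Set ℂ := {w | w.re < 0} with hU
    have hexp : ∀ w ∈ U, ‖exp w‖ < 1 := fun w hw => by
      rw [Complex.norm_exp]
      rw [← Real.exp_zero]; exact Real.exp_lt_exp.2 hw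
    set J : ℂ → ℂ := fun w => (exp w + (exp w)⁻¹) / (√x : ℂ) with hJ
    have hJd : Differentiable ℂ J := fun w =>
      (Complex.differentiable_exp w).add ((Complex.differentiable_exp w).inv (Complex.exp_ne_zero w))
        |>.div_const _
    have hJm : ∀ w ∈ U, ((J w : ℂ) : OnePoint ℂ) ∉ slit x := fun w hw =>
      joukowsky_notMem_slit hx (hexp w hw) (Complex.exp_ne_zero w)
    have hUo : IsOpen U := isOpen_lt Complex.continuous_re continuous_const
    have hUc : Convex ℝ U := convex_halfSpace_re_lt 0
    have hd : DifferentiableOn ℂ (fun w => g (J w : ℂ)) U := fun w hw =>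
      (((hol false).differentiableAt ((isOpen_compl_slit x).mem_nhds (hJm w hw))).comp w
        (hJd w)).differentiableWithinAt
    set C : ℝ := (|R| + 1) * √x + 1 with hC
    have hCp : 1 < C := by
      have : 0 < (|R| + 1) * √x := by positivity
      linarith
    have hbig : ∀ w : ℂ, w.re < -Real.log C → g (J w : ℂ) = 0 := fun w hw => by
      have hw0 : w ∈ U := hw.trans (neg_lt_zero.2 (Real.log_pos hCp))
      refine h0 _ (hJm w hw0) ?_
      have h1 : C < ‖(exp w)⁻¹‖ := by
        rw [← Complex.exp_neg, Complex.norm_exp, Complex.neg_re]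
        exact (Real.log_lt_iff_lt_exp (by linarith)).1 (by linarith)
      have h2 := hexp w hw0
      have h3 : ‖(exp w)⁻¹‖ - ‖exp w‖ ≤ ‖exp w + (exp w)⁻¹‖ := by
        have := norm_sub_norm_le (exp w)⁻¹ (-exp w)
        rwa [norm_neg, sub_neg_eq_add, add_comm (exp w)⁻¹] at this
      rw [hJ, norm_div, norm_real, norm_of_nonneg hs.le, lt_div_iff₀ hs]
      nlinarith [le_abs_self R]
    set w₀ : ℂ := ((-Real.log C - 1 : ℝ) : ℂ) with hw₀
    have h1 := (hd.analyticOnNhd hUo).eqOn_zero_of_preconnected_of_eventuallyEq_zero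
      hUc.isPreconnected (z₀ := w₀) (by
        simp only [hU, hw₀, Set.mem_ofPred_eq, ofReal_re]
        linarith [Real.log_pos hCp])
      (by
        filter_upwards [(isOpen_lt Complex.continuous_re continuous_const).mem_nhds
          (show w₀.re < -Real.log C by rw [hw₀, ofReal_re]; linarith)] with w hw
        exact hbig w hw)
    have h2 := h1 (x := log (zc x y)) (by
      rw [hU, Set.mem_ofPred_eq, Complex.log_re]
      exact Real.log_neg (norm_pos_iff.2 hz0) hz1)
    simp only [hJ, Complex.exp_log hz0, hz, Pi.zero_apply] at h2
    rwa [mul_div_cancel_left₀ _ (sqrt_ne_zero_of_pos hx)] at h2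

lemma eq_zero_off_slits_of_large {n : ℕ} {r : Fin n → ℝ} (hr : ∀ j, 0 < r j)
    {G : (Fin n → OnePoint ℂ) → ℂ}
    (hol : ∀ b : Fin n → Bool, DifferentiableOn ℂ (fun u : Fin n → ℂ => G fun j => chart (b j) (u j))
      {u | ∀ j, chart (b j) (u j) ∉ slit (r j)}) {R : ℝ}
    (h0 : ∀ y : Fin n → ℂ, (∀ j, R < ‖y j‖) → G (fun j => y j) = 0) {y : Fin n → OnePoint ℂ}
    (hy : ∀ j, y j ∉ slit (r j)) : G y = 0 := by
  have hchart : ∀ y : OnePoint ℂ, ∃ b u, chart b u = y := fun y => by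
    induction y using OnePoint.rec with
    | infty => exact ⟨true, 0, by simp [chart]⟩
    | coe y => exact ⟨false, y, rfl⟩
  suffices H : ∀ S : Finset (Fin n), ∀ y : Fin n → OnePoint ℂ, (∀ j, y j ∉ slit (r j)) →
      (∀ j ∉ S, ∃ z : ℂ, y j = z ∧ R < ‖z‖) → G y = 0 from
    H univ y hy fun j hj => absurd (mem_univ j) hj
  intro S
  induction S using Finset.induction_on with
  | empty =>
    intro y _ h
    choose z hz hz' using fun j => h j (Finset.notMem_empty j)
    rw [funext hz]
    exact h0 z hz'
  | insert a S ha ih =>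
    intro y hy h
    have hupd : ∀ t, t ∉ slit (r a) → ∀ j, update y a t j ∉ slit (r j) := fun t ht j => by
      rcases eq_or_ne j a with rfl | hj <;> simp_all
    choose b u hbu using fun j => hchart (y j)
    have key := eq_zero_off_slit_of_large (x := r a) (hr a) (g := fun t => G (update y a t))
      (R := R) (fun b' => ?_) (fun t ht hR => ?_) (hy a)
    · simpa only [Function.update_eq_self] using key
    · have h1 := (hol (update b a b')).comp (g := fun u : Fin n → ℂ =>
        G fun j => chart (update b a b' j) (u j)) (f := fun t : ℂ => update u a t)
        (s := {t | chart b' t ∉ slit (r a)}) (fun t _ => ?_) (fun t ht j => ?_)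
      · refine h1.congr fun t _ => ?_
        simp only [Function.comp_apply]
        congr 1
        funext j
        rcases eq_or_ne j a with rfl | hj <;> simp_all
      · refine (differentiableAt_pi.2 fun j => ?_).differentiableWithinAt
        rcases eq_or_ne j a with rfl | hj <;> simp [*]
      · rcases eq_or_ne j a with rfl | hj <;> simp_all
    · refine ih _ (hupd _ ht) fun j hj => ?_
      rcases eq_or_ne j a with rfl | hja
      · exact ⟨t, update_self .., hR⟩
      · rw [update_of_ne hja]
        exact h j (by simp [hja, hj])

end Identity

/-! ### The correlation functions -/

lemma series_ext {f g : Series d} (h : ∀ m k, coeffN m k f = coeffN m k g) : f = g :=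
  coN_ext (f := (f : PS d LK)) (g := g) h

lemma exists_values_eq {α : Type} (s : Multiset α) : ∃ (n : ℕ) (v : Fin n → α), values v = s := by
  induction s using induction_on with
  | empty => exact ⟨0, Fin.elim0, by rw [values, univ_eq_empty]; rfl⟩
  | cons a s ih =>
    obtain ⟨n, v, rfl⟩ := ih
    exact ⟨n + 1, Fin.cons a v, by rw [CorrModel.values_succ]; simp⟩

lemma mem_values {ι α : Type} [Fintype ι] {v : ι → α} {a : α} : a ∈ values v ↔ ∃ i, v i = a := by
  simp [values]

lemma values_map {ι α β : Type} [Fintype ι] (v : ι → α) (f : α → β) :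
    (values v).map f = values fun i => f (v i) := by
  simp [values, Function.comp_def]

lemma values_sumElim {ι ι' α : Type} [Fintype ι] [Fintype ι'] (v : ι → α) (v' : ι' → α) :
    values (Sum.elim v v') = values v + values v' := by
  rw [values, ← Finset.univ_disjSum_univ, Finset.val_disjSum, Multiset.disjSum, Multiset.map_add,
    map_map, map_map]
  rfl

lemma IsConnectedCorrelators.eq_of_mem_offCuts {W W' : Family d} (h : IsConnectedCorrelators κ W)
    (h' : IsConnectedCorrelators κ W') (hκ : ∀ c, 0 < κ c) {s : Multiset (Point d)}
    {A : Labels d} (hs : ∀ X ∈ s, X ∈ offCuts κ) : W s A = W' s A := by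
  obtain ⟨n, v, rfl⟩ := exists_values_eq s
  obtain ⟨l, B, rfl⟩ := exists_values_eq A
  refine series_ext fun m k => ?_
  obtain ⟨w, hw1, hw2⟩ := h.expansion n l (fun j => (v j).1) B m
  obtain ⟨w', hw1', hw2'⟩ := h'.expansion n l (fun j => (v j).1) B m
  have hww : w = w' := funext fun p => laurent_finsupp_ext fun N hN => by
    rw [← hw1 p N hN, hw1' p N hN]
  subst hww
  obtain ⟨R, hR⟩ := hw2 k
  obtain ⟨R', hR'⟩ := hw2' k
  have key := eq_zero_off_slits_of_large (r := fun j => κ (v j).1) (fun j => hκ _)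
    (G := fun y => coeffN m k (W (values fun j => ((v j).1, y j)) (values B))
      - coeffN m k (W' (values fun j => ((v j).1, y j)) (values B))) (R := max R R')
    (fun b => (h.holomorphic n l _ B m k b).sub (h'.holomorphic n l _ B m k b))
    (fun y hy => sub_eq_zero.2 ((hR y fun j => (le_max_left _ _).trans_lt (hy j)).unique
      (hR' y fun j => (le_max_right _ _).trans_lt (hy j))))
    (y := fun j => (v j).2) fun j => hs (v j) (mem_values.2 ⟨j, rfl⟩)
  exact sub_eq_zero.1 key

namespace CorrModel
variable (M : CorrModel κ)

/-- The slot of `tr (1 / (x - M_c))`. -/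
def pointSlot (κ : Fin d → ℝ) (X : Point d) : Fin d × Vec := (X.1, evPt (κ X.1) X.2)

/-- The slot of `tr (M_c ^ a)`. -/
def powSlot (κ : Fin d → ℝ) (b : Label d) : Fin d × Vec := (b.1, powVec (κ b.1) b.2)

/-- The correlation functions of the model. -/
def W : Family d := fun s A =>
  (M.hat.corr (s.map (pointSlot κ) + A.map (powSlot κ)) : PS d LK)

lemma coeffN_W (m : Order d) (k : ℤ) (s : Multiset (Point d)) (A : Labels d) : coeffN m k (M.W s A)
      = coN m k (M.hat.corr (s.map (pointSlot κ) + A.map (powSlot κ)) : PS d LK) := rfl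

lemma isConnectedCorrelators_W (hκ : ∀ c, 0 < κ c) (hM : ∀ s m, ∃ w : ℤ →₀ ℂ,
    (∀ k, w k = coN m k (M.I.corr s)) ∧ ∀ (N : ℕ) (hN : 0 < N),
      MvPowerSeries.coeff m ((finiteInsertions hκ hN).corr s) = w.sum fun k z => z * (N : ℂ) ^ k) :
    IsConnectedCorrelators κ M.W where
  holomorphic n l c B m k b := by
    simp only [coeffN_W, values_map]
    exact M.differentiableOn_multiSlot c (values fun i => powSlot κ (B i)) m k b
  expansion n l c B m := by
    choose w hw1 hw2 using fun p : Fin n → ℕ =>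
      hM (values (Sum.elim (fun j => (c j, p j)) B : Fin n ⊕ Fin l → Label d)) m
    refine ⟨w, fun p N hN => ?_, fun k => ?_⟩
    · rw [connectedTraces_eq_corr hN hκ, hw2 p N hN]
    · obtain ⟨R, hR⟩ := M.exists_hasSum_multiSlot_evPt c (values fun i => powSlot κ (B i)) m k
      refine ⟨R, fun x hx => ?_⟩
      simp only [coeffN_W, values_map]
      refine HasSum.congr_fun (f := fun p => _) (hR x hx) fun p => ?_
      rw [hw1, ← coe_hat_corr_powVec, values_sumElim, Multiset.map_add, values_map, values_map]
      rfl

lemma hasSum_W (s : Multiset (Point d)) (A : Labels d) (c : Fin d)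
    (m : Order d) (k : ℤ) {z : ℂ} (hz : 2 / √(κ c) < ‖z‖) :
    HasSum (fun a : ℕ => coeffN m k (M.W s ((c, a) ::ₘ A)) * z⁻¹ ^ (a + 1))
      (coeffN m k (M.W ((c, (z : OnePoint ℂ)) ::ₘ s) A)) := by
  have h := hasSum_pair_evPt (M.pos c) (M.pBdd_slot c (s.map (pointSlot κ) + A.map (powSlot κ)) m k) hz
  simp only [coeffN_W, map_cons, cons_add, Multiset.add_cons]
  simp only [← pair_powVec (M.pos c) (M.pBdd_slot _ _ _ _), ← coN_hat_corr_cons'] at h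
  exact h

end CorrModel

lemma exists_corrModel (hκ : ∀ c, 0 < κ c) : ∃ M : CorrModel κ, IsConnectedCorrelators κ M.W := by
  obtain ⟨I, hD, hsd, hF, hfin, hdeg⟩ := exists_seriesInsertions hκ
  exact ⟨⟨⟨I, hD, hsd, hF⟩, hκ, hdeg⟩, CorrModel.isConnectedCorrelators_W _ hκ hfin⟩

namespace CorrModel
variable (M : CorrModel κ)

/-! ### The loop equation for a resolvent -/

/-- The constant `N ^ k`. -/
def nConst (k : ℤ) : M.tameAlgebra := ⟨nPow unitN k, fun _ _ => TF.nPow k⟩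

lemma hat_D_nConst (a : Fin d × Vec) (k : ℤ) : M.hat.D a (M.nConst k) = 0 := by
  refine Subtype.ext ?_
  change hsum a.2 (fun q => M.J.D (a.1, chebP (κ a.1) q) (nPow unitN k)) = 0
  simp only [M.D_nPow]
  refine coN_ext fun m k => ?_
  rw [coN_hsum (M := M) (y := fun _ => 0) a.2 (tame_const (0 : M.tameAlgebra))]
  simp

lemma iter_nConst_mul (s : Slots d) (k : ℤ) (f : M.tameAlgebra) :
    M.hat.iter s (M.nConst k * f) = M.nConst k * M.hat.iter s f :=
  M.hat.iter_mul_of_D_eq_zero _ _ _ fun a => M.hat_D_nConst a k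

lemma coe_hat_corr_shiftX (i : Fin d) (a : ℕ) (L : Vec) (s : Slots d) :
    (M.hat.corr ((i, (shiftX (κ i))^[a] L) ::ₘ s) : PS d LK)
      = hsum L fun r => (M.hat.iter s (M.polyF i (chebP (κ i) r * X ^ a)) : PS d LK) := by
  refine coN_ext fun m k => ?_
  have hP : PolyBdd (κ i) natWt fun q => chebP (κ i) q * X ^ a := by
    have := PolyBdd.X_pow_mul (M.pos i) a
    simpa only [mul_comm] using this
  rw [coN_hat_corr_cons', pair_shiftX_iterate (M.pos i) (M.pBdd_slot i s m k),
    coN_hsum L (M.tame_iter_polyF i hP s)]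
  exact tsum_congr fun q => by
    rw [comp_apply, mulLeft_apply, mul_comm (X ^ a), slot_apply]

lemma coe_hat_iter_powSlot (A : Labels d) (f : M.tameAlgebra) :
    (M.hat.iter (A.map (powSlot κ)) f : PS d LK) = M.J.iter (A.map fun b => (b.1, X ^ b.2)) f := by
  induction A using induction_on with
  | empty => simp
  | cons a A ih =>
    rw [map_cons, map_cons, iter_cons, iter_cons, ← ih,
      polyInsertions_D, polyMap_X_pow]
    exact M.coe_hat_D_powVec a.1 a.2 _

/-- The slots of `∏ c ∈ B, tr (M_c ^ a_c)`. -/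
def powSlots (κ : Fin d → ℝ) (a : Fin d → ℕ) (B : Finset (Fin d)) : Slots d :=
  (B.val.map fun c => (c, a c)).map (powSlot κ)

lemma coe_hat_corr_powSlots (a : Fin d → ℕ) (B : Finset (Fin d)) :
    (M.hat.corr (powSlots κ a B) : PS d LK) = M.J.corr (B.val.map fun c => (c, X ^ a c)) := by
  rw [powSlots]
  refine (M.coe_hat_corr_powVec _).trans ?_
  rw [← polyInsertions_corr_X_pow, map_map]
  rfl

/-- The interaction terms in the loop equation for `∑ q, L q * tr P_q(M_i)`. -/
def hatInteraction (i : Fin d) (L : Vec) : Coupling d → M.tameAlgebra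
  | Sum.inl a => (a i : ℂ) • (M.nConst (2 - d) *
      ∑ S ∈ (univ.erase i).powerset, ∑ Λ : Finpartition (univ.erase i \ S),
        (∏ B : {B // B ∈ Λ.parts}, M.hat.corr (powSlots κ a B.1)) *
          M.hat.corr ((i, (shiftX (κ i))^[a i - 1] L) ::ₘ powSlots κ a S))
  | Sum.inr (c, k) => if c = i then
      (k : ℂ) • (M.nConst 1 * M.hat.corr {(i, (shiftX (κ i))^[k - 1] L)}) else 0

lemma tame_interaction (i : Fin d) (u : Coupling d) :
    M.Tame natWt fun q => M.interaction i (chebP (κ i) q) u :=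
  fun _ _ => M.tf_interaction (fun m' _ => est m') i u

lemma hsum_congr_coe {y y' : ℕ → PS d LK} (L : Vec) (h : ∀ q, y q = y' q) : hsum L y = hsum L y' := by
  rw [funext h]

lemma tame_sum {ι : Type*} (S : Finset ι) {y : ι → ℕ → PS d LK}
    (hy : ∀ j ∈ S, M.Tame natWt (y j)) : M.Tame natWt fun q => ∑ j ∈ S, y j q :=
  fun m n => TF.sum S fun j hj => hy j hj m n

lemma hsum_finset_sum {ι : Type*} (S : Finset ι) (L : Vec) {y : ι → ℕ → PS d LK}
    (hy : ∀ j ∈ S, M.Tame natWt (y j)) :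
    hsum L (fun q => ∑ j ∈ S, y j q) = ∑ j ∈ S, hsum L (y j) := coN_ext fun m k => by
  rw [coN_hsum L (M.tame_sum S hy), map_sum]
  simp only [map_sum, mul_sum]
  rw [Summable.tsum_finsetSum fun j hj => summable_coN L (hy j hj) m k]
  exact sum_congr rfl fun j hj => (coN_hsum L (hy j hj) m k).symm

lemma coe_hatInteraction (i : Fin d) (L : Vec) (u : Coupling d) :
    (M.hatInteraction i L u : PS d LK) = hsum L fun q => M.interaction i (chebP (κ i) q) u := by
  have hP : ∀ a, PolyBdd (κ i) natWt fun q => chebP (κ i) q * X ^ a := fun a => by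
    have := PolyBdd.X_pow_mul (M.pos i) a
    simpa only [mul_comm] using this
  have h0 : M.Tame natWt fun _ => (0 : PS d LK) := tame_const (0 : M.tameAlgebra)
  rcases u with a | ⟨c, k⟩
  · have hc : ∀ (S : Finset (Fin d)) q, M.J.corr ((i, chebP (κ i) q * X ^ (a i - 1)) ::ₘ
        S.val.map fun c => (c, X ^ a c)) = (M.hat.iter (powSlots κ a S)
          (M.polyF i (chebP (κ i) q * X ^ (a i - 1))) : PS d LK) := fun S q => by
      rw [powSlots, coe_hat_iter_powSlot, map_map, corr_cons]
      rfl
    have ht : ∀ S : Finset (Fin d), M.Tame natWt fun q => (M.hat.iter (powSlots κ a S)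
        (M.polyF i (chebP (κ i) q * X ^ (a i - 1))) : PS d LK) := fun S =>
      M.tame_iter_polyF i (hP _) _
    set C : ∀ S : Finset (Fin d), Finpartition (univ.erase i \ S) → M.tameAlgebra :=
      fun S Λ => ∏ B : {B // B ∈ Λ.parts}, M.hat.corr (powSlots κ a B.1) with hC
    have hC' : ∀ S Λ, ∏ B ∈ Λ.parts, M.J.corr (B.val.map fun c => (c, X ^ a c))
        = (C S Λ : PS d LK) := fun S Λ => by
      simp only [← coe_hat_corr_powSlots]
      rw [hC, ← prod_coe_sort]
      exact (map_prod M.tameAlgebra.val _ _).symm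
    have h1 : ∀ q, M.interaction i (chebP (κ i) q) (Sum.inl a)
        = (a i : ℂ) • (nPow unitN (2 - d) * ∑ S ∈ (univ.erase i).powerset,
          ∑ Λ : Finpartition (univ.erase i \ S), (C S Λ : PS d LK) *
            (M.hat.iter (powSlots κ a S) (M.polyF i (chebP (κ i) q * X ^ (a i - 1))) : PS d LK)) :=
      fun q => by
        simp only [MatrixModel.interaction, hc, hC', mul_comm (C _ _ : PS d LK)]
    have h2 := fun S Λ => (tame_const (wt := natWt) (C S Λ)).mul (ht S)
    have h3 := fun S => M.tame_sum (univ : Finset (Finpartition (univ.erase i \ S)))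
      (fun Λ _ => h2 S Λ)
    have h4 := M.tame_sum (univ.erase i).powerset fun S _ => h3 S
    have h5 : M.Tame natWt fun _ => nPow unitN (2 - d) := tame_const (M.nConst (2 - d))
    rw [hsum_congr_coe L h1, hsum_smul L _ (h5.mul h4), hsum_mul L _ h5 h4,
      M.hsum_finset_sum _ L fun S _ => h3 S]
    simp only [hatInteraction, Subalgebra.coe_smul, Subalgebra.coe_mul]
    refine congrArg (fun z => (a i : ℂ) • (nPow unitN (2 - d) * z)) ?_
    simp only [AddSubmonoidClass.coe_finset_sum]
    refine sum_congr rfl fun S _ => ?_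
    rw [M.hsum_finset_sum _ L fun Λ _ => h2 S Λ]
    refine sum_congr rfl fun Λ _ => ?_
    rw [hsum_mul L _ (tame_const (C S Λ)) (ht S), ← coe_hat_corr_shiftX]
    rfl
  · simp only [MatrixModel.interaction, hatInteraction]
    split_ifs
    · have ht := M.tame_iter_polyF i (hP (k - 1)) 0
      have h5 : M.Tame natWt fun _ => nPow unitN 1 := tame_const (M.nConst 1)
      refine Eq.trans ?_ (hsum_smul L _ (h5.mul ht)).symm
      rw [hsum_mul L _ h5 ht, ← coe_hat_corr_shiftX]
      rfl
    · refine coN_ext fun m k => ?_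
      rw [coN_hsum L h0]
      simp

lemma hsum_cSum (L : Vec) {F : ℕ → Coupling d → PS d LK} (hF : ∀ u, M.Tame natWt fun q => F q u)
    (hc : M.Tame natWt fun q => cSum (F q)) :
    hsum L (fun q => cSum (F q)) = cSum fun u => hsum L fun q => F q u := coN_ext fun m k => by
  rw [coN_hsum L hc, coN_cSum]
  simp only [coN_cSum, mul_sum]
  rw [Summable.tsum_finsetSum fun u _ => summable_coN L (hF u) _ k]
  exact sum_congr rfl fun u _ => (coN_hsum L (hF u) _ k).symm

lemma coN_evPt_pairing (i : Fin d) {x : ℂ} (hx : OffSlit (κ i) x) (m : Order d) (k : ℤ)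
    (hg : PBdd natWt fun q => coN m k (ncDeriv (pairing M.I i) (chebP (κ i) q))) :
    coN m k ((M.hat.F (i, evPt (κ i) x) * M.hat.F (i, evPt (κ i) x)
        + M.hat.D (i, evPt (κ i) x) (M.hat.F (i, evPt (κ i) x)) : M.tameAlgebra) : PS d LK)
      = ∑' q, (evPt (κ i) x).1 q * coN m k (ncDeriv (pairing M.I i) (chebP (κ i) q)) := by
  set e := evPt (κ i) x with he
  have hF := tame_B_F (M := M) i
  have h2 : M.Tame addWt fun z => M.B.F (i, z.1) * M.B.F (i, z.2) :=
    Tame.mul (hF.comp (wt' := fun z : ℕ × ℕ => z.1 + z.2) (fun z => z.1) 1 fun z => by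
      dsimp only [natWt]; omega) (hF.comp (wt' := fun z : ℕ × ℕ => z.1 + z.2) (fun z => z.2) 1
        fun z => by dsimp only [natWt]; omega)
  have h3 : M.Tame addWt fun z => M.B.D (i, z.1) (M.B.F (i, z.2)) :=
    hF.insert.comp (wt' := fun z : ℕ × ℕ => z.1 + z.2) (fun z => (z.2, (i, z.1))) 1 fun z => by
      dsimp only [natWt]; omega
  have h23 := h2.add h3
  have hs : ∀ q, M.Tame natWt fun r => M.B.F (i, q) * M.B.F (i, r) + M.B.D (i, q) (M.B.F (i, r)) :=
    fun q => Tame.apply (wt := natWt) h23 q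
  have hin : ∀ q, hsum e (fun r => M.B.F (i, q) * M.B.F (i, r) + M.B.D (i, q) (M.B.F (i, r)))
      = M.B.F (i, q) * (M.hat.F (i, e) : PS d LK) + M.B.D (i, q) (M.hat.F (i, e) : PS d LK) := fun q => by
    have ha : hsum e (fun r => M.B.F (i, q) * M.B.F (i, r)) = M.B.F (i, q) * (M.hat.F (i, e) : PS d LK) :=
      hsum_mul e (M.B.F (i, q)) (tame_const (wt := natWt) (M.polyF i (chebP (κ i) q))) hF
    have hb : hsum e (fun r => M.B.D (i, q) (M.B.F (i, r))) = M.B.D (i, q) (M.hat.F (i, e) : PS d LK) :=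
      (D_hsum e i (chebP (κ i) q) hF).symm
    rw [← ha, ← hb]
    exact hsum_add (y := fun r => M.B.F (i, q) * M.B.F (i, r)) (y' := fun r => M.B.D (i, q) (M.B.F (i, r)))
      e (Tame.apply (wt := natWt) h2 q) (Tame.apply (wt := natWt) h3 q)
  have hout := tame_hsum (wt := natWt) e h23
  have key : hsum e (fun q => hsum e fun r => M.B.F (i, q) * M.B.F (i, r) + M.B.D (i, q) (M.B.F (i, r)))
      = ((M.hat.F (i, e) * M.hat.F (i, e) + M.hat.D (i, e) (M.hat.F (i, e)) : M.tameAlgebra) : PS d LK) := by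
    rw [hsum_congr_coe e hin]
    have ht : M.Tame natWt fun q => M.B.F (i, q) * (M.hat.F (i, e) : PS d LK) := hF.mul (tame_const _)
    rw [hsum_add e ht (tame_B_D i _)]
    simp only [mul_comm (M.B.F _)] at ht ⊢
    rw [hsum_mul e _ (tame_const _) hF]
    rfl
  rw [← key, coN_hsum e hout]
  refine Eq.trans (tsum_congr fun q => by rw [coN_hsum e (hs q)]) (Eq.symm ?_)
  refine tsum_ev_antidiagonal (M.pos i) (norm_zc_lt_one (M.pos i) hx)
    (f := fun z => coN m k (M.B.F (i, z.1) * M.B.F (i, z.2) + M.B.D (i, z.1) (M.B.F (i, z.2))))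
    (h23.pBdd m k) hg ?_ fun q => ?_
  · rw [chebP_zero, ncDeriv_one, map_zero]
  · rw [ncDeriv_chebP, map_smul, map_sum, smul_eq_mul]
    rfl

lemma loop_equation_base (i : Fin d) {x : ℂ} (hx : OffSlit (κ i) x) :
    ((M.hat.F (i, evPt (κ i) x) * M.hat.F (i, evPt (κ i) x)
        + M.hat.D (i, evPt (κ i) x) (M.hat.F (i, evPt (κ i) x))
        - (κ i : ℂ) • (M.nConst 1 * (x • M.hat.F (i, evPt (κ i) x) - M.nConst 1)) : M.tameAlgebra) : PS d LK)
      = cSum fun u => (M.hatInteraction i (evPt (κ i) x) u : PS d LK) := by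
  set e := evPt (κ i) x with he
  refine coN_ext fun m k => ?_
  have hX : PolyBdd (κ i) natWt fun q => X * chebP (κ i) q := by
    have := PolyBdd.X_pow_mul (M.pos i) 1
    simpa only [pow_one] using this
  have ht := M.tame_polyF i hX
  have h1 : M.Tame natWt fun _ => nPow unitN 1 := tame_const (M.nConst 1)
  have hL := Tame.smul (κ i : ℂ) (h1.mul ht)
  have hsd : ∀ q, ncDeriv (pairing M.I i) (chebP (κ i) q)
      = (κ i : ℂ) • (nPow unitN 1 * (M.polyF i (X * chebP (κ i) q) : PS d LK))
        + cSum (M.interaction i (chebP (κ i) q)) := fun q =>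
    (sub_eq_iff_eq_add.1 (M.sd_poly i (chebP (κ i) q)).symm)
  have hsm : ∀ u, Summable fun q => e.1 q * coN (m - single u 1) k (M.interaction i (chebP (κ i) q) u) :=
    fun u => summable_coN e (M.tame_interaction i u) _ k
  have hg : PBdd natWt fun q => coN m k (ncDeriv (pairing M.I i) (chebP (κ i) q)) := by
    simp only [hsd, map_add, coN_cSum]
    exact (hL.pBdd m k).add (PBdd.sum _ fun u _ => (M.tame_interaction i u).pBdd _ k)
  have hshift : hsum e (fun q => (κ i : ℂ) • (nPow unitN 1 * (M.polyF i (X * chebP (κ i) q) : PS d LK)))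
      = (((κ i : ℂ) • (M.nConst 1 * (x • M.hat.F (i, e) - M.nConst 1)) : M.tameAlgebra) : PS d LK) := by
    rw [hsum_smul e _ (h1.mul ht), hsum_mul e _ h1 ht]
    have h3 := M.coe_hat_corr_shiftX i 1 e 0
    rw [corr_cons] at h3
    simp only [iter_zero, Function.iterate_one, pow_one, mul_comm (chebP _ _) X] at h3
    rw [← h3, he, shiftX_evPt (M.pos i) hx]
    have hF := tame_B_F (M := M) i
    have h4 : (M.hat.F (i, x • e - delta 0) : PS d LK) = x • (M.hat.F (i, e) : PS d LK) - nPow unitN 1 := by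
      change hsum _ _ = x • hsum _ _ - _
      rw [sub_eq_add_neg, ← neg_one_smul ℂ (delta 0), add_hsum _ _ hF, smul_hsum _ _ hF, smul_hsum _ _ hF,
        delta_hsum 0 hF, neg_one_smul, ← sub_eq_add_neg]
      congr 1
      change M.J.F (i, chebP (κ i) 0) = _
      rw [chebP_zero, polyInsertions_F, polyMap_one, M.F_zero, nPow_one]
    rw [h4]
    rfl
  rw [Subalgebra.coe_sub, map_sub, M.coN_evPt_pairing i hx m k hg, ← hshift, coN_hsum e hL, coN_cSum]
  simp only [coe_hatInteraction, coN_hsum e (M.tame_interaction i _)]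
  rw [← Summable.tsum_finsetSum fun u _ => hsm u, sub_eq_iff_eq_add,
    ← (summable_sum fun u _ => hsm u).tsum_add (summable_coN e hL m k)]
  exact tsum_congr fun q => by rw [hsd, map_add, coN_cSum, mul_add, mul_sum, add_comm]

end CorrModel

namespace CorrModel
variable (M : CorrModel κ)

/-! ### Insertions in the loop equation -/

lemma hat_iter_cSum {x : M.tameAlgebra} {G : Coupling d → M.tameAlgebra}
    {Y : Fin d × Vec → M.tameAlgebra} {Z : Slots d → Fin d → ℕ → PS d LK}
    (hx : (x : PS d LK) = cSum fun u => (G u : PS d LK))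
    (hZt : ∀ s c, M.Tame natWt (Z s c))
    (hZ : ∀ s c q, nPow unitN (-1) * polyMap (fun k => (M.hat.iter s (G (Sum.inr (c, k))) : PS d LK))
      (chebP (κ c) q) = Z s c q)
    (hY : ∀ s a, (M.hat.iter s (Y a) : PS d LK) = hsum a.2 (Z s a.1))
    {n : ℕ} (v : Fin n → Fin d × Vec) :
    (M.hat.iter (values v) x : PS d LK) = cSum (fun u => (M.hat.iter (values v) (G u) : PS d LK))
      - ∑ j, (M.hat.iter ((univ.erase j).val.map v) (Y (v j)) : PS d LK) := by
  have hstep : ∀ (a : Fin d × Vec) s (y : M.tameAlgebra),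
      (y : PS d LK) = cSum (fun u => (M.hat.iter s (G u) : PS d LK)) →
      ((M.hat.D a y + M.hat.iter s (Y a) : M.tameAlgebra) : PS d LK)
        = cSum fun u => (M.hat.iter (a ::ₘ s) (G u) : PS d LK) := by
    rintro ⟨c, L⟩ s y hy
    have hD : ∀ q, M.B.D (c, q) (y : PS d LK) + Z s c q
        = cSum fun u => M.B.D (c, q) (M.hat.iter s (G u) : PS d LK) := fun q => by
      rw [hy, ← hZ]
      exact (sub_eq_iff_eq_add.1 (M.D_cSum c (chebP (κ c) q) _).symm).symm
    have ht := (tame_B_D c y).add (hZt s c)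
    rw [Subalgebra.coe_add, hY]
    change hsum L (fun q => M.B.D (c, q) (y : PS d LK)) + hsum L (Z s c) = _
    rw [← hsum_add L (tame_B_D c y) (hZt s c), hsum_congr_coe L hD,
      M.hsum_cSum L (fun u => tame_B_D c _) (by simpa only [hD] using ht)]
    simp only [iter_cons]
    rfl
  have hex : ∀ s : Slots d, ∃ y : M.tameAlgebra,
      (y : PS d LK) = cSum fun u => (M.hat.iter s (G u) : PS d LK) := fun s => by
    induction s using induction_on with
    | empty => exact ⟨x, by simpa using hx⟩
    | cons a s ih =>
      obtain ⟨y, hy⟩ := ih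
      exact ⟨_, hstep a s y hy⟩
  choose Φ hΦ using hex
  have h0 : Φ 0 = x := Subtype.ext (by rw [hΦ, hx]; simp)
  have h := M.hat.iter_of_step v Φ Y (fun a s => by
    rw [eq_sub_iff_add_eq]
    exact Subtype.ext (by rw [hstep a s _ (hΦ s), hΦ])) univ
  rw [h0] at h
  rw [values, h, ← hΦ, Subalgebra.coe_sub]
  congr 1
  exact AddSubmonoidClass.coe_finset_sum _ _

lemma tameForm_slot (i : Fin d) (s : Slots d) (m : Order d) (k : ℤ) :
    TameForm (κ i) (M.slot i s m k) := M.pBdd_slot i s m k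

/-- The insertion of `∑ r, L r * tr (P_q' (M_i) P_r (M_i))`. -/
def derivF (i : Fin d) (L : Vec) (q : ℕ) : M.tameAlgebra :=
  ⟨hsum L fun r => (M.polyF i (derivative (chebP (κ i) q) * chebP (κ i) r) : PS d LK),
    tame_hsum (Θ := Unit) (wt := fun _ => 0) L
      (Y := fun z => (M.polyF i (derivative (chebP (κ i) q) * chebP (κ i) z.2) : PS d LK))
      (Tame.comp (wt' := fun z : Unit × ℕ => 0 + z.2)
        (M.tame_polyF i (PolyBdd.mul_const_chebP (M.pos i) (derivative (chebP (κ i) q))))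
        (fun z => z.2) 1 fun z => by dsimp only [natWt]; omega)⟩

lemma tame_iter_derivF_aux (i : Fin d) (s : Slots d) : M.Tame addWt fun z =>
      (M.hat.iter s (M.polyF i (derivative (chebP (κ i) z.1) * chebP (κ i) z.2)) : PS d LK) :=
  M.tame_iter_polyF i (PolyBdd.mul_chebP _ PolyBdd.derivative) s

lemma coe_iter_derivF (i : Fin d) (L : Vec) (q : ℕ) (s : Slots d) :
    (M.hat.iter s (M.derivF i L q) : PS d LK) = hsum L fun r =>
      (M.hat.iter s (M.polyF i (derivative (chebP (κ i) q) * chebP (κ i) r)) : PS d LK) :=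
  hat_iter_hsum (y := fun r => M.polyF i (derivative (chebP (κ i) q) * chebP (κ i) r))
    (Tame.apply (wt := natWt) (M.tame_iter_derivF_aux i 0) q) L _ rfl s

lemma tame_iter_derivF (i : Fin d) (L : Vec) (s : Slots d) :
    M.Tame natWt fun q => (M.hat.iter s (M.derivF i L q) : PS d LK) := by
  simp only [coe_iter_derivF]
  exact tame_hsum (wt := natWt) L (M.tame_iter_derivF_aux i s)

lemma coN_iter_derivF (i : Fin d) (L : Vec) (q : ℕ) (s : Slots d)
    (m : Order d) (k : ℤ) : coN m k (M.hat.iter s (M.derivF i L q) : PS d LK)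
      = mulForm (M.tameForm_slot i s m k) (M.pos i) L (derivative (chebP (κ i) q)) := by
  rw [coe_iter_derivF, coN_hsum L (Tame.apply (wt := natWt) (M.tame_iter_derivF_aux i s) q)]
  rfl

lemma polyMap_corr_shiftX (i : Fin d) (L : Vec) (q : ℕ) (s : Slots d) :
    polyMap (fun k => (k : ℂ) • (M.hat.corr ((i, (shiftX (κ i))^[k - 1] L) ::ₘ s) : PS d LK))
      (chebP (κ i) q) = (M.hat.iter s (M.derivF i L q) : PS d LK) := by
  refine coN_ext fun m k => ?_
  rw [coN_iter_derivF, map_polyMap]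
  refine LinearMap.congr_fun (g := mulForm (M.tameForm_slot i s m k) (M.pos i) L ∘ₗ derivative) ?_ _
  rw [linearMap_eq_polyMap (mulForm _ _ L ∘ₗ derivative)]
  congr 1
  funext a
  rw [map_smul, coN_hat_corr_cons', pair_shiftX_iterate (M.pos i) (M.tameForm_slot i s m k),
    comp_apply, derivative_X_pow, ← smul_eq_C_mul, map_smul, mulForm_apply]

/-- The contribution of the insertion of `∑ q, L' q * tr P_q(M_c)` to the loop equation. -/
def derivCorr (i : Fin d) (L : Vec) (a : Fin d × Vec) : M.tameAlgebra :=
  if a.1 = i then ⟨hsum a.2 fun q => (M.derivF i L q : PS d LK),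
    tame_hsum (Θ := Unit) (wt := fun _ => 0) a.2 (Y := fun z => (M.derivF i L z.2 : PS d LK))
      (Tame.comp (wt' := fun z : Unit × ℕ => 0 + z.2) (M.tame_iter_derivF i L 0)
        (fun z => z.2) 1 fun z => by dsimp only [natWt]; omega)⟩ else 0

lemma coe_iter_derivCorr (i : Fin d) (L L' : Vec) (s : Slots d) :
    (M.hat.iter s (M.derivCorr i L (i, L')) : PS d LK)
      = hsum L' fun q => (M.hat.iter s (M.derivF i L q) : PS d LK) := by
  rw [derivCorr, if_pos rfl]
  exact hat_iter_hsum (y := M.derivF i L) (M.tame_iter_derivF i L 0) L' _ rfl s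

lemma coN_iter_derivCorr (i : Fin d) {x x' : ℂ} (hx : OffSlit (κ i) x)
    (hx' : OffSlit (κ i) x') (s : Slots d) (m : Order d) (k : ℤ) :
    coN m k (M.hat.iter s (M.derivCorr i (evPt (κ i) x) (i, evPt (κ i) x')) : PS d LK)
      = deriv (dslope (fun z : ℂ => coN m k (M.hat.corr ((i, evPt (κ i) z) ::ₘ s) : PS d LK)) x) x' := by
  rw [coe_iter_derivCorr, coN_hsum _ (M.tame_iter_derivF i _ s)]
  simp only [coN_hat_corr_cons']
  rw [← pair_mulForm_comp_derivative (M.pos i) (M.tameForm_slot i s m k) hx hx']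
  exact tsum_congr fun q => by rw [coN_iter_derivF]; rfl

lemma loop_equation (i : Fin d) {x : ℂ} (hx : OffSlit (κ i) x) {n : ℕ} (v : Fin n → Fin d × Vec) :
    ((∑ J : Finset (Fin n), M.hat.corr ((i, evPt (κ i) x) ::ₘ J.val.map v)
          * M.hat.corr ((i, evPt (κ i) x) ::ₘ Jᶜ.val.map v)
        + M.hat.corr ((i, evPt (κ i) x) ::ₘ (i, evPt (κ i) x) ::ₘ values v)
        - (κ i : ℂ) • (M.nConst 1 * (x • M.hat.corr ((i, evPt (κ i) x) ::ₘ values v)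
          - M.hat.iter (values v) (M.nConst 1))) : M.tameAlgebra) : PS d LK)
      = cSum (fun u => (M.hat.iter (values v) (M.hatInteraction i (evPt (κ i) x) u) : PS d LK))
        - ∑ j, (M.hat.iter ((univ.erase j).val.map v)
            (M.derivCorr i (evPt (κ i) x) (v j)) : PS d LK) := by
  set e := evPt (κ i) x with he
  have key := M.hat_iter_cSum (Y := M.derivCorr i e)
    (Z := fun s c q => if c = i then (M.hat.iter s (M.derivF i e q) : PS d LK) else 0)
    (M.loop_equation_base i hx) (fun s c => ?_) (fun s c q => ?_) (fun s a => ?_) v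
  · rw [← key, Insertions.iter_sub, Insertions.iter_add, iter_smul, iter_nConst_mul,
      Insertions.iter_sub, iter_smul, Insertions.iter_mul_univ, ← Insertions.iter_cons']
    simp only [corr_cons]
    rfl
  · by_cases hc : c = i
    · simp only [hc, if_true]; exact M.tame_iter_derivF i e s
    · simp only [hc, if_false]; exact tame_const (0 : M.tameAlgebra)
  · by_cases hc : c = i
    · subst hc
      simp only [hatInteraction, if_true, ← polyMap_corr_shiftX]
      rw [← mulLeft_apply (R := ℂ) (nPow unitN (-1)), map_polyMap]
      congr 2
      funext k
      rw [iter_smul, iter_nConst_mul, mulLeft_apply, Subalgebra.coe_smul,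
        mul_smul_comm, Subalgebra.coe_mul]
      congr 1
      change nPow unitN (-1) * (nPow unitN 1 * _) = _
      rw [← mul_assoc, ← nPow_add, neg_add_cancel, nPow_zero, one_mul, 
        M.hat.iter_corr _ _ (Multiset.singleton_ne_zero _), add_comm, singleton_add]
    · simp only [hatInteraction, hc, if_false, iter_zero_right, ZeroMemClass.coe_zero]
      rw [show polyMap (fun _ : ℕ => (0 : PS d LK)) = 0 from
        (linearMap_eq_polyMap (0 : ℂ[X] →ₗ[ℂ] PS d LK)).symm, LinearMap.zero_apply, mul_zero]
  · obtain ⟨c, L⟩ := a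
    by_cases hc : c = i
    · subst hc
      simp only [if_true]
      exact M.coe_iter_derivCorr c e L s
    · simp only [derivCorr, hc, if_false, iter_zero_right, ZeroMemClass.coe_zero]
      refine coN_ext fun m k => ?_
      rw [coN_hsum (M := M) (y := fun _ => 0) L (tame_const (0 : M.tameAlgebra))]
      simp

end CorrModel

/-! ### The colored loop equations -/

/-- The identification of the two notations for the ring of series. -/
def ps : Series d →+* PS d LK where
  toFun f := f
  map_one' := rfl
  map_mul' _ _ := rfl
  map_zero' := rfl
  map_add' _ _ := rfl

lemma coeffN_eq (m : Order d) (k : ℤ) (f : Series d) : coeffN m k f = coN m k (ps f) := rfl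

lemma ps_couplingSum (F : Coupling d → Series d) :
    ps (couplingSum F) = cSum fun v => ps (F v) := rfl

lemma ps_scalar (z : ℂ) : ps (scalar z : Series d) = algebraMap ℂ (PS d LK) z :=
  (MvPowerSeries.algebraMap_apply (R := ℂ) (A := LK)).symm

lemma ps_scalar_mul (z : ℂ) (f : Series d) : ps (scalar z * f) = z • ps f := by
  rw [map_mul, ps_scalar, Algebra.smul_def]

lemma ps_powN (k : ℤ) : ps (powN d k) = nPow unitN k := by
  rw [nPow, coe_unitN_zpow]; rfl

lemma ps_injective : Function.Injective (ps (d := d)) := fun _ _ h => h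

namespace CorrModel
variable (M : CorrModel κ)

lemma ps_W (s : Multiset (Point d)) (A : Labels d) :
    ps (M.W s A) = (M.hat.corr (s.map (pointSlot κ) + A.map (powSlot κ)) : PS d LK) := rfl

/-- A correlator as a linear function of one of its slots. -/
def corrLin (i : Fin d) (s : Slots d) : Vec →ₗ[ℂ] PS d LK where
  toFun L := (M.hat.corr ((i, L) ::ₘ s) : PS d LK)
  map_add' L L' := coN_ext fun m k => by
    rw [map_add, coN_hat_corr_cons', coN_hat_corr_cons', coN_hat_corr_cons',
      pair_add (M.tameForm_slot i s m k)]
  map_smul' z L := coN_ext fun m k => by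
    rw [map_smul, coN_hat_corr_cons', coN_hat_corr_cons', pair_smul]; rfl

lemma corrLin_apply (i : Fin d) (s : Slots d) (L : Vec) :
    M.corrLin i s L = (M.hat.corr ((i, L) ::ₘ s) : PS d LK) := rfl

lemma ps_W_cons_pow (i : Fin d) (l : ℕ) (s : Multiset (Point d)) (A : Labels d) :
    ps (M.W s ((i, l) ::ₘ A))
      = M.corrLin i (s.map (pointSlot κ) + A.map (powSlot κ)) (powVec (κ i) l) := by
  rw [ps_W, map_cons, Multiset.add_cons, corrLin_apply]
  rfl

lemma ps_colorU (i : Fin d) {x : ℂ} (hx : OffSlit (κ i) x) (a : ℕ)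
    (s : Multiset (Point d)) (A : Labels d) :
    x ^ (a - 1) • ps (M.W ((i, (x : OnePoint ℂ)) ::ₘ s) A) - ps (colorU M.W i a x s A)
      = (M.hat.corr ((i, (shiftX (κ i))^[a - 1] (evPt (κ i) x)) ::ₘ
          (s.map (pointSlot κ) + A.map (powSlot κ))) : PS d LK) := by
  rw [← corrLin_apply, shiftX_iterate_evPt (M.pos i) hx, map_sub, map_smul, map_sum, colorU, map_sum,
    corrLin_apply, ps_W, map_cons, cons_add]
  congr 1
  exact sum_congr rfl fun l _ => by rw [ps_scalar_mul, ps_W_cons_pow, map_smul, Nat.sub_sub a 1 1]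

lemma ps_colorU_two (i : Fin d) (x : ℂ) (s : Multiset (Point d)) :
    ps (colorU M.W i 2 x s 0) = (M.hat.iter (s.map (pointSlot κ)) (M.nConst 1) : PS d LK) := by
  rw [colorU]
  simp only [Nat.reduceSub, Finset.sum_range_one, Nat.sub_self, pow_zero]
  rw [ps_scalar_mul, one_smul, ps_W_cons_pow, corrLin_apply, Multiset.map_zero, add_zero,
    corr_cons]
  congr 2
  refine Subtype.ext ((M.coe_hat_F_powVec i 0).trans ?_)
  rw [M.F_zero, ← nPow_one]
  rfl

/-- The terms of the loop equation with single-trace couplings. -/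
def singleTrace (i : Fin d) (x : ℂ) (s : Multiset (Point d)) : Coupling d → PS d LK
  | Sum.inl _ => 0
  | Sum.inr (c, k) => if c = i then (k : ℂ) • (x ^ (k - 1) • ps (M.W ((i, (x : OnePoint ℂ)) ::ₘ s) 0)
      - ps (colorU M.W i k x s 0)) else 0

lemma ps_colorV'_sub_colorP (i : Fin d) (x : ℂ) (s : Multiset (Point d)) :
    ps (colorV' κ i x) * ps (M.W ((i, (x : OnePoint ℂ)) ::ₘ s) 0) - ps (colorP κ M.W i x s)
      = (κ i : ℂ) • (x • ps (M.W ((i, (x : OnePoint ℂ)) ::ₘ s) 0)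
          - (M.hat.iter (s.map (pointSlot κ)) (M.nConst 1) : PS d LK))
        + cSum (M.singleTrace i x s) := by
  set w := ps (M.W ((i, (x : OnePoint ℂ)) ::ₘ s) 0) with hw
  have h : cSum (M.singleTrace i x s) = w * ps (couplingSum fun v => match v with
          | Sum.inl _ => 0
          | Sum.inr (c, k) => if c = i then scalar ((k : ℂ) * x ^ (k - 1)) else 0)
        - ps (couplingSum fun v => match v with
          | Sum.inl _ => 0
          | Sum.inr (c, k) => if c = i then scalar (k : ℂ) * colorU M.W i k x s 0 else 0) := by
    rw [eq_sub_iff_add_eq, ps_couplingSum, ps_couplingSum, mul_cSum, ← cSum_add]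
    congr 1
    funext v
    rcases v with a | ⟨c, k⟩
    · simp [singleTrace]
    · simp only [singleTrace]
      by_cases hc : c = i
      · simp only [hc, if_true, ps_scalar_mul, ps_scalar]
        rw [smul_sub, sub_add_cancel, smul_smul, mul_comm w, ← Algebra.smul_def]
      · simp [hc]
  have hV : ps (colorV' κ i x) = ps (scalar ((κ i : ℂ) * x)) + ps (couplingSum fun v => match v with
      | Sum.inl _ => 0
      | Sum.inr (c, k) => if c = i then scalar ((k : ℂ) * x ^ (k - 1)) else 0) := rfl
  have hP : ps (colorP κ M.W i x s) = ps (scalar (κ i : ℂ) * colorU M.W i 2 x s 0)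
      + ps (couplingSum fun v => match v with
        | Sum.inl _ => 0
        | Sum.inr (c, k) => if c = i then scalar (k : ℂ) * colorU M.W i k x s 0 else 0) := rfl
  rw [h, hV, hP, ps_scalar_mul, ps_colorU_two, ps_scalar]
  simp only [Algebra.smul_def, map_mul]
  ring

lemma nPow_mul_colorMultiTrace (i : Fin d) {x : ℂ} (hx : OffSlit (κ i) x) {n : ℕ}
    (Y : Fin n → Point d) :
    nPow unitN (2 - d) * ps (colorMultiTrace M.W i x Y)
      = cSum (Sum.elim (fun a => (M.hat.iter (values fun j => pointSlot κ (Y j))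
        (M.hatInteraction i (evPt (κ i) x) (Sum.inl a)) : PS d LK)) fun _ => 0) := by
  simp only [colorMultiTrace, map_sum, ps_couplingSum]
  simp only [← cSum_finset_sum]
  rw [mul_cSum]
  congr 1
  funext u
  rcases u with a | ⟨c, k⟩
  · simp only [Sum.elim_inl, hatInteraction, iter_smul, iter_nConst_mul,
      Insertions.iter_sum, Subalgebra.coe_smul, Subalgebra.coe_mul]
    rw [← mul_smul_comm]
    symm
    refine congrArg (nPow unitN (2 - d) * ·) ?_
    simp only [AddSubmonoidClass.coe_finsetSum, smul_sum]
    refine sum_congr rfl fun S _ => sum_congr rfl fun Λ _ => ?_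
    have h := M.hat.iter_prod (fun j => pointSlot κ (Y j)) (fun o : Option {B // B ∈ Λ.parts} =>
      o.elim (M.hat.corr ((i, (shiftX (κ i))^[a i - 1] (evPt (κ i) x)) ::ₘ powSlots κ a S))
        fun B => M.hat.corr (powSlots κ a B.1))
    simp only [Fintype.prod_option, Option.elim_none, Option.elim_some] at h
    rw [mul_comm (∏ B : {B // B ∈ Λ.parts}, _), h, AddSubmonoidClass.coe_finsetSum, smul_sum]
    refine sum_congr rfl fun f _ => ?_
    rw [ps_scalar_mul, map_mul, map_prod, map_sub, ps_scalar_mul, ps_colorU M i hx, mul_comm, Subalgebra.coe_mul]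
    congr 2
    · refine (map_prod M.tameAlgebra.val _ _).trans (prod_congr rfl fun B _ => ?_)
      rw [ps_W, Subalgebra.coe_val, M.hat.iter_corr, map_map]
      · rfl
      · obtain ⟨c, hc⟩ := Λ.nonempty_of_mem_parts B.2
        have hc := Multiset.mem_map_of_mem (powSlot κ) (Multiset.mem_map_of_mem (fun c => (c, a c)) hc)
        intro h0
        rw [powSlots] at h0
        rw [h0] at hc
        exact Multiset.notMem_zero _ hc
    · rw [M.hat.iter_corr_cons, map_map]
      congr 2
  · simp

lemma cSum_hatInteraction (i : Fin d) {x : ℂ} (hx : OffSlit (κ i) x) {n : ℕ} (Y : Fin n → Point d) :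
    cSum (fun u => (M.hat.iter (values fun j => pointSlot κ (Y j))
        (M.hatInteraction i (evPt (κ i) x) u) : PS d LK))
      = nPow unitN (2 - d) * ps (colorMultiTrace M.W i x Y)
        + nPow unitN 1 * cSum (M.singleTrace i x (values Y)) := by
  rw [M.nPow_mul_colorMultiTrace i hx, mul_cSum, ← cSum_add]
  congr 1
  funext u
  rcases u with a | ⟨c, k⟩
  · simp [singleTrace]
  · simp only [singleTrace, hatInteraction, Sum.elim_inr, zero_add]
    by_cases hc : c = i
    · simp only [hc, if_true, iter_smul, iter_nConst_mul, ps_colorU M i hx]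
      rw [M.hat.iter_corr _ _ (Multiset.singleton_ne_zero _), add_comm, singleton_add,
        Multiset.map_zero, add_zero, values_map, mul_smul_comm]
      rfl
    · simp [hc, iter_zero_right]

lemma coloredLHS_W (i : Fin d) {x : ℂ} (hx : OffSlit (κ i) x) {n : ℕ}
    (X : Fin n → FinitePoint d) (hX : ∀ j, (X j).toPoint ∈ offCuts κ) (m : Order d) (k : ℤ) :
    coloredLHS κ M.W i x X m k = 0 := by
  set Y : Fin n → Point d := fun j => (X j).toPoint with hY
  have h := congrArg (coN m k) (M.loop_equation i hx fun j => pointSlot κ (Y j))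
  rw [map_sub, map_sum, M.cSum_hatInteraction i hx Y] at h
  have hd : ∑ j ∈ univ.filter fun j => (X j).1 = i, deriv (dslope (fun z : ℂ =>
        coeffN m k (M.W ((i, (z : OnePoint ℂ)) ::ₘ (univ.erase j).val.map Y) 0)) x) (X j).2
      = ∑ j, coN m k (M.hat.iter ((univ.erase j).val.map fun j => pointSlot κ (Y j))
          (M.derivCorr i (evPt (κ i) x) (pointSlot κ (Y j))) : PS d LK) := by
    rw [sum_filter]
    refine sum_congr rfl fun j _ => ?_
    by_cases hj : (X j).1 = i
    · rw [if_pos hj]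
      have h1 : pointSlot κ (Y j) = (i, evPt (κ i) ((X j).2 : OnePoint ℂ)) := by
        rw [← hj]; rfl
      have h2 : ((X j).2 : OnePoint ℂ) ∉ slit (κ i) := by
        rw [← hj]; exact hX j
      rw [h1, M.coN_iter_derivCorr i hx h2]
      simp only [coeffN_W, map_cons, map_map, Multiset.map_zero, add_zero]
      rfl
    · rw [if_neg hj, show M.derivCorr i (evPt (κ i) x) (pointSlot κ (Y j)) = 0 from if_neg hj,
        iter_zero_right]
      simp
  have h1 := M.ps_colorV'_sub_colorP i x (values Y)
  have h2 : ∀ s : Multiset (Point d), ps (M.W s 0) = (M.hat.corr (s.map (pointSlot κ)) : PS d LK) :=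
    fun s => by rw [ps_W, Multiset.map_zero, add_zero]
  have h3 := congrArg (coN m k) (congrArg (nPow unitN 1 * ·) h1)
  have h4 : ∀ s : Multiset (Fin n), (s.map Y).map (pointSlot κ) = s.map fun j => pointSlot κ (Y j) :=
    fun s => map_map _ _ _
  rw [coloredLHS]
  simp only [← hY]
  rw [hd, coeffN_eq, coeffN_eq, map_mul, ps_powN]
  simp only [map_add, map_sub, map_sum, map_mul, ps_powN, mul_assoc]
  have h6 : pointSlot κ (i, (x : OnePoint ℂ)) = (i, evPt (κ i) x) := rfl
  simp only [h2, map_cons, h4, h6, values_map, mul_sub, mul_add, map_add, map_sub, mul_smul_comm] at h3 ⊢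
  simp only [Subalgebra.coe_add, Subalgebra.coe_sub, AddSubmonoidClass.coe_finsetSum, Subalgebra.coe_mul,
    Subalgebra.coe_smul, map_add, map_sub, map_sum, mul_sub, smul_sub] at h h3
  have h5 : ((M.nConst 1 : M.tameAlgebra) : PS d LK) = nPow unitN 1 := rfl
  simp only [h5, mul_smul_comm] at h
  linear_combination h - h3

end CorrModel

/-! ### Products of traces -/

namespace Insertions
variable {Λ : Type} {R : Type*} [CommRing R] [Algebra ℂ R] (I : Insertions Λ R)

instance : LeftCommutative (fun a f => f * I.F a + I.D a f) := ⟨fun a b f => by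
  simp only [map_add, Derivation.leibniz, smul_eq_mul, I.comm a b f, I.symm a b]
  ring⟩

/-- The expectation of a product of traces. -/
def moment (s : Multiset Λ) : R := s.foldr (fun a f => f * I.F a + I.D a f) 1

lemma moment_cons (a : Λ) (s : Multiset Λ) :
    I.moment (a ::ₘ s) = I.moment s * I.F a + I.D a (I.moment s) := Multiset.foldr_cons _ _ _ _

lemma moment_eq_sum_corr {ι : Type} [DecidableEq ι] (v : ι → Λ) (S : Finset ι) (hS : S.Nonempty) :
    I.moment (S.val.map v) = ∑ π : Finpartition S, ∏ B ∈ π.parts, I.corr (B.val.map v) := by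
  rw [moment_eq_sum_cumulant (fun S => I.moment (S.val.map v)) S hS]
  refine sum_congr rfl fun π _ => prod_congr rfl fun B hB => ?_
  refine I.cumulant_eq_corr v _ rfl (fun S j hj => ?_) B (π.nonempty_of_mem_parts hB)
  rw [insert_val_of_notMem hj, map_cons, moment_cons]

end Insertions

namespace CorrModel
variable (M : CorrModel κ)

lemma tame_moment_cons {Θ : Type} {wt : Θ → ℕ} {y : Θ → M.tameAlgebra}
    (hy : M.Tame wt fun θ => (y θ : PS d LK)) (c : Fin d) : M.Tame (fun z : Θ × ℕ => wt z.1 + z.2)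
      fun z => (y z.1 : PS d LK) * M.B.F (c, z.2) + M.B.D (c, z.2) (y z.1 : PS d LK) :=
  Tame.add (Tame.mul (hy.comp (wt' := fun z : Θ × ℕ => wt z.1 + z.2) (fun z => z.1) 1 fun z => by
      omega)
    ((tame_B_F (M := M) c).comp (wt' := fun z : Θ × ℕ => wt z.1 + z.2) (fun z => z.2) 1 fun z => by
      dsimp only [natWt]; omega))
    (hy.insert.comp (wt' := fun z : Θ × ℕ => wt z.1 + z.2) (fun z => (z.1, (c, z.2))) 1 fun z => by
      dsimp only; omega)

lemma coe_moment_delta (c : Fin d) (q : ℕ) (s : Slots d) :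
    (M.hat.moment ((c, delta q) ::ₘ s) : PS d LK)
      = (M.hat.moment s : PS d LK) * M.B.F (c, q) + M.B.D (c, q) (M.hat.moment s : PS d LK) := by
  rw [Insertions.moment_cons]
  exact congrArg₂ (fun f g => (M.hat.moment s : PS d LK) * f + g) (delta_hsum q (tame_B_F (M := M) c))
    (delta_hsum q (tame_B_D (M := M) c _))

/-- A coefficient of the expectation of a product of traces, as a function of several slots. -/
def momentSlot {n : ℕ} (c : Fin n → Fin d) (A : Slots d) (m : Order d) (k : ℤ)
    (v : Fin n → Vec) : ℂ :=
  coN m k (M.hat.iter A (M.hat.moment (values fun j => (c j, v j))) : PS d LK)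

lemma slotForm_momentSlot {n : ℕ} (c : Fin n → Fin d) (A : Slots d)
    (m : Order d) (k : ℤ) : SlotForm (M.momentSlot c A m k) where
  slot v j L := by
    simp only [momentSlot, values_update]
    set s := (univ.erase j).val.map fun i => (c i, v i)
    have hy : M.Tame natWt fun q => (M.hat.moment ((c j, delta q) ::ₘ s) : PS d LK) := by
      simp only [coe_moment_delta]
      exact ((tame_const _).mul (tame_B_F (M := M) (c j))).add (tame_B_D (M := M) (c j) _)
    have hx : (M.hat.moment ((c j, L) ::ₘ s) : PS d LK)
        = hsum L fun q => (M.hat.moment ((c j, delta q) ::ₘ s) : PS d LK) := by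
      rw [Insertions.moment_cons, hsum_congr_coe L fun q => M.coe_moment_delta (c j) q s,
        hsum_add L ((tame_const _).mul (tame_B_F (M := M) (c j))) (tame_B_D (M := M) (c j) _),
        hsum_mul L _ (tame_const _) (tame_B_F (M := M) (c j))]
      rfl
    have ht := tame_hat_iter (y := fun q => M.hat.moment ((c j, delta q) ::ₘ s)) hy A
    rw [hat_iter_hsum (y := fun q => M.hat.moment ((c j, delta q) ::ₘ s)) hy L _ hx A,
      coN_hsum L ht]
    exact (summable_coN L ht m k).hasSum
  bound := by
    refine Tame.exists_bound (M := M) (y := fun p : Fin n → ℕ =>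
      (M.hat.iter A (M.hat.moment (values fun j => (c j, delta (p j)))) : PS d LK))
      (tame_hat_iter (y := fun p : Fin n → ℕ => M.hat.moment (values fun j => (c j, delta (p j))))
        ?_ A) m k
    induction n with
    | zero => exact tame_const (1 : M.tameAlgebra)
    | succ n ih =>
      simp only [values_succ, coe_moment_delta]
      exact (M.tame_moment_cons (ih fun j => c j.succ) (c 0)).comp
        (fun p : Fin (n + 1) → ℕ => ((fun j : Fin n => p j.succ), p 0)) 1 fun p => by
          dsimp only
          rw [Fin.sum_univ_succ]
          omega

end CorrModel

end

section
open Vec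

variable {d : ℕ} {κ : Fin d → ℝ}

/-! ### Integrals over tori -/

namespace SlotForm
open MeasureTheory
variable {n : ℕ} {H : (Fin n → Vec) → ℂ} {ρ : ℝ} {g : Fin n → ℂ → ℂ}

lemma torusIntegrable (hH : SlotForm H) (x : Fin n → ℝ) (hρ : 1 < ρ)
    (hg : ∀ j, ContinuousOn (g j) (sphere 0 ρ)) :
    TorusIntegrable (fun z => (∏ j, g j (z j)) * H fun j => ev (x j) (z j)⁻¹) 0 fun _ => ρ := by
  have hρ0 : 0 < ρ := zero_lt_one.trans hρ
  refine Continuous.integrableOn_Icc (.mul (continuous_finsetProd _ fun j _ => ?_) ?_)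
  · exact ((hg j).comp_continuous (continuous_circleMap 0 ρ)
      (circleMap_mem_sphere 0 hρ0.le)).comp (continuous_apply j)
  · have h1 : Continuous fun θ : Fin n → ℝ => fun j => (circleMap 0 ρ (θ j))⁻¹ :=
      continuous_pi fun j => ((continuous_circleMap 0 ρ).inv₀
        fun θ => circleMap_ne_center hρ0.ne').comp (continuous_apply j)
    refine continuous_iff_continuousAt.2 fun θ => ContinuousAt.comp
      (g := fun w : Fin n → ℂ => H fun j => ev (x j) (w j))
      (hH.differentiableAt_ev x fun j => ?_).continuousAt h1.continuousAt
    change ‖(circleMap 0 ρ (θ j))⁻¹‖ < 1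
    rw [norm_inv, norm_circleMap_zero, abs_of_pos hρ0]
    exact inv_lt_one_of_one_lt₀ hρ

lemma torusIntegral_eq (hH : SlotForm H) (x : Fin n → ℝ) (hρ : 1 < ρ)
    (hg : ∀ j, ContinuousOn (g j) (sphere 0 ρ)) {u : Fin n → Vec}
    (hu : ∀ j q, (∮ z in C(0, ρ), g j z * ((√(x j) : ℂ) * z⁻¹ ^ (q + 1)))
      = 2 * pi * I * (u j).1 q) :
    (1 / (2 * pi * I)) ^ n * torusIntegral
      (fun z => (∏ j, g j (z j)) * H fun j => ev (x j) (z j)⁻¹) 0 (fun _ => ρ) = H u := by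
  have hρ0 : 0 < ρ := zero_lt_one.trans hρ
  set μ : Measure ℝ := volume.restrict (Set.Icc 0 (2 * pi)) with hμ
  have hpi : (volume : Measure (Fin n → ℝ)).restrict (Set.Icc 0 fun _ => 2 * pi)
      = Measure.pi fun _ => μ := by
    rw [hμ, ← Measure.restrict_pi_pi, ← volume_pi, Set.pi_univ_Icc]; rfl
  set b : Fin n → ℝ → ℂ := fun j θ => deriv (circleMap 0 ρ) θ * g j (circleMap 0 ρ θ) with hb
  set a : Fin n → ℕ → ℝ → ℂ := fun j q θ =>
    b j θ * ((√(x j) : ℂ) * (circleMap 0 ρ θ)⁻¹ ^ (q + 1)) with ha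
  have hbc : ∀ j, Continuous (b j) := fun j => by
    refine .mul ?_ ((hg j).comp_continuous (continuous_circleMap 0 ρ) (circleMap_mem_sphere 0 hρ0.le))
    rw [funext (deriv_circleMap 0 ρ)]
    exact (continuous_circleMap 0 ρ).mul continuous_const
  have hac : ∀ j q, Continuous (a j q) := fun j q => (hbc j).mul (continuous_const.mul
    (((continuous_circleMap 0 ρ).inv₀ fun θ => circleMap_ne_center hρ0.ne').pow _))
  have hai : ∀ j q, Integrable (a j q) μ := fun j q => (hac j q).integrableOn_Icc
  have han : ∀ j q, ∫ θ, ‖a j q θ‖ ∂μ = (∫ θ, ‖b j θ‖ ∂μ) * √(x j) * ρ⁻¹ * ρ⁻¹ ^ q := fun j q => by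
    rw [mul_assoc, mul_assoc, ← integral_mul_const]
    refine integral_congr_ae (.of_forall fun θ => ?_)
    simp only [ha, norm_mul, norm_pow, norm_inv, norm_circleMap_zero, abs_of_pos hρ0,
      norm_real, norm_of_nonneg (sqrt_nonneg _)]
    rw [pow_succ']
  have hau : ∀ j q, ∫ θ, a j q θ ∂μ = 2 * pi * I * (u j).1 q := fun j q => by
    rw [← hu, circleIntegral_def_Icc]
    exact integral_congr_ae (.of_forall fun θ => mul_assoc _ _ _)
  set F : (Fin n → ℕ) → (Fin n → ℝ) → ℂ := fun p θ =>
    (∏ j, a j (p j) (θ j)) * H fun j => delta (p j) with hF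
  have hFi : ∀ p, Integrable (F p) (Measure.pi fun _ => μ) := fun p =>
    (Integrable.fintype_prod fun j => hai j (p j)).mul_const _
  obtain ⟨C, e, hC, h⟩ := hH.bound
  have hFs : Summable fun p => ∫ θ, ‖F p θ‖ ∂Measure.pi fun _ => μ := by
    have h1 := (hasSum_pi_prod (fun j q => ((∫ θ, ‖b j θ‖ ∂μ) * √(x j) * ρ⁻¹) *
      ((1 + q : ℝ) ^ e * ρ⁻¹ ^ q)) _ (fun j q => mul_nonneg (mul_nonneg (mul_nonneg
        (integral_nonneg fun _ => norm_nonneg _) (sqrt_nonneg _)) (by positivity))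
        (by positivity)) fun j => ((summable_pow_mul_geometric e (inv_nonneg.2 hρ0.le)
          (inv_lt_one_of_one_lt₀ hρ)).mul_left _).hasSum).summable
    refine Summable.of_nonneg_of_le (fun p => integral_nonneg fun _ => norm_nonneg _) (fun p => ?_)
      (h1.mul_left C)
    simp only [hF, norm_mul, norm_prod]
    rw [integral_mul_const, integral_fintype_prod_eq_prod (fun j θ => ‖a j (p j) θ‖), mul_comm]
    refine (mul_le_mul_of_nonneg_right (h p) (prod_nonneg fun j _ =>
      integral_nonneg fun _ => norm_nonneg _)).trans_eq ?_
    rw [mul_assoc, ← prod_mul_distrib]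
    refine congrArg (C * ·) (prod_congr rfl fun j _ => ?_)
    rw [han]
    ring
  have hsum := hasSum_integral_of_summable_integral_norm hFi hFs
  have h2 : ∀ p, ∫ θ, F p θ ∂(Measure.pi fun _ => μ) = (2 * pi * I) ^ n *
      ((∏ j, (u j).1 (p j)) * H fun j => delta (p j)) := fun p => by
    simp only [hF]
    rw [integral_mul_const, integral_fintype_prod_eq_prod (fun j θ => a j (p j) θ)]
    simp only [hau, prod_mul_distrib, Finset.prod_const, card_univ, Fintype.card_fin]
    ring
  simp only [h2] at hsum
  have h3 := hsum.unique ((hH.hasSum u).mul_left _)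
  have h4 : torusIntegral (fun z => (∏ j, g j (z j)) * H fun j => ev (x j) (z j)⁻¹) 0
      (fun _ => ρ) = ∫ θ, ∑' p, F p θ ∂Measure.pi fun _ => μ := by
    rw [torusIntegral, hpi]
    refine integral_congr_ae (.of_forall fun θ => ?_)
    have hw : ∀ j, ‖(circleMap 0 ρ (θ j))⁻¹‖ < 1 := fun j => by
      rw [norm_inv, norm_circleMap_zero, abs_of_pos hρ0]
      exact inv_lt_one_of_one_lt₀ hρ
    have h5 := ((hH.hasSum fun j => ev (x j) (circleMap 0 ρ (θ j))⁻¹).mul_left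
      (∏ j, b j (θ j))).tsum_eq
    have h6 : ∀ j, torusMap 0 (fun _ => ρ) θ j = circleMap 0 ρ (θ j) := fun j => rfl
    have h7 : ∏ j, ((ρ : ℂ) * exp (θ j * I) * I)
        = ∏ j, deriv (circleMap 0 ρ) (θ j) := prod_congr rfl fun j _ => by
      rw [deriv_circleMap, circleMap_zero]
    simp only [smul_eq_mul, h6]
    rw [h7, ← mul_assoc, ← prod_mul_distrib]
    refine h5.symm.trans (tsum_congr fun p => ?_)
    rw [hF, ← mul_assoc, ← prod_mul_distrib]
    exact congrArg (· * _) (prod_congr rfl fun j _ => by rw [ev_apply _ (hw j)])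
  rw [h4, h3, ← mul_assoc, ← mul_pow, one_div,
    inv_mul_cancel₀ Complex.two_pi_I_ne_zero, one_pow, one_mul]

end SlotForm

/-! ### Integrals over circles -/

lemma circleIntegral_inv_pow {ρ : ℝ} (hρ : 0 < ρ) (q : ℕ) :
    (∮ z in C(0, ρ), z⁻¹ ^ (q + 1)) = if q = 0 then 2 * pi * I else 0 := by
  split_ifs with hq
  · simpa [hq] using circleIntegral.integral_sub_center_inv 0 hρ.ne'
  · have := circleIntegral.integral_sub_zpow_of_ne (n := -((q : ℤ) + 1)) (by omega) 0 0 ρ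
    refine Eq.trans (congrArg (circleIntegral · 0 ρ) (funext fun z => ?_)) this
    rw [sub_zero, zpow_neg, inv_pow]
    norm_cast

lemma circleIntegral_inv_pow_mul_inv_sub {ρ : ℝ} (hρ : 0 < ρ) {b : ℂ} (hb0 : b ≠ 0) (hb : ‖b‖ ≠ ρ)
    (q : ℕ) : (∮ z in C(0, ρ), z⁻¹ ^ (q + 1) * (z - b)⁻¹)
      = b⁻¹ ^ (q + 1) * ((∮ z in C(0, ρ), (z - b)⁻¹) - 2 * pi * I) := by
  have h0 : ∀ z ∈ sphere (0 : ℂ) ρ, z ≠ 0 := fun z hz h => by simp [h, hρ.ne] at hz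
  have h1 : ∀ z ∈ sphere (0 : ℂ) ρ, z - b ≠ 0 := fun z hz h => by
    rw [← sub_eq_zero.1 h] at hb; simp [hb] at hz
  have hc : ∀ q, CircleIntegrable (fun z : ℂ => z⁻¹ ^ q * (z - b)⁻¹) 0 ρ := fun q =>
    ((ContinuousOn.inv₀ continuousOn_id h0).pow q |>.mul
      ((continuousOn_id.sub continuousOn_const).inv₀ h1)).circleIntegrable hρ.le
  have hz : ∀ q : ℕ, CircleIntegrable (fun z : ℂ => z⁻¹ ^ q) 0 ρ := fun q =>
    ((ContinuousOn.inv₀ continuousOn_id h0).pow q).circleIntegrable hρ.le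
  have hs : ∀ q, (∮ z in C(0, ρ), z⁻¹ ^ (q + 1) * (z - b)⁻¹)
      = b⁻¹ * ((∮ z in C(0, ρ), z⁻¹ ^ q * (z - b)⁻¹) - ∮ z in C(0, ρ), z⁻¹ ^ (q + 1)) := fun q => by
    rw [← circleIntegral.integral_sub (hc q) (hz (q + 1)), ← circleIntegral.integral_const_mul]
    refine circleIntegral.integral_congr hρ.le fun z hz' => ?_
    have := h0 z hz'
    have := h1 z hz'
    simp only [inv_pow]
    field_simp
    ring
  induction q with
  | zero => rw [hs 0]; simpa using Or.inl (circleIntegral.integral_sub_center_inv 0 hρ.ne')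
  | succ q ih =>
    rw [hs, ih, circleIntegral_inv_pow hρ, if_neg (succ_ne_zero q), sub_zero, ← mul_assoc,
      ← pow_succ']

/-- Against the weight `g`, the resolvents on the contour integrate to `u`. -/
structure ContourRep (κ : Fin d → ℝ) (ρ : ℝ) (c : Fin d) (g : ℂ → ℂ) (u : Vec) : Prop where
  cont : ContinuousOn g (sphere 0 ρ)
  eq : ∀ q, (∮ z in C(0, ρ), g z * ((√(κ c) : ℂ) * z⁻¹ ^ (q + 1))) = 2 * pi * I * u.1 q
  zero : ∀ a : ℕ, (∮ z in C(0, ρ), g z * joukowsky κ c z ^ a) = 0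

namespace ContourRep
variable {ρ : ℝ} {c : Fin d}

lemma ne_zero_of_mem_sphere (hρ : 1 < ρ) {z : ℂ} (hz : z ∈ sphere (0 : ℂ) ρ) : z ≠ 0 :=
  fun h => by simp [h, (zero_lt_one.trans hρ).ne] at hz

lemma hasDerivAt_joukowsky {z : ℂ} (hz : z ≠ 0) :
    HasDerivAt (joukowsky κ c) ((1 - z⁻¹ ^ 2) / (√(κ c) : ℂ)) z := by
  have := ((hasDerivAt_id z).add (hasDerivAt_inv hz)).div_const (√(κ c) : ℂ)
  exact HasDerivAt.congr_deriv (f := joukowsky κ c) this (by rw [inv_pow, ← sub_eq_add_neg])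

lemma continuousOn_joukowsky (hρ : 1 < ρ) : ContinuousOn (joukowsky κ c) (sphere 0 ρ) :=
  fun _ hz => (hasDerivAt_joukowsky (ne_zero_of_mem_sphere hρ hz)).continuousAt.continuousWithinAt

lemma continuousOn_inv_pow (hρ : 1 < ρ) (q : ℕ) :
    ContinuousOn (fun z : ℂ => z⁻¹ ^ q) (sphere 0 ρ) :=
  (continuousOn_id.inv₀ fun _ => ne_zero_of_mem_sphere hρ).pow q

lemma mul_joukowsky (hκ : 0 < κ c) (hρ : 1 < ρ) {g : ℂ → ℂ} {u : Vec} (h : ContourRep κ ρ c g u) :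
    ContourRep κ ρ c (fun z => g z * joukowsky κ c z) (shiftX (κ c) u) where
  cont := h.cont.mul (continuousOn_joukowsky hρ)
  zero a := by simpa only [mul_assoc, ← pow_succ'] using h.zero (a + 1)
  eq q := by
    have hρ0 := zero_lt_one.trans hρ
    have hs := sqrt_ne_zero_of_pos hκ
    have hi : ∀ q : ℕ, CircleIntegrable (fun z => g z * z⁻¹ ^ q) 0 ρ := fun q =>
      (h.cont.mul (continuousOn_inv_pow hρ q)).circleIntegrable hρ0.le
    have hm : ∀ q : ℕ, (∮ z in C(0, ρ), g z * z⁻¹ ^ (q + 1))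
        = (√(κ c) : ℂ)⁻¹ * (2 * pi * I * u.1 q) := fun q => by
      rw [← h.eq, ← circleIntegral.integral_const_mul]
      congr 1
      funext z
      field_simp
    have h1 : (∮ z in C(0, ρ), g z * joukowsky κ c z * ((√(κ c) : ℂ) * z⁻¹ ^ (q + 1)))
        = (∮ z in C(0, ρ), g z * z⁻¹ ^ q) + ∮ z in C(0, ρ), g z * z⁻¹ ^ (q + 1 + 1) := by
      rw [← circleIntegral.integral_add (hi _) (hi _)]
      refine circleIntegral.integral_congr hρ0.le fun z hz => ?_
      have := ne_zero_of_mem_sphere hρ hz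
      simp only [joukowsky, inv_pow]
      field_simp
      ring
    rw [h1, hm, shiftX_apply]
    rcases q with _ | q
    · have := h.zero 0
      simp only [pow_zero] at this ⊢
      rw [this]
      simp only [if_true]
      ring
    · rw [hm, if_neg (succ_ne_zero q), Nat.add_sub_cancel]
      ring

lemma mul_joukowsky_pow (hκ : 0 < κ c) (hρ : 1 < ρ) {g : ℂ → ℂ} {u : Vec}
    (h : ContourRep κ ρ c g u) (a : ℕ) :
    ContourRep κ ρ c (fun z => g z * joukowsky κ c z ^ a) ((shiftX (κ c))^[a] u) := by
  induction a with
  | zero => simpa using h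
  | succ a ih =>
    rw [Function.iterate_succ_apply']
    simpa only [pow_succ, mul_assoc] using ih.mul_joukowsky hκ hρ

lemma continuousOn_deriv_joukowsky (hρ : 1 < ρ) :
    ContinuousOn (deriv (joukowsky κ c)) (sphere 0 ρ) :=
  ((continuousOn_const.sub (continuousOn_inv_pow hρ 2)).div_const _).congr fun _ hz =>
    (hasDerivAt_joukowsky (ne_zero_of_mem_sphere hρ hz)).deriv

lemma deriv_joukowsky (hκ : 0 < κ c) (hρ : 1 < ρ) :
    ContourRep κ ρ c (deriv (joukowsky κ c)) (delta 0) where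
  cont := continuousOn_deriv_joukowsky hρ
  zero a := by
    refine circleIntegral.integral_eq_zero_of_hasDerivWithinAt (zero_lt_one.trans hρ).le
      (f := fun z => joukowsky κ c z ^ (a + 1) / ((a + 1 : ℕ) : ℂ)) fun z hz => ?_
    have h := hasDerivAt_joukowsky (κ := κ) (c := c) (ne_zero_of_mem_sphere hρ hz)
    have h1 := ((h.fun_pow (a + 1)).div_const ((a + 1 : ℕ) : ℂ)).hasDerivWithinAt (s := sphere 0 ρ)
    have h2 : ((a + 1 : ℕ) : ℂ) ≠ 0 := Nat.cast_ne_zero.2 (succ_ne_zero a)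
    rw [h.deriv]
    convert h1 using 1
    rw [Nat.add_sub_cancel]
    field_simp
  eq q := by
    have hρ0 := zero_lt_one.trans hρ
    have hs := sqrt_ne_zero_of_pos hκ
    have h1 : (∮ z in C(0, ρ), deriv (joukowsky κ c) z * ((√(κ c) : ℂ) * z⁻¹ ^ (q + 1)))
        = (∮ z in C(0, ρ), z⁻¹ ^ (q + 1)) - ∮ z in C(0, ρ), z⁻¹ ^ (q + 2 + 1) := by
      rw [← circleIntegral.integral_sub ((continuousOn_inv_pow hρ _).circleIntegrable hρ0.le)
        ((continuousOn_inv_pow hρ _).circleIntegrable hρ0.le)]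
      refine circleIntegral.integral_congr hρ0.le fun z hz => ?_
      simp only [(hasDerivAt_joukowsky (κ := κ) (c := c) (ne_zero_of_mem_sphere hρ hz)).deriv]
      field_simp
      ring
    rw [h1, circleIntegral_inv_pow hρ0, circleIntegral_inv_pow hρ0, if_neg (succ_ne_zero (q + 1)),
      sub_zero]
    rcases q with _ | q <;> simp [delta]

lemma deriv_joukowsky_div_sub (hκ : 0 < κ c) (hρ : 1 < ρ) {y : ℂ}
    (hy : OffSlit (κ c) y) (ho : OutsideContour κ ρ (c, y)) :
    ContourRep κ ρ c (fun z => deriv (joukowsky κ c) z / (y - joukowsky κ c z)) (evPt (κ c) y) := by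
  have hρ0 := zero_lt_one.trans hρ
  have hs := sqrt_ne_zero_of_pos hκ
  have hn := norm_zc_lt_one hκ hy
  obtain ⟨hb0, hb⟩ := zc_add_inv hκ hy
  set b := zc (κ c) y with hbdef
  obtain ⟨f, hf⟩ : ∃ f, f = fun z => deriv (joukowsky κ c) z / (y - joukowsky κ c z) := ⟨_, rfl⟩
  rw [← hf]
  have hb1 : ρ < ‖b⁻¹‖ := by
    refine lt_of_not_ge fun h => ho b⁻¹ ?_ h ?_
    · rw [norm_inv]
      exact (one_le_inv₀ (norm_pos_iff.2 hb0)).2 hn.le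
    · rw [joukowsky, inv_inv, add_comm, hb, mul_div_cancel_left₀ _ hs]
  have hne : ∀ z ∈ sphere (0 : ℂ) ρ, y - joukowsky κ c z ≠ 0 := fun z hz h => by
    have hz1 : ‖z‖ = ρ := by simpa using hz
    exact ho z (hz1.symm ▸ hρ.le) hz1.le (sub_eq_zero.1 h).symm
  have h1 : ∀ w : ℂ, ‖w‖ ≠ ρ → ∀ z ∈ sphere (0 : ℂ) ρ, z - w ≠ 0 := fun w hw z hz h => by
    rw [sub_eq_zero.1 h, mem_sphere_zero_iff_norm] at hz
    exact hw hz
  have hg : ∀ z ∈ sphere (0 : ℂ) ρ, f z = z⁻¹ - (z - b)⁻¹ - (z - b⁻¹)⁻¹ := fun z hz => by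
    have hz0 := ne_zero_of_mem_sphere hρ hz
    have h3 := h1 b (hn.trans hρ).ne z hz
    have h4 := h1 _ hb1.ne' z hz
    have h5 : y - joukowsky κ c z = -((z - b) * (z - b⁻¹)) / (√(κ c) * z) := by
      rw [eq_div_of_mul_eq hs ((mul_comm _ _).trans hb.symm), joukowsky]
      field_simp
      ring
    simp only [hf, h5, (hasDerivAt_joukowsky hz0).deriv]
    have h7 : b * b⁻¹ = 1 := mul_inv_cancel₀ hb0
    generalize b⁻¹ = w at h4 h7
    field_simp
    linear_combination -h7
  have hi : ∀ (q : ℕ) (w : ℂ), ‖w‖ ≠ ρ → CircleIntegrable (fun z => z⁻¹ ^ q * (z - w)⁻¹) 0 ρ :=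
    fun q w hw => ((continuousOn_inv_pow hρ q).mul
      ((continuousOn_id.sub continuousOn_const).inv₀ (h1 w hw))).circleIntegrable hρ0.le
  have hI1 : (∮ z in C(0, ρ), (z - b)⁻¹) = 2 * pi * I :=
    circleIntegral.integral_sub_inv_of_mem_ball (by simpa using hn.trans hρ)
  have hI2 : (∮ z in C(0, ρ), (z - b⁻¹)⁻¹) = 0 := by
    have h3 : ∀ z ∈ Metric.closedBall (0 : ℂ) ρ, z - b⁻¹ ≠ 0 := fun z hz h => by
      rw [sub_eq_zero.1 h, mem_closedBall_zero_iff] at hz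
      linarith
    refine Complex.circleIntegral_eq_zero_of_differentiable_on_off_countable hρ0.le
      Set.countable_empty ((continuousOn_id.sub continuousOn_const).inv₀ h3) fun z hz => ?_
    exact (differentiableAt_id.sub_const _).inv (h3 z (Metric.ball_subset_closedBall hz.1))
  have hq : ∀ q : ℕ, (∮ z in C(0, ρ), f z * z⁻¹ ^ q) = (∮ z in C(0, ρ), z⁻¹ ^ (q + 1))
      - (∮ z in C(0, ρ), z⁻¹ ^ q * (z - b)⁻¹) - ∮ z in C(0, ρ), z⁻¹ ^ q * (z - b⁻¹)⁻¹ := fun q => by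
    have h3 := ((continuousOn_inv_pow hρ (q + 1)).circleIntegrable hρ0.le)
    rw [← circleIntegral.integral_sub h3 (hi q b (hn.trans hρ).ne),
      ← circleIntegral.integral_sub (f := fun z => z⁻¹ ^ (q + 1) - z⁻¹ ^ q * (z - b)⁻¹)
        (h3.sub (hi q b (hn.trans hρ).ne)) (hi q _ hb1.ne')]
    refine circleIntegral.integral_congr hρ0.le fun z hz => ?_
    simp only [hg z hz]
    ring
  have hj := continuousOn_joukowsky (κ := κ) (c := c) hρ
  have hc : ContinuousOn f (sphere 0 ρ) :=
    hf ▸ (continuousOn_deriv_joukowsky hρ).div (continuousOn_const.sub hj) hne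
  refine ⟨hc, fun q => ?_, fun a => ?_⟩
  · simp only [mul_left_comm _ (√(κ c) : ℂ), circleIntegral.integral_const_mul]
    rw [hq, circleIntegral_inv_pow_mul_inv_sub hρ0 hb0 (hn.trans hρ).ne, hI1,
      circleIntegral_inv_pow_mul_inv_sub hρ0 (inv_ne_zero hb0) hb1.ne', hI2,
      circleIntegral_inv_pow hρ0, if_neg (succ_ne_zero q), evPt, ev_apply _ hn, inv_inv]
    ring
  · induction a with
    | zero =>
      have := hq 0
      simp only [pow_zero, mul_one, one_mul, circleIntegral_inv_pow hρ0, if_true, hI1, hI2] at this ⊢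
      simpa using this
    | succ a ih =>
      have h4 : (∮ z in C(0, ρ), f z * joukowsky κ c z ^ (a + 1)) = y *
          (∮ z in C(0, ρ), f z * joukowsky κ c z ^ a)
          - ∮ z in C(0, ρ), deriv (joukowsky κ c) z * joukowsky κ c z ^ a := by
        rw [← circleIntegral.integral_const_mul, ← circleIntegral.integral_sub
          (f := fun z => y * (f z * joukowsky κ c z ^ a))
          (g := fun z => deriv (joukowsky κ c) z * joukowsky κ c z ^ a)
          ((continuousOn_const.mul (hc.mul (hj.pow a))).circleIntegrable hρ0.le)
          (((continuousOn_deriv_joukowsky hρ).mul (hj.pow a)).circleIntegrable hρ0.le)]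
        refine circleIntegral.integral_congr hρ0.le fun z hz => ?_
        have := div_mul_cancel₀ (deriv (joukowsky κ c) z) (hne z hz)
        simp only [hf]
        linear_combination -joukowsky κ c z ^ a * this
      rw [h4, (deriv_joukowsky (c := c) hκ hρ).zero a, ih, mul_zero, sub_zero]

end ContourRep

/-! ### Families that agree off the cuts -/

lemma values_option {ι α : Type} [Fintype ι] (a : α) (f : ι → α) :
    values (fun o : Option ι => o.elim a f) = a ::ₘ values f := by
  rw [values, univ_option]
  simp only [Finset.insertNone, values, Function.comp_def, OrderEmbedding.coe_ofMapLEIff,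
    cons_val, map_cons, map_val, map_map, Option.elim]
  rfl

lemma values_subtype {ι α : Type} [Fintype ι] (p : ι → Prop) [DecidablePred p]
    [Fintype {j // p j}] (f : ι → α) :
    values (fun j : {j // p j} => f j.1) = (univ.filter p).val.map f := by
  have h : univ.filter p
      = (univ : Finset {j // p j}).map (Function.Embedding.subtype p) := by ext; simp
  rw [h, map_val, map_map]
  rfl

lemma deriv_dslope_congr {f g : ℂ → ℂ} {S : Set ℂ} (hS : IsOpen S) (h : ∀ z ∈ S, f z = g z) {a b : ℂ}
    (ha : a ∈ S) (hb : b ∈ S) : deriv (dslope f a) b = deriv (dslope g a) b := by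
  refine Filter.EventuallyEq.deriv_eq ?_
  filter_upwards [hS.mem_nhds hb] with z hz
  by_cases hza : z = a
  · subst hza
    rw [dslope_same, dslope_same]
    exact Filter.EventuallyEq.deriv_eq (Filter.eventuallyEq_of_mem (hS.mem_nhds ha) h)
  · rw [dslope_of_ne _ hza, dslope_of_ne _ hza, slope_def_field, slope_def_field, h z hz, h a ha]

/-- The families `W` and `W'` agree off the cuts. -/
def AgreeOffCuts (κ : Fin d → ℝ) (W W' : Family d) : Prop :=
  ∀ s A, (∀ X ∈ s, X ∈ offCuts κ) → W s A = W' s A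

namespace AgreeOffCuts
variable {W W' : Family d} {n : ℕ}

lemma map (hW : AgreeOffCuts κ W W') {Y : Fin n → Point d} (hY : ∀ j, Y j ∈ offCuts κ)
    (s : Multiset (Fin n)) (A : Labels d) : W (s.map Y) A = W' (s.map Y) A :=
  hW _ _ fun X hX => by obtain ⟨j, -, rfl⟩ := Multiset.mem_map.1 hX; exact hY j

lemma cons (hW : AgreeOffCuts κ W W') {X : Point d} (hX : X ∈ offCuts κ) :
    AgreeOffCuts κ (fun s => W (X ::ₘ s)) fun s => W' (X ::ₘ s) :=
  fun s A hs => hW _ A fun Y hY => (Multiset.mem_cons.1 hY).elim (fun h => h ▸ hX) (hs Y)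

lemma colorU_eq (hW : AgreeOffCuts κ W W') {Y : Fin n → Point d} (hY : ∀ j, Y j ∈ offCuts κ)
    (i : Fin d) (a : ℕ) (x : ℂ) (s : Multiset (Fin n)) (A : Labels d) :
    colorU W i a x (s.map Y) A = colorU W' i a x (s.map Y) A := by
  simp only [colorU, hW.map hY]

lemma colorP_eq (hW : AgreeOffCuts κ W W') {Y : Fin n → Point d} (hY : ∀ j, Y j ∈ offCuts κ)
    (i : Fin d) (x : ℂ) : colorP κ W i x (values Y) = colorP κ W' i x (values Y) := by
  simp only [colorP, values, hW.colorU_eq hY]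

lemma deriv_eq (hW : AgreeOffCuts κ W W') {Y : Fin n → Point d} (hY : ∀ j, Y j ∈ offCuts κ)
    {f : ℂ → ℂ} {c : Fin d} {x y : ℂ} (hx : OffSlit (κ c) x)
    (hy : OffSlit (κ c) y) (s : Multiset (Fin n)) (m : Order d) (k : ℤ)
    (hf : ∀ z : ℂ, OffSlit (κ c) z → f z = coeffN m k (W ((c, (z : OnePoint ℂ)) ::ₘ s.map Y) 0)) :
    deriv (dslope f x) y = deriv (dslope (fun z : ℂ =>
      coeffN m k (W' ((c, (z : OnePoint ℂ)) ::ₘ s.map Y) 0)) x) y :=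
  deriv_dslope_congr (isOpen_compl_slit (κ c)) (fun z hz => (hf z hz).trans
    (congrArg (coeffN m k) ((hW.cons (X := (c, (z : OnePoint ℂ))) hz).map hY s 0))) hx hy

lemma coloredLHS_eq (hW : AgreeOffCuts κ W W') (i : Fin d) {x : ℂ}
    (hx : OffSlit (κ i) x) (X : Fin n → FinitePoint d)
    (hX : ∀ j, (X j).toPoint ∈ offCuts κ) (m : Order d) (k : ℤ) :
    coloredLHS κ W i x X m k = coloredLHS κ W' i x X m k := by
  have h0 := hW.cons (X := (i, (x : OnePoint ℂ))) hx
  have h1 := fun s A => h0.map hX s A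
  have h2 := fun s A => (h0.cons (X := (i, (x : OnePoint ℂ))) hx).map hX s A
  have h3 : ∑ j ∈ univ.filter fun j => (X j).1 = i, deriv (dslope (fun z : ℂ => coeffN m k
      (W ((i, (z : OnePoint ℂ)) ::ₘ (univ.erase j).val.map fun j => (X j).toPoint) 0)) x)
        (X j).2 = ∑ j ∈ univ.filter fun j => (X j).1 = i, deriv (dslope (fun z : ℂ =>
      coeffN m k (W' ((i, (z : OnePoint ℂ)) ::ₘ (univ.erase j).val.map fun j =>
        (X j).toPoint) 0)) x) (X j).2 :=
    sum_congr rfl fun j hj => hW.deriv_eq hX hx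
      (by rw [← (mem_filter.1 hj).2]; exact hX j) _ m k fun _ _ => rfl
  simp only [coloredLHS, h3, colorMultiTrace, hW.colorU_eq hX, hW.colorP_eq hX, hW.map hX]
  simp only [values, h1, h2]

lemma globalW_eq (hW : AgreeOffCuts κ W W') {ι : Type} [Fintype ι] {X : ι → Point d}
    (hX : ∀ j, X j ∈ offCuts κ) : globalW κ W X = W' (values X) 0 := by
  classical
  rw [globalW, sum_eq_single fun j => (X j).1]
  · rw [Finset.prod_eq_one fun j _ => if_pos ⟨rfl, hX j⟩, one_mul]
    exact hW _ _ fun Y hY => by obtain ⟨j, rfl⟩ := mem_values.1 hY; exact hX j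
  · intro i _ hi
    obtain ⟨j, hj⟩ := Function.ne_iff.1 hi
    rw [Finset.prod_eq_zero (mem_univ j) (if_neg fun h => hj h.1.symm), zero_mul]
  · simp

lemma globalP_eq (hW : AgreeOffCuts κ W W') (X₀ : FinitePoint d) {Y : Fin n → Point d}
    (hY : ∀ j, Y j ∈ offCuts κ) :
    globalP κ W X₀ Y = colorP κ W' X₀.1 X₀.2 (values Y) := by
  rw [globalP, sum_eq_single X₀.1, sum_eq_single fun j => (Y j).1]
  · simpa using hW.colorP_eq hY X₀.1 X₀.2
  · intro i _ hi
    obtain ⟨j, hj⟩ := Function.ne_iff.1 hi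
    rw [Finset.prod_eq_zero (mem_univ j) (if_neg fun h => hj h.symm), mul_zero, zero_mul]
  · simp
  · exact fun c _ hc => by simp [hc.symm]
  · simp

lemma globalSingleTrace_eq (hW : AgreeOffCuts κ W W') {X₀ : FinitePoint d}
    (h₀ : X₀.toPoint ∈ offCuts κ) (X : Fin n → FinitePoint d)
    (hX : ∀ j, (X j).toPoint ∈ offCuts κ) (m : Order d) (k : ℤ) :
    globalSingleTrace κ W X₀ X m k = coloredLHS κ W' X₀.1 X₀.2 X m k
      + coeffN m k (powN d (2 - (d : ℤ)) * colorMultiTrace W' X₀.1 X₀.2 fun j => (X j).toPoint) := by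
  set Y : Fin n → Point d := fun j => (X j).toPoint with hY
  have h1 : ∀ J : Finset (Fin n), globalW κ W (fun o : Option {j // j ∈ J} => o.elim X₀.toPoint
      fun j => Y j.1) = W' (X₀.toPoint ::ₘ J.val.map Y) 0 := fun J => by
    rw [hW.globalW_eq fun o => by cases o with | none => exact h₀ | some j => exact hX j.1,
      values_option, values_subtype (· ∈ J), Finset.filter_univ_mem]
  have h2 : globalW κ W (fun o : Option (Fin n) => o.elim X₀.toPoint Y)
      = W' (X₀.toPoint ::ₘ values Y) 0 := by
    rw [hW.globalW_eq fun o => by cases o with | none => exact h₀ | some j => exact hX j,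
      values_option]
  have h3 : globalW κ W (fun o : Option (Option (Fin n)) => o.elim X₀.toPoint fun o' =>
      o'.elim X₀.toPoint Y) = W' (X₀.toPoint ::ₘ X₀.toPoint ::ₘ values Y) 0 := by
    rw [hW.globalW_eq fun o => by rcases o with _ | _ | j; exacts [h₀, h₀, hX j],
      values_option, values_option]
  have h4 : globalV' κ X₀ = colorV' κ X₀.1 X₀.2 := by simp [globalV']
  have h5 : ∑ j, sameSheet X₀ (X j) * deriv (dslope (fun z : ℂ =>
        coeffN m k (globalW κ W (update Y j ((X j).1, (z : OnePoint ℂ))))) X₀.2) (X j).2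
      = ∑ j ∈ univ.filter fun j => (X j).1 = X₀.1, deriv (dslope (fun z : ℂ =>
        coeffN m k (W' ((X₀.1, (z : OnePoint ℂ)) ::ₘ (univ.erase j).val.map Y) 0)) X₀.2)
          (X j).2 := by
    rw [sum_filter]
    refine sum_congr rfl fun j _ => ?_
    by_cases hj : (X j).1 = X₀.1
    · rw [if_pos hj, sameSheet, if_pos hj.symm, one_mul]
      refine AgreeOffCuts.deriv_eq (W := W') (fun _ _ _ => rfl) hX h₀
        (hj ▸ hX j : ((X j).2 : OnePoint ℂ) ∉ slit (κ X₀.1)) _ m k fun z hz => ?_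
      have hu : update Y j ((X j).1, (z : OnePoint ℂ)) = fun i => ((X i).1,
          update (fun i => ((X i).2 : OnePoint ℂ)) j z i) := funext fun i => by
        by_cases hi : i = j
        · subst hi; simp
        · simp [update_of_ne hi, hY, FinitePoint.toPoint]
      rw [hW.globalW_eq fun i => ?_, hu, CorrModel.values_update, hj]
      · rfl
      · by_cases hi : i = j
        · rw [hi, update_self, hj]; exact hz
        · rw [update_of_ne hi]; exact hX i
    · rw [if_neg hj, sameSheet, if_neg (Ne.symm hj), zero_mul]
  have h6 : powN d 1 * globalV' κ X₀ * globalW κ W (fun o : Option (Fin n) => o.elim X₀.toPoint Y)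
      = powN d 1 * colorV' κ X₀.1 X₀.2 * W' (X₀.toPoint ::ₘ values Y) 0 := by rw [h2, h4]
  refine Eq.trans ?_ (sub_add_cancel _ (coeffN m k _)).symm
  exact congrArg₂ (· + ·) (congrArg (coeffN m k) (congrArg₂ (· + ·) (congrArg₂ (· - ·)
    (congrArg₂ (· + ·) (sum_congr rfl fun J _ => congrArg₂ (· * ·) (h1 J) (h1 Jᶜ)) h3) h6)
    (congrArg (powN d 1 * ·) (hW.globalP_eq X₀ hX)))) h5

end AgreeOffCuts

/-! ### Contour integrals -/

section Torus
open MeasureTheory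
variable {n : ℕ} {f g : (Fin n → ℂ) → ℂ} {ρ : ℝ}

lemma torus_congr (hρ : 0 < ρ) (h : ∀ z : Fin n → ℂ, (∀ j, ‖z j‖ = ρ) → f z = g z) :
    (fun θ => f (torusMap 0 (fun _ => ρ) θ)) = fun θ => g (torusMap 0 (fun _ => ρ) θ) :=
  funext fun θ => h _ fun j =>
    (norm_circleMap_zero ρ (θ j) : ‖circleMap 0 ρ (θ j)‖ = |ρ|).trans (abs_of_pos hρ)

lemma torusIntegral_congr (hρ : 0 < ρ) (h : ∀ z : Fin n → ℂ, (∀ j, ‖z j‖ = ρ) → f z = g z) :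
    torusIntegral f 0 (fun _ => ρ) = torusIntegral g 0 fun _ => ρ := by
  have h1 := fun θ => congrFun (torus_congr hρ h) θ
  simp only [torusIntegral, h1]

lemma torusIntegrable_congr (hρ : 0 < ρ) (h : ∀ z : Fin n → ℂ, (∀ j, ‖z j‖ = ρ) → f z = g z)
    (hg : TorusIntegrable g 0 fun _ => ρ) : TorusIntegrable f 0 fun _ => ρ := by
  rw [TorusIntegrable, torus_congr hρ h]
  exact hg

lemma torusIntegrable_finset_sum {ι : Type*} (S : Finset ι) {F : ι → (Fin n → ℂ) → ℂ}
    (h : ∀ i ∈ S, TorusIntegrable (F i) 0 fun _ => ρ) :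
    TorusIntegrable (fun z => ∑ i ∈ S, F i z) 0 fun _ => ρ := integrable_finsetSum S h

lemma torusIntegral_finset_sum {ι : Type*} (S : Finset ι) {F : ι → (Fin n → ℂ) → ℂ}
    (h : ∀ i ∈ S, TorusIntegrable (F i) 0 fun _ => ρ) :
    torusIntegral (fun z => ∑ i ∈ S, F i z) 0 (fun _ => ρ)
      = ∑ i ∈ S, torusIntegral (F i) 0 fun _ => ρ := by
  simp only [torusIntegral, smul_sum]
  exact integral_finsetSum S fun i hi => (h i hi).function_integrable

lemma measurePreserving_comp_perm (π : Equiv.Perm (Fin n)) :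
    MeasurePreserving (fun θ : Fin n → ℝ => θ ∘ π) ∧
      MeasurableEmbedding (fun θ : Fin n → ℝ => θ ∘ π) := by
  have h : (MeasurableEquiv.piCongrLeft (fun _ : Fin n => ℝ) π.symm : (Fin n → ℝ) → Fin n → ℝ)
      = fun θ => θ ∘ π := by
    funext θ j
    have := MeasurableEquiv.piCongrLeft_apply_apply (β := fun _ : Fin n => ℝ) π.symm θ (π j)
    rwa [Equiv.symm_apply_apply] at this
  rw [← h]
  exact ⟨volume_measurePreserving_piCongrLeft _ _, MeasurableEquiv.measurableEmbedding _⟩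

lemma preimage_comp_perm (π : Equiv.Perm (Fin n)) :
    (fun θ : Fin n → ℝ => θ ∘ π) ⁻¹' (Set.Icc 0 fun _ => 2 * pi) = Set.Icc 0 fun _ => 2 * pi := by
  ext θ
  simp only [Set.mem_preimage, Set.mem_Icc, Pi.le_def, Function.comp_apply, Pi.zero_apply,
    π.forall_congr_right (q := fun j => 0 ≤ θ j), π.forall_congr_right (q := fun j => θ j ≤ 2 * pi)]

lemma torusIntegrable_comp_perm (π : Equiv.Perm (Fin n)) (hf : TorusIntegrable f 0 fun _ => ρ) :
    TorusIntegrable (fun z => f (z ∘ π)) 0 fun _ => ρ := by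
  have h := ((measurePreserving_comp_perm π).1.integrableOn_comp_preimage
    (measurePreserving_comp_perm π).2).2 hf
  rwa [preimage_comp_perm] at h

lemma torusIntegral_comp_perm (π : Equiv.Perm (Fin n)) :
    torusIntegral (fun z => f (z ∘ π)) 0 (fun _ => ρ) = torusIntegral f 0 fun _ => ρ := by
  have h := (measurePreserving_comp_perm π).1.setIntegral_preimage_emb (measurePreserving_comp_perm π).2
    (fun θ => (∏ i, (ρ : ℂ) * exp (θ i * I) * I) • f (torusMap 0 (fun _ => ρ) θ))
    (Set.Icc 0 fun _ => 2 * pi)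
  rw [preimage_comp_perm] at h
  refine Eq.trans (integral_congr_ae (.of_forall fun θ => ?_)) h
  dsimp only
  rw [← Equiv.prod_comp π fun i => (ρ : ℂ) * exp (θ i * I) * I]
  rfl

end Torus

/-- The integrand of a contour integral, on the contours of colors `γ`. -/
def pullback (κ : Fin d → ℝ) (F : (Fin d → FinitePoint d) → ℂ) (γ : Fin d → Fin d) (z : Fin d → ℂ) : ℂ :=
  (∏ j, deriv (joukowsky κ (γ j)) (z j)) * F fun j => (γ j, joukowsky κ (γ j) (z j))

/-- Integrability on all the contours. -/
def ContourIntegrable (κ : Fin d → ℝ) (ρ : ℝ) (F : (Fin d → FinitePoint d) → ℂ) : Prop :=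
  ∀ γ, TorusIntegrable (pullback κ F γ) 0 fun _ => ρ

section Contour
variable {ρ : ℝ} {F G : (Fin d → FinitePoint d) → ℂ}

lemma joukowsky_mem {c : Fin d} (hκ : 0 < κ c) (hρ : 1 < ρ) {z : ℂ} (hz : ‖z‖ = ρ) :
    (joukowsky κ c z : OnePoint ℂ) ∉ slit (κ c) ∧
      evPt (κ c) (joukowsky κ c z : OnePoint ℂ) = ev (κ c) z⁻¹ := by
  have hz0 : z ≠ 0 := norm_pos_iff.1 (hz ▸ zero_lt_one.trans hρ)
  have h1 : ‖z⁻¹‖ < 1 := by rw [norm_inv, hz]; exact inv_lt_one_of_one_lt₀ hρ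
  have h2 : joukowsky κ c z = (z⁻¹ + z⁻¹⁻¹) / (√(κ c) : ℂ) := by
    rw [joukowsky, inv_inv, add_comm]
  rw [h2, evPt, zc_joukowsky hκ h1 (inv_ne_zero hz0)]
  exact ⟨joukowsky_notMem_slit hκ h1 (inv_ne_zero hz0), rfl⟩

lemma pullback_congr (hκ : ∀ c, 0 < κ c) (hρ : 1 < ρ)
    (h : ∀ ζ : Fin d → FinitePoint d, (∀ j, (ζ j).toPoint ∈ offCuts κ) → F ζ = G ζ)
    (γ : Fin d → Fin d) (z : Fin d → ℂ) (hz : ∀ j, ‖z j‖ = ρ) : pullback κ F γ z = pullback κ G γ z :=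
  congrArg (_ * ·) (h _ fun j => (joukowsky_mem (hκ (γ j)) hρ (hz j)).1)

lemma contourIntegral_congr (hκ : ∀ c, 0 < κ c) (hρ : 1 < ρ)
    (h : ∀ ζ : Fin d → FinitePoint d, (∀ j, (ζ j).toPoint ∈ offCuts κ) → F ζ = G ζ) :
    contourIntegral κ ρ F = contourIntegral κ ρ G :=
  sum_congr rfl fun γ _ => congrArg (_ * ·)
    (torusIntegral_congr (zero_lt_one.trans hρ) (pullback_congr hκ hρ h γ))

lemma contourIntegral_sub (hF : ContourIntegrable κ ρ F) (hG : ContourIntegrable κ ρ G) :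
    contourIntegral κ ρ (fun ζ => F ζ - G ζ) = contourIntegral κ ρ F - contourIntegral κ ρ G := by
  simp only [contourIntegral, ← sum_sub_distrib, ← mul_sub]
  refine sum_congr rfl fun γ _ => congrArg (_ * ·) ?_
  refine Eq.trans ?_ (torusIntegral_sub (hF γ) (hG γ))
  exact congrArg (torusIntegral · 0 fun _ => ρ) (funext fun z => mul_sub _ _ _)

lemma contourIntegral_sum_perm (hF : ContourIntegrable κ ρ F) (c : ℂ) (S : Finset (Equiv.Perm (Fin d))) :
    contourIntegral κ ρ (fun ζ => c * ∑ π ∈ S, F fun j => ζ (π j))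
      = c * S.card * contourIntegral κ ρ F := by
  have h0 : ∀ γ (π : Equiv.Perm (Fin d)) z, (∏ j, deriv (joukowsky κ (γ j)) (z j)) *
      F (fun j => (γ (π j), joukowsky κ (γ (π j)) (z (π j)))) = pullback κ F (γ ∘ π) (z ∘ π) :=
    fun γ π z => by
      rw [pullback, ← Equiv.prod_comp π]
      rfl
  have h1 : ∀ γ, torusIntegral (fun z : Fin d → ℂ => (∏ j, deriv (joukowsky κ (γ j)) (z j)) *
      (c * ∑ π ∈ S, F fun j => (γ (π j), joukowsky κ (γ (π j)) (z (π j))))) 0 (fun _ => ρ)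
      = c * ∑ π ∈ S, torusIntegral (pullback κ F (γ ∘ π)) 0 fun _ => ρ := fun γ => by
    rw [show (fun z : Fin d → ℂ => (∏ j, deriv (joukowsky κ (γ j)) (z j)) * (c * ∑ π ∈ S, F fun j =>
      (γ (π j), joukowsky κ (γ (π j)) (z (π j))))) = fun z => c * ∑ π ∈ S,
        pullback κ F (γ ∘ π) (z ∘ π) from funext fun z => by
          rw [mul_left_comm, mul_sum]; simp only [h0], torusIntegral_const_mul, torusIntegral_finset_sum S fun π _ =>
      torusIntegrable_comp_perm (f := pullback κ F (γ ∘ π)) π (hF (γ ∘ π))]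
    exact congrArg (c * ·) (sum_congr rfl fun π _ => torusIntegral_comp_perm π)
  rw [contourIntegral, sum_congr rfl fun γ _ => congrArg (_ * ·) (h1 γ)]
  simp only [mul_sum]
  rw [sum_comm]
  have h2 : ∀ π ∈ S, ∑ γ : Fin d → Fin d, (1 / (2 * pi * I)) ^ d *
      (c * torusIntegral (pullback κ F (γ ∘ π)) 0 fun _ => ρ) = c * contourIntegral κ ρ F :=
    fun π _ => by
      rw [contourIntegral, mul_sum]
      refine Fintype.sum_equiv (π.symm.arrowCongr (Equiv.refl _)) _ _ fun γ => ?_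
      rw [mul_left_comm]
      rfl
  rw [sum_congr rfl h2, sum_const, nsmul_eq_mul]
  ring

lemma card_perm_apply_eq (i p : Fin d) :
    (univ.filter fun π : Equiv.Perm (Fin d) => π i = p).card = (d - 1).factorial := by
  have h1 : ∀ q, (univ.filter fun π : Equiv.Perm (Fin d) => π i = q).card
      = (univ.filter fun π : Equiv.Perm (Fin d) => π i = p).card := fun q =>
    Finset.card_equiv (Equiv.mulLeft (Equiv.swap q p)) fun π => by
      simp [Equiv.swap_apply_eq_iff]
  have h2 := Finset.card_eq_sum_card_fiberwise (s := (univ : Finset (Equiv.Perm (Fin d))))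
    (f := fun π => π i) (t := univ) fun _ _ => Finset.mem_coe.2 (mem_univ _)
  simp only [h1, sum_const, card_univ, Fintype.card_perm, Fintype.card_fin, smul_eq_mul] at h2
  rw [← Nat.mul_factorial_pred i.pos.ne'] at h2
  exact (Nat.eq_of_mul_eq_mul_left i.pos h2).symm

end Contour

/-! ### The global loop equations -/

lemma coeffN_globalDT_mul (e : ℤ) (s : ℂ) (i : Fin d) {ξ : Fin d → FinitePoint d}
    (hξ : ∀ j, (ξ j).1 = j) (f : Series d) (m : Order d) (k : ℤ) :
    coeffN m k (powN d e * (scalar s * globalDT i ξ) * f) = ∑ u ∈ m.support,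
      Sum.elim (fun a : Fin d → ℕ => s * ((a i : ℂ) * (ξ i).2 ^ (a i - 1) *
        ∏ j ∈ univ.erase i, (ξ j).2 ^ a j)) (fun _ => 0) u *
          coN (m - single u 1) (k - e) (ps f) := by
  have h : ps (powN d e * (scalar s * globalDT i ξ) * f) = nPow unitN e * cSum fun u =>
      Sum.elim (fun a : Fin d → ℕ => s * ((a i : ℂ) * (ξ i).2 ^ (a i - 1) *
        ∏ j ∈ univ.erase i, (ξ j).2 ^ a j)) (fun _ => 0) u • ps f := by
    have h1 : globalDT i ξ = couplingSum fun v => match v with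
        | Sum.inl a => scalar ((a i : ℂ) * (ξ i).2 ^ (a i - 1) *
            ∏ j ∈ univ.erase i, (ξ j).2 ^ a j)
        | Sum.inr _ => 0 := by
      rw [globalDT, Finset.prod_eq_one fun j _ => if_pos (hξ j)]
      exact one_mul _
    rw [h1, map_mul, map_mul, ps_powN, ps_scalar_mul, ps_couplingSum, mul_assoc]
    refine congrArg (nPow unitN e * ·) ?_
    rw [smul_mul_assoc, mul_comm (cSum _), mul_cSum, Algebra.smul_def, mul_cSum]
    congr 1
    funext u
    rcases u with a | b
    · simp only [Sum.elim_inl, ps_scalar, Algebra.smul_def, map_mul]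
      ring
    · simp
  rw [coeffN_eq, h, coN_nPow_mul, CorrModel.coN_cSum]
  exact sum_congr rfl fun u _ => map_smul _ _ _

namespace CorrModel
variable (M : CorrModel κ) {W : Family d} {n : ℕ}

lemma ps_globalProducts (hW : AgreeOffCuts κ W M.W) (i : Fin d) {Y : Fin n → Point d}
    (hY : ∀ j, Y j ∈ offCuts κ) {ζ : Fin d → FinitePoint d} (hζ : ∀ j, (ζ j).toPoint ∈ offCuts κ) :
    ps (globalProducts κ W Y ζ) = (M.hat.iter (values fun j => pointSlot κ (Y j))
      (M.hat.moment (values fun j => pointSlot κ (ζ j).toPoint)) : PS d LK) := by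
  rw [values, values, M.hat.moment_eq_sum_corr _ _ ⟨i, mem_univ i⟩, Insertions.iter_sum,
    globalProducts, map_sum, AddSubmonoidClass.coe_finsetSum]
  refine sum_congr rfl fun K _ => ?_
  have h := M.hat.iter_prod (fun j => pointSlot κ (Y j)) fun B : {B // B ∈ K.parts} =>
    M.hat.corr (B.1.val.map fun j => pointSlot κ (ζ j).toPoint)
  rw [prod_coe_sort K.parts fun B => M.hat.corr (B.val.map fun j =>
    pointSlot κ (ζ j).toPoint), values] at h
  rw [h, map_sum, AddSubmonoidClass.coe_finsetSum]
  refine sum_congr rfl fun f _ => ?_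
  rw [map_prod]
  refine Eq.trans (prod_congr rfl fun B _ => ?_) (map_prod M.tameAlgebra.val _ _).symm
  rw [hW.globalW_eq, values_sumElim, values_subtype (· ∈ B.1) fun q => (ζ q).toPoint,
    values_subtype (fun j => f j = B), Finset.filter_univ_mem, ps_W, Subalgebra.coe_val, M.hat.iter_corr,
    Multiset.map_add, map_map, map_map, Multiset.map_zero, add_zero, add_comm]
  · rfl
  · obtain ⟨c, hc⟩ := K.nonempty_of_mem_parts B.2
    exact fun h0 => Multiset.notMem_zero _ (h0 ▸ Multiset.mem_map_of_mem
      (fun j => pointSlot κ (ζ j).toPoint) (Finset.mem_def.1 hc))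
  · rintro (q | j)
    exacts [hζ q.1, hY j.1]

/-- The slots of `tr (M_i ^ (a_i - 1) / (x - M_i)) ∏ c ≠ i, tr (M_c ^ a_c)`. -/
def mixedSlot (κ : Fin d → ℝ) (i : Fin d) (x : ℂ) (a : Fin d → ℕ) : Fin d → Vec :=
  update (fun c => powVec (κ c) (a c)) i ((shiftX (κ i))^[a i - 1] (evPt (κ i) x))

lemma hatInteraction_inl (i : Fin d) (x : ℂ) (a : Fin d → ℕ) :
    M.hatInteraction i (evPt (κ i) x) (Sum.inl a)
      = (a i : ℂ) • (M.nConst (2 - d) * M.hat.moment (values fun j => (j, mixedSlot κ i x a j))) := by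
  rw [hatInteraction, values, M.hat.moment_eq_sum_corr _ _ ⟨i, mem_univ i⟩,
    sum_finpartition_prod _ (mem_univ i)]
  have h : ∀ B : Finset (Fin d), i ∉ B →
      B.val.map (fun j => (j, mixedSlot κ i x a j)) = powSlots κ a B := fun B hB => by
    rw [powSlots, map_map]
    refine Multiset.map_congr rfl fun j hj => ?_
    rw [mixedSlot, update_of_ne fun hji : j = i => hB (Finset.mem_def.2 (hji ▸ hj))]
    rfl
  refine congrArg (fun f => (a i : ℂ) • (M.nConst (2 - d) * f)) ?_
  refine sum_congr rfl fun S hS => sum_congr rfl fun Λ _ => ?_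
  have hi : i ∉ S := fun h => notMem_erase i _ (mem_powerset.1 hS h)
  rw [mul_comm, insert_val_of_notMem hi, map_cons, h S hi, ← prod_coe_sort Λ.parts]
  refine congrArg₂ (· * ·) (by rw [mixedSlot, update_self])
    (prod_congr rfl fun B _ => congrArg M.hat.corr (h B.1 fun hB => ?_).symm)
  exact notMem_erase i _ (mem_sdiff.1 (Λ.le B.2 hB)).1

/-- The integrand of the multi-trace terms, with the derivative of `T` evaluated at `φ ζ_i`. -/
def traceTerm (κ : Fin d → ℝ) (W : Family d) (X₀ : FinitePoint d) (Y : Fin n → Point d)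
    (m : Order d) (k : ℤ) (φ : ℂ → ℂ) (ζ : Fin d → FinitePoint d) : ℂ :=
  coeffN m k (powN d (2 - (d : ℤ)) * (scalar (sameSheet X₀ (ζ X₀.1) / (X₀.2 - (ζ X₀.1).2)) *
    globalDT X₀.1 (update ζ X₀.1 (X₀.1, φ (ζ X₀.1).2))) * globalProducts κ W Y ζ)

lemma globalDT_eq_zero {ξ : Fin d → FinitePoint d} (q : Fin d) {j : Fin d} (h : (ξ j).1 ≠ j) :
    globalDT q ξ = 0 := by
  rw [globalDT, Finset.prod_eq_zero (mem_univ j) (if_neg h), scalar, map_zero, map_zero, zero_mul]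

lemma traceTerm_eq_zero (X₀ : FinitePoint d) (Y : Fin n → Point d) (m : Order d) (k : ℤ)
    (φ : ℂ → ℂ) {ζ : Fin d → FinitePoint d} {j : Fin d} (hj : (ζ j).1 ≠ j) :
    traceTerm κ W X₀ Y m k φ ζ = 0 := by
  by_cases h : j = X₀.1
  · subst h
    rw [traceTerm, sameSheet, if_neg (Ne.symm hj), zero_div, scalar, map_zero, map_zero, zero_mul,
      mul_zero, zero_mul, coeffN, map_zero]
    rfl
  · rw [traceTerm, globalDT_eq_zero X₀.1 (j := j) (by rwa [update_of_ne h]), mul_zero,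
      mul_zero, zero_mul, coeffN, map_zero]
    rfl

/-- The weights of the contour integrals in the multi-trace terms. -/
def weight (κ : Fin d → ℝ) (X₀ : FinitePoint d) (φ : ℂ → ℂ) (a : Fin d → ℕ) : Fin d → ℂ → ℂ :=
  update (fun c z => deriv (joukowsky κ c) z * joukowsky κ c z ^ a c) X₀.1 fun z =>
    deriv (joukowsky κ X₀.1) z / (X₀.2 - joukowsky κ X₀.1 z) * φ (joukowsky κ X₀.1 z) ^ (a X₀.1 - 1)

lemma pullback_traceTerm (hW : AgreeOffCuts κ W M.W) (X₀ : FinitePoint d) {Y : Fin n → Point d}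
    (hY : ∀ j, Y j ∈ offCuts κ) (m : Order d) (k : ℤ) (φ : ℂ → ℂ) {ρ : ℝ} (hρ : 1 < ρ)
    (z : Fin d → ℂ) (hz : ∀ j, ‖z j‖ = ρ) :
    pullback κ (traceTerm κ W X₀ Y m k φ) id z = ∑ u ∈ m.support,
      Sum.elim (fun a : Fin d → ℕ => (a X₀.1 : ℂ)) (fun _ => 0) u *
        ((∏ j, weight κ X₀ φ (Sum.elim id (fun _ => 0) u) j (z j)) *
          M.momentSlot id (values fun j => pointSlot κ (Y j)) (m - single u 1)
            (k - (2 - d)) fun j => ev (κ j) (z j)⁻¹) := by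
  have hζ := fun j => joukowsky_mem (M.pos j) hρ (hz j)
  rw [pullback, traceTerm, coeffN_globalDT_mul, mul_sum]
  · refine sum_congr rfl fun u _ => ?_
    rw [M.ps_globalProducts hW X₀.1 hY (ζ := fun j => (id j, joukowsky κ (id j) (z j))) fun j => (hζ j).1]
    have h : values (fun j => pointSlot κ (FinitePoint.toPoint (id j, joukowsky κ (id j) (z j))))
        = values fun j => (id j, ev (κ j) (z j)⁻¹) :=
      congrArg values (funext fun j => congrArg (Prod.mk j) (hζ j).2)
    rw [h, ← momentSlot]
    rcases u with a | b
    · simp only [Sum.elim_inl, id, weight]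
      set g := update (fun c z => deriv (joukowsky κ c) z * joukowsky κ c z ^ a c) X₀.1
        fun z => deriv (joukowsky κ X₀.1) z / (X₀.2 - joukowsky κ X₀.1 z) *
          φ (joukowsky κ X₀.1 z) ^ (a X₀.1 - 1) with hg
      have h3 : ∏ j ∈ univ.erase X₀.1, g j (z j) = ∏ j ∈ univ.erase X₀.1,
          (deriv (joukowsky κ j) (z j) * joukowsky κ j (z j) ^ a j) :=
        prod_congr rfl fun j hj => by
          rw [hg, update_of_ne (ne_of_mem_erase hj)]
      rw [← mul_prod_erase _ _ (mem_univ X₀.1), ← mul_prod_erase univ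
        (fun j => g j (z j)) (mem_univ X₀.1), h3, hg, update_self,
        update_self, sameSheet, if_pos rfl, prod_mul_distrib]
      have h2 : ∏ j ∈ univ.erase X₀.1, (update (fun j => (j, joukowsky κ j (z j)))
          X₀.1 (X₀.1, φ (joukowsky κ X₀.1 (z X₀.1))) j).2 ^ a j
          = ∏ j ∈ univ.erase X₀.1, joukowsky κ j (z j) ^ a j :=
        prod_congr rfl fun j hj => by rw [update_of_ne (ne_of_mem_erase hj)]
      rw [h2]
      ring
    · simp
  · intro j
    by_cases hj : j = X₀.1
    · subst hj; simp
    · rw [update_of_ne hj]; rfl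

variable {X₀ : FinitePoint d} {ρ : ℝ}

lemma continuousOn_weight (hκ : ∀ c, 0 < κ c) (h₀ : X₀.toPoint ∈ offCuts κ) (hρ : 1 < ρ) (ho : OutsideContour κ ρ X₀)
    {φ : ℂ → ℂ} (hφ : Continuous φ) (a : Fin d → ℕ) (j : Fin d) :
    ContinuousOn (weight κ X₀ φ a j) (sphere 0 ρ) := by
  by_cases hj : j = X₀.1
  · subst hj
    rw [weight, update_self]
    exact (ContourRep.deriv_joukowsky_div_sub (hκ _) hρ h₀ ho).cont.mul
      ((hφ.comp_continuousOn (ContourRep.continuousOn_joukowsky hρ)).pow _)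
  · rw [weight, update_of_ne hj]
    exact (ContourRep.continuousOn_deriv_joukowsky hρ).mul
      ((ContourRep.continuousOn_joukowsky hρ).pow _)

lemma contourIntegrable_traceTerm (hW : AgreeOffCuts κ W M.W) (h₀ : X₀.toPoint ∈ offCuts κ)
    {Y : Fin n → Point d} (hY : ∀ j, Y j ∈ offCuts κ) (m : Order d) (k : ℤ) (hρ : 1 < ρ)
    (ho : OutsideContour κ ρ X₀) {φ : ℂ → ℂ} (hφ : Continuous φ) :
    ContourIntegrable κ ρ (traceTerm κ W X₀ Y m k φ) := fun γ => by
  by_cases hγ : γ = id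
  · subst hγ
    refine torusIntegrable_congr (zero_lt_one.trans hρ)
      (M.pullback_traceTerm hW X₀ hY m k φ hρ) (torusIntegrable_finset_sum _ fun u _ => ?_)
    exact ((M.slotForm_momentSlot id _ _ _).torusIntegrable κ hρ
      (continuousOn_weight M.pos h₀ hρ ho hφ _)).const_mul _
  · obtain ⟨j, hj⟩ := Function.ne_iff.1 hγ
    have h : pullback κ (traceTerm κ W X₀ Y m k φ) γ = fun _ => 0 := funext fun z => by
      rw [pullback, traceTerm_eq_zero (j := j) X₀ Y m k φ hj, mul_zero]
    rw [h]
    exact TorusIntegrable.torusIntegrable_const 0 _ _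

lemma contourIntegral_traceTerm (hW : AgreeOffCuts κ W M.W) (h₀ : X₀.toPoint ∈ offCuts κ)
    {Y : Fin n → Point d} (hY : ∀ j, Y j ∈ offCuts κ) (m : Order d) (k : ℤ) (hρ : 1 < ρ)
    (ho : OutsideContour κ ρ X₀) :
    contourIntegral κ ρ (traceTerm κ W X₀ Y m k id)
      = coeffN m k (powN d (2 - (d : ℤ)) * colorMultiTrace M.W X₀.1 X₀.2 Y) := by
  rw [contourIntegral, sum_eq_single id]
  · rw [coeffN_eq, map_mul, ps_powN, M.nPow_mul_colorMultiTrace X₀.1 h₀, coN_cSum,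
      show (fun z : Fin d → ℂ => (∏ j, deriv (joukowsky κ (id j)) (z j)) *
        traceTerm κ W X₀ Y m k id fun j => (id j, joukowsky κ (id j) (z j)))
        = pullback κ (traceTerm κ W X₀ Y m k id) id from rfl,
      torusIntegral_congr (zero_lt_one.trans hρ) (M.pullback_traceTerm hW X₀ hY m k id hρ),
      torusIntegral_finset_sum _ fun u _ => ?_, mul_sum]
    swap
    · exact ((M.slotForm_momentSlot id _ _ _).torusIntegrable κ hρ
        (continuousOn_weight M.pos h₀ hρ ho continuous_id _)).const_mul _
    refine sum_congr rfl fun u _ => ?_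
    rw [torusIntegral_const_mul, mul_left_comm]
    rcases u with a | b
    · rw [(M.slotForm_momentSlot id _ _ _).torusIntegral_eq κ hρ
        (continuousOn_weight M.pos h₀ hρ ho continuous_id _) (u := mixedSlot κ X₀.1 X₀.2 a) fun j => ?_]
      · simp only [Sum.elim_inl, hatInteraction_inl, Insertions.iter_smul, iter_nConst_mul,
          Subalgebra.coe_smul, Subalgebra.coe_mul, map_smul]
        refine congrArg (_ * ·) ?_
        exact (coN_nPow_mul _ _ _ _).symm
      · simp only [Sum.elim_inl, id, weight, mixedSlot]
        by_cases hj : j = X₀.1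
        · subst hj
          rw [update_self, update_self]
          exact ((ContourRep.deriv_joukowsky_div_sub (M.pos _) hρ h₀ ho).mul_joukowsky_pow
            (M.pos _) hρ _).eq
        · rw [update_of_ne hj, update_of_ne hj]
          exact ((ContourRep.deriv_joukowsky (M.pos _) hρ).mul_joukowsky_pow (M.pos _) hρ _).eq
    · simp
  · intro γ _ hγ
    obtain ⟨j, hj⟩ := Function.ne_iff.1 hγ
    simp only [traceTerm_eq_zero (W := W) X₀ Y m k id (ζ := fun j => (γ j, joukowsky κ (γ j) _)) hj]
    simp [torusIntegral]
  · simp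

variable {W : Family d} {X : Fin n → FinitePoint d}

lemma scalar_mul_globalDT_update (X₀ : FinitePoint d) (ζ : Fin d → FinitePoint d) :
    scalar (sameSheet X₀ (ζ X₀.1) / (X₀.2 - (ζ X₀.1).2)) *
        globalDT X₀.1 (update ζ X₀.1 (X₀.1, id (ζ X₀.1).2))
      = scalar (sameSheet X₀ (ζ X₀.1) / (X₀.2 - (ζ X₀.1).2)) * globalDT X₀.1 ζ := by
  by_cases h : X₀.1 = (ζ X₀.1).1
  · rw [show (X₀.1, id (ζ X₀.1).2) = ζ X₀.1 from Prod.ext h rfl, Function.update_eq_self]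
  · simp [sameSheet, h, scalar]

lemma contourIntegral_globalDT (X₀ : FinitePoint d) (Y : Fin n → Point d) (m : Order d)
    (k : ℤ) : contourIntegral κ ρ (fun ζ => coeffN m k (powN d (2 - (d : ℤ)) *
      (∑ q, scalar (sameSheet X₀ (ζ q) / (X₀.2 - (ζ q).2)) * globalDT q ζ) * globalProducts κ W Y ζ))
      = contourIntegral κ ρ (traceTerm κ W X₀ Y m k id) := by
  refine congrArg (contourIntegral κ ρ) (funext fun ζ => ?_)
  rw [traceTerm, scalar_mul_globalDT_update, sum_eq_single X₀.1]
  · intro q _ hq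
    by_cases h : X₀.1 = (ζ q).1
    · rw [globalDT_eq_zero q (j := q) fun h' => hq (h'.symm.trans h.symm), mul_zero]
    · simp [sameSheet, h, scalar]
  · simp

lemma globalLHS'_eq_zero (hW : AgreeOffCuts κ W M.W) (h₀ : X₀.toPoint ∈ offCuts κ)
    (hX : ∀ j, (X j).toPoint ∈ offCuts κ) (m : Order d) (k : ℤ) (hρ : 1 < ρ)
    (ho : OutsideContour κ ρ X₀) : globalLHS' κ W ρ X₀ X m k = 0 := by
  rw [globalLHS', hW.globalSingleTrace_eq h₀ X hX, M.coloredLHS_W X₀.1 h₀ X hX, zero_add,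
    ← M.contourIntegral_traceTerm hW h₀ hX m k hρ ho, contourIntegral_globalDT, sub_self]

lemma globalLHS_eq_globalLHS' (hW : AgreeOffCuts κ W M.W) (h₀ : X₀.toPoint ∈ offCuts κ)
    (hX : ∀ j, (X j).toPoint ∈ offCuts κ) (m : Order d) (k : ℤ) (hρ : 1 < ρ)
    (ho : OutsideContour κ ρ X₀) : globalLHS κ W ρ X₀ X m k = globalLHS' κ W ρ X₀ X m k := by
  have hA := M.contourIntegrable_traceTerm hW h₀ hX m k hρ ho (φ := fun _ => X₀.2) continuous_const
  have hA' := M.contourIntegrable_traceTerm hW h₀ hX m k hρ ho continuous_id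
  set Y : Fin n → Point d := fun j => (X j).toPoint with hY
  set S := univ.filter fun π : Equiv.Perm (Fin d) => π X₀.1 = ⟨0, X₀.1.pos⟩ with hS
  set Q : (Fin d → FinitePoint d) → ℂ := fun ζ =>
    traceTerm κ W X₀ Y m k (fun _ => X₀.2) ζ - traceTerm κ W X₀ Y m k id ζ with hQ
  have hQi : ContourIntegrable κ ρ Q := fun γ => by
    have h : pullback κ Q γ = pullback κ (traceTerm κ W X₀ Y m k fun _ => X₀.2) γ
        - pullback κ (traceTerm κ W X₀ Y m k id) γ := funext fun z => mul_sub _ _ _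
    rw [h]
    exact (hA γ).sub (hA' γ)
  have h1 : contourIntegral κ ρ (fun ζ => coeffN m k (powN d (2 - (d : ℤ)) *
      (∑ q, scalar (sameSheet X₀ (ζ q) / (X₀.2 - (ζ q).2)) * globalDT q (update ζ q X₀)) *
      globalProducts κ W Y ζ)) = contourIntegral κ ρ (traceTerm κ W X₀ Y m k fun _ => X₀.2) := by
    refine congrArg (contourIntegral κ ρ) (funext fun ζ => ?_)
    rw [traceTerm, sum_eq_single X₀.1]
    · intro q _ hq
      rw [globalDT_eq_zero q (j := q) (by rw [update_self]; exact Ne.symm hq), mul_zero]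
    · simp
  have h2 : contourIntegral κ ρ (fun ζ => coeffN m k (powN d (2 - (d : ℤ)) *
      globalU X₀ ζ * globalProducts κ W Y ζ)) = contourIntegral κ ρ fun ζ =>
        1 / ((d - 1).factorial : ℂ) * ∑ π ∈ S, Q fun j => ζ (π j) := by
    refine contourIntegral_congr M.pos hρ fun ζ hζ => ?_
    have hg : ∀ π : Equiv.Perm (Fin d), globalProducts κ W Y (fun j => ζ (π j))
        = globalProducts κ W Y ζ := fun π => ps_injective <| by
      rw [M.ps_globalProducts hW X₀.1 hX hζ,
        M.ps_globalProducts hW X₀.1 hX (ζ := fun j => ζ (π j)) fun j => hζ (π j)]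
      congr 3
      exact (congrArg (fun s : Finset (Fin d) => s.val.map fun j => pointSlot κ (ζ j).toPoint)
        (Finset.map_univ_equiv π)).symm.trans (by rw [map_val, map_map]; rfl) |>.symm
    have hU : globalU X₀ ζ = multiTraceU X₀.1 X₀ ζ := by simp [globalU]
    rw [hU, multiTraceU, mul_left_comm (powN d _), mul_assoc (scalar _), coeffN_scalar_mul,
      mul_sum, sum_mul, coeffN_eq, map_sum, map_sum]
    refine congrArg (_ * ·) (sum_congr rfl fun π hπ => ?_)
    simp only [hQ, traceTerm, hg, scalar_mul_globalDT_update X₀ fun j => ζ (π j)]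
    rw [(mem_filter.1 hπ).2, mul_sub, mul_sub, sub_mul, map_sub, map_sub]
    rfl
  rw [globalLHS, globalLHS', h1, h2, contourIntegral_globalDT, contourIntegral_sum_perm hQi, hS,
    card_perm_apply_eq, one_div_mul_cancel (Nat.cast_ne_zero.2 (Nat.factorial_ne_zero _)), one_mul, hQ,
    contourIntegral_sub hA hA']
  ring

end CorrModel

end

end
end MultiTrace

theorem mainTheorem4 (d : ℕ) (κ : Fin d → ℝ) (hκ : ∀ c, 0 < κ c) :
    (∃ W : Family d, IsConnectedCorrelators κ W) ∧
    ∀ W : Family d, IsConnectedCorrelators κ W →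
      -- extraction of coefficients at infinity
      (∀ (s : Multiset (Point d)) (A : Multiset (Fin d × ℕ)) (c : Fin d)
          (m : Coupling d →₀ ℕ) (k : ℤ) (z : ℂ),
        (∀ X ∈ s, X ∈ offCuts κ) → 2 / Real.sqrt (κ c) < ‖z‖ →
        HasSum (fun a : ℕ => coeffN m k (W s ((c, a) ::ₘ A)) * z⁻¹ ^ (a + 1))
          (coeffN m k (W ((c, (z : OnePoint ℂ)) ::ₘ s) A))) ∧
      -- colored loop equations
      (∀ (n : ℕ) (i : Fin d) (x₀ : ℂ) (X : Fin n → FinitePoint d)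
          (m : Coupling d →₀ ℕ) (k : ℤ),
        (i, (x₀ : OnePoint ℂ)) ∈ offCuts κ → (∀ j, (X j).toPoint ∈ offCuts κ) →
        coloredLHS κ W i x₀ X m k = 0) ∧
      -- global loop equations
      (∀ (n : ℕ) (X₀ : FinitePoint d) (X : Fin n → FinitePoint d)
          (m : Coupling d →₀ ℕ) (k : ℤ) (ρ : ℝ),
        X₀.toPoint ∈ offCuts κ → (∀ j, (X j).toPoint ∈ offCuts κ) →
        1 < ρ → OutsideContour κ ρ X₀ →
        globalLHS κ W ρ X₀ X m k = 0 ∧ globalLHS' κ W ρ X₀ X m k = 0) := by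
  obtain ⟨M, hM⟩ := exists_corrModel hκ
  refine ⟨⟨M.W, hM⟩, fun W h => ?_⟩
  have hW : AgreeOffCuts κ W M.W := fun s A hs => h.eq_of_mem_offCuts hM hκ hs
  refine ⟨fun s A c m k z hs hz => ?_, fun n i x₀ X m k h₀ hX => ?_,
    fun n X₀ X m k ρ h₀ hX hρ ho => ?_⟩
  · have hsum := M.hasSum_W s A c m k hz
    simp only [hW s _ hs]
    have e : W ((c, (z : OnePoint ℂ)) ::ₘ s) A = M.W ((c, (z : OnePoint ℂ)) ::ₘ s) A :=
      hW.cons (X := (c, (z : OnePoint ℂ))) (notMem_slit_of_lt hz) s A hs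
    rwa [e]
  · rw [hW.coloredLHS_eq i h₀ X hX]
    exact M.coloredLHS_W i h₀ X hX m k
  · have h0 := M.globalLHS'_eq_zero hW h₀ hX m k hρ ho
    exact ⟨(M.globalLHS_eq_globalLHS' hW h₀ hX m k hρ ho).trans h0, h0⟩
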